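/- **Setting.** Let $M>1$ be an integer, $0<c<1$, and let $\Omega_M$ be the hierarchical group of sequences $x=(x_1,x_2,\dots)$ with $x_i\in\{0,\dots,M-1\}$ and finitely many nonzero entries, with componentwise addition mod $M$ and the hierarchical distance $|x-y|=\max\{i:x_i\ne y_i\}$ ($0$ if $x=y$). The $c$-random walk is the continuous-time walk on $\Omega_M$, with right-continuous paths with left limits, that at rate $1$ chooses a distance $j\ge 1$ with probability $(1-\frac cM)(\frac cM)^{j-1}$ and jumps to a point uniformly distributed among those at distance $j$ from its position. Put $$\gamma=\frac{\log c}{\log (M/c)}\in(-1,0),\qquad H=\frac{1-\gamma}2,\qquad a=\frac cM,\qquad b=\frac{M^2-c}{M(M-1)},\qquad K=\Big(\frac{M-1}{M\,b^{1+\gamma}}\Big)^{1/2}.$$ At time $0$ there are $\theta_x$ particles at each $x\in\Omega_M$, where the $\theta_x$ are independent copies of a random variable $\theta$ with values in $\{0,1,2,\dots\}$ and $E\theta^3<\infty$. The particles then move, without branching, as $c$-random walks, independently of each other and of the initial configuration. Let $N_t(A)$ be the number of particles in $A\subset\Omega_M$ at time $t$, and for $\varphi:\Omega_M\to\mathbb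 R$ with bounded support and $T>0$ let $$\langle X_T(t),\varphi\rangle=\frac1{F_T}\int_0^{Tt}\big(\langle N_r,\varphi\rangle-E\langle N_r,\varphi\rangle\big)\,dr,\quad t\ge0,\qquad F_T=T^{(1-\gamma)/2},\qquad \langle N_r,\varphi\rangle=\sum_{x}\varphi(x)N_r(\{x\}).$$ Let $h_0=0$ and $h_t=\sum_{j\in\mathbb Z}(ba^jt)^{-2H}\big(e^{-ba^jt}-1+ba^jt\big)$ for $t>0$. **Theorem.** Then $\frac12<H<1$, the series for $h_t$ converges for every $t>0$, and $K>0$. At every time $t\ge0$ each $N_t(\{x\})$ is almost surely finite and has finite expectation, and, almost surely, $r\mapsto\langle N_r,\varphi\rangle-E\langle N_r,\varphi\rangle$ is integrable on every $[0,t]$. There exist independent continuous centered Gaussian processes $\zeta^H$ (oscillatory sub-fractional Brownian motion, osfBm) and $\eta^H$ on $[0,\infty)$ with covariances $$E\zeta^H_s\zeta^H_t=s^{2H}h_s+t^{2H}h_t-\tfrac12\big[(s+t)^{2H}h_{s+t}+|s-t|^{2H}h_{|s-t|}\big],\qquad E\eta^H_s\eta^H_t=(s+t)^{2H}h_{s+t}-t^{2H}h_t-s^{2H}h_s,$$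 and along $T_n=a^{-n}$, for every $\varphi$ with bounded support and every $\tau>0$, $$\langle X_{T_n},\varphi\rangle\ \Rightarrow\ K\big(\sqrt{2E\theta}\,\zeta^H+\sqrt{\operatorname{Var}\theta}\,\eta^H\big)\sum_{x\in\Omega_M}\varphi(x)\qquad\text{weakly in } C([0,\tau]).$$ If $\theta$ is Poisson or, more generally, $E\theta=\operatorname{Var}\theta$, then there is a continuous centered Gaussian process $\xi^H$ (oscillatory fractional Brownian motion, ofBm) with covariance $E\xi^H_s\xi^H_t=\frac12\big(s^{2H}h_s+t^{2H}h_t-|s-t|^{2H}h_{|s-t|}\big)$ such that, for every such $\varphi$ and $\tau$, the same sequence converges weakly in $C([0,\tau])$ to $K\sqrt{2E\theta}\,\big(\sum_x\varphi(x)\big)\,\xi^H$. -/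

import Mathlib

open MeasureTheory ProbabilityTheory Filter Topology
open scoped NNReal ENNReal

noncomputable section

/-! ### The hierarchical group -/

/-- The hierarchical group `Ω_M`: sequences with values in `{0, …, M-1}` and only finitely many
nonzero entries, with componentwise addition mod `M`. The coordinate written `x_{i+1}`
(`i = 0, 1, …`) in the usual one-based numbering is `x i` here. -/
abbrev HierGroup (M : ℕ) : Type := ℕ →₀ ZMod M

/-- `Ω_M` is a countable discrete space: every subset is measurable. -/
instance instMeasurableSpaceHierGroup (M : ℕ) : MeasurableSpace (HierGroup M) := ⊤

/-- The hierarchical distance: `0` if `x = y`, and otherwise the largest (one-based) index of a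
coordinate in which `x` and `y` differ. -/
def hdist {M : ℕ} (x y : HierGroup M) : ℕ := (x - y).support.sup fun i => i + 1

/-- Functions on `Ω_M` with bounded support (the test functions). -/
def HasBddSupport {M : ℕ} (φ : HierGroup M → ℝ) : Prop :=
  ∃ R : ℕ, ∀ x, φ x ≠ 0 → hdist 0 x ≤ R

/-! ### The `c`-random walk -/

/-- The law of the jump distance of the `c`-random walk: `r_j = (1 - c/M) (c/M)^(j-1)`, `j ≥ 1`. -/
def jumpDistProb (M : ℕ) (c : ℝ) (j : ℕ) : ℝ :=
  if j = 0 then 0 else (1 - c / M) * (c / M) ^ (j - 1)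

/-- One-step transition probability: a distance `j` is chosen with probability `r_j`, and then a
point uniformly among all the points at distance `j` from `x`. -/
def stepProb (M : ℕ) (c : ℝ) (x y : HierGroup M) : ℝ :=
  jumpDistProb M c (hdist x y) / (Set.ncard {w : HierGroup M | hdist x w = hdist x y} : ℝ)

open Classical in
/-- `n`-step transition probability of the discrete time walk. -/
def nStepProb (M : ℕ) (c : ℝ) : ℕ → HierGroup M → HierGroup M → ℝ
  | 0, x, y => if x = y then 1 else 0
  | n + 1, x, y => ∑' w : HierGroup M, stepProb M c x w * nStepProb M c n w y

/-- Transition probability `p_t(x, y)` of the continuous time walk with jump rate `1`. -/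
def transProb (M : ℕ) (c : ℝ) (t : ℝ) (x y : HierGroup M) : ℝ :=
  Real.exp (-t) * ∑' n : ℕ, t ^ n / (n.factorial : ℝ) * nStepProb M c n x y

/-- `Z` is a continuous time `c`-random walk on `Ω_M` started at `0`: it has independent
increments, `Z_t - Z_s` has the law `p_{t-s}(0, ·)`, and its paths are right-continuous with left
limits in the discrete space `Ω_M` (that is, locally constant from the right and from the left). -/
structure IsCRandomWalk (M : ℕ) (c : ℝ) {Ω : Type*} [MeasurableSpace Ω] (μ : Measure Ω)
    (Z : ℝ≥0 → Ω → HierGroup M) : Prop where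
  measurable : ∀ t, Measurable (Z t)
  start : ∀ᵐ ω ∂μ, Z 0 ω = 0
  indep_increments : HasIndepIncrements Z μ
  increment_law : ∀ s t : ℝ≥0, s ≤ t → ∀ y,
    μ {ω | Z t ω - Z s ω = y} = ENNReal.ofReal (transProb M c ((t : ℝ) - s) 0 y)
  right_cont : ∀ ω t, ∀ᶠ s in 𝓝[≥] t, Z s ω = Z t ω
  left_lim : ∀ ω t, 0 < t → ∃ y, ∀ᶠ s in 𝓝[<] t, Z s ω = y

/-! ### The particle system -/

/-- The non-branching particle system: at time `0` there are `θ x` particles at the site `x`, with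
`(θ x)` i.i.d. of law `ν`; the `j`-th particle (`j < θ x`) that starts at `x` is at time `t` at
the point `x + Z x j t`, where the `Z x j` are independent `c`-random walks started at `0`, which
are independent of the initial condition. -/
structure IsParticleSystem (M : ℕ) (c : ℝ) (ν : Measure ℕ) {Ω : Type*} [MeasurableSpace Ω]
    (μ : Measure Ω) (θ : HierGroup M → Ω → ℕ)
    (Z : HierGroup M → ℕ → ℝ≥0 → Ω → HierGroup M) : Prop where
  measurable_init : ∀ x, Measurable (θ x)
  law_init : ∀ x, μ.map (θ x) = ν
  indep_init : iIndepFun θ μ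
  walk : ∀ x j, IsCRandomWalk M c μ (Z x j)
  indep_walks : iIndepFun (fun (q : HierGroup M × ℕ) (ω : Ω) (t : ℝ≥0) => Z q.1 q.2 t ω) μ
  indep_init_walks : IndepFun (fun (ω : Ω) (x : HierGroup M) => θ x ω)
    (fun (ω : Ω) (q : HierGroup M × ℕ) (t : ℝ≥0) => Z q.1 q.2 t ω) μ

/-- The empirical process: `N_t(A)` is the number of particles in `A` at time `t`. -/
def empirical {M : ℕ} {Ω : Type*} (θ : HierGroup M → Ω → ℕ)
    (Z : HierGroup M → ℕ → ℝ≥0 → Ω → HierGroup M) (t : ℝ≥0) (A : Set (HierGroup M)) (ω : Ω) : ℕ∞ :=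
  Set.encard {q : HierGroup M × ℕ | q.2 < θ q.1 ω ∧ q.1 + Z q.1 q.2 t ω ∈ A}

/-- The pairing `⟨N_t, φ⟩ = ∑_x φ(x) N_t({x})`. -/
def empiricalPairing {M : ℕ} {Ω : Type*} (θ : HierGroup M → Ω → ℕ)
    (Z : HierGroup M → ℕ → ℝ≥0 → Ω → HierGroup M) (φ : HierGroup M → ℝ) (t : ℝ≥0) (ω : Ω) : ℝ :=
  ∑' x : HierGroup M, φ x * ((empirical θ Z t {x} ω).toNat : ℝ)

/-- `⟨N_r, φ⟩ - E⟨N_r, φ⟩`, as a function of a real time `r` (used for `r ≥ 0` only). -/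
def centeredPairing {M : ℕ} {Ω : Type*} [MeasurableSpace Ω] (μ : Measure Ω)
    (θ : HierGroup M → Ω → ℕ) (Z : HierGroup M → ℕ → ℝ≥0 → Ω → HierGroup M)
    (φ : HierGroup M → ℝ) (r : ℝ) (ω : Ω) : ℝ :=
  empiricalPairing θ Z φ r.toNNReal ω - ∫ ω', empiricalPairing θ Z φ r.toNNReal ω' ∂μ

/-- The occupation time fluctuation process with norming `F`, paired with `φ`:
`⟨X_T(t), φ⟩ = F⁻¹ ∫_0^{Tt} (⟨N_r, φ⟩ - E⟨N_r, φ⟩) dr`. -/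
def occFluct {M : ℕ} {Ω : Type*} [MeasurableSpace Ω] (μ : Measure Ω)
    (θ : HierGroup M → Ω → ℕ) (Z : HierGroup M → ℕ → ℝ≥0 → Ω → HierGroup M)
    (F T : ℝ) (φ : HierGroup M → ℝ) (t : ℝ≥0) (ω : Ω) : ℝ :=
  F⁻¹ * ∫ r in (0 : ℝ)..(T * t), centeredPairing μ θ Z φ r ω

/-! ### Parameters -/

/-- The degree `γ = log c / log (M/c)` of the `c`-random walk. -/
def walkDegree (M : ℕ) (c : ℝ) : ℝ := Real.log c / Real.log (M / c)

/-- `a = c / M`. -/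
def parA (M : ℕ) (c : ℝ) : ℝ := c / M

/-- `b = (M² - c) / (M (M - 1))`. -/
def parB (M : ℕ) (c : ℝ) : ℝ := ((M : ℝ) ^ 2 - c) / (M * (M - 1))

/-- The constant `K` of the limit, `K² = (M - 1) / (M b^(1+γ))`. -/
def limitConst (M : ℕ) (c : ℝ) : ℝ :=
  Real.sqrt (((M : ℝ) - 1) / (M * parB M c ^ (1 + walkDegree M c)))

/-! ### The limit processes -/

/-- The `j`-th term `(b a^j t)^(-2H) (exp(-b a^j t) - 1 + b a^j t)` of the series for `h_t`. -/
def oscTerm (a b H t : ℝ) (j : ℤ) : ℝ :=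
  (b * a ^ j * t) ^ (-(2 * H)) * (Real.exp (-(b * a ^ j * t)) - 1 + b * a ^ j * t)

open Classical in
/-- The oscillating function `h_t`, with `h_0 = 0`. -/
def oscH (a b H t : ℝ) : ℝ := if t = 0 then 0 else ∑' j : ℤ, oscTerm a b H t j

/-- `t^(2H) h_t`. -/
def oscPow (a b H t : ℝ) : ℝ := t ^ (2 * H) * oscH a b H t

/-- Covariance of oscillatory fractional Brownian motion. -/
def ofBmCov (a b H s t : ℝ) : ℝ :=
  (oscPow a b H s + oscPow a b H t - oscPow a b H |s - t|) / 2

/-- Covariance of oscillatory sub-fractional Brownian motion. -/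
def osfBmCov (a b H s t : ℝ) : ℝ :=
  oscPow a b H s + oscPow a b H t - (oscPow a b H (s + t) + oscPow a b H |s - t|) / 2

/-- Covariance of the process `η^H`. -/
def etaCov (a b H s t : ℝ) : ℝ :=
  oscPow a b H (s + t) - oscPow a b H t - oscPow a b H s

/-- `X` is a centered Gaussian process on `[0, ∞)` with continuous paths and covariance `C`. -/
structure IsContCenteredGaussian {Ω : Type*} [MeasurableSpace Ω] (P : Measure Ω)
    (X : ℝ≥0 → Ω → ℝ) (C : ℝ → ℝ → ℝ) : Prop where
  gaussian : IsGaussianProcess X P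
  mean : ∀ t, ∫ ω, X t ω ∂P = 0
  cov : ∀ s t : ℝ≥0, ∫ ω, X s ω * X t ω ∂P = C s t
  continuous_paths : ∀ ω, Continuous fun t => X t ω

/-! ### Weak convergence in the spaces of continuous functions -/

/-- `C([0, τ])` carries its Borel σ-algebra (for the topology of uniform convergence). -/
instance instMeasurableSpacePathSpace (τ : ℝ≥0) : MeasurableSpace C(Set.Icc (0 : ℝ≥0) τ, ℝ) :=
  borel _

instance instBorelSpacePathSpace (τ : ℝ≥0) : BorelSpace C(Set.Icc (0 : ℝ≥0) τ, ℝ) := ⟨rfl⟩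

/-- The processes `X n` converge to the process `Y` weakly in `C([0, τ])` for each `τ > 0`:
restricted to `[0, τ]`, all of them almost surely coincide with random elements of `C([0, τ])`, and
the latter converge in distribution. -/
def ConvergesWeaklyC {Ω Ω' : Type*} [MeasurableSpace Ω] [MeasurableSpace Ω']
    (μ : Measure Ω) [IsProbabilityMeasure μ] (P : Measure Ω') [IsProbabilityMeasure P]
    (X : ℕ → ℝ≥0 → Ω → ℝ) (Y : ℝ≥0 → Ω' → ℝ) : Prop :=
  ∀ τ : ℝ≥0, 0 < τ →
    ∃ (X' : ℕ → Ω → C(Set.Icc (0 : ℝ≥0) τ, ℝ)) (Y' : Ω' → C(Set.Icc (0 : ℝ≥0) τ, ℝ)),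
      (∀ n, ∀ᵐ ω ∂μ, ∀ t : Set.Icc (0 : ℝ≥0) τ, X' n ω t = X n t ω) ∧
      (∀ᵐ ω ∂P, ∀ t : Set.Icc (0 : ℝ≥0) τ, Y' ω t = Y t ω) ∧
      TendstoInDistribution X' atTop Y' (fun _ => μ) P

end

/-! The group is ultrametric: the balls around the origin are subgroups, and averaging over them is
compatible with the walk. Differences of averages over two consecutive balls are eigenkernels of the
step operator with eigenvalues `1 - b a^i` (`specKer_eigen`), and Poissonization gives `p_t(x, y) =
∑ i, e^{-b a^i t} specKer i (x - y)` (`transProb_eq`).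

Grouping the particles by starting site writes the unnormed fluctuation as a sum over sites of
independent centered compound sums (`IsParticleSystem.ae_hasSum_occField`). The covariance
contributed by one site is `Eθ` times the mixed second moment of a single occupation time plus `Var
θ - Eθ` times a product of means. Summed over all sites, the second moments become double time
integrals of the semigroup at `|r - v|`, and the products of means, by symmetry of the walk, the
same integrals at `r + v`. Integrating exponentials twice expresses both through one function
`walkVar`, a series of `(e^{-βt} - 1 + βt) / β²` with `β = b a^i` and weights of order `M^{-i}`.
Stretching time by `a^{-n}` shifts the summation index by `n`, and since `a^{1+γ} = 1/M` the powers
match: the normed series converges to `K² (∑ φ)² t^{2H} h_t` (`tendsto_walkVar_scaled`). Integer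
shifts correspond exactly to the scales `a^{-n}`, whence the restriction to this sequence.

Finite-dimensional convergence comes from a quantitative Lyapunov theorem
(`norm_integral_cexp_tsum_sub_gaussian_le`). Its error is a multiple of the sum over sites of third
absolute moments, which heat kernel decay bounds by `T^{3-2s}` for every `s < 1 + γ`
(`IsCRandomWalk.exists_tsum_occ_cube_le`); the norming divides by `T^{3H}`, and the quotient
vanishes as soon as `s > 3(1 + γ)/4`. Since `2H > 1`, second moments suffice for tightness: those of
increments are at most `A |t - s|^p` with some `p` in `(1, 2H)`, uniformly in `n`, and dyadic
interpolation gives weak convergence of paths (`convergesWeaklyC_of_charFun`).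

The limit kernels inherit positivity from finite scales (`IsCRandomWalk.limit_kernels`): the kernel
of `η` is a limit of forms built from squared means, that of `ζ` a limit of forms built from
variances. The processes are constructed from the isonormal process over a reproducing kernel
Hilbert space, followed by a continuous modification, and are made independent on a product space.
The identity `2 osfBm = 2 ofBm - η` between the kernels turns the limiting covariance into `K² (∑
φ)² (2 Eθ osfBm + Var θ η)`, which collapses to a multiple of the ofBm kernel when `Eθ = Var θ`. -/

noncomputable section

/-! ### Ultrametric geometry of the hierarchical group: balls and spheres. -/

section Hierarchical

variable {M : ℕ}

/-- The hierarchical length of a point: its distance to the origin. -/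
def hlen (z : HierGroup M) : ℕ := z.support.sup fun i => i + 1

lemma hdist_eq_hlen (x y : HierGroup M) : hdist x y = hlen (x - y) := rfl

lemma hlen_le_iff {z : HierGroup M} {k : ℕ} : hlen z ≤ k ↔ ∀ i, k ≤ i → z i = 0 := by
  simp only [hlen, Finset.sup_le_iff, Finsupp.mem_support_iff]
  constructor
  · intro h i hi
    by_contra h0
    have := h i h0
    omega
  · intro h i h0
    by_contra hk
    exact h0 (h i (by omega))

lemma hlen_zero : hlen (0 : HierGroup M) = 0 := by simp [hlen]

lemma hlen_eq_zero {z : HierGroup M} : hlen z = 0 ↔ z = 0 := by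
  constructor
  · intro h
    ext i
    exact (hlen_le_iff.1 h.le) i (Nat.zero_le _)
  · rintro rfl; exact hlen_zero

lemma hlen_neg (z : HierGroup M) : hlen (-z) = hlen z := by simp [hlen]

lemma hlen_sub_le {y z : HierGroup M} {k : ℕ} (hy : hlen y ≤ k) (hz : hlen z ≤ k) :
    hlen (y - z) ≤ k := by
  rw [hlen_le_iff] at *
  intro i hi
  simp [hy i hi, hz i hi]

lemma hlen_add_le {y z : HierGroup M} {k : ℕ} (hy : hlen y ≤ k) (hz : hlen z ≤ k) :
    hlen (y + z) ≤ k := by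
  rw [hlen_le_iff] at *
  intro i hi
  simp [hy i hi, hz i hi]

/-- Subtracting a shorter vector does not change the hierarchical length. -/
lemma hlen_sub_of_lt {z v : HierGroup M} {k : ℕ} (hv : hlen v ≤ k) (hz : k < hlen z) :
    hlen (z - v) = hlen z := by
  apply le_antisymm (hlen_sub_le le_rfl (hv.trans hz.le))
  by_contra h
  push Not at h
  have h2 : hlen z ≤ max (hlen (z - v)) k := by
    have : z = (z - v) + v := by simp
    conv_lhs => rw [this]
    exact hlen_add_le (le_max_left _ _) (hv.trans (le_max_right _ _))
  rcases max_cases (hlen (z - v)) k with ⟨h3, _⟩ | ⟨h3, _⟩ <;> omega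

variable [NeZero M]

/-- The ball of radius `k` around the origin. -/
def hball (M : ℕ) [NeZero M] (k : ℕ) : Finset (HierGroup M) :=
  (Finset.range k).finsupp fun _ => Finset.univ

lemma mem_hball {z : HierGroup M} {k : ℕ} : z ∈ hball M k ↔ hlen z ≤ k := by
  simp only [hball, Finset.mem_finsupp_iff, Finset.mem_univ, implies_true, and_true, hlen_le_iff]
  constructor
  · intro h i hi
    by_contra h0
    have := h (Finsupp.mem_support_iff.2 h0)
    simp at this
    omega
  · intro h i hi
    rw [Finsupp.mem_support_iff] at hi
    by_contra hk
    exact hi (h i (by simpa using hk))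

lemma card_hball (k : ℕ) : (hball M k).card = M ^ k := by
  simp [hball, Finset.card_finsupp, ZMod.card]

lemma hball_mono {j k : ℕ} (h : j ≤ k) : hball M j ⊆ hball M k := fun _ hz =>
  mem_hball.2 ((mem_hball.1 hz).trans h)

lemma hball_subset_iUnion (s : Finset (HierGroup M)) : ∃ k, s ⊆ hball M k :=
  ⟨s.sup hlen, fun _ hz => mem_hball.2 (Finset.le_sup hz)⟩

/-- The ball is a subgroup, so for `z` inside it `v ↦ z - v` is an involution of the ball. -/
lemma hball_sum_comp_sub {k : ℕ} (f : HierGroup M → ℝ) {z : HierGroup M} (hz : hlen z ≤ k) :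
    ∑ v ∈ hball M k, f (z - v) = ∑ v ∈ hball M k, f v := by
  refine Finset.sum_bij' (fun v _ => z - v) (fun v _ => z - v) ?_ ?_ ?_ ?_ ?_
  · intro v hv; exact mem_hball.2 (hlen_sub_le hz (mem_hball.1 hv))
  · intro v hv; exact mem_hball.2 (hlen_sub_le hz (mem_hball.1 hv))
  · intro v hv; simp
  · intro v hv; simp
  · intro v hv; rfl

/-- Spheres of positive radius. -/
lemma ncard_sphere (x : HierGroup M) (k : ℕ) :
    (Set.ncard {w : HierGroup M | hdist x w = k + 1} : ℝ) = (M : ℝ) ^ (k + 1) - (M : ℝ) ^ k := by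
  have h1 : {w : HierGroup M | hdist x w = k + 1} =
      (fun v => x - v) '' ((hball M (k + 1) \ hball M k : Finset _) : Set (HierGroup M)) := by
    ext w
    simp only [Set.mem_ofPred_eq, Set.mem_image, Finset.coe_sdiff, Set.mem_sdiff, Finset.mem_coe,
      mem_hball, hdist_eq_hlen]
    constructor
    · intro h
      exact ⟨x - w, ⟨by omega, by omega⟩, by simp⟩
    · rintro ⟨v, ⟨h1, h2⟩, rfl⟩
      simp only [sub_sub_cancel]
      omega
  rw [h1, Set.ncard_image_of_injective _ (fun u v h => by simpa using h), Set.ncard_coe_finset,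
    Finset.card_sdiff_of_subset (hball_mono (Nat.le_succ k)), card_hball, card_hball,
    Nat.cast_sub (Nat.pow_le_pow_right (NeZero.pos M) (Nat.le_succ k))]
  push_cast
  rfl

end Hierarchical

/-! ### Spectral decomposition of the walk. -/

section Kernel

variable {M : ℕ} {c : ℝ}

/-- One-step probability as a function of the displacement. -/
def stepKer (M : ℕ) (c : ℝ) (z : HierGroup M) : ℝ :=
  jumpDistProb M c (hlen z) / ((M : ℝ) ^ (hlen z) - (M : ℝ) ^ (hlen z - 1))

lemma stepProb_eq_stepKer [NeZero M] (x w : HierGroup M) :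
    stepProb M c x w = stepKer M c (x - w) := by
  unfold stepProb stepKer
  rw [hdist_eq_hlen]
  rcases h : hlen (x - w) with _ | k
  -- At displacement zero both numerators vanish, so the denominators, one of which is `1 - 1`, do
  -- not matter.
  · simp [jumpDistProb]
  · rw [ncard_sphere]; simp

lemma stepKer_eq {z : HierGroup M} {k : ℕ} (h : hlen z = k + 1) :
    stepKer M c z = (1 - c / M) * (c / M) ^ k / ((M : ℝ) ^ (k + 1) - (M : ℝ) ^ k) := by
  simp [stepKer, jumpDistProb, h]

lemma stepKer_zero : stepKer M c 0 = 0 := by simp [stepKer, jumpDistProb, hlen_zero]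

lemma stepKer_nonneg (hM : 1 < M) (hc0 : 0 < c) (hc1 : c < 1) (z : HierGroup M) :
    0 ≤ stepKer M c z := by
  have hM' : (1 : ℝ) < M := by exact_mod_cast hM
  rcases h : hlen z with _ | k
  · rw [hlen_eq_zero.1 h, stepKer_zero]
  · rw [stepKer_eq h]
    have h1 : c / M ≤ 1 := by rw [div_le_one (by linarith)]; linarith
    have h2 : (M : ℝ) ^ k ≤ (M : ℝ) ^ (k + 1) := pow_le_pow_right₀ hM'.le (Nat.le_succ k)
    have h3 : 0 ≤ c / M := by positivity
    exact div_nonneg (mul_nonneg (by linarith) (by positivity)) (by linarith)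

/-- The sphere of radius `j` carries exactly the mass `r_j`, so the mass of a ball is a partial sum
of a geometric series. -/
lemma sum_hball_stepKer (hM : 1 < M) [NeZero M] (k : ℕ) :
    ∑ v ∈ hball M k, stepKer M c v = 1 - (c / M) ^ k := by
  have hM' : (1 : ℝ) < M := by exact_mod_cast hM
  induction k with
  | zero =>
    have : hball M 0 = {0} := by
      ext z; simp [mem_hball, hlen_eq_zero]
    simp [this, stepKer_zero]
  | succ k ih =>
    have h2 : (0 : ℝ) < (M : ℝ) ^ (k + 1) - (M : ℝ) ^ k := by
      have : (M : ℝ) ^ k < (M : ℝ) ^ (k + 1) := pow_lt_pow_right₀ hM' (Nat.lt_succ_self k)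
      linarith
    rw [← Finset.sum_sdiff (hball_mono (Nat.le_succ k)), ih]
    have : ∀ v ∈ hball M (k + 1) \ hball M k, stepKer M c v =
        (1 - c / M) * (c / M) ^ k / ((M : ℝ) ^ (k + 1) - (M : ℝ) ^ k) := by
      intro v hv
      simp only [Finset.mem_sdiff, mem_hball] at hv
      exact stepKer_eq (by omega)
    rw [Finset.sum_congr rfl this, Finset.sum_const,
      Finset.card_sdiff_of_subset (hball_mono (Nat.le_succ k)), card_hball, card_hball,
      nsmul_eq_mul, Nat.cast_sub (Nat.pow_le_pow_right (NeZero.pos M) (Nat.le_succ k))]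
    push_cast
    rw [mul_div_cancel₀ _ h2.ne']
    ring

lemma summable_stepKer (hM : 1 < M) (hc0 : 0 < c) (hc1 : c < 1) :
    Summable (stepKer M c) := by
  have : NeZero M := ⟨by omega⟩
  refine summable_of_sum_le (c := 1) (stepKer_nonneg hM hc0 hc1) fun u => ?_
  obtain ⟨k, hk⟩ := hball_subset_iUnion u
  refine (Finset.sum_le_sum_of_subset_of_nonneg hk
    fun i _ _ => stepKer_nonneg hM hc0 hc1 i).trans ?_
  rw [sum_hball_stepKer hM]
  have : 0 ≤ (c / M) ^ k := by positivity
  linarith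

/-- The uniform probability on the ball of radius `k`. -/
def unifKer (M : ℕ) (k : ℕ) (z : HierGroup M) : ℝ := if hlen z ≤ k then ((M : ℝ) ^ k)⁻¹ else 0

/-- Kernel of the spectral projection of level `i`. -/
def specKer (M : ℕ) (i : ℕ) (z : HierGroup M) : ℝ := unifKer M i z - unifKer M (i + 1) z

/-- If `x - y` lies in the ball, translation by it preserves the ball and only the mass of the ball
enters. If it lies outside, the ultrametric inequality makes the step kernel constant on the
translated ball, so averaging leaves it unchanged. -/
lemma tsum_stepKer_unifKer (hM : 1 < M) (k : ℕ) (x y : HierGroup M) :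
    HasSum (fun w => stepKer M c (x - w) * unifKer M k (w - y))
    (if hlen (x - y) ≤ k then ((M : ℝ) ^ k)⁻¹ * (1 - (c / M) ^ k) else stepKer M c (x - y)) := by
  have : NeZero M := ⟨by omega⟩
  have h1 : HasSum (fun v => stepKer M c (x - y - v) * unifKer M k v)
      (∑ v ∈ hball M k, stepKer M c (x - y - v) * unifKer M k v) := by
    refine hasSum_sum_of_ne_finset_zero fun v hv => ?_
    rw [mem_hball] at hv
    simp [unifKer, hv]
  have h2 : ∑ v ∈ hball M k, stepKer M c (x - y - v) * unifKer M k v =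
      (∑ v ∈ hball M k, stepKer M c (x - y - v)) * ((M : ℝ) ^ k)⁻¹ := by
    rw [Finset.sum_mul]
    refine Finset.sum_congr rfl fun v hv => ?_
    rw [mem_hball] at hv
    simp [unifKer, hv]
  have h3 : (∑ v ∈ hball M k, stepKer M c (x - y - v)) * ((M : ℝ) ^ k)⁻¹ =
      if hlen (x - y) ≤ k then ((M : ℝ) ^ k)⁻¹ * (1 - (c / M) ^ k) else stepKer M c (x - y) := by
    split_ifs with h
    · rw [hball_sum_comp_sub _ h, sum_hball_stepKer hM, mul_comm]
    · push Not at h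
      rw [Finset.sum_congr rfl (g := fun _ => stepKer M c (x - y)), Finset.sum_const, card_hball,
        nsmul_eq_mul]
      · have : (M : ℝ) ^ k ≠ 0 := by positivity
        push_cast
        field_simp
      · intro v hv
        rw [mem_hball] at hv
        simp only [stepKer, hlen_sub_of_lt hv h]
  rw [h2, h3] at h1
  rw [← (Equiv.subRight y).hasSum_iff] at h1
  convert h1 using 2 with w
  simp

/-- Outside the ball of radius `i + 1` the two averages give the same value and cancel. Comparison
of the values inside the ball of radius `i` is what determines the eigenvalue and hence `b`; the
sphere of radius `i + 1` is consistent with it. -/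
lemma specKer_eigen (hM : 1 < M) (i : ℕ) (x y : HierGroup M) :
    HasSum (fun w => stepKer M c (x - w) * specKer M i (w - y))
    ((1 - parB M c * parA M c ^ i) * specKer M i (x - y)) := by
  have hM' : (1 : ℝ) < M := by exact_mod_cast hM
  have h := (tsum_stepKer_unifKer (c := c) hM i x y).sub (tsum_stepKer_unifKer (c := c) hM (i + 1) x y)
  have e0 : (fun w => stepKer M c (x - w) * specKer M i (w - y)) = fun w =>
      stepKer M c (x - w) * unifKer M i (w - y) - stepKer M c (x - w) * unifKer M (i + 1) (w - y) := by
    ext w; simp only [specKer]; ring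
  rw [e0]
  have e : (1 - parB M c * parA M c ^ i) * specKer M i (x - y) =
      (if hlen (x - y) ≤ i then ((M : ℝ) ^ i)⁻¹ * (1 - (c / M) ^ i) else stepKer M c (x - y)) -
      if hlen (x - y) ≤ i + 1 then ((M : ℝ) ^ (i + 1))⁻¹ * (1 - (c / M) ^ (i + 1))
        else stepKer M c (x - y) := by
    have e1 : (M : ℝ) ≠ 0 := by positivity
    have e2 : (M : ℝ) - 1 ≠ 0 := by linarith
    rcases lt_trichotomy (hlen (x - y)) (i + 1) with h | h | h
    · have h1 : hlen (x - y) ≤ i := by omega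
      have h2 : hlen (x - y) ≤ i + 1 := by omega
      simp only [specKer, unifKer, h1, h2, if_true, parA, parB]
      simp only [div_pow, pow_succ]
      field_simp
      ring
    · have h1 : ¬ hlen (x - y) ≤ i := by omega
      have h2 : hlen (x - y) ≤ i + 1 := by omega
      have e4 : (M : ℝ) ^ (i + 1) - (M : ℝ) ^ i = M ^ i * (M - 1) := by ring
      simp only [specKer, unifKer, h1, h2, if_true, if_false, parA, parB, stepKer_eq h]
      rw [e4]
      simp only [div_pow, pow_succ]
      field_simp
      ring
    · have h1 : ¬ hlen (x - y) ≤ i := by omega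
      have h2 : ¬ hlen (x - y) ≤ i + 1 := by omega
      simp [specKer, unifKer, h1, h2]
  rw [e]
  exact h

lemma abs_specKer_le (hM : 1 < M) (i : ℕ) (z : HierGroup M) :
    |specKer M i z| ≤ ((M : ℝ)⁻¹) ^ i := by
  have hM' : (1 : ℝ) < M := by exact_mod_cast hM
  have h1 : 0 ≤ unifKer M i z := by unfold unifKer; split_ifs <;> positivity
  have h2 : 0 ≤ unifKer M (i + 1) z := by unfold unifKer; split_ifs <;> positivity
  have h3 : unifKer M i z ≤ ((M : ℝ)⁻¹) ^ i := by
    unfold unifKer; split_ifs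
    · rw [inv_pow]
    · positivity
  have h4 : unifKer M (i + 1) z ≤ ((M : ℝ)⁻¹) ^ i := by
    unfold unifKer; split_ifs
    · rw [← inv_pow]
      exact pow_le_pow_of_le_one (by positivity) (inv_le_one_of_one_le₀ hM'.le) (Nat.le_succ i)
    · positivity
  rw [specKer, abs_le]
  constructor <;> linarith

lemma summable_inv_pow (hM : 1 < M) : Summable fun i : ℕ => ((M : ℝ)⁻¹) ^ i :=
  summable_geometric_of_lt_one (by positivity) (inv_lt_one_of_one_lt₀ (by exact_mod_cast hM))

/-- Resolution of the identity: the sum telescopes from the point mass (radius zero) to averages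
over balls of growing radius, which tend to zero pointwise. -/
lemma hasSum_specKer (hM : 1 < M) (z : HierGroup M) :
    HasSum (fun i => specKer M i z) (if z = 0 then 1 else 0) := by
  have hs : Summable fun i => specKer M i z :=
    Summable.of_norm_bounded (summable_inv_pow hM) (abs_specKer_le hM · z)
  refine (hs.hasSum_iff_tendsto_nat).2 ?_
  have h1 : ∀ n, ∑ i ∈ Finset.range n, specKer M i z = unifKer M 0 z - unifKer M n z := fun n =>
    Finset.sum_range_sub' (fun i => unifKer M i z) n
  simp only [h1]
  have h2 : unifKer M 0 z = if z = 0 then 1 else 0 := by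
    simp [unifKer, hlen_eq_zero]
  rw [h2]
  have h3 : Tendsto (fun n => unifKer M n z) atTop (𝓝 0) := by
    refine squeeze_zero (g := fun n => ((M : ℝ)⁻¹) ^ n) (fun n => ?_) (fun n => ?_)
      (summable_inv_pow hM).tendsto_atTop_zero
    · unfold unifKer; split_ifs <;> positivity
    · unfold unifKer; split_ifs
      · rw [inv_pow]
      · positivity
  simpa using h3.const_sub (if z = 0 then (1 : ℝ) else 0)

lemma parB_pos (hM : 1 < M) (hc1 : c < 1) : 0 < parB M c := by
  have hM' : (1 : ℝ) < M := by exact_mod_cast hM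
  refine div_pos ?_ (mul_pos (by linarith) (by linarith))
  nlinarith

/-- Since `b` exceeds `1`, the eigenvalue of level zero is negative; this bound keeps it at or above
`-1`. -/
lemma parB_le_two (hM : 1 < M) (hc0 : 0 < c) : parB M c ≤ 2 := by
  have hM' : (2 : ℝ) ≤ M := by exact_mod_cast hM
  rw [parB, div_le_iff₀ (mul_pos (by linarith) (by linarith))]
  nlinarith

lemma parA_pos (hM : 1 < M) (hc0 : 0 < c) : 0 < parA M c := by
  have hM' : (1 : ℝ) < M := by exact_mod_cast hM
  exact div_pos hc0 (by linarith)

lemma parA_lt_one (hM : 1 < M) (hc1 : c < 1) : parA M c < 1 := by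
  have hM' : (1 : ℝ) < M := by exact_mod_cast hM
  rw [parA, div_lt_one (by linarith)]; linarith

lemma abs_eigenvalue_le_one (hM : 1 < M) (hc0 : 0 < c) (hc1 : c < 1) (i : ℕ) :
    |1 - parB M c * parA M c ^ i| ≤ 1 := by
  have h1 := parB_pos (c := c) hM hc1
  have h2 := parB_le_two hM hc0
  have h3 : 0 < parA M c ^ i := pow_pos (parA_pos hM hc0) i
  have h4 : parA M c ^ i ≤ 1 := pow_le_one₀ (parA_pos hM hc0).le (parA_lt_one hM hc1).le
  rw [abs_le]
  constructor <;> nlinarith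

/-- The induction starts from the resolution of the identity, and each further step multiplies level
`i` by its eigenvalue. The sums over the group and over the levels may be exchanged because the
terms are dominated by the product of the step kernel and `M^{-i}`. -/
lemma nStepProb_eq (hM : 1 < M) (hc0 : 0 < c) (hc1 : c < 1) (n : ℕ) (x y : HierGroup M) :
    nStepProb M c n x y = ∑' i, (1 - parB M c * parA M c ^ i) ^ n * specKer M i (x - y) := by
  have : NeZero M := ⟨by omega⟩
  induction n generalizing x with
  | zero =>
    simp only [nStepProb, pow_zero, one_mul, (hasSum_specKer hM _).tsum_eq, sub_eq_zero]
  | succ n ih =>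
    simp only [nStepProb, stepProb_eq_stepKer, ih, ← tsum_mul_left]
    have hb : ∀ i z, |(1 - parB M c * parA M c ^ i) ^ n * specKer M i z| ≤ ((M : ℝ)⁻¹) ^ i := by
      intro i z
      rw [abs_mul, abs_pow]
      calc _ ≤ 1 * ((M : ℝ)⁻¹) ^ i := by
            gcongr
            · exact pow_le_one₀ (abs_nonneg _) (abs_eigenvalue_le_one hM hc0 hc1 i)
            · exact abs_specKer_le hM i z
        _ = _ := one_mul _
    have hsx : Summable fun w => stepKer M c (x - w) :=
      (Equiv.subLeft x).summable_iff.2 (summable_stepKer hM hc0 hc1)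
    have hs : Summable fun p : HierGroup M × ℕ => stepKer M c (x - p.1) *
        ((1 - parB M c * parA M c ^ p.2) ^ n * specKer M p.2 (p.1 - y)) := by
      refine Summable.of_norm_bounded (hsx.mul_of_nonneg (summable_inv_pow hM)
        (fun w => stepKer_nonneg hM hc0 hc1 _) (fun i => by positivity)) fun p => ?_
      rw [norm_mul, Real.norm_of_nonneg (stepKer_nonneg hM hc0 hc1 _)]
      exact mul_le_mul_of_nonneg_left (hb _ _) (stepKer_nonneg hM hc0 hc1 _)
    rw [← hs.tsum_comm (f := fun w i => stepKer M c (x - w) *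
        ((1 - parB M c * parA M c ^ i) ^ n * specKer M i (w - y)))]
    refine tsum_congr fun i => ?_
    have := (specKer_eigen (c := c) hM i x y).mul_left ((1 - parB M c * parA M c ^ i) ^ n)
    rw [pow_succ, mul_assoc, ← this.tsum_eq]
    refine tsum_congr fun w => ?_
    ring

lemma hasSum_poisson_pow (t l : ℝ) :
    HasSum (fun n : ℕ => Real.exp (-t) * (t ^ n / (n.factorial : ℝ) * l ^ n))
      (Real.exp (-((1 - l) * t))) := by
  have h1 := (NormedSpace.expSeries_div_hasSum_exp (t * l))
  rw [← Real.exp_eq_exp_ℝ] at h1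
  have h2 := h1.mul_left (Real.exp (-t))
  rw [← Real.exp_add, show -t + t * l = -((1 - l) * t) by ring] at h2
  refine h2.congr_fun fun n => ?_
  rw [mul_pow, div_mul_eq_mul_div]

/-- A Poisson number of steps turns the power `l^n` into `e^{-(1-l)t}`; the bound `|l i| ≤ 1` makes
the double series absolutely convergent. -/
lemma tsum_poisson_mixture (l e : ℕ → ℝ) (hl : ∀ i, |l i| ≤ 1) (he : Summable fun i => |e i|)
    (t : ℝ) : Real.exp (-t) * ∑' n : ℕ, t ^ n / (n.factorial : ℝ) * ∑' i, l i ^ n * e i =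
      ∑' i, Real.exp (-((1 - l i) * t)) * e i := by
  have hs : Summable (Function.uncurry fun n i : ℕ => Real.exp (-t) *
      (t ^ n / (n.factorial : ℝ) * (l i ^ n * e i))) := by
    refine Summable.mul_left _ ?_
    refine Summable.of_norm_bounded ((Real.summable_pow_div_factorial t).abs.mul_of_nonneg he
      (fun w => abs_nonneg _) (fun i => abs_nonneg _)) fun p => ?_
    rw [norm_mul, norm_mul, norm_pow, Real.norm_eq_abs, Real.norm_eq_abs, Real.norm_eq_abs]
    refine mul_le_mul_of_nonneg_left ?_ (abs_nonneg _)
    exact mul_le_of_le_one_left (abs_nonneg _) (pow_le_one₀ (abs_nonneg _) (hl _))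
  rw [← tsum_mul_left]
  simp_rw [← tsum_mul_left]
  rw [← hs.tsum_comm]
  refine tsum_congr fun i => ?_
  rw [← ((hasSum_poisson_pow t (l i)).mul_right (e i)).tsum_eq]
  refine tsum_congr fun n => ?_
  ring

/-- Spectral representation of the transition probability of the `c`-random walk. -/
lemma transProb_eq (hM : 1 < M) (hc0 : 0 < c) (hc1 : c < 1) (t : ℝ) (x y : HierGroup M) :
    transProb M c t x y =
      ∑' i, Real.exp (-(parB M c * parA M c ^ i * t)) * specKer M i (x - y) := by
  have h := tsum_poisson_mixture (fun i => 1 - parB M c * parA M c ^ i)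
    (fun i => specKer M i (x - y)) (abs_eigenvalue_le_one hM hc0 hc1)
    (Summable.of_nonneg_of_le (fun _ => abs_nonneg _) (fun i => abs_specKer_le hM i _)
      (summable_inv_pow hM)) t
  simp only [sub_sub_cancel] at h
  rw [← h, transProb]
  congr 1
  refine tsum_congr fun n => ?_
  rw [nStepProb_eq hM hc0 hc1]

/-- Return probability bound: `∑ M^{-i} e^{-b a^i t}`. -/
def returnBound (M : ℕ) (c : ℝ) (t : ℝ) : ℝ :=
  ∑' i : ℕ, Real.exp (-(parB M c * parA M c ^ i * t)) * ((M : ℝ)⁻¹) ^ i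

lemma exp_rate_le_one (hM : 1 < M) (hc0 : 0 < c) (hc1 : c < 1) {t : ℝ} (ht : 0 ≤ t) (i : ℕ) :
    Real.exp (-(parB M c * parA M c ^ i * t)) ≤ 1 := by
  rw [Real.exp_le_one_iff]
  have h1 := parB_pos (c := c) hM hc1
  have h3 : 0 < parA M c ^ i := pow_pos (parA_pos hM hc0) i
  have : 0 ≤ parB M c * parA M c ^ i * t := by positivity
  linarith

lemma summable_returnBound (hM : 1 < M) (hc0 : 0 < c) (hc1 : c < 1) {t : ℝ} (ht : 0 ≤ t) :
    Summable fun i : ℕ => Real.exp (-(parB M c * parA M c ^ i * t)) * ((M : ℝ)⁻¹) ^ i := by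
  refine Summable.of_nonneg_of_le (fun i => by positivity) (fun i => ?_) (summable_inv_pow hM)
  have := exp_rate_le_one hM hc0 hc1 ht i
  have h2 : 0 ≤ ((M : ℝ)⁻¹) ^ i := by positivity
  nlinarith

lemma abs_transProb_le (hM : 1 < M) (hc0 : 0 < c) (hc1 : c < 1) {t : ℝ} (ht : 0 ≤ t)
    (x y : HierGroup M) : |transProb M c t x y| ≤ returnBound M c t := by
  rw [transProb_eq hM hc0 hc1, ← Real.norm_eq_abs]
  refine tsum_of_norm_bounded (summable_returnBound hM hc0 hc1 ht).hasSum fun i => ?_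
  rw [norm_mul, Real.norm_of_nonneg (Real.exp_nonneg _)]
  exact mul_le_mul_of_nonneg_left (abs_specKer_le hM i _) (Real.exp_nonneg _)

end Kernel

/-! ### The exponents and constants of the model. -/

section Parameters

variable {M : ℕ} {c : ℝ}

lemma log_ratio_pos (hM : 1 < M) (hc0 : 0 < c) (hc1 : c < 1) : 0 < Real.log (M / c) := by
  have hM' : (1 : ℝ) < M := by exact_mod_cast hM
  exact Real.log_pos (by rw [one_lt_div hc0]; linarith)

lemma walkDegree_neg (hM : 1 < M) (hc0 : 0 < c) (hc1 : c < 1) : walkDegree M c < 0 :=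
  div_neg_of_neg_of_pos (Real.log_neg hc0 hc1) (log_ratio_pos hM hc0 hc1)

lemma neg_one_lt_walkDegree (hM : 1 < M) (hc0 : 0 < c) (hc1 : c < 1) : -1 < walkDegree M c := by
  have hM' : (1 : ℝ) < M := by exact_mod_cast hM
  rw [walkDegree, lt_div_iff₀ (log_ratio_pos hM hc0 hc1), Real.log_div (by positivity) hc0.ne']
  have := Real.log_pos hM'
  linarith

/-- This identity singles out `γ`: it balances the decay `M^{-i}` of the spectral weights against
the rates `a^i`. -/
lemma parA_rpow_one_add_walkDegree (hM : 1 < M) (hc0 : 0 < c) (hc1 : c < 1) :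
    parA M c ^ (1 + walkDegree M c) = (M : ℝ)⁻¹ := by
  have hM' : (0 : ℝ) < M := by positivity
  have hl := log_ratio_pos hM hc0 hc1
  rw [Real.rpow_def_of_pos (parA_pos hM hc0)]
  have h1 : Real.log (parA M c) * (1 + walkDegree M c) = -Real.log M := by
    rw [Real.log_div hM'.ne' hc0.ne'] at hl
    rw [parA, walkDegree, Real.log_div hc0.ne' hM'.ne', Real.log_div hM'.ne' hc0.ne']
    field_simp
    ring
  rw [h1, Real.exp_neg, Real.exp_log hM']

lemma limitConst_sq (hM : 1 < M) (hc1 : c < 1) :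
    limitConst M c ^ 2 = ((M : ℝ) - 1) / M * parB M c ^ (-(1 + walkDegree M c)) := by
  have hM' : (1 : ℝ) < M := by exact_mod_cast hM
  have hb := Real.rpow_pos_of_pos (parB_pos (c := c) hM hc1) (1 + walkDegree M c)
  rw [limitConst, Real.sq_sqrt (div_nonneg (by linarith) (by positivity)),
    Real.rpow_neg (parB_pos hM hc1).le]
  field_simp

lemma limitConst_pos (hM : 1 < M) (hc1 : c < 1) : 0 < limitConst M c := by
  have hM' : (1 : ℝ) < M := by exact_mod_cast hM
  have hb := Real.rpow_pos_of_pos (parB_pos (c := c) hM hc1) (1 + walkDegree M c)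
  exact Real.sqrt_pos.2 (div_pos (by linarith) (by positivity))

end Parameters

/-! ### The oscillating function and the scaling of occupation time variances. -/

section Oscillation

/-- `e^{-x} - 1 + x`. -/
def expRem (x : ℝ) : ℝ := Real.exp (-x) - 1 + x

lemma expRem_nonneg (x : ℝ) : 0 ≤ expRem x := by
  have := Real.add_one_le_exp (-x)
  simp only [expRem]; linarith

lemma expRem_le_self {x : ℝ} (hx : 0 ≤ x) : expRem x ≤ x := by
  have : Real.exp (-x) ≤ 1 := by rw [Real.exp_le_one_iff]; linarith
  simp only [expRem]; linarith

lemma expRem_le_sq {x : ℝ} (hx : 0 ≤ x) : expRem x ≤ x ^ 2 := by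
  rcases le_or_gt x 1 with h | h
  · have := Real.norm_exp_sub_one_sub_id_le (x := -x) (by rw [norm_neg, Real.norm_of_nonneg hx]; exact h)
    rw [norm_neg, Real.norm_of_nonneg hx] at this
    have h2 := (abs_le.1 this).2
    simp only [expRem]; linarith
  · have := expRem_le_self hx
    nlinarith

/-- Interpolation between the quadratic behaviour at zero and the linear behaviour at infinity. -/
lemma expRem_le_rpow {x p : ℝ} (hx : 0 < x) (hp1 : 1 ≤ p) (hp2 : p ≤ 2) : expRem x ≤ x ^ p := by
  rcases le_or_gt x 1 with h | h
  · refine (expRem_le_sq hx.le).trans ?_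
    rw [← Real.rpow_two]
    exact Real.rpow_le_rpow_of_exponent_ge hx h hp2
  · refine (expRem_le_self hx.le).trans ?_
    conv_lhs => rw [← Real.rpow_one x]
    exact Real.rpow_le_rpow_of_exponent_le h.le hp1

/-- Dominating series for `t^(2H) h_t`. -/
def oscMajorant (a b H p : ℝ) (j : ℤ) : ℝ :=
  (b * a ^ j) ^ ((if 0 ≤ j then 2 else p) - 2 * H)

lemma rpow_mul_zpow {a b : ℝ} (ha : 0 < a) (hb : 0 < b) (j : ℤ) (s : ℝ) :
    (b * a ^ j) ^ s = b ^ s * (a ^ s) ^ j := by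
  rw [Real.mul_rpow hb.le (zpow_pos ha j).le, ← Real.rpow_intCast, ← Real.rpow_intCast,
    ← Real.rpow_mul ha.le, ← Real.rpow_mul ha.le, mul_comm (j : ℝ)]

/-- Small rates (`j ≥ 0`) are treated with the exponent `2 > 2H` and large rates (`j < 0`) with `p <
2H`, so both tails are geometric. -/
lemma summable_oscMajorant {a b H p : ℝ} (ha0 : 0 < a) (ha1 : a < 1) (hb : 0 < b)
    (hH : H < 1) (hp : p < 2 * H) : Summable (oscMajorant a b H p) := by
  refine Summable.of_nat_of_neg_add_one ?_ ?_
  · have : ∀ n : ℕ, oscMajorant a b H p n = b ^ (2 - 2 * H) * (a ^ (2 - 2 * H)) ^ n := by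
      intro n
      have h : (0 : ℤ) ≤ n := by positivity
      simp only [oscMajorant, h, if_true]
      rw [rpow_mul_zpow ha0 hb, zpow_natCast]
    simp only [this]
    exact (summable_geometric_of_lt_one (by positivity)
      (Real.rpow_lt_one ha0.le ha1 (by linarith))).mul_left _
  · have : ∀ n : ℕ, oscMajorant a b H p (-(n + 1 : ℤ)) =
        b ^ (p - 2 * H) * (a ^ (2 * H - p)) ^ (n + 1) := by
      intro n
      have h : ¬ (0 : ℤ) ≤ -(n + 1 : ℤ) := by omega
      simp only [oscMajorant, h, if_false, rpow_mul_zpow ha0 hb]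
      have e : a ^ (p - 2 * H) = (a ^ (2 * H - p))⁻¹ := by rw [← Real.rpow_neg ha0.le]; ring_nf
      rw [e, inv_zpow', neg_neg]
      norm_cast
    simp only [this]
    exact ((summable_nat_add_iff 1).2 (summable_geometric_of_lt_one (by positivity)
      (Real.rpow_lt_one ha0.le ha1 (by linarith)))).mul_left _

variable {a b H : ℝ}

lemma oscTerm_nonneg (ha0 : 0 < a) (hb : 0 < b) {t : ℝ} (ht : 0 ≤ t) (j : ℤ) :
    0 ≤ oscTerm a b H t j := by
  have : 0 ≤ b * a ^ j * t := by positivity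
  exact mul_nonneg (by positivity) (expRem_nonneg _)

lemma rpow_mul_oscTerm (ha0 : 0 < a) (hb : 0 < b) {t : ℝ} (ht : 0 < t) (j : ℤ) :
    t ^ (2 * H) * oscTerm a b H t j = (b * a ^ j) ^ (-(2 * H)) * expRem (b * a ^ j * t) := by
  have h : 0 < b * a ^ j := by positivity
  rw [oscTerm, Real.mul_rpow h.le ht.le, Real.rpow_neg ht.le, expRem]
  have := Real.rpow_pos_of_pos ht (2 * H)
  field_simp

lemma rpow_mul_oscTerm_le (ha0 : 0 < a) (hb : 0 < b) {p N t : ℝ} (hp1 : 1 ≤ p) (hp2 : p ≤ 2)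
    (ht : 0 < t) (htN : t ≤ N) (j : ℤ) :
    t ^ (2 * H) * oscTerm a b H t j ≤ oscMajorant a b H p j * ((1 + N) * t ^ p) := by
  have h : 0 < b * a ^ j := by positivity
  rw [rpow_mul_oscTerm ha0 hb ht, oscMajorant, sub_eq_neg_add, Real.rpow_add h,
    mul_assoc ((b * a ^ j) ^ (-(2 * H)))]
  refine mul_le_mul_of_nonneg_left ?_ (by positivity)
  have hN : 0 < N := ht.trans_le htN
  have htp : 0 < t ^ p := by positivity
  split_ifs with hj
  · refine (expRem_le_rpow (by positivity) one_le_two le_rfl).trans ?_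
    rw [Real.mul_rpow h.le ht.le]
    refine mul_le_mul_of_nonneg_left ?_ (by positivity)
    have e : t ^ (2 : ℝ) = t ^ (2 - p) * t ^ p := by rw [← Real.rpow_add ht]; ring_nf
    rw [e]
    refine mul_le_mul_of_nonneg_right ?_ htp.le
    -- Since `2 - p` lies in `[0, 1]`, the factor `t^(2-p)` is at most `max 1 t`, hence at most `1 +
    -- N`.
    rcases le_or_gt t 1 with h1 | h1
    · have := Real.rpow_le_one ht.le h1 (by linarith : 0 ≤ 2 - p)
      linarith
    · have := Real.rpow_le_rpow_of_exponent_le h1.le (by linarith : 2 - p ≤ 1)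
      rw [Real.rpow_one] at this
      linarith
  · refine (expRem_le_rpow (by positivity) hp1 hp2).trans ?_
    rw [Real.mul_rpow h.le ht.le]
    refine mul_le_mul_of_nonneg_left ?_ (by positivity)
    nlinarith

lemma summable_oscTerm (ha0 : 0 < a) (ha1 : a < 1) (hb : 0 < b) (hH0 : 1 / 2 < H) (hH : H < 1)
    {t : ℝ} (ht : 0 < t) : Summable (oscTerm a b H t) := by
  -- The exponent `p = 1` is admissible because `2H > 1`.
  have h := ((summable_oscMajorant (p := 1) ha0 ha1 hb hH (by linarith)).mul_right
    ((1 + t) * t ^ (1 : ℝ))).mul_left (t ^ (2 * H))⁻¹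
  refine Summable.of_nonneg_of_le (oscTerm_nonneg ha0 hb ht.le) (fun j => ?_) h
  rw [← div_eq_inv_mul, le_div_iff₀ (by positivity), mul_comm]
  exact rpow_mul_oscTerm_le ha0 hb le_rfl one_le_two ht le_rfl j

lemma oscPow_zero : oscPow a b H 0 = 0 := by simp [oscPow, oscH]

lemma oscPow_eq {t : ℝ} (ht : t ≠ 0) : oscPow a b H t = t ^ (2 * H) * ∑' j, oscTerm a b H t j := by
  simp [oscPow, oscH, ht]

lemma oscPow_nonneg (ha0 : 0 < a) (hb : 0 < b) {t : ℝ} (ht : 0 ≤ t) : 0 ≤ oscPow a b H t := by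
  rcases ht.eq_or_lt with rfl | h
  · rw [oscPow_zero]
  · rw [oscPow_eq h.ne']
    exact mul_nonneg (by positivity) (tsum_nonneg fun j => oscTerm_nonneg ha0 hb ht j)

/-- Hölder-type bound at the origin with an exponent `p ∈ (1, 2H)`. -/
lemma exists_oscPow_le (ha0 : 0 < a) (ha1 : a < 1) (hb : 0 < b) (hH0 : 1 / 2 < H) (hH : H < 1)
    {p : ℝ} (hp1 : 1 ≤ p) (hp : p < 2 * H) (N : ℝ) (hN : 0 ≤ N) :
    ∃ C, 0 ≤ C ∧ ∀ t, 0 ≤ t → t ≤ N → oscPow a b H t ≤ C * t ^ p := by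
  have hs := summable_oscMajorant ha0 ha1 hb hH hp
  refine ⟨(∑' j, oscMajorant a b H p j) * (1 + N),
    mul_nonneg (tsum_nonneg fun j => by unfold oscMajorant; positivity) (by linarith),
    fun t ht htN => ?_⟩
  rcases ht.eq_or_lt with rfl | h
  · rw [oscPow_zero, Real.zero_rpow (by linarith), mul_zero]
  · rw [oscPow_eq h.ne', ← tsum_mul_left, mul_assoc, ← tsum_mul_right]
    exact Summable.tsum_le_tsum (fun j => rpow_mul_oscTerm_le ha0 hb hp1 (by linarith) h htN j)
      ((summable_oscTerm ha0 ha1 hb hH0 hH h).mul_left _) (hs.mul_right _)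

/-- The second antiderivative `(e^{-βt} - 1 + βt) / β²` of `e^{-βt}`. -/
def expG (β t : ℝ) : ℝ := expRem (β * t) / β ^ 2

/-- Occupation time variance function of the spectral weights `q`. -/
def occVar (a b : ℝ) (q : ℕ → ℝ) (t : ℝ) : ℝ := ∑' i, q i * expG (b * a ^ i) t

/-- Relative spectral weights seen from scale `n`. -/
def relWeight (M : ℕ) (q : ℕ → ℝ) (n : ℕ) (j : ℤ) : ℝ :=
  if 0 ≤ j + n then q (j + n).toNat * (M : ℝ) ^ (j + n).toNat else 0

/-- Stretching time by `a^{-n}` replaces the rate `b a^i` by `b a^{i-n}`; the hypothesis `haM`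
expresses `M^i` as a power of `a`, and all remaining powers cancel. -/
lemma scaled_term {M : ℕ} (ha0 : 0 < a) (hb : 0 < b)
    (haM : a ^ (2 - 2 * H) = (M : ℝ)⁻¹) {t : ℝ} (ht : 0 < t) (n i : ℕ) :
    expG (b * a ^ i) (a ^ (-(n : ℤ)) * t) / (a ^ (-(n : ℤ))) ^ (2 * H) =
      b ^ (-(2 - 2 * H)) * t ^ (2 * H) * ((M : ℝ) ^ i * oscTerm a b H t (i - n)) := by
  have e1 : b ^ (-(2 - 2 * H)) * t ^ (2 * H) * ((M : ℝ) ^ i * oscTerm a b H t (i - n)) =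
      b ^ (-(2 - 2 * H)) * (M : ℝ) ^ i * (t ^ (2 * H) * oscTerm a b H t (i - n)) := by ring
  have hz : (b * a ^ i) * (a ^ (-(n : ℤ)) * t) = b * a ^ ((i : ℤ) - n) * t := by
    rw [sub_eq_add_neg, zpow_add₀ ha0.ne', zpow_natCast]; ring
  rw [e1, rpow_mul_oscTerm ha0 hb ht, expG, hz]
  have hMi : (M : ℝ) ^ i = (a ^ (-(2 - 2 * H))) ^ (i : ℤ) := by
    rw [Real.rpow_neg ha0.le, haM, inv_inv, zpow_natCast]
  have key : b ^ (-(2 - 2 * H)) * (M : ℝ) ^ i * (b * a ^ ((i : ℤ) - n)) ^ (-(2 * H)) =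
      ((b * a ^ i) ^ 2)⁻¹ * ((a ^ (-(n : ℤ))) ^ (2 * H))⁻¹ := by
    have c1 : ((b * a ^ i) ^ 2)⁻¹ = (b * a ^ (i : ℤ)) ^ (-(2 : ℝ)) := by
      rw [Real.rpow_neg (by positivity), Real.rpow_two, zpow_natCast]
    have c2 : ((a ^ (-(n : ℤ))) ^ (2 * H))⁻¹ = (1 * a ^ (-(n : ℤ))) ^ (-(2 * H)) := by
      rw [one_mul, Real.rpow_neg (by positivity)]
    rw [c1, c2, hMi, rpow_mul_zpow ha0 hb, rpow_mul_zpow ha0 hb, rpow_mul_zpow ha0 one_pos,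
      Real.one_rpow, one_mul, ← Real.rpow_intCast, ← Real.rpow_intCast, ← Real.rpow_intCast,
      ← Real.rpow_intCast, ← Real.rpow_mul ha0.le, ← Real.rpow_mul ha0.le, ← Real.rpow_mul ha0.le,
      ← Real.rpow_mul ha0.le]
    have : b ^ (-(2 - 2 * H)) * a ^ (-(2 - 2 * H) * ((i : ℤ) : ℝ)) *
        (b ^ (-(2 * H)) * a ^ (-(2 * H) * (((i : ℤ) - n : ℤ) : ℝ))) =
        (b ^ (-(2 - 2 * H)) * b ^ (-(2 * H))) * (a ^ (-(2 - 2 * H) * ((i : ℤ) : ℝ)) *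
         a ^ (-(2 * H) * (((i : ℤ) - n : ℤ) : ℝ))) := by ring
    rw [this, ← Real.rpow_add hb, ← Real.rpow_add ha0, mul_assoc, ← Real.rpow_add ha0]
    congr 2
    · ring
    · push_cast; ring
  rw [← mul_assoc, key]
  field_simp

/-- The substitution `j = i - n` covers exactly the integers `j ≥ -n`; below that range the relative
weight is zero, so the series may be taken over all integers. -/
lemma occVar_scaled {M : ℕ} (ha0 : 0 < a) (hb : 0 < b)
    (haM : a ^ (2 - 2 * H) = (M : ℝ)⁻¹) (q : ℕ → ℝ) {t : ℝ} (ht : 0 < t) (n : ℕ) :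
    occVar a b q (a ^ (-(n : ℤ)) * t) / (a ^ (-(n : ℤ))) ^ (2 * H) =
      b ^ (-(2 - 2 * H)) * t ^ (2 * H) * ∑' j : ℤ, relWeight M q n j * oscTerm a b H t j := by
  have hinj : Function.Injective fun i : ℕ => (i : ℤ) - n := fun i j h => by simpa using h
  rw [occVar, ← tsum_div_const, ← tsum_mul_left, ← hinj.tsum_eq]
  · refine tsum_congr fun i => ?_
    rw [mul_div_assoc, scaled_term ha0 hb haM ht, relWeight]
    simp only [sub_add_cancel, Nat.cast_nonneg, if_true, Int.toNat_natCast]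
    ring
  · intro j hj
    by_contra h
    refine hj ?_
    have : ¬ 0 ≤ j + n := fun h0 => h ⟨(j + n).toNat, by simp [Int.toNat_of_nonneg h0]⟩
    simp [relWeight, this]

lemma abs_relWeight_le {M : ℕ} (hM : 0 < M) {q : ℕ → ℝ} {C : ℝ} (hC : 0 ≤ C)
    (hq : ∀ i, |q i| ≤ C * ((M : ℝ)⁻¹) ^ i) (n : ℕ) (j : ℤ) : |relWeight M q n j| ≤ C := by
  have hM' : (0 : ℝ) < M := by exact_mod_cast hM
  unfold relWeight
  split_ifs
  · rw [abs_mul, abs_of_nonneg (by positivity : 0 ≤ (M : ℝ) ^ (j + n).toNat)]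
    refine (mul_le_mul_of_nonneg_right (hq _) (by positivity)).trans ?_
    rw [mul_assoc, ← mul_pow, inv_mul_cancel₀ hM'.ne', one_pow, mul_one]
  · simpa using hC

lemma tendsto_relWeight {M : ℕ} {q : ℕ → ℝ} {l : ℝ}
    (hl : Tendsto (fun i => q i * (M : ℝ) ^ i) atTop (𝓝 l)) (j : ℤ) :
    Tendsto (fun n => relWeight M q n j) atTop (𝓝 l) := by
  have h1 : Tendsto (fun n : ℕ => (j + n).toNat) atTop atTop := by
    refine tendsto_atTop.2 fun k => ?_
    filter_upwards [eventually_ge_atTop (k + j.natAbs)] with n hn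
    omega
  refine (hl.comp h1).congr' ?_
  filter_upwards [eventually_ge_atTop j.natAbs] with n hn
  have : 0 ≤ j + n := by omega
  simp [relWeight, this]

/-- Scaling limit of the occupation time variance function. -/
lemma tendsto_occVar_scaled {M : ℕ} (ha0 : 0 < a) (ha1 : a < 1) (hb : 0 < b) (hM : 0 < M)
    (hH0 : 1 / 2 < H) (hH : H < 1)
    (haM : a ^ (2 - 2 * H) = (M : ℝ)⁻¹) {q : ℕ → ℝ} {C l : ℝ} (hC : 0 ≤ C)
    (hq : ∀ i, |q i| ≤ C * ((M : ℝ)⁻¹) ^ i)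
    (hl : Tendsto (fun i => q i * (M : ℝ) ^ i) atTop (𝓝 l)) {t : ℝ} (ht : 0 ≤ t) :
    Tendsto (fun n : ℕ => occVar a b q (a ^ (-(n : ℤ)) * t) / (a ^ (-(n : ℤ))) ^ (2 * H)) atTop
      (𝓝 (l * b ^ (-(2 - 2 * H)) * oscPow a b H t)) := by
  rcases ht.eq_or_lt with rfl | h
  · simp [oscPow_zero, occVar, expG, expRem]
  · simp only [occVar_scaled ha0 hb haM q h]
    rw [oscPow_eq h.ne']
    have e : l * b ^ (-(2 - 2 * H)) * (t ^ (2 * H) * ∑' j, oscTerm a b H t j) =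
      b ^ (-(2 - 2 * H)) * t ^ (2 * H) * ∑' j, l * oscTerm a b H t j := by
      rw [tsum_mul_left]; ring
    rw [e]
    refine Tendsto.const_mul _ ?_
    -- Every relative weight converges to `l` and all are bounded by `C`, so `C` times the series of
    -- `h_t` dominates.
    refine tendsto_tsum_of_dominated_convergence (bound := fun j => C * oscTerm a b H t j)
      ((summable_oscTerm ha0 ha1 hb hH0 hH h).mul_left _)
      (fun j => (tendsto_relWeight hl j).mul_const _) (Eventually.of_forall fun n j => ?_)
    rw [norm_mul, Real.norm_of_nonneg (oscTerm_nonneg ha0 hb ht j)]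
    exact mul_le_mul_of_nonneg_right (abs_relWeight_le hM hC hq n j) (oscTerm_nonneg ha0 hb ht j)

/-- Uniform bound of the occupation time variance function along the scaling sequence. -/
lemma occVar_scaled_le {M : ℕ} (ha0 : 0 < a) (ha1 : a < 1) (hb : 0 < b) (hM : 0 < M)
    (hH0 : 1 / 2 < H) (hH : H < 1)
    (haM : a ^ (2 - 2 * H) = (M : ℝ)⁻¹) {q : ℕ → ℝ} {C : ℝ} (hC : 0 ≤ C)
    (hq : ∀ i, |q i| ≤ C * ((M : ℝ)⁻¹) ^ i) {t : ℝ} (ht : 0 ≤ t) (n : ℕ) :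
    occVar a b q (a ^ (-(n : ℤ)) * t) / (a ^ (-(n : ℤ))) ^ (2 * H) ≤
      C * b ^ (-(2 - 2 * H)) * oscPow a b H t := by
  rcases ht.eq_or_lt with rfl | h
  · simp [oscPow_zero, occVar, expG, expRem]
  · have hs := summable_oscTerm ha0 ha1 hb hH0 hH h
    have hb' : ∀ j, ‖relWeight M q n j * oscTerm a b H t j‖ ≤ C * oscTerm a b H t j := fun j => by
      rw [norm_mul, Real.norm_of_nonneg (oscTerm_nonneg ha0 hb ht j)]
      exact mul_le_mul_of_nonneg_right (abs_relWeight_le hM hC hq n j)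
        (oscTerm_nonneg ha0 hb ht j)
    rw [occVar_scaled ha0 hb haM q h, oscPow_eq h.ne']
    have e : C * b ^ (-(2 - 2 * H)) * (t ^ (2 * H) * ∑' j, oscTerm a b H t j) =
      b ^ (-(2 - 2 * H)) * t ^ (2 * H) * ∑' j, C * oscTerm a b H t j := by
      rw [tsum_mul_left]; ring
    rw [e]
    refine mul_le_mul_of_nonneg_left ?_ (by positivity)
    refine Summable.tsum_le_tsum (fun j => (le_abs_self _).trans (hb' j)) ?_ (hs.mul_left _)
    exact Summable.of_norm_bounded (hs.mul_left _) hb'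

end Oscillation

/-! ### Decay of the heat kernel. -/

section ReturnBound

variable {M : ℕ} {c : ℝ}

lemma exp_neg_le_rpow_neg {x s : ℝ} (hx : 0 < x) (hs0 : 0 ≤ s) (hs1 : s ≤ 1) :
    Real.exp (-x) ≤ x ^ (-s) := by
  rcases le_or_gt x 1 with h | h
  · have h1 : Real.exp (-x) ≤ 1 := by rw [Real.exp_le_one_iff]; linarith
    exact h1.trans (Real.one_le_rpow_of_pos_of_le_one_of_nonpos hx h (by linarith))
  · have h1 : Real.exp (-x) ≤ x⁻¹ := by
      rw [Real.exp_neg]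
      exact inv_anti₀ hx (by linarith [Real.add_one_le_exp x])
    refine h1.trans ?_
    rw [← Real.rpow_neg_one]
    exact Real.rpow_le_rpow_of_exponent_le h.le (by linarith)

/-- Heat kernel decay with any exponent `s < 1 + γ`. -/
lemma exists_returnBound_le (hM : 1 < M) (hc0 : 0 < c) (hc1 : c < 1) {s : ℝ} (hs0 : 0 ≤ s)
    (hs : s < 1 + walkDegree M c) :
    ∃ C, 0 ≤ C ∧ ∀ t, 0 < t → returnBound M c t ≤ C * t ^ (-s) := by
  have ha0 := parA_pos hM hc0
  have ha1 := parA_lt_one hM hc1 (c := c)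
  have hb := parB_pos (c := c) hM hc1
  have hneg := walkDegree_neg hM hc0 hc1
  -- After `e^{-x} ≤ x^{-s}`, level `i` contributes `(a^{-s} / M)^i = a^{(1+γ-s)i}`, a geometric
  -- term because `s < 1 + γ`.
  set r := parA M c ^ (-s) * (M : ℝ)⁻¹ with hr
  have hr1 : r < 1 := by
    rw [hr, ← parA_rpow_one_add_walkDegree hM hc0 hc1, ← Real.rpow_add ha0]
    exact Real.rpow_lt_one ha0.le ha1 (by linarith)
  have hr0 : 0 ≤ r := by positivity
  have hsum : Summable fun i : ℕ => r ^ i := summable_geometric_of_lt_one hr0 hr1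
  refine ⟨parB M c ^ (-s) * ∑' i : ℕ, r ^ i,
    mul_nonneg (by positivity) (tsum_nonneg fun i => by positivity), fun t ht => ?_⟩
  rw [returnBound, mul_right_comm, ← tsum_mul_left]
  refine Summable.tsum_le_tsum (fun i => ?_) (summable_returnBound hM hc0 hc1 ht.le)
    (hsum.mul_left _)
  have hx : 0 < parB M c * parA M c ^ i * t := by positivity
  refine (mul_le_mul_of_nonneg_right (exp_neg_le_rpow_neg hx hs0 (by linarith))
    (by positivity)).trans (le_of_eq ?_)
  rw [Real.mul_rpow (by positivity) ht.le, Real.mul_rpow hb.le (by positivity), hr, mul_pow,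
    ← Real.rpow_natCast, ← Real.rpow_natCast (parA M c ^ (-s)), ← Real.rpow_mul ha0.le,
    ← Real.rpow_mul ha0.le, mul_comm (i : ℝ)]
  ring

end ReturnBound

/-! ### A quantitative central limit theorem for countable sums. -/

section Lyapunov

/-- For `|x| ≤ 1` this is the Taylor remainder; for `|x| > 1` each of the terms is dominated by a
multiple of `|x|^3`. The constant is not optimal. -/
lemma norm_cexp_taylor_two_le (x : ℝ) :
    ‖Complex.exp (x * Complex.I) - (1 + x * Complex.I - x ^ 2 / 2)‖ ≤ 4 * |x| ^ 3 := by
  have hn : ‖(x : ℂ) * Complex.I‖ = |x| := by simp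
  rcases le_or_gt |x| 1 with h | h
  · have h1 := Complex.exp_bound (x := x * Complex.I) (by rw [hn]; exact h) (n := 3) (by norm_num)
    rw [hn] at h1
    have h2 : ∑ m ∈ Finset.range 3, ((x : ℂ) * Complex.I) ^ m / (m.factorial : ℂ) =
        1 + x * Complex.I - x ^ 2 / 2 := by
      simp [Finset.sum_range_succ, mul_pow, Nat.factorial]
      ring
    rw [h2] at h1
    refine h1.trans ?_
    rw [mul_comm]
    refine mul_le_mul_of_nonneg_right ?_ (by positivity)
    norm_num [Nat.factorial]
  · have h1 : ‖Complex.exp (x * Complex.I)‖ = 1 := Complex.norm_exp_ofReal_mul_I x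
    have h2 : ‖(1 + x * Complex.I - x ^ 2 / 2 : ℂ)‖ ≤ 1 + |x| + |x| ^ 2 / 2 := by
      refine (norm_sub_le _ _).trans (add_le_add ((norm_add_le _ _).trans ?_) ?_)
      · simp
      · simp
    refine (norm_sub_le _ _).trans ?_
    rw [h1]
    nlinarith [pow_pos (zero_lt_one.trans h) 2, pow_pos (zero_lt_one.trans h) 3,
      mul_pos (sub_pos.2 h) (pow_pos (zero_lt_one.trans h) 2), mul_pos (sub_pos.2 h)
      (zero_lt_one.trans h)]

variable {Ω : Type*} [MeasurableSpace Ω] {μ : Measure Ω} [IsProbabilityMeasure μ]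

lemma integrable_pow_of_integrable_abs_cube {X : Ω → ℝ} (hX : AEStronglyMeasurable X μ)
    (h3 : Integrable (fun ω => |X ω| ^ 3) μ) : Integrable X μ ∧ Integrable (fun ω => X ω ^ 2) μ := by
  constructor
  · refine ((integrable_const (1 : ℝ)).add h3).mono' hX (ae_of_all _ fun ω => ?_)
    simp only [Pi.add_apply, Real.norm_eq_abs]
    rcases le_or_gt |X ω| 1 with h | h
    · have : 0 ≤ |X ω| ^ 3 := by positivity
      linarith
    · have : |X ω| ^ 1 ≤ |X ω| ^ 3 := pow_le_pow_right₀ h.le (by norm_num)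
      linarith
  · refine ((integrable_const (1 : ℝ)).add h3).mono' (hX.pow 2) (ae_of_all _ fun ω => ?_)
    simp only [Pi.add_apply, Real.norm_eq_abs, abs_pow]
    rcases le_or_gt |X ω| 1 with h | h
    · have : 0 ≤ |X ω| ^ 3 := by positivity
      have : |X ω| ^ 2 ≤ 1 := pow_le_one₀ (abs_nonneg _) h
      linarith
    · have : |X ω| ^ 2 ≤ |X ω| ^ 3 := pow_le_pow_right₀ h.le (by norm_num)
      linarith

/-- Lyapunov's inequality between the second and the third absolute moments. -/
lemma sq_moment_rpow_le {X : Ω → ℝ} (hX : AEStronglyMeasurable X μ)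
    (h3 : Integrable (fun ω => |X ω| ^ 3) μ) :
    √(∫ ω, X ω ^ 2 ∂μ) ^ 3 ≤ ∫ ω, |X ω| ^ 3 ∂μ := by
  obtain ⟨_, h2⟩ := integrable_pow_of_integrable_abs_cube hX h3
  set v := ∫ ω, X ω ^ 2 ∂μ
  have hv : 0 ≤ v := integral_nonneg fun ω => sq_nonneg _
  set s := √v
  have hs : 0 ≤ s := Real.sqrt_nonneg _
  have hsv : s ^ 2 = v := Real.sq_sqrt hv
  -- Young's inequality `s x² ≤ (2/3)|x|³ + s³/3` with `s` the standard deviation: the left side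
  -- integrates to `s³`, and two thirds of it remain after subtraction.
  have h : ∫ ω, s * X ω ^ 2 ∂μ ≤ ∫ ω, (2 / 3 * |X ω| ^ 3 + s ^ 3 / 3) ∂μ := by
    refine integral_mono (h2.const_mul _) ((h3.const_mul _).add (integrable_const _)) fun ω => ?_
    have h4 : 0 ≤ |X ω| := abs_nonneg _
    simp only
    rw [← sq_abs (X ω)]
    nlinarith [mul_nonneg (add_nonneg (mul_nonneg zero_le_two h4) hs) (sq_nonneg (|X ω| - s))]
  rw [integral_const_mul, integral_add (h3.const_mul _) (integrable_const _), integral_const_mul,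
    integral_const, probReal_univ, one_smul] at h
  have : s * v = s ^ 3 := by rw [← hsv]; ring
  change s * v ≤ _ at h
  linarith

/-- The constant `5` is `4 + 1`: the Taylor remainder of the characteristic function, and the
difference between `1 - v/2` and `e^{-v/2}`, which is at most `v^{3/2}` and hence at most the third
absolute moment. -/
lemma norm_integral_cexp_sub_gaussian_le {X : Ω → ℝ} (hX : AEStronglyMeasurable X μ)
    (h3 : Integrable (fun ω => |X ω| ^ 3) μ) (h0 : ∫ ω, X ω ∂μ = 0) :
    ‖∫ ω, Complex.exp (X ω * Complex.I) ∂μ - Complex.exp (-((∫ ω, X ω ^ 2 ∂μ : ℝ) : ℂ) / 2)‖ ≤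
      5 * ∫ ω, |X ω| ^ 3 ∂μ := by
  obtain ⟨h1, h2⟩ := integrable_pow_of_integrable_abs_cube hX h3
  set v := ∫ ω, X ω ^ 2 ∂μ with hvdef
  have hv : 0 ≤ v := integral_nonneg fun ω => sq_nonneg _
  have hL := sq_moment_rpow_le hX h3
  rw [← hvdef] at hL
  have i1 : Integrable (fun ω => (X ω : ℂ) * Complex.I) μ := h1.ofReal.mul_const _
  have i2 : Integrable (fun ω => (X ω : ℂ) ^ 2 / 2) μ := by
    have := h2.ofReal (𝕜 := ℂ)
    simp only [Complex.coe_algebraMap, RCLike.ofReal_pow] at this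
    exact this.div_const 2
  have i0 : Integrable (fun ω => Complex.exp (X ω * Complex.I)) μ := by
    refine (integrable_const (1 : ℝ)).mono' ?_ (ae_of_all _ fun ω => by
      rw [Complex.norm_exp_ofReal_mul_I])
    exact Complex.continuous_exp.comp_aestronglyMeasurable
      ((Complex.continuous_ofReal.comp_aestronglyMeasurable hX).mul_const _)
  have i3 : Integrable (fun ω => 1 + (X ω : ℂ) * Complex.I) μ := (integrable_const _).add i1
  have i4 : Integrable (fun ω => 1 + (X ω : ℂ) * Complex.I - (X ω : ℂ) ^ 2 / 2) μ := i3.sub i2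
  have e1 : ∫ ω, (1 + (X ω : ℂ) * Complex.I - (X ω : ℂ) ^ 2 / 2) ∂μ = 1 - (v : ℂ) / 2 := by
    rw [integral_sub i3 i2, integral_add (integrable_const _) i1,
      integral_mul_const, integral_div, integral_complex_ofReal, h0]
    have : ∫ ω, (X ω : ℂ) ^ 2 ∂μ = (v : ℂ) := by
      rw [hvdef, ← integral_complex_ofReal]; simp
    simp [this]
  have h4 : ‖∫ ω, Complex.exp (X ω * Complex.I) ∂μ - (1 - (v : ℂ) / 2)‖ ≤
      4 * ∫ ω, |X ω| ^ 3 ∂μ := by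
    rw [← e1, ← integral_sub i0 i4, ← integral_const_mul]
    refine norm_integral_le_of_norm_le (h3.const_mul 4) (ae_of_all _ fun ω => ?_)
    exact norm_cexp_taylor_two_le (X ω)
  have h5 : ‖(1 - (v : ℂ) / 2) - Complex.exp (-(v : ℂ) / 2)‖ ≤ ∫ ω, |X ω| ^ 3 ∂μ := by
    refine le_trans ?_ hL
    have e2 : (1 - (v : ℂ) / 2) - Complex.exp (-(v : ℂ) / 2) = ((-expRem (v / 2) : ℝ) : ℂ) := by
      simp only [expRem]; push_cast; rw [neg_div]; ring
    rw [e2, Complex.norm_real, norm_neg, Real.norm_of_nonneg (expRem_nonneg _)]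
    have hs : 0 ≤ √v := Real.sqrt_nonneg _
    have hsv : √v ^ 2 = v := Real.sq_sqrt hv
    have b1 := expRem_le_sq (x := v / 2) (by positivity)
    have b2 := expRem_le_self (x := v / 2) (by positivity)
    generalize √v = s at *
    rw [← hsv] at b1 b2 ⊢
    -- The quadratic bound `s^4/4` is used for `s ≤ 1`, the linear bound `s^2/2` for `s > 1`; both
    -- are below `s^3`.
    rcases le_or_gt s 1 with h | h
    · nlinarith [pow_nonneg hs 3, mul_nonneg (pow_nonneg hs 3) (sub_nonneg.2 h)]
    · nlinarith [mul_nonneg (sq_nonneg s) (sub_pos.2 h).le, sq_nonneg s]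
  calc _ = ‖(∫ ω, Complex.exp (X ω * Complex.I) ∂μ - (1 - (v : ℂ) / 2)) +
        ((1 - (v : ℂ) / 2) - Complex.exp (-(v : ℂ) / 2))‖ := by congr 1; ring
    _ ≤ _ := norm_add_le _ _
    _ ≤ _ := by linarith

/-- The factors are exchanged one at a time; those not exchanged have modulus at most one. -/
lemma norm_prod_sub_prod_le_sum {ι : Type*} (s : Finset ι) (f g : ι → ℂ) (hf : ∀ i, ‖f i‖ ≤ 1)
    (hg : ∀ i, ‖g i‖ ≤ 1) : ‖∏ i ∈ s, f i - ∏ i ∈ s, g i‖ ≤ ∑ i ∈ s, ‖f i - g i‖ := by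
  classical
  induction s using Finset.induction_on with
  | empty => simp
  | insert i s hi ih =>
    rw [Finset.prod_insert hi, Finset.prod_insert hi, Finset.sum_insert hi]
    have e : f i * ∏ i ∈ s, f i - g i * ∏ i ∈ s, g i =
        (f i - g i) * ∏ i ∈ s, f i + g i * (∏ i ∈ s, f i - ∏ i ∈ s, g i) := by ring
    rw [e]
    refine (norm_add_le _ _).trans (add_le_add ?_ ?_)
    · rw [norm_mul]
      refine mul_le_of_le_one_right (norm_nonneg _) ?_
      rw [norm_prod]
      exact Finset.prod_le_one (fun _ _ => norm_nonneg _) fun i _ => hf i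
    · rw [norm_mul]
      exact (mul_le_of_le_one_left (norm_nonneg _) (hg i)).trans ih

/-- Quantitative Lyapunov central limit theorem for a countable sum of independent centered
random variables. -/
theorem norm_integral_cexp_tsum_sub_gaussian_le {ι : Type*} [Countable ι] {X : ι → Ω → ℝ}
    (hX : ∀ i, Measurable (X i)) (hind : iIndepFun X μ)
    (h3 : ∀ i, Integrable (fun ω => |X i ω| ^ 3) μ) (h0 : ∀ i, ∫ ω, X i ω ∂μ = 0)
    {v ρ : ℝ} (hv : HasSum (fun i => ∫ ω, X i ω ^ 2 ∂μ) v)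
    (hρ : HasSum (fun i => ∫ ω, |X i ω| ^ 3 ∂μ) ρ) {W : Ω → ℝ}
    (hW : ∀ᵐ ω ∂μ, HasSum (fun i => X i ω) (W ω)) :
    ‖∫ ω, Complex.exp (W ω * Complex.I) ∂μ - Complex.exp (-(v : ℂ) / 2)‖ ≤ 5 * ρ := by
  have hm : ∀ s : Finset ι, Measurable fun ω => Complex.exp ((∑ i ∈ s, X i ω : ℝ) * Complex.I) :=
    fun s => by fun_prop
  have t1 : Tendsto (fun s : Finset ι => ∫ ω, Complex.exp ((∑ i ∈ s, X i ω : ℝ) * Complex.I) ∂μ)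
      atTop (𝓝 (∫ ω, Complex.exp (W ω * Complex.I) ∂μ)) := by
    refine tendsto_integral_filter_of_dominated_convergence (fun _ => 1)
      (Eventually.of_forall fun s => (hm s).aestronglyMeasurable)
      (Eventually.of_forall fun s => ae_of_all _ fun ω => by
        rw [Complex.norm_exp_ofReal_mul_I]) (integrable_const _) ?_
    filter_upwards [hW] with ω hω
    have hω' : Tendsto (fun s : Finset ι => ∑ i ∈ s, X i ω) atTop (𝓝 (W ω)) := hω
    exact (Complex.continuous_exp.comp
      (Complex.continuous_ofReal.mul continuous_const)).continuousAt.tendsto.comp hω'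
  have e1 : ∀ s : Finset ι, ∫ ω, Complex.exp ((∑ i ∈ s, X i ω : ℝ) * Complex.I) ∂μ =
      ∏ i ∈ s, ∫ ω, Complex.exp (X i ω * Complex.I) ∂μ := by
    intro s
    have h := congrFun ((hind.restrict s).charFun_map_fun_finsetSum_eq_prod
      (fun i _ => (hX i).aemeasurable)) 1
    rw [charFun_apply_real, integral_map (by fun_prop) (by fun_prop)] at h
    simp only [Complex.ofReal_one, one_mul, Finset.prod_apply] at h
    rw [h]
    refine Finset.prod_congr rfl fun i _ => ?_
    rw [charFun_apply_real, integral_map (hX i).aemeasurable (by fun_prop)]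
    simp
  have t2 : Tendsto (fun s : Finset ι => ∏ i ∈ s,
      Complex.exp (-((∫ ω, X i ω ^ 2 ∂μ : ℝ) : ℂ) / 2)) atTop
      (𝓝 (Complex.exp (-(v : ℂ) / 2))) := by
    simp_rw [← Complex.exp_sum]
    have e : ∀ s : Finset ι, ∑ i ∈ s, (-((∫ ω, X i ω ^ 2 ∂μ : ℝ) : ℂ) / 2) =
        -((∑ i ∈ s, ∫ ω, X i ω ^ 2 ∂μ : ℝ) : ℂ) / 2 := by
      intro s
      rw [← Finset.sum_div, Finset.sum_neg_distrib]; push_cast; rfl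
    simp_rw [e]
    have hv' : Tendsto (fun s : Finset ι => ∑ i ∈ s, ∫ ω, X i ω ^ 2 ∂μ) atTop (𝓝 v) := hv
    have hc : Continuous fun y : ℝ => Complex.exp (-(y : ℂ) / 2) := by fun_prop
    exact hc.continuousAt.tendsto.comp hv'
  simp_rw [e1] at t1
  -- The estimate is uniform over finite partial sums and therefore passes to the limit along finite
  -- index sets.
  refine le_of_tendsto (t1.sub t2).norm (Eventually.of_forall fun s => ?_)
  refine (norm_prod_sub_prod_le_sum s _ _ (fun i => ?_) (fun i => ?_)).trans ?_
  · refine (norm_integral_le_integral_norm _).trans ?_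
    simp [Complex.norm_exp_ofReal_mul_I]
  · rw [Complex.norm_exp, Real.exp_le_one_iff]
    have : 0 ≤ ∫ ω, X i ω ^ 2 ∂μ := integral_nonneg fun ω => sq_nonneg _
    have e : (-((∫ ω, X i ω ^ 2 ∂μ : ℝ) : ℂ) / 2).re = -(∫ ω, X i ω ^ 2 ∂μ) / 2 := by
      rw [← Complex.ofReal_neg]; simp
    rw [e]; linarith
  · calc _ ≤ ∑ i ∈ s, 5 * ∫ ω, |X i ω| ^ 3 ∂μ := Finset.sum_le_sum fun i _ =>
          norm_integral_cexp_sub_gaussian_le (hX i).aestronglyMeasurable (h3 i) (h0 i)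
      _ ≤ 5 * ρ := by
          rw [← Finset.mul_sum]
          refine mul_le_mul_of_nonneg_left ?_ (by norm_num)
          exact sum_le_hasSum s (fun i _ => integral_nonneg fun ω => by positivity) hρ

end Lyapunov

/-! ### Dyadic chaining from second moments of increments. -/

section Chaining

/-- The `i`-th point of the dyadic grid of level `m` in `[0, τ]`. -/
def dyadicPt (τ : ℝ≥0) (m i : ℕ) : ℝ≥0 := i * τ / 2 ^ m

/-- `ℓ²`-norm of the increments of `f` over the dyadic grid of level `m`. -/
def dyadicOsc (τ : ℝ≥0) (m : ℕ) (f : ℝ≥0 → ℝ) : ℝ :=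
  √(∑ i ∈ Finset.range (2 ^ m), (f (dyadicPt τ m (i + 1)) - f (dyadicPt τ m i)) ^ 2)

/-- The last point before `t` on the dyadic grid of level `m`. -/
def dyadicFloor (τ : ℝ≥0) (m : ℕ) (t : ℝ≥0) : ℝ≥0 := dyadicPt τ m ⌊2 ^ m * t / τ⌋₊

/-- The `ℓ²`-norm replaces the maximum of the increments because second moments control it. -/
lemma abs_increment_le_dyadicOsc (τ : ℝ≥0) (m : ℕ) (f : ℝ≥0 → ℝ) {i : ℕ} (hi : i < 2 ^ m) :
    |f (dyadicPt τ m (i + 1)) - f (dyadicPt τ m i)| ≤ dyadicOsc τ m f := by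
  rw [← Real.sqrt_sq_eq_abs]
  exact Real.sqrt_le_sqrt (Finset.single_le_sum
    (f := fun i => (f (dyadicPt τ m (i + 1)) - f (dyadicPt τ m i)) ^ 2)
    (fun i _ => sq_nonneg _) (Finset.mem_range.2 hi))

lemma dyadicPt_succ_two_mul (τ : ℝ≥0) (m i : ℕ) : dyadicPt τ (m + 1) (2 * i) = dyadicPt τ m i := by
  simp only [dyadicPt, pow_succ]
  push_cast
  field_simp

lemma dyadicFloor_le {τ : ℝ≥0} (hτ : 0 < τ) (m : ℕ) (t : ℝ≥0) : dyadicFloor τ m t ≤ t := by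
  rw [dyadicFloor, dyadicPt, div_le_iff₀ (by positivity)]
  calc _ ≤ (2 ^ m * t / τ) * τ := by gcongr; exact Nat.floor_le (by positivity)
    _ = _ := by field_simp

lemma le_dyadicFloor_add {τ : ℝ≥0} (hτ : 0 < τ) (m : ℕ) (t : ℝ≥0) :
    t ≤ dyadicFloor τ m t + τ / 2 ^ m := by
  have h := (Nat.lt_floor_add_one (2 ^ m * t / τ)).le
  rw [dyadicFloor, dyadicPt, ← add_div, le_div_iff₀ (by positivity)]
  calc t * 2 ^ m = (2 ^ m * t / τ) * τ := by field_simp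
    _ ≤ (⌊2 ^ m * t / τ⌋₊ + 1) * τ := by gcongr
    _ = _ := by ring

lemma tendsto_dyadicFloor {τ : ℝ≥0} (hτ : 0 < τ) (t : ℝ≥0) :
    Tendsto (fun m => dyadicFloor τ m t) atTop (𝓝 t) := by
  have h2 : Tendsto (fun m : ℕ => τ / 2 ^ m) atTop (𝓝 0) := by
    have := (NNReal.tendsto_pow_atTop_nhds_zero_of_lt_one (r := (2 : ℝ≥0)⁻¹)
      (inv_lt_one_of_one_lt₀ one_lt_two)).const_mul τ
    simpa [div_eq_mul_inv] using this
  rw [← NNReal.tendsto_coe]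
  rw [← NNReal.tendsto_coe] at h2
  have h3 : Tendsto (fun m : ℕ => (t : ℝ) - ((τ / 2 ^ m : ℝ≥0) : ℝ)) atTop (𝓝 t) := by
    simpa using h2.const_sub (t : ℝ)
  refine tendsto_of_tendsto_of_tendsto_of_le_of_le h3 tendsto_const_nhds (fun m => ?_)
    (fun m => NNReal.coe_le_coe.2 (dyadicFloor_le hτ m t))
  have := NNReal.coe_le_coe.2 (le_dyadicFloor_add hτ m t)
  rw [NNReal.coe_add] at this
  simp only
  linarith

lemma floor_le_two_pow {τ t : ℝ≥0} (hτ : 0 < τ) (ht : t ≤ τ) (m : ℕ) :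
    ⌊2 ^ m * t / τ⌋₊ ≤ 2 ^ m := by
  have : 2 ^ m * t / τ ≤ ((2 ^ m : ℕ) : ℝ≥0) := by
    push_cast
    rw [div_le_iff₀ hτ]
    gcongr
  exact Nat.floor_le_of_le this

/-- Refining the grid once leaves the left grid point in place or moves it to the adjacent midpoint,
so at most one increment of the finer level occurs. -/
lemma dist_dyadicFloor_succ_le {τ t : ℝ≥0} (hτ : 0 < τ) (ht : t ≤ τ) (m : ℕ) (f : ℝ≥0 → ℝ) :
    dist (f (dyadicFloor τ m t)) (f (dyadicFloor τ (m + 1) t)) ≤ dyadicOsc τ (m + 1) f := by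
  set u : ℝ≥0 := 2 ^ m * t / τ with hu
  have hu2 : 2 ^ (m + 1) * t / τ = 2 * u := by rw [hu, pow_succ]; ring
  have h1 : 2 * ⌊u⌋₊ ≤ ⌊2 * u⌋₊ := by
    apply Nat.le_floor
    push_cast
    gcongr
    exact Nat.floor_le zero_le
  have h2 : ⌊2 * u⌋₊ < 2 * ⌊u⌋₊ + 2 := by
    rw [Nat.floor_lt zero_le]
    push_cast
    calc 2 * u < 2 * ((⌊u⌋₊ : ℝ≥0) + 1) := by gcongr; exact Nat.lt_floor_add_one u
      _ = _ := by ring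
  have h3 := floor_le_two_pow hτ ht (m + 1)
  simp only [dyadicFloor]
  rw [hu2] at h3 ⊢
  rw [← hu, ← dyadicPt_succ_two_mul, dist_comm, Real.dist_eq]
  rcases (by omega : ⌊2 * u⌋₊ = 2 * ⌊u⌋₊ ∨ ⌊2 * u⌋₊ = 2 * ⌊u⌋₊ + 1) with h | h
  · rw [h, sub_self, abs_zero]; exact Real.sqrt_nonneg _
  · rw [h]
    exact abs_increment_le_dyadicOsc τ (m + 1) f (by omega)

/-- Total dyadic oscillation from level `m` on. -/
def dyadicTail (τ : ℝ≥0) (m : ℕ) (f : ℝ≥0 → ℝ) : ℝ≥0∞ :=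
  ∑' k, ENNReal.ofReal (dyadicOsc τ (m + k) f)

lemma edist_dyadicFloor_le {τ t : ℝ≥0} (hτ : 0 < τ) (ht : t ≤ τ) (m : ℕ) (f : ℝ≥0 → ℝ) {l : ℝ}
    (hl : Tendsto (fun m => f (dyadicFloor τ m t)) atTop (𝓝 l)) :
    edist (f (dyadicFloor τ m t)) l ≤ dyadicTail τ (m + 1) f := by
  have h := edist_le_tsum_of_edist_le_of_tendsto (f := fun m => f (dyadicFloor τ m t))
    (fun m => ENNReal.ofReal (dyadicOsc τ (m + 1) f)) (fun n => by
      rw [edist_dist]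
      exact ENNReal.ofReal_le_ofReal (dist_dyadicFloor_succ_le hτ ht n f)) hl m
  refine h.trans (le_of_eq ?_)
  simp only [dyadicTail]
  congr 1; ext k; congr 2; ring

/-- Projection to the unit interval. -/
def clampUnit (x : ℝ) : ℝ := max 0 (min 1 x)

lemma continuous_clampUnit : Continuous clampUnit := by unfold clampUnit; fun_prop

/-- Piecewise linear interpolation over the dyadic grid of level `m`. -/
def dyadicInterp (τ : ℝ≥0) (m : ℕ) (f : ℝ≥0 → ℝ) (t : ℝ≥0) : ℝ :=
  f (dyadicPt τ m 0) + ∑ i ∈ Finset.range (2 ^ m),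
    (f (dyadicPt τ m (i + 1)) - f (dyadicPt τ m i)) * clampUnit (2 ^ m * t / τ - i)

/-- Ramps to the left of the cell of `t` have the value one and ramps to its right the value zero;
only a fraction of the increment over that cell remains. At `t = τ` there is no such cell and the
difference is zero. -/
lemma dist_dyadicInterp_le {τ t : ℝ≥0} (hτ : 0 < τ) (ht : t ≤ τ) (m : ℕ) (f : ℝ≥0 → ℝ) :
    dist (dyadicInterp τ m f t) (f (dyadicFloor τ m t)) ≤ dyadicOsc τ m f := by
  set u : ℝ≥0 := 2 ^ m * t / τ with hu
  have hur : (2 : ℝ) ^ m * t / τ = u := by rw [hu]; push_cast; rfl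
  have hk := floor_le_two_pow hτ ht m
  set k := ⌊u⌋₊ with hkdef
  have hk1 : (k : ℝ) ≤ u := by exact_mod_cast Nat.floor_le zero_le
  have hk2 : (u : ℝ) < k + 1 := by exact_mod_cast Nat.lt_floor_add_one u
  have hfl : f (dyadicFloor τ m t) = f (dyadicPt τ m 0) + ∑ i ∈ Finset.range k,
      (f (dyadicPt τ m (i + 1)) - f (dyadicPt τ m i)) := by
    rw [Finset.sum_range_sub (fun i => f (dyadicPt τ m i))]
    simp [dyadicFloor, ← hu, ← hkdef]
  have hlow : ∀ i ∈ Finset.range k, (f (dyadicPt τ m (i + 1)) - f (dyadicPt τ m i)) *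
      clampUnit (2 ^ m * t / τ - i) = f (dyadicPt τ m (i + 1)) - f (dyadicPt τ m i) := by
    intro i hi
    have h1 : (i : ℝ) + 1 ≤ k := by exact_mod_cast Finset.mem_range.1 hi
    have : clampUnit (2 ^ m * t / τ - i) = 1 := by
      rw [hur, clampUnit, min_eq_left (by linarith), max_eq_right zero_le_one]
    rw [this, mul_one]
  have hhigh : ∀ i, k + 1 ≤ i → clampUnit (2 ^ m * t / τ - i) = 0 := by
    intro i hi
    have h1 : (k : ℝ) + 1 ≤ i := by exact_mod_cast hi
    rw [hur, clampUnit, max_eq_left]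
    exact (min_le_right _ _).trans (by linarith)
  have hc : |clampUnit (2 ^ m * t / τ - k)| ≤ 1 := by
    rw [clampUnit, abs_of_nonneg (le_max_left _ _)]
    exact max_le zero_le_one (min_le_left _ _)
  rw [Real.dist_eq, dyadicInterp, hfl, ← Finset.sum_range_add_sum_Ico _ hk, Finset.sum_congr rfl hlow,
    ← sub_sub, add_sub_cancel_left, add_sub_cancel_left]
  rcases hk.eq_or_lt with h | h
  · rw [h, Finset.Ico_self, Finset.sum_empty, abs_zero]; exact Real.sqrt_nonneg _
  · rw [Finset.sum_eq_sum_Ico_succ_bot h, Finset.sum_eq_zero (s := Finset.Ico (k + 1) (2 ^ m)),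
      add_zero, abs_mul]
    · exact (mul_le_of_le_one_right (abs_nonneg _) hc).trans (abs_increment_le_dyadicOsc τ m f h)
    · intro i hi
      rw [hhigh i (Finset.mem_Ico.1 hi).1, mul_zero]

lemma dyadicTail_eq_add (τ : ℝ≥0) (m : ℕ) (f : ℝ≥0 → ℝ) :
    dyadicTail τ m f = ENNReal.ofReal (dyadicOsc τ m f) + dyadicTail τ (m + 1) f := by
  rw [dyadicTail, tsum_eq_zero_add' ENNReal.summable, dyadicTail]
  simp only [add_zero]
  congr 2; ext k; congr 2; ring

lemma edist_dyadicInterp_le {τ t : ℝ≥0} (hτ : 0 < τ) (ht : t ≤ τ) (m : ℕ) (f : ℝ≥0 → ℝ) {l : ℝ}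
    (hl : Tendsto (fun m => f (dyadicFloor τ m t)) atTop (𝓝 l)) :
    edist (dyadicInterp τ m f t) l ≤ dyadicTail τ m f := by
  rw [dyadicTail_eq_add]
  refine (edist_triangle _ (f (dyadicFloor τ m t)) _).trans (add_le_add ?_
    (edist_dyadicFloor_le hτ ht m f hl))
  rw [edist_dist]
  exact ENNReal.ofReal_le_ofReal (dist_dyadicInterp_le hτ ht m f)

variable {Ω : Type*} [MeasurableSpace Ω] {μ : Measure Ω}

lemma dyadicPt_le {τ : ℝ≥0} {m i : ℕ} (hi : i ≤ 2 ^ m) : dyadicPt τ m i ≤ τ := by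
  rw [dyadicPt, div_le_iff₀ (by positivity), mul_comm]
  gcongr
  exact_mod_cast hi

lemma coe_dyadicPt_succ_sub (τ : ℝ≥0) (m i : ℕ) :
    ((dyadicPt τ m (i + 1) : ℝ≥0) : ℝ) - dyadicPt τ m i = τ / 2 ^ m := by
  simp only [dyadicPt]; push_cast; ring

/-- Kolmogorov's moment condition with exponents `2` and `p` on `[0, τ]`. -/
def IncrementBound (μ : Measure Ω) (X : ℝ≥0 → Ω → ℝ) (τ : ℝ≥0) (C p : ℝ) : Prop :=
  ∀ s t : ℝ≥0, s ≤ t → t ≤ τ →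
    ∫⁻ ω, ENNReal.ofReal ((X t ω - X s ω) ^ 2) ∂μ ≤ ENNReal.ofReal (C * ((t : ℝ) - s) ^ p)

/-- For the sum `S` of squared increments, `√S ≤ ρ^m + ρ^{-m} S`. The ratio `ρ` is chosen so that
the moment condition gives `E S ≤ C τ^p ρ^{2m}`, and both terms are then of order `ρ^m`. -/
lemma lintegral_dyadicOsc_le [IsProbabilityMeasure μ] {X : ℝ≥0 → Ω → ℝ} (hX : ∀ t, AEMeasurable (X t) μ)
    {τ : ℝ≥0} {C p : ℝ} (hC : 0 ≤ C) (hB : IncrementBound μ X τ C p) (m : ℕ) :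
    ∫⁻ ω, ENNReal.ofReal (dyadicOsc τ m fun t => X t ω) ∂μ ≤
      ENNReal.ofReal ((1 + C * (τ : ℝ) ^ p) * (2 ^ ((1 - p) / 2) : ℝ) ^ m) := by
  set ρ : ℝ := 2 ^ ((1 - p) / 2) with hρ
  have hρ0 : 0 < ρ := by positivity
  have h1 : ∀ ω, ENNReal.ofReal (dyadicOsc τ m fun t => X t ω) ≤
      ENNReal.ofReal (ρ ^ m) + ENNReal.ofReal ((ρ ^ m)⁻¹) * ∑ i ∈ Finset.range (2 ^ m),
        ENNReal.ofReal ((X (dyadicPt τ m (i + 1)) ω - X (dyadicPt τ m i) ω) ^ 2) := by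
    intro ω
    rw [← ENNReal.ofReal_sum_of_nonneg (fun i _ => sq_nonneg _), ← ENNReal.ofReal_mul (by positivity),
      ← ENNReal.ofReal_add (by positivity)
        (mul_nonneg (by positivity) (Finset.sum_nonneg fun i _ => sq_nonneg _))]
    refine ENNReal.ofReal_le_ofReal ?_
    rw [dyadicOsc]
    set S := ∑ i ∈ Finset.range (2 ^ m), (X (dyadicPt τ m (i + 1)) ω - X (dyadicPt τ m i) ω) ^ 2
    have hS : 0 ≤ S := Finset.sum_nonneg fun i _ => sq_nonneg _
    have hr : 0 < ρ ^ m := by positivity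
    have hs := Real.sq_sqrt hS
    have h0 := Real.sqrt_nonneg S
    rw [← div_eq_inv_mul, ← sub_le_iff_le_add', le_div_iff₀ hr]
    nlinarith [sq_nonneg (√S - ρ ^ m), mul_nonneg h0 hr.le]
  refine (lintegral_mono h1).trans ?_
  rw [lintegral_add_left (by fun_prop), lintegral_const_mul'' _ (by fun_prop),
    lintegral_finsetSum' _ (fun i _ => by fun_prop), lintegral_const, measure_univ, mul_one]
  have h2 : ∑ i ∈ Finset.range (2 ^ m), ∫⁻ ω, ENNReal.ofReal
      ((X (dyadicPt τ m (i + 1)) ω - X (dyadicPt τ m i) ω) ^ 2) ∂μ ≤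
      ENNReal.ofReal (2 ^ m * (C * ((τ : ℝ) / 2 ^ m) ^ p)) := by
    have : ∀ i ∈ Finset.range (2 ^ m), ∫⁻ ω, ENNReal.ofReal
      ((X (dyadicPt τ m (i + 1)) ω - X (dyadicPt τ m i) ω) ^ 2) ∂μ ≤
        ENNReal.ofReal (C * ((τ : ℝ) / 2 ^ m) ^ p) := by
      intro i hi
      have hi' := Finset.mem_range.1 hi
      rw [← coe_dyadicPt_succ_sub τ m i]
      refine hB _ _ ?_ (dyadicPt_le (by omega))
      simp only [dyadicPt]
      gcongr
      omega
    refine (Finset.sum_le_sum this).trans (le_of_eq ?_)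
    rw [Finset.sum_const, Finset.card_range, nsmul_eq_mul, ENNReal.ofReal_mul (p := 2 ^ m) (by positivity)]
    congr 1
    rw [ENNReal.ofReal_pow (by norm_num)]
    simp
  refine (add_le_add_right (mul_le_mul_right h2 _) _).trans (le_of_eq ?_)
  rw [← ENNReal.ofReal_mul (by positivity), ← ENNReal.ofReal_add (by positivity) (by positivity)]
  congr 1
  have h3 : (2 : ℝ) ^ m * ((2 : ℝ) ^ m) ^ (-p) = ρ ^ m * ρ ^ m := by
    rw [hρ, ← Real.rpow_natCast, ← Real.rpow_natCast, ← Real.rpow_mul zero_le_two,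
      ← Real.rpow_mul zero_le_two, ← Real.rpow_add zero_lt_two, ← Real.rpow_add zero_lt_two]
    congr 1; ring
  rw [Real.div_rpow (NNReal.coe_nonneg _) (by positivity), div_eq_mul_inv ((τ : ℝ) ^ p),
    ← Real.rpow_neg (by positivity)]
  have h4 : (ρ ^ m)⁻¹ * (2 ^ m * (C * ((τ : ℝ) ^ p * (2 ^ m) ^ (-p)))) =
      (ρ ^ m)⁻¹ * (C * (τ : ℝ) ^ p * ((2 : ℝ) ^ m * ((2 : ℝ) ^ m) ^ (-p))) := by ring
  rw [h4, h3]
  field_simp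

lemma lintegral_dyadicTail_le [IsProbabilityMeasure μ] {X : ℝ≥0 → Ω → ℝ}
    (hX : ∀ t, AEMeasurable (X t) μ) {τ : ℝ≥0} {C p : ℝ} (hC : 0 ≤ C) (hp : 1 < p)
    (hB : IncrementBound μ X τ C p) (m : ℕ) :
    ∫⁻ ω, dyadicTail τ m (fun t => X t ω) ∂μ ≤ ENNReal.ofReal
      ((1 + C * (τ : ℝ) ^ p) * (1 - 2 ^ ((1 - p) / 2) : ℝ)⁻¹ * (2 ^ ((1 - p) / 2) : ℝ) ^ m) := by
  have hr1 : (2 : ℝ) ^ ((1 - p) / 2) < 1 :=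
    Real.rpow_lt_one_of_one_lt_of_neg one_lt_two (by linarith)
  have hr0 : (0 : ℝ) < 2 ^ ((1 - p) / 2) := by positivity
  set ρ : ℝ := 2 ^ ((1 - p) / 2)
  simp only [dyadicTail]
  rw [lintegral_tsum (fun k => by unfold dyadicOsc; fun_prop)]
  refine (ENNReal.tsum_le_tsum fun k => lintegral_dyadicOsc_le hX hC hB (m + k)).trans ?_
  have hs : Summable fun k : ℕ => (1 + C * (τ : ℝ) ^ p) * ρ ^ (m + k) := by
    simp only [pow_add]
    exact ((summable_geometric_of_lt_one hr0.le hr1).mul_left _).mul_left _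
  rw [← ENNReal.ofReal_tsum_of_nonneg (fun k => by positivity) hs]
  refine le_of_eq (congrArg _ ?_)
  simp only [pow_add]
  rw [tsum_mul_left, tsum_mul_left, tsum_geometric_of_lt_one hr0.le hr1]
  ring

end Chaining

/-! ### Weak convergence of continuous processes. -/

section WeakConvergence

lemma dist_integral_comp_le {Ω₀ E : Type*} [MeasurableSpace Ω₀] (Q : Measure Ω₀)
    [IsProbabilityMeasure Q] [PseudoMetricSpace E] [MeasurableSpace E] [BorelSpace E]
    {U V : Ω₀ → E} (hU : AEMeasurable U Q) (hV : AEMeasurable V Q) {d : ℝ} (hd : 0 ≤ d)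
    (hdist : ∫⁻ ω, edist (U ω) (V ω) ∂Q ≤ ENNReal.ofReal d) {f : E → ℝ} {C : ℝ}
    (hC : ∀ x y, dist (f x) (f y) ≤ C) {L : ℝ≥0} (hL : LipschitzWith L f) :
    dist (∫ ω, f (U ω) ∂Q) (∫ ω, f (V ω) ∂Q) ≤ L * d := by
  have hint : ∀ W : Ω₀ → E, AEMeasurable W Q → Integrable (fun ω => f (W ω)) Q := by
    intro W hW
    obtain ⟨ω₀⟩ : Nonempty Ω₀ := nonempty_of_isProbabilityMeasure Q
    refine Integrable.of_bound (C := C + |f (W ω₀)|)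
      (hL.continuous.measurable.comp_aemeasurable hW).aestronglyMeasurable
      (Eventually.of_forall fun ω => ?_)
    have h1 := hC (W ω) (W ω₀)
    rw [Real.dist_eq] at h1
    rw [Real.norm_eq_abs]
    calc |f (W ω)| = |(f (W ω) - f (W ω₀)) + f (W ω₀)| := by ring_nf
      _ ≤ _ := (abs_add_le _ _).trans (by gcongr)
  rw [Real.dist_eq, ← integral_sub (hint U hU) (hint V hV), ← Real.norm_eq_abs]
  have h2 := enorm_integral_le_lintegral_enorm (μ := Q) (fun ω => f (U ω) - f (V ω))
  have h3 : ∫⁻ ω, ‖f (U ω) - f (V ω)‖ₑ ∂Q ≤ ENNReal.ofReal (L * d) := by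
    calc _ ≤ ∫⁻ ω, L * edist (U ω) (V ω) ∂Q := by
          refine lintegral_mono fun ω => ?_
          rw [← edist_eq_enorm_sub]
          exact hL _ _
      _ = L * ∫⁻ ω, edist (U ω) (V ω) ∂Q := lintegral_const_mul' _ _ ENNReal.coe_ne_top
      _ ≤ L * ENNReal.ofReal d := by gcongr
      _ = _ := by
        rw [ENNReal.ofReal_mul L.coe_nonneg, ENNReal.ofReal_coe_nnreal]
  have h4 := h2.trans h3
  rw [← ofReal_norm, ENNReal.ofReal_le_ofReal_iff (by positivity)] at h4
  exact h4

/-- Convergence in distribution from approximations which converge in distribution. -/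
lemma tendstoInDistribution_of_approx {Ω Ω' E : Type*} [MeasurableSpace Ω] [MeasurableSpace Ω']
    {μ : Measure Ω} [IsProbabilityMeasure μ] {P : Measure Ω'} [IsProbabilityMeasure P]
    [PseudoMetricSpace E] [MeasurableSpace E] [BorelSpace E]
    {X : ℕ → Ω → E} {Y : Ω' → E} (hX : ∀ n, AEMeasurable (X n) μ) (hY : AEMeasurable Y P)
    {A : ℕ → ℕ → Ω → E} {B : ℕ → Ω' → E}
    (hAB : ∀ m, TendstoInDistribution (A m) atTop (B m) (fun _ => μ) P)
    {δ : ℕ → ℝ} (hδ : Tendsto δ atTop (𝓝 0)) (hδ0 : ∀ m, 0 ≤ δ m)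
    (hXA : ∀ m n, ∫⁻ ω, edist (X n ω) (A m n ω) ∂μ ≤ ENNReal.ofReal (δ m))
    (hYB : ∀ m, ∫⁻ ω, edist (Y ω) (B m ω) ∂P ≤ ENNReal.ofReal (δ m)) :
    TendstoInDistribution X atTop Y (fun _ => μ) P := by
  refine ⟨hX, hY, ?_⟩
  refine tendsto_iff_forall_lipschitz_integral_tendsto.2 ?_
  rintro f ⟨C, hC⟩ ⟨L, hL⟩
  have hmap : ∀ n, ∫ x, f x ∂(μ.map (X n)) = ∫ ω, f (X n ω) ∂μ := fun n =>
    integral_map (hX n) hL.continuous.measurable.aestronglyMeasurable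
  simp only [ProbabilityMeasure.coe_mk, hmap,
    integral_map hY hL.continuous.measurable.aestronglyMeasurable]
  have hA : ∀ m, Tendsto (fun n => ∫ ω, f (A m n ω) ∂μ) atTop (𝓝 (∫ ω, f (B m ω) ∂P)) := by
    intro m
    have := (tendsto_iff_forall_lipschitz_integral_tendsto.1 (hAB m).tendsto) f ⟨C, hC⟩ ⟨L, hL⟩
    simp only [ProbabilityMeasure.coe_mk,
      integral_map (hAB m).aemeasurable_limit hL.continuous.measurable.aestronglyMeasurable] at this
    refine this.congr fun n => ?_
    exact integral_map ((hAB m).forall_aemeasurable n) hL.continuous.measurable.aestronglyMeasurable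
  rw [Metric.tendsto_atTop]
  intro ε hε
  have h5 : Tendsto (fun m => (L : ℝ) * δ m) atTop (𝓝 0) := by simpa using hδ.const_mul (L : ℝ)
  -- The level `m` is fixed first, because the approximation error is uniform in `n`; only then is
  -- `n` taken large.
  obtain ⟨m, hm⟩ := (h5.eventually_lt_const (by positivity : 0 < ε / 3)).exists
  obtain ⟨N, hN⟩ := Metric.tendsto_atTop.1 (hA m) (ε / 3) (by positivity)
  refine ⟨N, fun n hn => ?_⟩
  have h6 := dist_integral_comp_le μ (hX n) ((hAB m).forall_aemeasurable n) (hδ0 m) (hXA m n) hC hL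
  have h7 := dist_integral_comp_le P hY (hAB m).aemeasurable_limit (hδ0 m) (hYB m) hC hL
  have h8 := hN n hn
  have h9 := dist_triangle4_right (∫ ω, f (X n ω) ∂μ) (∫ ω, f (Y ω) ∂P) (∫ ω, f (A m n ω) ∂μ)
    (∫ ω, f (B m ω) ∂P)
  linarith

/-- The tent functions of the dyadic grid, integrated: `0` before the `i`-th grid point, `1` after
the next one. -/
def rampPath (τ : ℝ≥0) (m i : ℕ) : C(Set.Icc (0 : ℝ≥0) τ, ℝ) :=
  ⟨fun t => clampUnit (2 ^ m * ((t : ℝ≥0) : ℝ) / τ - i), by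
    have := continuous_clampUnit
    fun_prop⟩

/-- The piecewise linear path with given values at the dyadic grid points. -/
def interpPath (τ : ℝ≥0) (m : ℕ) (v : EuclideanSpace ℝ (Fin (2 ^ m + 1))) :
    C(Set.Icc (0 : ℝ≥0) τ, ℝ) :=
  v 0 • (1 : C(Set.Icc (0 : ℝ≥0) τ, ℝ)) +
    ∑ i : Fin (2 ^ m), (v i.succ - v i.castSucc) • rampPath τ m i

lemma continuous_interpPath (τ : ℝ≥0) (m : ℕ) : Continuous (interpPath τ m) := by
  unfold interpPath
  fun_prop

/-- The values of `f` at the dyadic grid points. -/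
def gridVec (τ : ℝ≥0) (m : ℕ) (f : ℝ≥0 → ℝ) : EuclideanSpace ℝ (Fin (2 ^ m + 1)) :=
  WithLp.toLp 2 fun i => f (dyadicPt τ m i)

lemma interpPath_gridVec (τ : ℝ≥0) (m : ℕ) (f : ℝ≥0 → ℝ) (t : Set.Icc (0 : ℝ≥0) τ) :
    interpPath τ m (gridVec τ m f) t = dyadicInterp τ m f t := by
  simp [interpPath, gridVec, dyadicInterp, rampPath, Finset.sum_range]

lemma edist_interpPath_le {τ : ℝ≥0} (hτ : 0 < τ) (m : ℕ) {f : ℝ≥0 → ℝ} (hf : Continuous f)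
    (F : C(Set.Icc (0 : ℝ≥0) τ, ℝ)) (hF : ∀ t, F t = f t) :
    edist F (interpPath τ m (gridVec τ m f)) ≤ dyadicTail τ m f := by
  by_cases htop : dyadicTail τ m f = ⊤
  · rw [htop]; exact le_top
  rw [← ENNReal.ofReal_toReal htop, edist_dist]
  refine ENNReal.ofReal_le_ofReal ?_
  rw [ContinuousMap.dist_le ENNReal.toReal_nonneg]
  intro t
  have h := edist_dyadicInterp_le hτ t.2.2 m f (l := f t)
    ((hf.tendsto _).comp (tendsto_dyadicFloor hτ _))
  rw [interpPath_gridVec, hF, dist_comm]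
  rw [edist_dist] at h
  exact (ENNReal.ofReal_le_iff_le_toReal htop).1 h

variable {Ω : Type*} [MeasurableSpace Ω] {μ : Measure Ω} [IsProbabilityMeasure μ]

omit [IsProbabilityMeasure μ] in
lemma aemeasurable_gridVec {X : ℝ≥0 → Ω → ℝ} (hX : ∀ t, AEMeasurable (X t) μ) (τ : ℝ≥0) (m : ℕ) :
    AEMeasurable (fun ω => gridVec τ m fun t => X t ω) μ := by
  unfold gridVec
  refine (WithLp.measurable_toLp 2 _).comp_aemeasurable ?_
  exact aemeasurable_pi_lambda _ fun i => hX _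

/-- The total oscillation has finite expectation, so it is almost surely a convergent series, and
its tails vanish. -/
lemma ae_tendsto_dyadicTail {X : ℝ≥0 → Ω → ℝ}
    (hX : ∀ t, AEMeasurable (X t) μ) {τ : ℝ≥0} {C p : ℝ} (hC : 0 ≤ C) (hp : 1 < p)
    (hB : IncrementBound μ X τ C p) :
    ∀ᵐ ω ∂μ, Tendsto (fun m => dyadicTail τ m fun t => X t ω) atTop (𝓝 0) := by
  have h := ae_lt_top' (μ := μ) (f := fun ω => dyadicTail τ 0 fun t => X t ω)
    (by unfold dyadicTail dyadicOsc; fun_prop)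
    (ne_top_of_le_ne_top ENNReal.ofReal_ne_top (lintegral_dyadicTail_le hX hC hp hB 0))
  filter_upwards [h] with ω hω
  have := ENNReal.tendsto_sum_nat_add (fun k => ENNReal.ofReal (dyadicOsc τ k fun t => X t ω))
    (by simpa [dyadicTail] using hω.ne)
  simpa [dyadicTail, add_comm] using this

open Classical in
/-- The restriction of `f` to `[0, τ]` as a continuous path, if `f` is continuous. -/
def toPath (τ : ℝ≥0) (f : ℝ≥0 → ℝ) : C(Set.Icc (0 : ℝ≥0) τ, ℝ) :=
  if h : Continuous f then ⟨fun t => f t, h.comp continuous_subtype_val⟩ else 0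

lemma toPath_apply {τ : ℝ≥0} {f : ℝ≥0 → ℝ} (h : Continuous f) (t : Set.Icc (0 : ℝ≥0) τ) :
    toPath τ f t = f t := by
  simp [toPath, h]

/-- The path is the almost sure uniform limit of its interpolations, and these are continuous
functions of finitely many values of the process. -/
lemma aemeasurable_toPath {X : ℝ≥0 → Ω → ℝ} (hX : ∀ t, AEMeasurable (X t) μ)
    (hc : ∀ᵐ ω ∂μ, Continuous fun t => X t ω) {τ : ℝ≥0} (hτ : 0 < τ) {C p : ℝ} (hC : 0 ≤ C)
    (hp : 1 < p) (hB : IncrementBound μ X τ C p) :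
    AEMeasurable (fun ω => toPath τ fun t => X t ω) μ := by
  refine aemeasurable_of_tendsto_metrizable_ae atTop (f := fun m ω =>
    interpPath τ m (gridVec τ m fun t => X t ω)) (fun m =>
    (continuous_interpPath τ m).measurable.comp_aemeasurable (aemeasurable_gridVec hX τ m)) ?_
  filter_upwards [hc, ae_tendsto_dyadicTail hX hC hp hB] with ω hω ht
  rw [tendsto_iff_edist_tendsto_0]
  refine tendsto_of_tendsto_of_tendsto_of_le_of_le tendsto_const_nhds ht (fun _ => zero_le)
    fun m => ?_
  dsimp only
  rw [edist_comm]
  exact edist_interpPath_le hτ m hω _ (toPath_apply hω)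

/-- Weak convergence in `C([0, τ])` from convergence of the finite dimensional characteristic
functions and a uniform moment bound for the increments. -/
theorem convergesWeaklyC_of_charFun {Ω' : Type*} [MeasurableSpace Ω'] {P : Measure Ω'}
    [IsProbabilityMeasure P] {X : ℕ → ℝ≥0 → Ω → ℝ} {Y : ℝ≥0 → Ω' → ℝ}
    (hX : ∀ n t, AEMeasurable (X n t) μ) (hY : ∀ t, AEMeasurable (Y t) P)
    (hXc : ∀ n, ∀ᵐ ω ∂μ, Continuous fun t => X n t ω) (hYc : ∀ᵐ ω ∂P, Continuous fun t => Y t ω)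
    {p : ℝ} (hp : 1 < p)
    (hB : ∀ τ : ℝ≥0, ∃ C, 0 ≤ C ∧ (∀ n, IncrementBound μ (X n) τ C p) ∧ IncrementBound P Y τ C p)
    (hfdd : ∀ (k : ℕ) (t : Fin k → ℝ≥0) (l : Fin k → ℝ),
      Tendsto (fun n => ∫ ω, Complex.exp ((∑ j, l j * X n (t j) ω : ℝ) * Complex.I) ∂μ) atTop
        (𝓝 (∫ ω, Complex.exp ((∑ j, l j * Y (t j) ω : ℝ) * Complex.I) ∂P))) :
    ConvergesWeaklyC μ P X Y := by
  intro τ hτ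
  obtain ⟨C, hC, hBX, hBY⟩ := hB τ
  refine ⟨fun n ω => toPath τ fun t => X n t ω, fun ω => toPath τ fun t => Y t ω,
    fun n => ?_, ?_, ?_⟩
  · filter_upwards [hXc n] with ω hω using toPath_apply hω
  · filter_upwards [hYc] with ω hω using toPath_apply hω
  have hr1 : (2 : ℝ) ^ ((1 - p) / 2) < 1 :=
    Real.rpow_lt_one_of_one_lt_of_neg one_lt_two (by linarith)
  have hr0 : (0 : ℝ) < 2 ^ ((1 - p) / 2) := by positivity
  set δ : ℕ → ℝ := fun m =>
    (1 + C * (τ : ℝ) ^ p) * (1 - 2 ^ ((1 - p) / 2) : ℝ)⁻¹ * (2 ^ ((1 - p) / 2) : ℝ) ^ m with hδ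
  have hδ0 : ∀ m, 0 ≤ δ m := fun m => by
    have : (0 : ℝ) < 1 - 2 ^ ((1 - p) / 2) := by linarith
    positivity
  -- On a fixed grid, Lévy's continuity theorem turns `hfdd` into convergence in law of the vector
  -- of grid values. Interpolation is a continuous map of this vector.
  have hvec : ∀ m, TendstoInDistribution (fun n ω => gridVec τ m fun t => X n t ω) atTop
      (fun ω => gridVec τ m fun t => Y t ω) (fun _ => μ) P := by
    intro m
    refine ⟨fun n => aemeasurable_gridVec (hX n) τ m, aemeasurable_gridVec hY τ m, ?_⟩
    refine ProbabilityMeasure.tendsto_iff_tendsto_charFun.2 ?_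
    intro l
    have hmeas : Measurable fun x : EuclideanSpace ℝ (Fin (2 ^ m + 1)) =>
        Complex.exp (inner ℝ x l * Complex.I) := by fun_prop
    simp only [ProbabilityMeasure.coe_mk, charFun_apply,
      integral_map (aemeasurable_gridVec (hX _) τ m) hmeas.aestronglyMeasurable,
      integral_map (aemeasurable_gridVec hY τ m) hmeas.aestronglyMeasurable]
    have := hfdd _ (fun i => dyadicPt τ m i) l
    simpa [gridVec, PiLp.inner_apply] using this
  refine tendstoInDistribution_of_approx
    (fun n => aemeasurable_toPath (hX n) (hXc n) hτ hC hp (hBX n))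
    (aemeasurable_toPath hY hYc hτ hC hp hBY) (δ := δ)
    (fun m => (hvec m).continuous_comp (continuous_interpPath τ m))
    (by simpa using (tendsto_pow_atTop_nhds_zero_of_lt_one hr0.le hr1).const_mul
          ((1 + C * (τ : ℝ) ^ p) * (1 - 2 ^ ((1 - p) / 2) : ℝ)⁻¹)) hδ0 (fun m n => ?_) (fun m => ?_)
  · refine (lintegral_mono_ae ?_).trans (lintegral_dyadicTail_le (hX n) hC hp (hBX n) m)
    filter_upwards [hXc n] with ω hω using edist_interpPath_le hτ m hω _ (toPath_apply hω)
  · refine (lintegral_mono_ae ?_).trans (lintegral_dyadicTail_le hY hC hp hBY m)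
    filter_upwards [hYc] with ω hω using edist_interpPath_le hτ m hω _ (toPath_apply hω)

end WeakConvergence

/-! ### Existence of Gaussian families with a prescribed covariance. -/

section GaussianExistence

/-- A centered Gaussian process with covariance `C`, described by its characteristic functions. -/
def HasGaussianFdd {S Ω : Type*} [MeasurableSpace Ω] (P : Measure Ω) (X : S → Ω → ℝ)
    (C : S → S → ℝ) : Prop :=
  ∀ (k : ℕ) (t : Fin k → S) (l : Fin k → ℝ),
    ∫ ω, Complex.exp ((∑ j, l j * X (t j) ω : ℝ) * Complex.I) ∂P =
      Complex.exp (-(∑ i, ∑ j, l i * l j * C (t i) (t j) : ℝ) / 2)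

/-- A product of standard Gaussian laws. -/
def stdGauss (ι : Type*) : Measure (ι → ℝ) := Measure.infinitePi fun _ => gaussianReal 0 1

instance (ι : Type*) : IsProbabilityMeasure (stdGauss ι) := by unfold stdGauss; infer_instance

lemma measurePreserving_eval_stdGauss {ι : Type*} (i : ι) :
    MeasurePreserving (Function.eval i) (stdGauss ι) (gaussianReal 0 1) :=
  measurePreserving_eval_infinitePi _ i

lemma integral_comp_eval_stdGauss {ι E : Type*} [NormedAddCommGroup E] [NormedSpace ℝ E] (i : ι)
    {f : ℝ → E} (hf : StronglyMeasurable f) :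
    ∫ ω, f (ω i) ∂(stdGauss ι) = ∫ x, f x ∂(gaussianReal 0 1) := by
  have h := measurePreserving_eval_stdGauss i
  rw [← h.map_eq, integral_map h.measurable.aemeasurable hf.aestronglyMeasurable]

lemma iIndepFun_eval_stdGauss (ι : Type*) :
    iIndepFun (fun (i : ι) (ω : ι → ℝ) => ω i) (stdGauss ι) :=
  iIndepFun_infinitePi (X := fun _ x => x) fun _ => measurable_id

/-- The coordinate functions on a product of standard Gaussian spaces, as elements of `L²`. -/
def gaussCoord (ι : Type*) (i : ι) : Lp ℝ 2 (stdGauss ι) :=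
  MemLp.toLp (fun ω : ι → ℝ => ω i)
    ((memLp_id_gaussianReal 2).comp_measurePreserving (measurePreserving_eval_stdGauss i))

lemma coeFn_gaussCoord (ι : Type*) (i : ι) : gaussCoord ι i
    =ᵐ[stdGauss ι] fun ω : ι → ℝ => ω i :=
  MemLp.coeFn_toLp _

lemma orthonormal_gaussCoord (ι : Type*) : Orthonormal ℝ (gaussCoord ι) := by
  classical
  have hinner : ∀ i j, inner ℝ (gaussCoord ι i) (gaussCoord ι j) =
      ∫ ω : ι → ℝ, ω i * ω j ∂(stdGauss ι) := by
    intro i j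
    rw [L2.inner_def]
    refine integral_congr_ae ?_
    filter_upwards [coeFn_gaussCoord ι i, coeFn_gaussCoord ι j] with ω h1 h2
    rw [h1, h2]
    simp [mul_comm]
  have hm : ∀ i : ι, ∫ ω : ι → ℝ, ω i ∂(stdGauss ι) = 0 := by
    intro i
    rw [integral_comp_eval_stdGauss i (f := fun x => x) stronglyMeasurable_id]
    simp
  rw [orthonormal_iff_ite]
  intro i j
  rw [hinner]
  split_ifs with h
  · subst h
    rw [integral_comp_eval_stdGauss i (f := fun x => x * x) (by fun_prop)]
    have := variance_eq_sub (memLp_id_gaussianReal (μ := 0) (v := 1) 2)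
    rw [variance_id_gaussianReal] at this
    simp only [id_eq, Pi.pow_apply, integral_id_gaussianReal] at this
    simp only [← pow_two]
    norm_num at this
    exact this.symm
  · rw [((iIndepFun_eval_stdGauss ι).indepFun h).integral_fun_mul_eq_mul_integral
      (measurable_pi_apply i).aestronglyMeasurable (measurable_pi_apply j).aestronglyMeasurable, hm,
      zero_mul]

/-- A standard Gaussian vector tested by a Hilbert space vector. -/
lemma integral_cexp_sum_gaussCoord {ι : Type*} (s : Finset ι) (c : ι → ℝ) :
    ∫ ω : ι → ℝ, Complex.exp ((∑ i ∈ s, c i * ω i : ℝ) * Complex.I)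
      ∂(stdGauss ι) =
      Complex.exp (-(∑ i ∈ s, c i ^ 2 : ℝ) / 2) := by
  have hmeas : ∀ i, Measurable fun x : ℝ => Complex.exp ((c i * x : ℝ) * Complex.I) := fun i => by
    fun_prop
  have h2 : iIndepFun (fun (i : s) (ω : ι → ℝ) => Complex.exp ((c i * ω i : ℝ) * Complex.I))
      (stdGauss ι) :=
    ((iIndepFun_eval_stdGauss ι).precomp Subtype.val_injective).comp
      (fun (i : s) x => Complex.exp ((c i * x : ℝ) * Complex.I)) fun i => hmeas i
  have h3 : ∫ ω : ι → ℝ, ∏ i : s, Complex.exp ((c i * ω i : ℝ) * Complex.I) ∂(stdGauss ι) =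
      ∏ i : s, ∫ ω : ι → ℝ, Complex.exp ((c i * ω i : ℝ) * Complex.I) ∂(stdGauss ι) :=
    h2.integral_fun_prod_eq_prod_integral fun i =>
      ((hmeas i).comp (measurable_pi_apply (i : ι))).aestronglyMeasurable
  have h4 : ∀ ω : ι → ℝ, Complex.exp ((∑ i ∈ s, c i * ω i : ℝ) * Complex.I) =
      ∏ i : s, Complex.exp ((c i * ω i : ℝ) * Complex.I) := by
    intro ω
    rw [← Complex.exp_sum, ← Finset.sum_mul, ← Complex.ofReal_sum,
      Finset.sum_coe_sort s (fun i => c i * ω i)]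
  have h5 : ∀ i : ι, ∫ ω : ι → ℝ, Complex.exp ((c i * ω i : ℝ) * Complex.I) ∂(stdGauss ι) =
      Complex.exp (-(c i ^ 2 : ℝ) / 2) := by
    intro i
    rw [integral_comp_eval_stdGauss i (f := fun x => Complex.exp ((c i * x : ℝ) * Complex.I))
      (hmeas i).stronglyMeasurable]
    have := charFun_gaussianReal (μ := 0) (v := 1) (c i)
    rw [charFun_apply_real] at this
    push_cast at this ⊢
    rw [this]
    congr 1
    simp
    ring
  simp only [h4, h3, h5]
  rw [Finset.prod_coe_sort s (fun i => Complex.exp (-(c i ^ 2 : ℝ) / 2)), ← Complex.exp_sum]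
  congr 1
  push_cast
  rw [← Finset.sum_div, Finset.sum_neg_distrib]

lemma norm_cexp_ofReal_sub_le (x y : ℝ) :
    ‖Complex.exp (x * Complex.I) - Complex.exp (y * Complex.I)‖ ≤ |x - y| := by
  have h : Complex.exp (x * Complex.I) - Complex.exp (y * Complex.I) =
      Complex.exp (y * Complex.I) * (Complex.exp (Complex.I * (x - y : ℝ)) - 1) := by
    rw [mul_sub, mul_one, ← Complex.exp_add]
    push_cast
    ring_nf
  rw [h, norm_mul, Complex.norm_exp_ofReal_mul_I, one_mul]
  simpa using Real.norm_exp_I_mul_ofReal_sub_one_le (x := x - y)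

/-- The characteristic functional is continuous on `L²`. -/
lemma continuous_integral_cexp_Lp {Ω : Type*} [MeasurableSpace Ω] (P : Measure Ω)
    [IsProbabilityMeasure P] :
    Continuous fun f : Lp ℝ 2 P => ∫ ω, Complex.exp ((f ω : ℝ) * Complex.I) ∂P := by
  have hint : ∀ f : Lp ℝ 2 P, Integrable (fun ω => Complex.exp ((f ω : ℝ) * Complex.I)) P := by
    intro f
    refine Integrable.of_bound (C := 1) ?_ (Eventually.of_forall fun ω => by
      rw [Complex.norm_exp_ofReal_mul_I])
    have := (Lp.aestronglyMeasurable f).aemeasurable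
    exact AEMeasurable.aestronglyMeasurable (by fun_prop)
  have hlip : LipschitzWith 1 fun f : Lp ℝ 2 P => ∫ ω, Complex.exp ((f ω : ℝ) * Complex.I) ∂P := by
    refine LipschitzWith.of_dist_le_mul fun f g => ?_
    rw [NNReal.coe_one, one_mul, dist_eq_norm, ← integral_sub (hint f) (hint g)]
    have hL2 : MemLp (f - g : Lp ℝ 2 P) 2 P := Lp.memLp _
    have h1 : Integrable (fun ω => ‖(f - g : Lp ℝ 2 P) ω‖) P :=
      (hL2.integrable (by norm_num)).norm
    calc _ ≤ ∫ ω, ‖(f - g : Lp ℝ 2 P) ω‖ ∂P := by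
          refine norm_integral_le_of_norm_le h1 ?_
          filter_upwards [Lp.coeFn_sub f g] with ω hω
          rw [hω]
          exact norm_cexp_ofReal_sub_le _ _
      _ ≤ dist f g := by
          rw [dist_eq_norm, Lp.norm_def, integral_norm_eq_lintegral_enorm hL2.1,
            ← eLpNorm_one_eq_lintegral_enorm]
          refine ENNReal.toReal_mono hL2.2.ne ?_
          exact eLpNorm_le_eLpNorm_of_exponent_le (by norm_num) hL2.1
  exact hlip.continuous

/-- The isonormal Gaussian process over a real Hilbert space. -/
theorem exists_isonormal (H : Type) [NormedAddCommGroup H] [InnerProductSpace ℝ H]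
    [CompleteSpace H] :
    ∃ (Ω : Type) (_ : MeasurableSpace Ω) (P : Measure Ω) (_ : IsProbabilityMeasure P)
      (J : H →ₗᵢ[ℝ] Lp ℝ 2 P), ∀ h : H,
        ∫ ω, Complex.exp ((J h ω : ℝ) * Complex.I) ∂P = Complex.exp (-(‖h‖ ^ 2 : ℝ) / 2) := by
  classical
  obtain ⟨w, b, -⟩ := exists_hilbertBasis ℝ H
  have hg := orthonormal_gaussCoord w
  -- The isometry sends a Hilbert basis to independent standard normal variables.
  let J : H →ₗᵢ[ℝ] Lp ℝ 2 (stdGauss w) :=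
    hg.orthogonalFamily.linearIsometry.comp b.repr.toLinearIsometry
  have hJb : ∀ i, J (b i) = gaussCoord w i := by
    intro i
    change hg.orthogonalFamily.linearIsometry (b.repr (b i)) = _
    rw [b.repr_self]
    simp
  refine ⟨w → ℝ, inferInstance, stdGauss w, inferInstance, J, ?_⟩
  -- Both sides are continuous in `h`, so the identity need only be verified on the span of the
  -- basis, where it concerns finite sums of independent normals.
  have hclosed : IsClosed {h : H | ∫ ω, Complex.exp ((J h ω : ℝ) * Complex.I)
      ∂(stdGauss w) = Complex.exp (-(‖h‖ ^ 2 : ℝ) / 2)} :=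
    isClosed_eq ((continuous_integral_cexp_Lp _).comp J.continuous) (by fun_prop)
  intro h
  have hmem : h ∈ closure (Submodule.span ℝ (Set.range b) : Set H) := by
    rw [← Submodule.topologicalClosure_coe, b.dense_span]
    trivial
  refine closure_minimal (fun x hx => ?_) hclosed hmem
  obtain ⟨c, rfl⟩ := Finsupp.mem_span_range_iff_exists_finsupp.1 hx
  change _ = _
  have h1 : J (c.sum fun i a => a • b i) = ∑ i ∈ c.support, c i • gaussCoord w i := by
    simp [Finsupp.sum, map_sum, hJb]
  have h2 : ‖c.sum fun i a => a • b i‖ ^ 2 = ∑ i ∈ c.support, c i ^ 2 := by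
    rw [← real_inner_self_eq_norm_sq, Finsupp.sum, b.orthonormal.inner_sum]
    simp [pow_two]
  have h3 : ∀ s : Finset w, (↑(∑ i ∈ s, c i • gaussCoord w i) : (w → ℝ) → ℝ)
      =ᵐ[stdGauss w] fun ω => ∑ i ∈ s, c i * ω i := by
    intro s
    induction s using Finset.induction_on with
    | empty =>
      simp only [Finset.sum_empty]
      exact Lp.coeFn_zero ℝ 2 (stdGauss w)
    | insert i s hi ih =>
      rw [Finset.sum_insert hi]
      filter_upwards [ih, Lp.coeFn_add (c i • gaussCoord w i) (∑ i ∈ s, c i • gaussCoord w i),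
        Lp.coeFn_smul (c i) (gaussCoord w i), coeFn_gaussCoord w i] with ω h1 h2 h3 h4
      rw [h2, Pi.add_apply, h1, h3, Pi.smul_apply, h4, Finset.sum_insert hi, smul_eq_mul]
  rw [h1, h2, ← integral_cexp_sum_gaussCoord c.support c]
  refine integral_congr_ae ?_
  filter_upwards [h3 c.support] with ω hω
  rw [hω]

/-- Gaussian processes with prescribed positive semidefinite covariance exist. -/
theorem exists_hasGaussianFdd {S : Type} (C : S → S → ℝ) (hsymm : ∀ s t, C s t = C t s)
    (hpsd : ∀ (f : S →₀ ℝ), 0 ≤ f.sum fun s a => f.sum fun t b => a * b * C s t) :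
    ∃ (Ω : Type) (_ : MeasurableSpace Ω) (P : Measure Ω) (_ : IsProbabilityMeasure P)
      (W : S → Ω → ℝ), (∀ t, Measurable (W t)) ∧ (∀ t, MemLp (W t) 2 P) ∧
        (∀ s t, ∫ ω, W s ω * W t ω ∂P = C s t) ∧ HasGaussianFdd P W C := by
  -- In the reproducing kernel Hilbert space of this kernel, the kernel functions have inner
  -- products `C s t`; the process is the isonormal process evaluated at them.
  let K : Matrix S S (ℝ →L[ℝ] ℝ) := Matrix.of fun s t => C s t • (1 : ℝ →L[ℝ] ℝ)
  have hK : K.PosSemidef := by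
    refine ((RKHS.posSemidef_tfae (K := K)).out 0 2).2 (And.intro ?_ fun f => ?_)
    · ext s t
      simp [K, hsymm s t, Matrix.conjTranspose_apply]
    · refine (hpsd f).trans (le_of_eq ?_)
      simp only [Finsupp.sum, K, Matrix.of_apply]
      simp
      refine Finset.sum_congr rfl fun s _ => Finset.sum_congr rfl fun t _ => ?_
      rw [hsymm]; ring
  have : Fact K.PosSemidef := ⟨hK⟩
  obtain ⟨Ω, mΩ, P, hP, J, hJ⟩ := exists_isonormal (RKHS.OfKernel K)
  let v : S → RKHS.OfKernel K := fun s => RKHS.kerFun (RKHS.OfKernel K) s (1 : ℝ)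
  have hv : ∀ s t, inner ℝ (v s) (v t) = C s t := by
    intro s t
    rw [← RKHS.kernel_inner, RKHS.OfKernel.kernel_ofKernel, hsymm]
    simp [K]
  have hrep : ∀ t, AEMeasurable (J (v t)) P := fun t => (Lp.aestronglyMeasurable _).aemeasurable
  have hae : ∀ t, (hrep t).mk (J (v t)) =ᵐ[P] J (v t) := fun t => (hrep t).ae_eq_mk.symm
  refine ⟨Ω, mΩ, P, hP, fun t => (hrep t).mk (J (v t)), fun t => (hrep t).measurable_mk,
    fun t => (memLp_congr_ae (hae t)).2 (Lp.memLp _), fun s t => ?_, fun k t l => ?_⟩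
  · rw [← hv, ← J.inner_map_map, L2.inner_def]
    refine integral_congr_ae ?_
    filter_upwards [hae s, hae t] with ω h1 h2
    rw [h1, h2]
    simp [mul_comm]
  · have h3 : ∀ s : Finset (Fin k), (J (∑ j ∈ s, l j • v (t j)) : Ω → ℝ) =ᵐ[P]
        fun ω => ∑ j ∈ s, l j * (hrep (t j)).mk (J (v (t j))) ω := by
      intro s
      induction s using Finset.induction_on with
      | empty =>
        simp only [Finset.sum_empty, map_zero]
        exact Lp.coeFn_zero ℝ 2 P
      | insert i s hi ih =>
        rw [Finset.sum_insert hi, map_add, map_smul]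
        filter_upwards [ih, Lp.coeFn_add (l i • J (v (t i))) (J (∑ j ∈ s, l j • v (t j))),
          Lp.coeFn_smul (l i) (J (v (t i))), hae (t i)] with ω h1 h2 h3 h4
        rw [h2, Pi.add_apply, h1, h3, Pi.smul_apply, ← h4, Finset.sum_insert hi, smul_eq_mul]
    have h4 : ‖∑ j, l j • v (t j)‖ ^ 2 = ∑ i, ∑ j, l i * l j * C (t i) (t j) := by
      rw [← real_inner_self_eq_norm_sq, sum_inner]
      refine Finset.sum_congr rfl fun i _ => ?_
      rw [inner_sum]
      refine Finset.sum_congr rfl fun j _ => ?_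
      rw [real_inner_smul_left, real_inner_smul_right, hv]
      ring
    rw [← h4, ← hJ]
    refine integral_congr_ae ?_
    filter_upwards [h3 Finset.univ] with ω hω
    rw [hω]

end GaussianExistence

/-! ### From characteristic functions to Gaussian processes. -/

section GaussianFdd

lemma lintegral_sub_sq_eq {Ω : Type*} [MeasurableSpace Ω] {P : Measure Ω} {U V : Ω → ℝ}
    (hU : MemLp U 2 P) (hV : MemLp V 2 P) :
    ∫⁻ ω, ENNReal.ofReal ((V ω - U ω) ^ 2) ∂P = ENNReal.ofReal
      (∫ ω, V ω * V ω ∂P - 2 * ∫ ω, U ω * V ω ∂P + ∫ ω, U ω * U ω ∂P) := by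
  have h1 : ∀ ω, (V ω - U ω) ^ 2 = V ω * V ω - 2 * (U ω * V ω) + U ω * U ω :=
    fun ω => by ring
  have hVV : Integrable (fun ω => V ω * V ω) P := hV.integrable_mul hV
  have hUU : Integrable (fun ω => U ω * U ω) P := hU.integrable_mul hU
  have hUV : Integrable (fun ω => 2 * (U ω * V ω)) P := (hU.integrable_mul hV).const_mul 2
  have hs : Integrable (fun ω => V ω * V ω - 2 * (U ω * V ω)) P := hVV.sub hUV
  have hint : Integrable (fun ω => (V ω - U ω) ^ 2) P := by
    simp only [h1]
    exact hs.add hUU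
  rw [← ofReal_integral_eq_lintegral_ofReal hint (Eventually.of_forall fun ω => sq_nonneg _)]
  simp only [h1]
  rw [integral_add hs hUU, integral_sub hVV hUV, integral_const_mul]

variable {S Ω : Type*} [MeasurableSpace Ω] {P : Measure Ω} [IsProbabilityMeasure P]
  {X : S → Ω → ℝ} {C : S → S → ℝ}

omit [IsProbabilityMeasure P] in
lemma HasGaussianFdd.integral_cexp (h : HasGaussianFdd P X C) {ι : Type*} [Fintype ι] (t : ι → S)
    (l : ι → ℝ) :
    ∫ ω, Complex.exp ((∑ j, l j * X (t j) ω : ℝ) * Complex.I) ∂P =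
      Complex.exp (-(∑ i, ∑ j, l i * l j * C (t i) (t j) : ℝ) / 2) := by
  have e := (Fintype.equivFin ι).symm
  have := h _ (t ∘ e) (l ∘ e)
  simp only [Function.comp_apply] at this
  have h2 : ∀ i, ∑ j, l (e i) * l (e j) * C (t (e i)) (t (e j)) =
      ∑ j, l (e i) * l j * C (t (e i)) (t j) := fun i =>
    e.sum_comp fun j => l (e i) * l j * C (t (e i)) (t j)
  have h3 : ∀ ω, ∑ j, l (e j) * X (t (e j)) ω = ∑ j, l j * X (t j) ω := fun ω =>
    e.sum_comp fun j => l j * X (t j) ω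
  simp only [h2, h3, e.sum_comp fun i => ∑ j, l i * l j * C (t i) (t j)] at this
  exact this

/-- Positivity of the quadratic form is not a hypothesis: it follows because a characteristic
function has modulus at most one. -/
lemma HasGaussianFdd.map_sum (h : HasGaussianFdd P X C) (hX : ∀ t, AEMeasurable (X t) P)
    {ι : Type*} [Fintype ι] (t : ι → S) (l : ι → ℝ) :
    0 ≤ ∑ i, ∑ j, l i * l j * C (t i) (t j) ∧
    P.map (fun ω => ∑ j, l j * X (t j) ω) =
      gaussianReal 0 (∑ i, ∑ j, l i * l j * C (t i) (t j)).toNNReal := by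
  have hv : 0 ≤ ∑ i, ∑ j, l i * l j * C (t i) (t j) := by
    have h1 := h.integral_cexp t l
    have h2 : ‖∫ ω, Complex.exp ((∑ j, l j * X (t j) ω : ℝ) * Complex.I) ∂P‖ ≤ 1 := by
      refine (norm_integral_le_of_norm_le_const (C := 1) (Eventually.of_forall fun ω => ?_)).trans
        (by simp)
      rw [Complex.norm_exp_ofReal_mul_I]
    rw [h1, Complex.norm_exp, Real.exp_le_one_iff, ← Complex.ofReal_neg] at h2
    have h3 : ((-(∑ i, ∑ j, l i * l j * C (t i) (t j)) : ℝ) / 2 : ℂ).re =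
      -(∑ i, ∑ j, l i * l j * C (t i) (t j)) / 2 := by
      rw [← Complex.ofReal_ofNat, ← Complex.ofReal_div, Complex.ofReal_re]
    rw [h3] at h2
    linarith
  refine ⟨hv, ?_⟩
  have hm : AEMeasurable (fun ω => ∑ j, l j * X (t j) ω) P := by fun_prop
  have := Measure.isProbabilityMeasure_map hm
  refine Measure.ext_of_charFun (funext fun u => ?_)
  rw [charFun_gaussianReal, charFun_apply_real, integral_map hm (by fun_prop)]
  have h1 := h.integral_cexp t (fun j => u * l j)
  have h2 : ∑ i, ∑ j, u * l i * (u * l j) * C (t i) (t j) =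
      u ^ 2 * ∑ i, ∑ j, l i * l j * C (t i) (t j) := by
    rw [Finset.mul_sum]
    refine Finset.sum_congr rfl fun i _ => ?_
    rw [Finset.mul_sum]
    exact Finset.sum_congr rfl fun j _ => by ring
  have h3 : ∀ ω, ∑ j, u * l j * X (t j) ω = u * ∑ j, l j * X (t j) ω := fun ω => by
    rw [Finset.mul_sum]
    exact Finset.sum_congr rfl fun j _ => by ring
  simp only [h2, h3] at h1
  simp only [Complex.ofReal_mul] at h1 ⊢
  rw [h1]
  congr 1
  rw [Real.coe_toNNReal _ hv]
  push_cast
  ring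

lemma HasGaussianFdd.isGaussianProcess (h : HasGaussianFdd P X C)
    (hX : ∀ t, AEMeasurable (X t) P) : IsGaussianProcess X P := by
  refine ⟨fun I => ⟨isGaussian_of_map_eq_gaussianReal fun L => ?_⟩⟩
  classical
  have hm : AEMeasurable (fun ω => I.restrict (X · ω)) P :=
    aemeasurable_pi_lambda _ fun i => hX _
  rw [AEMeasurable.map_map_of_aemeasurable (by fun_prop) hm]
  have h1 := (h.map_sum hX (ι := I) (fun i => (i : S)) fun i => L (Pi.single i 1)).2
  refine ⟨0, _, Eq.trans ?_ h1⟩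
  congr 1
  ext ω
  rw [Function.comp_apply, ← ContinuousLinearMap.coe_coe, LinearMap.pi_apply_eq_sum_univ]
  refine Finset.sum_congr rfl fun i _ => ?_
  have : (fun j => if i = j then (1 : ℝ) else 0) = Pi.single i 1 := by
    ext j; simp [Pi.single_apply, eq_comm]
  simp [mul_comm, this, Finset.restrict]

lemma HasGaussianFdd.integral_eq_zero (h : HasGaussianFdd P X C)
    (hX : ∀ t, AEMeasurable (X t) P) (t : S) : ∫ ω, X t ω ∂P = 0 := by
  have h1 := (h.map_sum hX (ι := Unit) (fun _ => t) fun _ => 1).2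
  simp only [Finset.univ_unique, Finset.sum_singleton, one_mul] at h1
  have h2 : ∫ ω, X t ω ∂P = ∫ x, x ∂(P.map fun ω => X t ω) :=
    (integral_map (f := fun x => x) (hX t) (by fun_prop)).symm
  rw [h2, h1]
  simp

omit [IsProbabilityMeasure P] in
lemma HasGaussianFdd.congr (h : HasGaussianFdd P X C) {Y : S → Ω → ℝ}
    (hXY : ∀ t, X t =ᵐ[P] Y t) : HasGaussianFdd P Y C := by
  intro k t l
  rw [← h k t l]
  refine integral_congr_ae ?_
  filter_upwards [ae_all_iff.2 fun j => hXY (t j)] with ω hω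
  simp only [hω]

end GaussianFdd

/-! ### From Gaussian processes to characteristic functions. -/

section Converse

variable {Ω : Type*} [MeasurableSpace Ω] {P : Measure Ω} {X : ℝ≥0 → Ω → ℝ} {C : ℝ → ℝ → ℝ}

lemma IsContCenteredGaussian.memLp_two (h : IsContCenteredGaussian P X C) (t : ℝ≥0) :
    MemLp (X t) 2 P := (h.gaussian.hasGaussianLaw_eval t).memLp_two

lemma IsContCenteredGaussian.hasGaussianFdd (h : IsContCenteredGaussian P X C) :
    HasGaussianFdd P X fun s t => C s t := by
  have := h.gaussian.isProbabilityMeasure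
  intro k t l
  have hg : HasGaussianLaw (fun ω => ∑ j, l j * X (t j) ω) P := by
    have h1 : IsGaussianProcess (fun (j : Fin k) ω => l j • X (t j) ω) P :=
      (h.gaussian.comp_right t).smul l
    simpa using h1.hasGaussianLaw_fun_sum (I := Finset.univ)
  have hm : ∫ ω, ∑ j, l j * X (t j) ω ∂P = 0 := by
    rw [integral_finsetSum _ fun j _ =>
      ((h.memLp_two (t j)).integrable (by norm_num)).const_mul (l j)]
    simp [integral_const_mul, h.mean]
  have hv : Var[fun ω => ∑ j, l j * X (t j) ω; P] = ∑ i, ∑ j, l i * l j * C (t i) (t j) := by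
    rw [variance_eq_integral hg.aemeasurable, hm]
    have h2 : ∀ ω, (∑ j, l j * X (t j) ω - 0) ^ 2 =
        ∑ i, ∑ j, l i * l j * (X (t i) ω * X (t j) ω) := by
      intro ω
      rw [sub_zero, pow_two, Finset.sum_mul_sum]
      exact Finset.sum_congr rfl fun i _ => Finset.sum_congr rfl fun j _ => by ring
    have hint : ∀ i j, Integrable (fun ω => l i * l j * (X (t i) ω * X (t j) ω)) P := fun i j =>
      ((h.memLp_two (t i)).integrable_mul (h.memLp_two (t j))).const_mul _
    simp only [h2]
    rw [integral_finsetSum _ fun i _ => integrable_finsetSum _ fun j _ => hint i j]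
    refine Finset.sum_congr rfl fun i _ => ?_
    rw [integral_finsetSum _ fun j _ => hint i j]
    refine Finset.sum_congr rfl fun j _ => ?_
    rw [integral_const_mul, h.cov]
  have h3 := charFun_gaussianReal (μ := 0)
    (v := (∑ i, ∑ j, l i * l j * C (t i) (t j)).toNNReal) 1
  rw [← hv, ← hm, ← hg.map_eq_gaussianReal, charFun_apply_real,
    integral_map hg.aemeasurable (by fun_prop), hm,
    Real.coe_toNNReal _ (variance_nonneg _ _), hv] at h3
  simp only [Complex.ofReal_one, one_mul] at h3
  rw [h3]
  congr 1
  simp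
  ring

lemma IsContCenteredGaussian.comp_measurePreserving (h : IsContCenteredGaussian P X C)
    {Ω' : Type*} [MeasurableSpace Ω'] {Q : Measure Ω'} {g : Ω' → Ω} (hg : MeasurePreserving g Q P) :
    IsContCenteredGaussian Q (fun t ω => X t (g ω)) C where
  gaussian := by
    refine ⟨fun I => ⟨?_⟩⟩
    have h1 := (h.gaussian.hasGaussianLaw I).isGaussian_map
    have h2 := (h.gaussian.hasGaussianLaw I).aemeasurable
    rw [← hg.map_eq] at h1 h2
    rw [AEMeasurable.map_map_of_aemeasurable h2 hg.measurable.aemeasurable] at h1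
    exact h1
  mean t := by
    rw [← h.mean t, ← hg.map_eq, integral_map hg.measurable.aemeasurable]
    rw [hg.map_eq]
    exact (h.memLp_two t).1
  cov s t := by
    rw [← h.cov s t, ← hg.map_eq, integral_map hg.measurable.aemeasurable]
    rw [hg.map_eq]
    exact (h.memLp_two s).1.mul (h.memLp_two t).1
  continuous_paths ω := h.continuous_paths _

end Converse

/-! ### Continuous modifications through dyadic limits. -/

section ContinuousModification

/-- Level `m + N` of the grid on `[0, 2^N]` has the same mesh as level `m` on `[0, 1]`. A single
definition of the limit therefore serves all time horizons. -/
lemma dyadicFloor_two_pow (N m : ℕ) (t : ℝ≥0) :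
    dyadicFloor (2 ^ N) (m + N) t = dyadicFloor 1 m t := by
  have h : 2 ^ (m + N) * t / 2 ^ N = 2 ^ m * t / 1 := by
    rw [pow_add]; field_simp
  rw [dyadicFloor, dyadicFloor, h, dyadicPt, dyadicPt, pow_add]
  field_simp

/-- The limit of `f` along dyadic approximations. -/
def dyadicLim (f : ℝ≥0 → ℝ) (t : ℝ≥0) : ℝ := limUnder atTop fun m => f (dyadicFloor 1 m t)

lemma cauchySeq_dyadicFloor {τ t : ℝ≥0} (hτ : 0 < τ) (ht : t ≤ τ) {f : ℝ≥0 → ℝ}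
    (hf : dyadicTail τ 0 f ≠ ⊤) : CauchySeq fun m => f (dyadicFloor τ m t) := by
  refine cauchySeq_of_edist_le_of_tsum_ne_top
    (fun m => ENNReal.ofReal (dyadicOsc τ (m + 1) f)) (fun n => ?_) ?_
  · rw [edist_dist]
    exact ENNReal.ofReal_le_ofReal (dist_dyadicFloor_succ_le hτ ht n f)
  · rw [dyadicTail_eq_add] at hf
    have := (ENNReal.add_ne_top.1 hf).2
    simpa [dyadicTail, add_comm] using this

lemma tendsto_dyadicLim {f : ℝ≥0 → ℝ} (hf : ∀ N : ℕ, dyadicTail (2 ^ N) 0 f ≠ ⊤) {N : ℕ} {t : ℝ≥0}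
    (ht : t ≤ 2 ^ N) : Tendsto (fun m => f (dyadicFloor (2 ^ N) m t)) atTop (𝓝 (dyadicLim f t)) := by
  have h1 := cauchySeq_dyadicFloor (by positivity) ht (hf N)
  obtain ⟨l, hl⟩ := cauchySeq_tendsto_of_complete h1
  have h2 := (tendsto_add_atTop_iff_nat N).2 hl
  simp only [dyadicFloor_two_pow] at h2
  rwa [dyadicLim, h2.limUnder_eq]

lemma continuous_dyadicInterp (τ : ℝ≥0) (m : ℕ) (f : ℝ≥0 → ℝ) :
    Continuous (dyadicInterp τ m f) := by
  have := continuous_clampUnit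
  unfold dyadicInterp
  fun_prop

/-- On `[0, 2^N]` the function is the uniform limit of piecewise linear interpolations, with the
tail of the oscillation series as error. -/
lemma continuous_dyadicLim {f : ℝ≥0 → ℝ} (hf : ∀ N : ℕ, dyadicTail (2 ^ N) 0 f ≠ ⊤) :
    Continuous (dyadicLim f) := by
  rw [continuous_iff_continuousAt]
  intro t
  obtain ⟨N, hN⟩ := pow_unbounded_of_one_lt t (one_lt_two (α := ℝ≥0))
  have hunif : TendstoUniformlyOn (fun m => dyadicInterp (2 ^ N) m f) (dyadicLim f) atTop
      (Set.Iic (2 ^ N)) := by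
    rw [EMetric.tendstoUniformlyOn_iff]
    intro ε hε
    have h1 : Tendsto (fun m => dyadicTail (2 ^ N) m f) atTop (𝓝 0) := by
      have := ENNReal.tendsto_sum_nat_add (fun k => ENNReal.ofReal (dyadicOsc (2 ^ N) k f))
        (by simpa [dyadicTail] using hf N)
      simpa [dyadicTail, add_comm] using this
    filter_upwards [h1.eventually_lt_const hε] with m hm s hs
    rw [edist_comm]
    exact (edist_dyadicInterp_le (by positivity) hs m f (tendsto_dyadicLim hf hs)).trans_lt hm
  have hc := hunif.continuousOn (Frequently.of_forall fun m => (continuous_dyadicInterp _ m f).continuousOn)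
  exact hc.continuousAt (Iic_mem_nhds hN)

variable {Ω : Type*} [MeasurableSpace Ω] {P : Measure Ω}

/-- By Fatou's lemma and the moment condition, the lower limit of the squared distance between `W t`
and its dyadic approximations has expectation zero; where the approximations converge, this lower
limit is the squared distance to their limit. -/
lemma ae_eq_dyadicLim {W : ℝ≥0 → Ω → ℝ} (hW : ∀ t, Measurable (W t)) {p : ℝ} (hp : 1 < p)
    (hB : ∀ τ : ℝ≥0, ∃ A, 0 ≤ A ∧ IncrementBound P W τ A p)
    (hf : ∀ᵐ ω ∂P, ∀ N : ℕ, dyadicTail (2 ^ N) 0 (fun t => W t ω) ≠ ⊤) (t : ℝ≥0) :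
    W t =ᵐ[P] fun ω => dyadicLim (fun t => W t ω) t := by
  obtain ⟨N, hN⟩ := pow_unbounded_of_one_lt t (one_lt_two (α := ℝ≥0))
  obtain ⟨A, hA, hA2⟩ := hB t
  have h0 : (0 : ℝ≥0) < 2 ^ N := by positivity
  have hlim : Tendsto (fun m => ENNReal.ofReal
      (A * ((t : ℝ) - (dyadicFloor (2 ^ N) m t : ℝ≥0)) ^ p)) atTop (𝓝 0) := by
    have h1 : Tendsto (fun m => (t : ℝ) - (dyadicFloor (2 ^ N) m t : ℝ≥0)) atTop (𝓝 0) := by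
      simpa using (NNReal.tendsto_coe.2 (tendsto_dyadicFloor h0 t)).const_sub (t : ℝ)
    have h2 := ((h1.rpow_const (p := p) (Or.inr (by linarith))).const_mul A)
    rw [Real.zero_rpow (by linarith), mul_zero] at h2
    simpa using ENNReal.tendsto_ofReal h2
  have hFatou := lintegral_liminf_le (μ := P) (u := (atTop : Filter ℕ)) (f := fun m ω => ENNReal.ofReal
    ((W t ω - W (dyadicFloor (2 ^ N) m t) ω) ^ 2)) (fun m => by fun_prop)
  have hz : ∫⁻ ω, liminf (fun m => ENNReal.ofReal
      ((W t ω - W (dyadicFloor (2 ^ N) m t) ω) ^ 2)) atTop ∂P = 0 := by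
    refine le_antisymm (hFatou.trans ?_) zero_le
    rw [← hlim.liminf_eq]
    exact liminf_le_liminf (Eventually.of_forall fun m => hA2 _ _ (dyadicFloor_le h0 m t) le_rfl)
  have hmeas : Measurable fun ω => liminf (fun m => ENNReal.ofReal
      ((W t ω - W (dyadicFloor (2 ^ N) m t) ω) ^ 2)) atTop :=
    Measurable.liminf fun m => by fun_prop
  rw [lintegral_eq_zero_iff hmeas] at hz
  filter_upwards [hz, hf] with ω h1 h2
  have h3 := tendsto_dyadicLim h2 hN.le
  have h4 : Tendsto (fun m => ENNReal.ofReal ((W t ω - W (dyadicFloor (2 ^ N) m t) ω) ^ 2)) atTop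
      (𝓝 (ENNReal.ofReal ((W t ω - dyadicLim (fun t => W t ω) t) ^ 2))) :=
    ENNReal.tendsto_ofReal ((h3.const_sub _).pow 2)
  rw [h4.liminf_eq, Pi.zero_apply, ENNReal.ofReal_eq_zero] at h1
  nlinarith [sq_nonneg (W t ω - dyadicLim (fun t => W t ω) t),
    pow_eq_zero_iff (two_ne_zero) |>.1 (le_antisymm h1 (sq_nonneg _))]

/-- Continuous centered Gaussian processes with prescribed covariance exist, under Kolmogorov's
condition. -/
theorem exists_isContCenteredGaussian (C : ℝ → ℝ → ℝ) (hsymm : ∀ s t : ℝ≥0, C s t = C t s)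
    (hpsd : ∀ f : ℝ≥0 →₀ ℝ, 0 ≤ f.sum fun s a => f.sum fun t b => a * b * C s t)
    {p : ℝ} (hp : 1 < p)
    (hB : ∀ τ : ℝ≥0, ∃ A, 0 ≤ A ∧ ∀ s t : ℝ≥0, s ≤ t → t ≤ τ →
      C t t - 2 * C s t + C s s ≤ A * ((t : ℝ) - s) ^ p) :
    ∃ (Ω : Type) (_ : MeasurableSpace Ω) (P : Measure Ω) (_ : IsProbabilityMeasure P)
      (X : ℝ≥0 → Ω → ℝ), IsContCenteredGaussian P X C := by
  classical
  obtain ⟨Ω, mΩ, P, hP, W, hWm, hW2, hWc, hWg⟩ :=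
    exists_hasGaussianFdd (S := ℝ≥0) (fun s t => C s t) hsymm hpsd
  have hBW : ∀ τ : ℝ≥0, ∃ A, 0 ≤ A ∧ IncrementBound P W τ A p := by
    intro τ
    obtain ⟨A, hA, hA2⟩ := hB τ
    refine ⟨A, hA, fun s t hst ht => ?_⟩
    rw [lintegral_sub_sq_eq (hW2 s) (hW2 t), hWc, hWc, hWc]
    exact ENNReal.ofReal_le_ofReal (hA2 s t hst ht)
  have hf : ∀ᵐ ω ∂P, ∀ N : ℕ, dyadicTail (2 ^ N) 0 (fun t => W t ω) ≠ ⊤ := by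
    rw [ae_all_iff]
    intro N
    obtain ⟨A, hA, hA2⟩ := hBW (2 ^ N)
    have h := ae_lt_top' (μ := P) (f := fun ω => dyadicTail (2 ^ N) 0 fun t => W t ω)
      (by unfold dyadicTail dyadicOsc; fun_prop)
      (ne_top_of_le_ne_top ENNReal.ofReal_ne_top
        (lintegral_dyadicTail_le (fun t => (hWm t).aemeasurable) hA hp hA2 0))
    filter_upwards [h] with ω hω using hω.ne
  -- On the exceptional null set the path is replaced by zero, so that every path is continuous and
  -- not only almost every one.
  let X : ℝ≥0 → Ω → ℝ := fun t ω => if ∀ N : ℕ, dyadicTail (2 ^ N) 0 (fun t => W t ω) ≠ ⊤ then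
    dyadicLim (fun t => W t ω) t else 0
  have hWX : ∀ t, W t =ᵐ[P] X t := by
    intro t
    filter_upwards [hf, ae_eq_dyadicLim hWm hp hBW hf t] with ω h1 h2
    simp only [X]
    rw [if_pos h1, h2]
  have hXm : ∀ t, AEMeasurable (X t) P := fun t => (hWm t).aemeasurable.congr (hWX t)
  have hXg := hWg.congr hWX
  refine ⟨Ω, mΩ, P, hP, X, hXg.isGaussianProcess hXm, hXg.integral_eq_zero hXm, fun s t => ?_,
    fun ω => ?_⟩
  · rw [← hWc]
    refine integral_congr_ae ?_
    filter_upwards [hWX s, hWX t] with ω h1 h2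
    rw [h1, h2]
  · simp only [X]
    split_ifs with h
    · exact continuous_dyadicLim h
    · exact continuous_const

end ContinuousModification

/-! ### Pairing and grouping of independent families. -/

section Independence

variable {Ω : Type*} [MeasurableSpace Ω] {μ : Measure Ω}

/-- Pairs built from two independent families of independent variables are independent. -/
lemma iIndepFun_prodMk_of_indepFun {ι : Type*} {α β : ι → Type*} [∀ i, MeasurableSpace (α i)]
    [∀ i, MeasurableSpace (β i)] {U : ∀ i, Ω → α i} {V : ∀ i, Ω → β i}
    (hU : ∀ i, Measurable (U i)) (hV : ∀ i, Measurable (V i)) (hUi : iIndepFun U μ)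
    (hVi : iIndepFun V μ) (hUV : IndepFun (fun ω i => U i ω) (fun ω i => V i ω) μ) :
    iIndepFun (fun i ω => (U i ω, V i ω)) μ := by
  -- Measurable rectangles form a π-system generating the σ-algebra of each pair, so independence is
  -- tested on them.
  refine iIndepSets.iIndep (fun i => ((hU i).prodMk (hV i)).comap_le)
    (fun i => {s | ∃ t ∈ Set.image2 (· ×ˢ ·) {A : Set (α i) | MeasurableSet A}
      {B : Set (β i) | MeasurableSet B}, (fun ω => (U i ω, V i ω)) ⁻¹' t = s})
    (fun i => isPiSystem_prod.comap _) (fun i => ?_) ?_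
  · change MeasurableSpace.comap (fun ω => (U i ω, V i ω)) Prod.instMeasurableSpace = _
    rw [← generateFrom_prod, MeasurableSpace.comap_generateFrom]
    rfl
  · rw [iIndepSets_iff]
    intro S f hf
    choose! t ht hft using hf
    choose! A hA B hB hAB using ht
    have h1 : ∀ i ∈ S, f i = U i ⁻¹' (A i) ∩ V i ⁻¹' (B i) := by
      intro i hi
      rw [← hft i hi, ← hAB i hi]
      rfl
    have h2 : ⋂ i ∈ S, f i = (⋂ i ∈ S, U i ⁻¹' (A i)) ∩ ⋂ i ∈ S, V i ⁻¹' (B i) := by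
      ext ω
      simp only [Set.mem_iInter, Set.mem_inter_iff]
      refine ⟨fun h => ⟨fun i hi => ?_, fun i hi => ?_⟩, fun h i hi => ?_⟩
      · have := h i hi; rw [h1 i hi] at this; exact this.1
      · have := h i hi; rw [h1 i hi] at this; exact this.2
      · rw [h1 i hi]; exact ⟨h.1 i hi, h.2 i hi⟩
    have h3 : μ ((⋂ i ∈ S, U i ⁻¹' (A i)) ∩ ⋂ i ∈ S, V i ⁻¹' (B i)) =
        μ (⋂ i ∈ S, U i ⁻¹' (A i)) * μ (⋂ i ∈ S, V i ⁻¹' (B i)) := by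
      have := hUV.measure_inter_preimage_eq_mul ((S : Set ι).pi A) ((S : Set ι).pi B)
        (MeasurableSet.pi S.countable_toSet fun i hi => hA i hi)
        (MeasurableSet.pi S.countable_toSet fun i hi => hB i hi)
      have e1 : (fun ω i => U i ω) ⁻¹' ((S : Set ι).pi A) = ⋂ i ∈ S, U i ⁻¹' (A i) := by
        ext ω; simp
      have e2 : (fun ω i => V i ω) ⁻¹' ((S : Set ι).pi B) = ⋂ i ∈ S, V i ⁻¹' (B i) := by
        ext ω; simp
      rwa [e1, e2] at this
    have h4 := hUi.meas_biInter (S := S) (s := fun i => U i ⁻¹' (A i)) fun i hi => ⟨A i, hA i hi, rfl⟩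
    have h5 := hVi.meas_biInter (S := S) (s := fun i => V i ⁻¹' (B i)) fun i hi => ⟨B i, hB i hi, rfl⟩
    rw [h2, h3, h4, h5, ← Finset.prod_mul_distrib]
    refine Finset.prod_congr rfl fun i hi => ?_
    rw [h1 i hi]
    exact ((hUV.comp (measurable_pi_apply i) (measurable_pi_apply i)).measure_inter_preimage_eq_mul
      _ _ (hA i hi) (hB i hi)).symm

/-- Grouping an independent family indexed by pairs by the first index. -/
lemma iIndepFun_curry {ι κ E : Type*} [MeasurableSpace E] {Y : ι × κ → Ω → E}
    (hY : ∀ q, Measurable (Y q)) (h : iIndepFun Y μ) :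
    iIndepFun (fun i ω (j : κ) => Y (i, j) ω) μ := by
  have := h.isProbabilityMeasure
  have : ∀ i j, IsProbabilityMeasure (μ.map (Y (i, j))) :=
    fun i j => Measure.isProbabilityMeasure_map (hY _).aemeasurable
  rw [iIndepFun_iff_map_fun_eq_infinitePi_map (fun i => measurable_pi_lambda _ fun j => hY _)]
  have h1 : ∀ i, μ.map (fun ω (j : κ) => Y (i, j) ω) = Measure.infinitePi fun j => μ.map (Y (i, j)) :=
    fun i => (iIndepFun_iff_map_fun_eq_infinitePi_map (fun j => hY _)).1
      (h.precomp (g := fun j => (i, j)) fun a b hab => by simpa using hab)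
  simp only [h1]
  rw [← Measure.infinitePi_map_curry (fun i j => μ.map (Y (i, j))),
    ← (iIndepFun_iff_map_fun_eq_infinitePi_map hY).1 h, Measure.map_map (by fun_prop)
      (measurable_pi_lambda _ hY)]
  rfl

end Independence

/-! ### Moments of compound sums and of series of independent variables. -/

section RandomSums

variable {Ω : Type*} [MeasurableSpace Ω] {μ : Measure Ω} [IsProbabilityMeasure μ]

/-- The sum of a random number of terms. -/
def randomSum (k : ℕ) (y : ℕ → ℝ) : ℝ := ∑ j ∈ Finset.range k, y j

lemma measurable_randomSum : Measurable fun p : ℕ × (ℕ → ℝ) => randomSum p.1 p.2 :=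
  measurable_from_prod_countable_right fun k => by
    change Measurable fun y : ℕ → ℝ => ∑ j ∈ Finset.range k, y j
    fun_prop

/-- Data for a compound sum: independent terms with common moments up to order three, independent
of the number of terms. -/
structure IsCompound (ν : Measure ℕ) (μ : Measure Ω) (θ : Ω → ℕ) (Y : ℕ → Ω → ℝ) (m e B : ℝ) :
    Prop where
  measurable_count : Measurable θ
  law_count : μ.map θ = ν
  integrable_count : Integrable (fun k : ℕ => (k : ℝ) ^ 3) ν
  measurable_term : ∀ j, Measurable (Y j)
  indep_terms : iIndepFun Y μ
  indep_count : IndepFun θ (fun ω j => Y j ω) μ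
  integrable_cube : ∀ j, Integrable (fun ω => |Y j ω| ^ 3) μ
  mean : ∀ j, ∫ ω, Y j ω ∂μ = m
  second : ∀ j, ∫ ω, Y j ω ^ 2 ∂μ = e
  third : ∀ j, ∫ ω, |Y j ω| ^ 3 ∂μ = B

variable {ν : Measure ℕ} {θ : Ω → ℕ} {Y : ℕ → Ω → ℝ} {m e B : ℝ}

namespace IsCompound

omit [IsProbabilityMeasure μ] in
lemma measurable_terms (h : IsCompound ν μ θ Y m e B) : Measurable fun ω j => Y j ω :=
  measurable_pi_lambda _ h.measurable_term

lemma map_prod (h : IsCompound ν μ θ Y m e B) :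
    μ.map (fun ω => (θ ω, fun j => Y j ω)) = ν.prod (μ.map fun ω j => Y j ω) := by
  rw [(indepFun_iff_map_prod_eq_prod_map_map h.measurable_count.aemeasurable
    h.measurable_terms.aemeasurable).1 h.indep_count, h.law_count]

omit [IsProbabilityMeasure μ] in
lemma measurable_sum (h : IsCompound ν μ θ Y m e B) :
    Measurable fun ω => randomSum (θ ω) fun j => Y j ω :=
  measurable_randomSum.comp (h.measurable_count.prodMk h.measurable_terms)

lemma isProbabilityMeasure_law (h : IsCompound ν μ θ Y m e B) : IsProbabilityMeasure ν := by
  rw [← h.law_count]; exact Measure.isProbabilityMeasure_map h.measurable_count.aemeasurable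

lemma integral_comp (h : IsCompound ν μ θ Y m e B) {g : ℝ → ℝ} (hg : Measurable g)
    (hi : Integrable (fun ω => g (randomSum (θ ω) fun j => Y j ω)) μ) :
    ∫ ω, g (randomSum (θ ω) fun j => Y j ω) ∂μ =
      ∫ k, ∫ ω, g (randomSum k fun j => Y j ω) ∂μ ∂ν := by
  have := h.isProbabilityMeasure_law
  have := Measure.isProbabilityMeasure_map (μ := μ) h.measurable_terms.aemeasurable
  have hm : Measurable fun p : ℕ × (ℕ → ℝ) => g (randomSum p.1 p.2) := hg.comp measurable_randomSum
  have hpair := (h.measurable_count.prodMk h.measurable_terms).aemeasurable (μ := μ)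
  have h1 : ∫ ω, g (randomSum (θ ω) fun j => Y j ω) ∂μ =
      ∫ p, g (randomSum p.1 p.2) ∂(ν.prod (μ.map fun ω j => Y j ω)) := by
    rw [← h.map_prod, integral_map hpair hm.aestronglyMeasurable]
  have h2 : Integrable (fun p : ℕ × (ℕ → ℝ) => g (randomSum p.1 p.2))
      (ν.prod (μ.map fun ω j => Y j ω)) := by
    rw [← h.map_prod, integrable_map_measure hm.aestronglyMeasurable hpair]
    exact hi
  rw [h1, integral_prod _ h2]
  refine integral_congr_ae (Eventually.of_forall fun k => ?_)
  exact integral_map h.measurable_terms.aemeasurable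
    (hm.comp (measurable_const.prodMk measurable_id)).aestronglyMeasurable

lemma lintegral_comp (h : IsCompound ν μ θ Y m e B) {g : ℝ → ℝ≥0∞} (hg : Measurable g) :
    ∫⁻ ω, g (randomSum (θ ω) fun j => Y j ω) ∂μ =
      ∫⁻ k, ∫⁻ ω, g (randomSum k fun j => Y j ω) ∂μ ∂ν := by
  have := h.isProbabilityMeasure_law
  have := Measure.isProbabilityMeasure_map (μ := μ) h.measurable_terms.aemeasurable
  have hm : Measurable fun p : ℕ × (ℕ → ℝ) => g (randomSum p.1 p.2) := hg.comp measurable_randomSum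
  have h1 : ∫⁻ ω, g (randomSum (θ ω) fun j => Y j ω) ∂μ =
      ∫⁻ p, g (randomSum p.1 p.2) ∂(ν.prod (μ.map fun ω j => Y j ω)) := by
    rw [← h.map_prod, lintegral_map hm (h.measurable_count.prodMk h.measurable_terms)]
  rw [h1, lintegral_prod _ hm.aemeasurable]
  refine lintegral_congr fun k => ?_
  exact lintegral_map (hm.comp (measurable_const.prodMk measurable_id)) h.measurable_terms

/-- Power mean inequality. The factor `k²` together with `k` summands is the reason why a third
moment of the number of particles is needed. -/
lemma abs_randomSum_cube_le (k : ℕ) (y : ℕ → ℝ) :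
    |randomSum k y| ^ 3 ≤ (k : ℝ) ^ 2 * ∑ j ∈ Finset.range k, |y j| ^ 3 := by
  have h1 : |randomSum k y| ≤ ∑ j ∈ Finset.range k, |y j| := Finset.abs_sum_le_sum_abs _ _
  rcases Nat.eq_zero_or_pos k with rfl | hk
  · simp [randomSum]
  have h2 := pow_sum_div_card_le_sum_pow (s := Finset.range k) (f := fun j => |y j|)
    (fun _ _ => abs_nonneg _) 2
  rw [Finset.card_range, div_le_iff₀ (by positivity), mul_comm] at h2
  exact (pow_le_pow_left₀ (abs_nonneg _) h1 3).trans h2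

lemma lintegral_abs_cube_le (h : IsCompound ν μ θ Y m e B) :
    ∫⁻ ω, ENNReal.ofReal (|randomSum (θ ω) fun j => Y j ω| ^ 3) ∂μ ≤
      ENNReal.ofReal ((∫ k, (k : ℝ) ^ 3 ∂ν) * B) := by
  have hB : 0 ≤ B := by rw [← h.third 0]; positivity
  rw [h.lintegral_comp (g := fun x => ENNReal.ofReal (|x| ^ 3)) (by fun_prop), ← integral_mul_const,
    ofReal_integral_eq_lintegral_ofReal (h.integrable_count.mul_const B)
      (Eventually.of_forall fun k => by positivity)]
  refine lintegral_mono fun k => ?_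
  have hs : Integrable (fun ω => (k : ℝ) ^ 2 * ∑ j ∈ Finset.range k, |Y j ω| ^ 3) μ :=
    (integrable_finsetSum _ fun j _ => h.integrable_cube j).const_mul _
  calc _ ≤ ∫⁻ ω, ENNReal.ofReal ((k : ℝ) ^ 2 * ∑ j ∈ Finset.range k, |Y j ω| ^ 3) ∂μ :=
        lintegral_mono fun ω => ENNReal.ofReal_le_ofReal (abs_randomSum_cube_le _ _)
    _ = ENNReal.ofReal ((k : ℝ) ^ 3 * B) := by
        rw [← ofReal_integral_eq_lintegral_ofReal hs (Eventually.of_forall fun ω => by positivity),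
          integral_const_mul, integral_finsetSum _ fun j _ => h.integrable_cube j]
        simp only [h.third, Finset.sum_const, Finset.card_range, nsmul_eq_mul]
        congr 1; ring

lemma integrable_abs_cube (h : IsCompound ν μ θ Y m e B) :
    Integrable (fun ω => |randomSum (θ ω) fun j => Y j ω| ^ 3) μ := by
  refine ⟨((h.measurable_sum.norm).pow_const 3).aestronglyMeasurable, ?_⟩
  rw [hasFiniteIntegral_iff_ofReal (Eventually.of_forall fun ω => by positivity)]
  exact h.lintegral_abs_cube_le.trans_lt ENNReal.ofReal_lt_top

lemma integral_abs_cube_le (h : IsCompound ν μ θ Y m e B) :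
    ∫ ω, |randomSum (θ ω) fun j => Y j ω| ^ 3 ∂μ ≤ (∫ k, (k : ℝ) ^ 3 ∂ν) * B := by
  have hB : 0 ≤ B := by rw [← h.third 0]; positivity
  have h0 : 0 ≤ ∫ k, (k : ℝ) ^ 3 ∂ν := integral_nonneg fun k => by positivity
  have := h.lintegral_abs_cube_le
  rw [← ofReal_integral_eq_lintegral_ofReal h.integrable_abs_cube
    (Eventually.of_forall fun ω => by positivity)] at this
  exact (ENNReal.ofReal_le_ofReal_iff (by positivity)).1 this

lemma integrable_term (h : IsCompound ν μ θ Y m e B) (j : ℕ) : Integrable (Y j) μ :=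
  (integrable_pow_of_integrable_abs_cube (h.measurable_term j).aestronglyMeasurable
    (h.integrable_cube j)).1

lemma memLp_term (h : IsCompound ν μ θ Y m e B) (j : ℕ) : MemLp (Y j) 2 μ :=
  (memLp_two_iff_integrable_sq (h.measurable_term j).aestronglyMeasurable).2
    (integrable_pow_of_integrable_abs_cube (h.measurable_term j).aestronglyMeasurable
      (h.integrable_cube j)).2

lemma integral_randomSum_const (h : IsCompound ν μ θ Y m e B) (k : ℕ) :
    ∫ ω, randomSum k (fun j => Y j ω) ∂μ = k * m := by
  simp only [randomSum]
  rw [integral_finsetSum _ fun j _ => h.integrable_term j]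
  simp [h.mean]

lemma integral_randomSum_sq_const (h : IsCompound ν μ θ Y m e B) (k : ℕ) :
    ∫ ω, randomSum k (fun j => Y j ω) ^ 2 ∂μ = k * e + ((k : ℝ) ^ 2 - k) * m ^ 2 := by
  have hint : ∀ i j, Integrable (fun ω => Y i ω * Y j ω) μ := fun i j =>
    (h.memLp_term i).integrable_mul (h.memLp_term j)
  have h1 : ∀ ω, randomSum k (fun j => Y j ω) ^ 2 =
      ∑ i ∈ Finset.range k, ∑ j ∈ Finset.range k, Y i ω * Y j ω := fun ω => by
    rw [randomSum, pow_two, Finset.sum_mul_sum]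
  have h2 : ∀ i j, ∫ ω, Y i ω * Y j ω ∂μ = m ^ 2 + if i = j then e - m ^ 2 else 0 := by
    intro i j
    split_ifs with hij
    · subst hij
      simp only [← pow_two, h.second]
      ring
    · rw [(h.indep_terms.indepFun hij).integral_fun_mul_eq_mul_integral
        (h.measurable_term i).aestronglyMeasurable (h.measurable_term j).aestronglyMeasurable,
        h.mean, h.mean]
      ring
  simp only [h1]
  rw [integral_finsetSum _ fun i _ => integrable_finsetSum _ fun j _ => hint i j]
  have h3 : ∀ i ∈ Finset.range k, ∫ ω, ∑ j ∈ Finset.range k, Y i ω * Y j ω ∂μ =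
      k * m ^ 2 + (e - m ^ 2) := by
    intro i hi
    rw [integral_finsetSum _ fun j _ => hint i j]
    simp only [h2, Finset.sum_add_distrib, Finset.sum_ite_eq, hi, if_true]
    simp
  rw [Finset.sum_congr rfl h3]
  simp
  ring

lemma integrable_count_pow (h : IsCompound ν μ θ Y m e B) :
    Integrable (fun k : ℕ => (k : ℝ)) ν ∧ Integrable (fun k : ℕ => (k : ℝ) ^ 2) ν := by
  have := h.isProbabilityMeasure_law
  refine integrable_pow_of_integrable_abs_cube (X := fun k : ℕ => (k : ℝ))
    Measurable.of_discrete.aestronglyMeasurable ?_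
  simpa using h.integrable_count

lemma integrable_sum (h : IsCompound ν μ θ Y m e B) :
    Integrable (fun ω => randomSum (θ ω) fun j => Y j ω) μ ∧
    Integrable (fun ω => (randomSum (θ ω) fun j => Y j ω) ^ 2) μ :=
  integrable_pow_of_integrable_abs_cube h.measurable_sum.aestronglyMeasurable h.integrable_abs_cube

lemma integral_sum (h : IsCompound ν μ θ Y m e B) :
    ∫ ω, randomSum (θ ω) (fun j => Y j ω) ∂μ = (∫ k, (k : ℝ) ∂ν) * m := by
  rw [h.integral_comp (g := fun x => x) measurable_id h.integrable_sum.1]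
  simp only [h.integral_randomSum_const]
  rw [integral_mul_const]

lemma integral_sum_sq (h : IsCompound ν μ θ Y m e B) :
    ∫ ω, randomSum (θ ω) (fun j => Y j ω) ^ 2 ∂μ =
      (∫ k, (k : ℝ) ∂ν) * e + (∫ k, (k : ℝ) ^ 2 ∂ν - ∫ k, (k : ℝ) ∂ν) * m ^ 2 := by
  rw [h.integral_comp (g := fun x => x ^ 2) (by fun_prop) h.integrable_sum.2]
  simp only [h.integral_randomSum_sq_const]
  have h1 := h.integrable_count_pow.1
  have h2 := h.integrable_count_pow.2
  have h12 : Integrable (fun k : ℕ => (k : ℝ) ^ 2 - k) ν := h2.sub h1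
  rw [integral_add (h1.mul_const e) (h12.mul_const _), integral_mul_const, integral_mul_const,
    integral_sub h2 h1]

/-- The centered compound sum. -/
lemma centered_second (h : IsCompound ν μ θ Y m e B) :
    ∫ ω, (randomSum (θ ω) (fun j => Y j ω) - (∫ k, (k : ℝ) ∂ν) * m) ^ 2 ∂μ =
      (∫ k, (k : ℝ) ∂ν) * e +
        (variance (fun k : ℕ => (k : ℝ)) ν - ∫ k, (k : ℝ) ∂ν) * m ^ 2 := by
  have := h.isProbabilityMeasure_law
  set a := (∫ k, (k : ℝ) ∂ν) * m with ha
  have hv : variance (fun k : ℕ => (k : ℝ)) ν = ∫ k, (k : ℝ) ^ 2 ∂ν - (∫ k, (k : ℝ) ∂ν) ^ 2 := by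
    rw [variance_eq_sub]
    · rfl
    · exact (memLp_two_iff_integrable_sq Measurable.of_discrete.aestronglyMeasurable).2
        h.integrable_count_pow.2
  have h1 : ∀ ω, (randomSum (θ ω) (fun j => Y j ω) - a) ^ 2 =
      randomSum (θ ω) (fun j => Y j ω) ^ 2 - 2 * a * randomSum (θ ω) (fun j => Y j ω) + a ^ 2 :=
    fun ω => by ring
  have i1 := h.integrable_sum.2
  have i2 : Integrable (fun ω => 2 * a * randomSum (θ ω) fun j => Y j ω) μ :=
    h.integrable_sum.1.const_mul _
  have i3 : Integrable (fun ω => (randomSum (θ ω) fun j => Y j ω) ^ 2 -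
    2 * a * randomSum (θ ω) fun j => Y j ω) μ := i1.sub i2
  simp only [h1]
  rw [integral_add i3 (integrable_const _), integral_sub i1 i2, integral_const_mul, h.integral_sum,
    h.integral_sum_sq, hv]
  simp only [integral_const, probReal_univ, smul_eq_mul, one_mul]
  rw [ha]
  ring

/-- The constant `8` is `4 + 4`: `|S - a|³ ≤ 4|S|³ + 4|a|³`, and `|a|³ ≤ E|S|³` by Jensen's
inequality. -/
lemma centered_third (h : IsCompound ν μ θ Y m e B) :
    Integrable (fun ω => |randomSum (θ ω) (fun j => Y j ω) - (∫ k, (k : ℝ) ∂ν) * m| ^ 3) μ ∧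
    ∫ ω, |randomSum (θ ω) (fun j => Y j ω) - (∫ k, (k : ℝ) ∂ν) * m| ^ 3 ∂μ ≤
      8 * ((∫ k, (k : ℝ) ^ 3 ∂ν) * B) := by
  have hi := h.integrable_abs_cube
  set S : Ω → ℝ := fun ω => randomSum (θ ω) fun j => Y j ω with hS
  have hint : ∫ ω, S ω ∂μ = (∫ k, (k : ℝ) ∂ν) * m := h.integral_sum
  rw [← hint]
  set a := ∫ ω, S ω ∂μ with ha
  have hle : ∀ ω, |S ω - a| ^ 3 ≤ 4 * |S ω| ^ 3 + 4 * |a| ^ 3 := by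
    intro ω
    have h1 : |S ω - a| ≤ |S ω| + |a| := abs_sub _ _
    have hx := abs_nonneg (S ω)
    have hy := abs_nonneg a
    calc |S ω - a| ^ 3 ≤ (|S ω| + |a|) ^ 3 := by gcongr
      _ ≤ _ := by nlinarith [mul_nonneg (add_nonneg hx hy) (sq_nonneg (|S ω| - |a|))]
  have hbd : Integrable (fun ω => 4 * |S ω| ^ 3 + 4 * |a| ^ 3) μ :=
    (hi.const_mul 4).add (integrable_const _)
  have hm : Measurable S := h.measurable_sum
  have hint3 : Integrable (fun ω => |S ω - a| ^ 3) μ := by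
    refine hbd.mono' (by fun_prop) (Eventually.of_forall fun ω => ?_)
    rw [Real.norm_eq_abs, abs_of_nonneg (by positivity)]
    exact hle ω
  have hJ : |a| ^ 3 ≤ ∫ ω, |S ω| ^ 3 ∂μ := by
    have i1 : Integrable (fun ω => |S ω|) μ := h.integrable_sum.1.abs
    have h1 : |a| ≤ ∫ ω, |S ω| ∂μ := abs_integral_le_integral_abs
    -- Jensen's inequality through the tangent line of `y ↦ y³` at `|a|`, which lies below the cubic
    -- for `y ≥ 0`.
    have h2 : ∫ ω, (|a| ^ 3 + 3 * |a| ^ 2 * (|S ω| - |a|)) ∂μ ≤ ∫ ω, |S ω| ^ 3 ∂μ := by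
      refine integral_mono ((integrable_const _).add ((i1.sub (integrable_const _)).const_mul _)) hi
        fun ω => ?_
      have hx := abs_nonneg (S ω)
      have hy := abs_nonneg a
      dsimp only
      nlinarith [mul_nonneg (add_nonneg hx (add_nonneg hy hy)) (sq_nonneg (|S ω| - |a|))]
    have i2 : Integrable (fun ω => |S ω| - |a|) μ := i1.sub (integrable_const _)
    rw [integral_add (integrable_const _) (i2.const_mul _), integral_const_mul,
      integral_sub i1 (integrable_const _)] at h2
    simp only [integral_const, probReal_univ, smul_eq_mul, one_mul] at h2
    nlinarith [sq_nonneg |a|, mul_nonneg (sq_nonneg |a|) (sub_nonneg.2 h1)]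
  refine ⟨hint3, (integral_mono hint3 hbd hle).trans ?_⟩
  rw [integral_add (hi.const_mul 4) (integrable_const _), integral_const_mul]
  simp only [integral_const, probReal_univ, smul_eq_mul, one_mul]
  have := h.integral_abs_cube_le
  linarith

end IsCompound

omit [IsProbabilityMeasure μ] in
/-- `L²` bound for a series of independent centered variables. -/
lemma lintegral_sq_tsum_le {ι : Type*} [Countable ι] {X : ι → Ω → ℝ}
    (hX : ∀ i, MemLp (X i) 2 μ) (hind : iIndepFun X μ) (h0 : ∀ i, ∫ ω, X i ω ∂μ = 0)
    {v : ℝ} (hv : HasSum (fun i => ∫ ω, X i ω ^ 2 ∂μ) v) {W : Ω → ℝ}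
    (hW : ∀ᵐ ω ∂μ, HasSum (fun i => X i ω) (W ω)) :
    ∫⁻ ω, ENNReal.ofReal (W ω ^ 2) ∂μ ≤ ENNReal.ofReal v := by
  classical
  have hs : ∀ s : Finset ι, ∫ ω, (∑ i ∈ s, X i ω) ^ 2 ∂μ = ∑ i ∈ s, ∫ ω, X i ω ^ 2 ∂μ := by
    intro s
    have hint : ∀ i j, Integrable (fun ω => X i ω * X j ω) μ := fun i j =>
      (hX i).integrable_mul (hX j)
    simp only [pow_two, Finset.sum_mul_sum]
    rw [integral_finsetSum _ fun i _ => integrable_finsetSum _ fun j _ => hint i j]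
    refine Finset.sum_congr rfl fun i hi => ?_
    rw [integral_finsetSum _ fun j _ => hint i j, Finset.sum_eq_single_of_mem i hi]
    intro j _ hji
    rw [(hind.indepFun hji.symm).integral_fun_mul_eq_mul_integral (hX i).1 (hX j).1, h0, zero_mul]
  have hle : ∀ s : Finset ι, ∫⁻ ω, ENNReal.ofReal ((∑ i ∈ s, X i ω) ^ 2) ∂μ ≤ ENNReal.ofReal v := by
    intro s
    have hm : MemLp (fun ω => ∑ i ∈ s, X i ω) 2 μ := memLp_finsetSum s fun i _ => hX i
    rw [← ofReal_integral_eq_lintegral_ofReal hm.integrable_sq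
      (Eventually.of_forall fun ω => sq_nonneg _), hs]
    exact ENNReal.ofReal_le_ofReal (sum_le_hasSum s (fun i _ => integral_nonneg fun ω => sq_nonneg _) hv)
  -- Fatou's lemma along finite index sets; this filter is countably generated because `ι` is
  -- countable.
  have hF := lintegral_liminf_le' (μ := μ) (u := (atTop : Filter (Finset ι)))
    (f := fun s ω => ENNReal.ofReal ((∑ i ∈ s, X i ω) ^ 2)) (fun s => by
      have : AEMeasurable (fun ω => ∑ i ∈ s, X i ω) μ :=
        Finset.aemeasurable_fun_sum s fun i _ => (hX i).1.aemeasurable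
      fun_prop)
  calc ∫⁻ ω, ENNReal.ofReal (W ω ^ 2) ∂μ
      = ∫⁻ ω, liminf (fun s : Finset ι => ENNReal.ofReal ((∑ i ∈ s, X i ω) ^ 2)) atTop ∂μ := by
        refine lintegral_congr_ae ?_
        filter_upwards [hW] with ω hω
        exact (ENNReal.tendsto_ofReal (hω.pow 2)).liminf_eq.symm
    _ ≤ _ := hF
    _ ≤ liminf (fun _ : Finset ι => ENNReal.ofReal v) atTop :=
        liminf_le_liminf (Eventually.of_forall hle)
    _ = _ := by simp

end RandomSums

/-! ### Measurability and uniqueness in law of the path of the walk. -/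

section WalkPaths

variable {M : ℕ}

instance instDiscreteMeasurableSpaceHierGroup : DiscreteMeasurableSpace (HierGroup M) :=
  ⟨fun _ => trivial⟩

instance instCountableHierGroup [NeZero M] : Countable (HierGroup M) := by
  unfold HierGroup; infer_instance

/-- The first point after `s` of the grid of mesh `1 / (m + 1)`. -/
def gridAfter (m : ℕ) (s : ℝ≥0) : ℝ≥0 := (⌊((m : ℝ≥0) + 1) * s⌋₊ + 1 : ℕ) / ((m : ℝ≥0) + 1)

lemma le_gridAfter (m : ℕ) (s : ℝ≥0) : s ≤ gridAfter m s := by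
  rw [gridAfter, le_div_iff₀ (by positivity), mul_comm]
  push_cast
  exact (Nat.lt_floor_add_one _).le

lemma gridAfter_le (m : ℕ) (s : ℝ≥0) : gridAfter m s ≤ s + 1 / ((m : ℝ≥0) + 1) := by
  have h : (s + 1 / ((m : ℝ≥0) + 1)) * ((m : ℝ≥0) + 1) = ((m : ℝ≥0) + 1) * s + 1 := by field_simp
  rw [gridAfter, div_le_iff₀ (by positivity), h]
  push_cast
  gcongr
  exact Nat.floor_le (by positivity)

lemma tendsto_gridAfter (s : ℝ≥0) : Tendsto (fun m => gridAfter m s) atTop (𝓝[≥] s) := by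
  rw [tendsto_nhdsWithin_iff]
  refine ⟨?_, Eventually.of_forall fun m => le_gridAfter m s⟩
  refine tendsto_of_tendsto_of_tendsto_of_le_of_le tendsto_const_nhds (h := fun m : ℕ =>
    s + 1 / ((m : ℝ≥0) + 1)) ?_ (fun m => le_gridAfter m s) fun m => gridAfter_le m s
  simpa using (tendsto_one_div_add_atTop_nhds_zero_nat (𝕜 := ℝ≥0)).const_add s

/-- Right-continuity of a path in a discrete space. -/
def RightCont {E : Type*} (z : ℝ≥0 → E) : Prop := ∀ t, ∀ᶠ s in 𝓝[≥] t, z s = z t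

lemma RightCont.eventually_gridAfter {E : Type*} {z : ℝ≥0 → E} (h : RightCont z) (s : ℝ≥0) :
    ∀ᶠ m in atTop, z (gridAfter m s) = z s :=
  (tendsto_gridAfter s).eventually (h s)

lemma measurable_gridAfter_comp {Ω E : Type*} [MeasurableSpace Ω] [MeasurableSpace E]
    {Z : ℝ≥0 → Ω → E} (hZ : ∀ t, Measurable (Z t)) (m : ℕ) :
    Measurable fun p : ℝ≥0 × Ω => Z (gridAfter m p.1) p.2 := by
  have h1 : Measurable fun p : ℕ × Ω => Z (((p.1 + 1 : ℕ) : ℝ≥0) / ((m : ℝ≥0) + 1)) p.2 :=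
    measurable_from_prod_countable_right fun k => hZ (((k + 1 : ℕ) : ℝ≥0) / ((m : ℝ≥0) + 1))
  have h2 : Measurable fun p : ℝ≥0 × Ω => (⌊((m : ℝ≥0) + 1) * p.1⌋₊, p.2) :=
    (Nat.measurable_floor.comp (measurable_fst.const_mul _)).prodMk measurable_snd
  exact h1.comp h2

/-- Right-continuous processes with values in a discrete space are jointly measurable. -/
lemma measurable_uncurry_of_rightCont {Ω E : Type*} [MeasurableSpace Ω] [MeasurableSpace E]
    [DiscreteMeasurableSpace E] {Z : ℝ≥0 → Ω → E} (hZ : ∀ t, Measurable (Z t))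
    (hr : ∀ ω, RightCont fun t => Z t ω) : Measurable fun p : ℝ≥0 × Ω => Z p.1 p.2 := by
  intro A _
  -- In a discrete space right-continuity means that the value at a time is eventually the value at
  -- the next grid point, so the event is a countable lower limit of measurable events.
  have h : (fun p : ℝ≥0 × Ω => Z p.1 p.2) ⁻¹' A =
      ⋃ N : ℕ, ⋂ m : ℕ, ⋂ _ : N ≤ m, {p : ℝ≥0 × Ω | Z (gridAfter m p.1) p.2 ∈ A} := by
    ext p
    obtain ⟨N, hN⟩ := eventually_atTop.1 ((hr p.2).eventually_gridAfter p.1)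
    simp only [Set.mem_preimage, Set.mem_iUnion, Set.mem_iInter, Set.mem_ofPred_eq]
    refine ⟨fun h => ⟨N, fun m hm => by rwa [hN m hm]⟩, fun ⟨N', hN'⟩ => ?_⟩
    rw [← hN (max N N') (le_max_left _ _)]
    exact hN' _ (le_max_right _ _)
  rw [h]
  exact MeasurableSet.iUnion fun N => MeasurableSet.iInter fun m => MeasurableSet.iInter fun _ =>
    measurable_gridAfter_comp hZ m (MeasurableSet.of_discrete)

lemma RightCont.measurable {E : Type*} [MeasurableSpace E] [DiscreteMeasurableSpace E]
    {z : ℝ≥0 → E} (h : RightCont z) : Measurable z :=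
  (measurable_uncurry_of_rightCont (Ω := Unit) (Z := fun t _ => z t) (fun _ => measurable_const)
    fun _ => h).comp (measurable_id.prodMk (measurable_const (a := ())))

/-- Occupation time functional of a path, started at `x` and tested with `φ`. -/
def occ (φ : HierGroup M → ℝ) (x : HierGroup M) (t : ℝ) (z : ℝ≥0 → HierGroup M) : ℝ :=
  ∫ r in (0 : ℝ)..t, φ (x + z r.toNNReal)

/-- A measurable version of the occupation time functional on the space of all paths. -/
lemma exists_measurable_occ {φ : HierGroup M → ℝ} {C : ℝ} (hφ : ∀ x, |φ x| ≤ C)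
    (x : HierGroup M) (t : ℝ) : ∃ Φ : (ℝ≥0 → HierGroup M) → ℝ, Measurable Φ ∧
      ∀ z, RightCont z → Φ z = occ φ x t z := by
  have hm : ∀ m, Measurable fun p : (ℝ≥0 → HierGroup M) × ℝ =>
      φ (x + p.1 (gridAfter m p.2.toNNReal)) := by
    intro m
    have h1 := measurable_gridAfter_comp (Ω := ℝ≥0 → HierGroup M) (E := HierGroup M)
      (Z := fun t z => z t) (fun t => measurable_pi_apply t) m
    have h2 : Measurable fun p : (ℝ≥0 → HierGroup M) × ℝ => (p.2.toNNReal, p.1) := by fun_prop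
    exact (Measurable.of_discrete (f := fun y => φ (x + y))).comp (h1.comp h2)
  -- Arbitrary paths need not be measurable in time. The integrals over grid values are measurable
  -- on the product space, and for right-continuous paths they converge to the occupation time.
  refine ⟨fun z => limsup (fun m => ∫ r in (0 : ℝ)..t, φ (x + z (gridAfter m r.toNNReal))) atTop,
    Measurable.limsup fun m => ?_, fun z hz => ?_⟩
  · simp only [intervalIntegral]
    exact ((hm m).stronglyMeasurable.integral_prod_right).measurable.sub
      ((hm m).stronglyMeasurable.integral_prod_right).measurable
  · refine Tendsto.limsup_eq ?_
    refine intervalIntegral.tendsto_integral_filter_of_dominated_convergence (fun _ => C)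
      (Eventually.of_forall fun m => ?_) (Eventually.of_forall fun m => ?_) (by simp) ?_
    · exact ((hm m).comp (measurable_const.prodMk measurable_id)).aestronglyMeasurable
    · exact Eventually.of_forall fun r _ => hφ _
    · refine Eventually.of_forall fun r _ => tendsto_const_nhds.congr' ?_
      filter_upwards [hz.eventually_gridAfter r.toNNReal] with m hm
      rw [hm]

/-- A finite set of times as part of an increasing sequence started at zero. -/
lemma exists_monotone_seq (I : Finset ℝ≥0) : ∃ t : ℕ → ℝ≥0, Monotone t ∧ t 0 = 0 ∧
    ∀ s ∈ I, ∃ k, t k = s := by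
  classical
  -- The `k`-th time is the largest element of `I` of rank at most `k`; the empty supremum supplies
  -- the initial zero.
  refine ⟨fun k => (I.filter fun s => (I.filter (· ≤ s)).card ≤ k).sup id, fun a b hab => ?_, ?_,
    fun s hs => ⟨(I.filter (· ≤ s)).card, le_antisymm ?_ ?_⟩⟩
  · exact Finset.sup_mono fun s hs => by
      simp only [Finset.mem_filter] at hs ⊢
      exact ⟨hs.1, hs.2.trans hab⟩
  · dsimp only
    rw [Finset.filter_eq_empty_iff.2, Finset.sup_empty]
    · rfl
    intro s hs h
    have := Finset.card_eq_zero.1 (Nat.le_zero.1 h)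
    have h2 : s ∈ I.filter (· ≤ s) := by simp [hs]
    rw [this] at h2
    simp at h2
  · refine Finset.sup_le fun u hu => ?_
    simp only [Finset.mem_filter] at hu
    by_contra hlt
    simp only [id, not_le] at hlt
    refine absurd hu.2 (not_le.2 (Finset.card_lt_card ?_))
    refine (Finset.ssubset_iff_of_subset fun v hv => ?_).2 ⟨u, ?_, ?_⟩
    · simp only [Finset.mem_filter] at hv ⊢
      exact ⟨hv.1, hv.2.trans hlt.le⟩
    · simp [hu.1]
    · simp [hlt]
  · exact Finset.le_sup (f := id) (by simp [hs])

variable {c : ℝ} {Ω : Type*} [MeasurableSpace Ω] {μ : Measure Ω} [IsProbabilityMeasure μ]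
  {Z Z' : ℝ≥0 → Ω → HierGroup M}

omit [IsProbabilityMeasure μ] in
lemma IsCRandomWalk.rightCont (hZ : IsCRandomWalk M c μ Z) (ω : Ω) : RightCont fun t => Z t ω :=
  hZ.right_cont ω

omit [IsProbabilityMeasure μ] in
lemma IsCRandomWalk.measurable_path (hZ : IsCRandomWalk M c μ Z) : Measurable fun ω t => Z t ω :=
  measurable_pi_lambda _ hZ.measurable

omit [IsProbabilityMeasure μ] in
lemma IsCRandomWalk.map_increment_eq [NeZero M] (hZ : IsCRandomWalk M c μ Z)
    (hZ' : IsCRandomWalk M c μ Z') {s t : ℝ≥0} (hst : s ≤ t) :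
    μ.map (fun ω => Z t ω - Z s ω) = μ.map (fun ω => Z' t ω - Z' s ω) := by
  have hm : Measurable fun ω => Z t ω - Z s ω :=
    (Measurable.of_discrete (f := fun p : HierGroup M × HierGroup M => p.1 - p.2)).comp
      ((hZ.measurable t).prodMk (hZ.measurable s))
  have hm' : Measurable fun ω => Z' t ω - Z' s ω :=
    (Measurable.of_discrete (f := fun p : HierGroup M × HierGroup M => p.1 - p.2)).comp
      ((hZ'.measurable t).prodMk (hZ'.measurable s))
  refine Measure.ext_of_singleton fun y => ?_
  rw [Measure.map_apply hm (measurableSet_singleton y), Measure.map_apply hm' (measurableSet_singleton y)]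
  exact (hZ.increment_law s t hst y).trans (hZ'.increment_law s t hst y).symm

/-- The law of the path of a `c`-random walk is unique. -/
theorem IsCRandomWalk.map_path_eq [NeZero M] (hZ : IsCRandomWalk M c μ Z)
    (hZ' : IsCRandomWalk M c μ Z') :
    μ.map (fun ω t => Z t ω) = μ.map (fun ω t => Z' t ω) := by
  rw [map_eq_iff_forall_finset_map_restrict_eq hZ.measurable_path.aemeasurable
    hZ'.measurable_path.aemeasurable]
  intro I
  obtain ⟨t, htm, ht0, htI⟩ := exists_monotone_seq I
  choose! k hk using htI
  -- Positions are partial sums of increments along the increasing sequence; the joint law of these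
  -- independent increments is the product of their prescribed laws.
  let G : (ℕ → HierGroup M) → I → HierGroup M := fun d s => ∑ i ∈ Finset.range (k s), d i
  have hG : Measurable G := by
    refine measurable_pi_lambda _ fun s => ?_
    exact Finset.measurable_fun_sum _ fun i _ => measurable_pi_apply i
  have key : ∀ {W : ℝ≥0 → Ω → HierGroup M}, IsCRandomWalk M c μ W →
      μ.map (fun ω => I.restrict (W · ω)) =
        (Measure.infinitePi fun i => μ.map fun ω => W (t (i + 1)) ω - W (t i) ω).map G := by
    intro W hW
    have hD : ∀ i, Measurable fun ω => W (t (i + 1)) ω - W (t i) ω := fun i =>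
      (Measurable.of_discrete (f := fun p : HierGroup M × HierGroup M => p.1 - p.2)).comp
        ((hW.measurable _).prodMk (hW.measurable _))
    rw [← (iIndepFun_iff_map_fun_eq_infinitePi_map hD).1 (hW.indep_increments.nat htm),
      Measure.map_map hG (measurable_pi_lambda _ hD)]
    refine Measure.map_congr ?_
    filter_upwards [hW.start] with ω hω
    ext1 s
    simp only [Function.comp_apply, G]
    rw [Finset.sum_range_sub (fun i => W (t i) ω), ht0, hω, sub_zero, hk s s.2]
    rfl
  rw [key hZ, key hZ']
  simp only [hZ.map_increment_eq hZ' (htm (Nat.le_succ _))]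

end WalkPaths

/-! ### Sums over starting points and the semigroup in spectral form. -/

section OccupationMoments

variable {M : ℕ} [NeZero M] {S : Finset (HierGroup M)} {φ : HierGroup M → ℝ}

omit [NeZero M] in
lemma HasBddSupport.exists_finset [NeZero M] (h : HasBddSupport φ) :
    ∃ S : Finset (HierGroup M), ∀ x, φ x ≠ 0 → x ∈ S := by
  obtain ⟨R, hR⟩ := h
  refine ⟨hball M R, fun x hx => mem_hball.2 ?_⟩
  have := hR x hx
  rwa [hdist_eq_hlen, zero_sub, hlen_neg] at this

/-- The correlation function of `φ`, a function supported by `S`. -/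
def corr (S : Finset (HierGroup M)) (φ : HierGroup M → ℝ) (z : HierGroup M) : ℝ :=
  ∑ x ∈ S, φ x * φ (x + z)

omit [NeZero M] in
lemma abs_le_sum_abs (hS : ∀ x, φ x ≠ 0 → x ∈ S) (x : HierGroup M) : |φ x| ≤ ∑ y ∈ S, |φ y| := by
  by_cases hx : φ x = 0
  · rw [hx, abs_zero]; exact Finset.sum_nonneg fun _ _ => abs_nonneg _
  · exact Finset.single_le_sum (f := fun y => |φ y|) (fun _ _ => abs_nonneg _) (hS x hx)

omit [NeZero M] in
lemma hasSum_shift (hS : ∀ x, φ x ≠ 0 → x ∈ S) (f : HierGroup M → ℝ) (a : HierGroup M) :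
    HasSum (fun x => φ (x + a) * f (x + a)) (∑ x ∈ S, φ x * f x) := by
  refine (Equiv.addRight a).hasSum_iff (f := fun y => φ y * f y) |>.2 ?_
  refine hasSum_sum_of_ne_finset_zero fun x hx => ?_
  rw [not_not.1 fun h => hx (hS x h), zero_mul]

omit [NeZero M] in
-- Translation invariance: summing over the starting point leaves only the displacement between the
-- two positions.
lemma hasSum_shift_mul (hS : ∀ x, φ x ≠ 0 → x ∈ S) (a b : HierGroup M) :
    HasSum (fun x => φ (x + a) * φ (x + b)) (corr S φ (b - a)) := by
  have := hasSum_shift hS (fun y => φ (y + (b - a))) a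
  simpa [corr, add_assoc] using this

omit [NeZero M] in
lemma hasSum_abs_shift (hS : ∀ x, φ x ≠ 0 → x ∈ S) (a : HierGroup M) :
    HasSum (fun x => |φ (x + a)|) (∑ x ∈ S, |φ x|) := by
  refine (Equiv.addRight a).hasSum_iff (f := fun y => |φ y|) |>.2 ?_
  refine hasSum_sum_of_ne_finset_zero fun x hx => ?_
  rw [not_not.1 fun h => hx (hS x h), abs_zero]

omit [NeZero M] in
lemma measurable_comp_shift {α : Type*} [MeasurableSpace α] (φ : HierGroup M → ℝ) (x : HierGroup M)
    {a : α → HierGroup M} (ha : Measurable a) : Measurable fun p => φ (x + a p) :=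
  (Measurable.of_discrete (f := fun y => φ (x + y))).comp ha

lemma measurable_sub_hier {α : Type*} [MeasurableSpace α] {a b : α → HierGroup M}
    (ha : Measurable a) (hb : Measurable b) : Measurable fun p => b p - a p :=
  (Measurable.of_discrete (f := fun p : HierGroup M × HierGroup M => p.2 - p.1)).comp
    (ha.prodMk hb)

lemma measurable_corr_sub {α : Type*} [MeasurableSpace α] {a b : α → HierGroup M}
    (ha : Measurable a) (hb : Measurable b) : Measurable fun p => corr S φ (b p - a p) := by
  have h : Measurable (corr S φ) := Measurable.of_discrete
  exact h.comp (measurable_sub_hier ha hb)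

lemma hasSum_integral_shift_mul {α : Type*} [MeasurableSpace α] (ρ : Measure α) [IsFiniteMeasure ρ]
    (hS : ∀ x, φ x ≠ 0 → x ∈ S) {a b : α → HierGroup M} (ha : Measurable a) (hb : Measurable b) :
    HasSum (fun x => ∫ p, φ (x + a p) * φ (x + b p) ∂ρ) (∫ p, corr S φ (b p - a p) ∂ρ) := by
  refine hasSum_integral_of_dominated_convergence
    (fun x p => |φ (x + a p)| * ∑ y ∈ S, |φ y|) (fun x => ?_) (fun x => ?_) ?_ ?_ ?_
  · exact ((measurable_comp_shift φ x ha).mul (measurable_comp_shift φ x hb)).aestronglyMeasurable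
  · refine Eventually.of_forall fun p => ?_
    rw [Real.norm_eq_abs, abs_mul]
    exact mul_le_mul_of_nonneg_left (abs_le_sum_abs hS _) (abs_nonneg _)
  · exact Eventually.of_forall fun p => ((hasSum_abs_shift hS (a p)).mul_right _).summable
  · simp only [fun p => ((hasSum_abs_shift hS (a p)).mul_right (∑ y ∈ S, |φ y|)).tsum_eq]
    exact integrable_const _
  · exact Eventually.of_forall fun p => hasSum_shift_mul hS _ _

omit [NeZero M] in
lemma occ_eq_integral (φ : HierGroup M → ℝ) (x : HierGroup M) {t : ℝ} (ht : 0 ≤ t)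
    (z : ℝ≥0 → HierGroup M) :
    occ φ x t z = ∫ r, φ (x + z r.toNNReal) ∂(volume.restrict (Set.Ioc 0 t)) := by
  rw [occ, intervalIntegral.integral_of_le ht]

omit [NeZero M] in
lemma measurable_toNNReal_path {α : Type*} [MeasurableSpace α] {A : ℝ≥0 → α → HierGroup M}
    (hA : ∀ t, Measurable (A t)) (hAr : ∀ ω, RightCont fun t => A t ω) :
    Measurable fun p : ℝ × α => A p.1.toNNReal p.2 :=
  (measurable_uncurry_of_rightCont hA hAr).comp
    ((measurable_real_toNNReal.comp measurable_fst).prodMk measurable_snd)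

/-- Fubini's theorem and translation invariance. The two processes `A` and `B` are kept separate so
that the statement applies both to one walk taken twice and to two independent copies. -/
lemma hasSum_integral_occ_mul {α : Type*} [MeasurableSpace α] (P : Measure α)
    [IsProbabilityMeasure P] (hS : ∀ x, φ x ≠ 0 → x ∈ S) {A B : ℝ≥0 → α → HierGroup M}
    (hA : ∀ t, Measurable (A t)) (hAr : ∀ ω, RightCont fun t => A t ω)
    (hB : ∀ t, Measurable (B t)) (hBr : ∀ ω, RightCont fun t => B t ω) {s t : ℝ} (hs : 0 ≤ s)
    (ht : 0 ≤ t) :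
    HasSum (fun x => ∫ ω, occ φ x s (fun r => A r ω) * occ φ x t (fun r => B r ω) ∂P)
      (∫ z, ∫ ω, corr S φ (B z.2.toNNReal ω - A z.1.toNNReal ω) ∂P
        ∂((volume.restrict (Set.Ioc 0 s)).prod (volume.restrict (Set.Ioc 0 t)))) := by
  have hmA : Measurable fun p : (ℝ × ℝ) × α => A p.1.1.toNNReal p.2 :=
    (measurable_toNNReal_path hA hAr).comp
      ((measurable_fst.comp measurable_fst).prodMk measurable_snd)
  have hmB : Measurable fun p : (ℝ × ℝ) × α => B p.1.2.toNNReal p.2 :=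
    (measurable_toNNReal_path hB hBr).comp
      ((measurable_snd.comp measurable_fst).prodMk measurable_snd)
  set ρ := (volume.restrict (Set.Ioc 0 s)).prod (volume.restrict (Set.Ioc (0 : ℝ) t)) with hρ
  have key := hasSum_integral_shift_mul (ρ.prod P) hS hmA hmB
  have hbd : ∀ z, |corr S φ z| ≤ ∑ x ∈ S, |φ x| * ∑ y ∈ S, |φ y| := fun z =>
    (Finset.abs_sum_le_sum_abs _ _).trans (Finset.sum_le_sum fun x _ => by
      rw [abs_mul]; exact mul_le_mul_of_nonneg_left (abs_le_sum_abs hS _) (abs_nonneg _))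
  rw [integral_prod _ (Integrable.of_bound (measurable_corr_sub hmA hmB).aestronglyMeasurable
    (∑ x ∈ S, |φ x| * ∑ y ∈ S, |φ y|) (Eventually.of_forall fun p => hbd _))] at key
  refine (congrArg (fun f => HasSum f _) (funext fun x => ?_)).mp key
  have hint : Integrable (fun p : (ℝ × ℝ) × α => φ (x + A p.1.1.toNNReal p.2) *
      φ (x + B p.1.2.toNNReal p.2)) (ρ.prod P) := by
    refine Integrable.of_bound ((measurable_comp_shift φ x hmA).mul
      (measurable_comp_shift φ x hmB)).aestronglyMeasurable
      ((∑ y ∈ S, |φ y|) * ∑ y ∈ S, |φ y|) (Eventually.of_forall fun p => ?_)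
    rw [Real.norm_eq_abs, abs_mul]
    exact mul_le_mul (abs_le_sum_abs hS _) (abs_le_sum_abs hS _) (abs_nonneg _)
      (Finset.sum_nonneg fun _ _ => abs_nonneg _)
  rw [integral_prod_symm _ hint]
  refine integral_congr_ae (Eventually.of_forall fun ω => ?_)
  dsimp only
  rw [occ_eq_integral φ x hs, occ_eq_integral φ x ht, hρ]
  exact integral_prod_mul (fun r : ℝ => φ (x + A r.toNNReal ω))
    fun r : ℝ => φ (x + B r.toNNReal ω)

/-- The spectral weights of the correlation function. -/
def corrWeight (S : Finset (HierGroup M)) (φ : HierGroup M → ℝ) (i : ℕ) : ℝ :=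
  ∑ x ∈ S, ∑ y ∈ S, φ x * φ y * specKer M i (x - y)

omit [NeZero M] in
lemma abs_corrWeight_le (hM : 1 < M) (S : Finset (HierGroup M)) (φ : HierGroup M → ℝ) (i : ℕ) :
    |corrWeight S φ i| ≤ (∑ x ∈ S, |φ x|) ^ 2 * (M : ℝ)⁻¹ ^ i := by
  rw [sq, Finset.sum_mul_sum, Finset.sum_mul]
  refine (Finset.abs_sum_le_sum_abs _ _).trans (Finset.sum_le_sum fun x _ => ?_)
  rw [Finset.sum_mul]
  refine (Finset.abs_sum_le_sum_abs _ _).trans (Finset.sum_le_sum fun y _ => ?_)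
  rw [abs_mul, abs_mul]
  exact mul_le_mul_of_nonneg_left (abs_specKer_le hM i _) (by positivity)

/-- Once the ball of radius `i` contains all differences of points of `S`, the spectral kernel there
is the constant `M^{-i} (1 - 1/M)`; the sequence is eventually constant. -/
lemma tendsto_corrWeight (hM : 1 < M) (S : Finset (HierGroup M)) (φ : HierGroup M → ℝ) :
    Tendsto (fun i => corrWeight S φ i * (M : ℝ) ^ i) atTop
      (𝓝 ((∑ x ∈ S, φ x) ^ 2 * (((M : ℝ) - 1) / M))) := by
  obtain ⟨k, hk⟩ := hball_subset_iUnion S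
  have hM0 : (M : ℝ) ≠ 0 := by positivity
  refine tendsto_const_nhds.congr' ?_
  filter_upwards [eventually_ge_atTop k] with i hi
  rw [corrWeight, sq, Finset.sum_mul_sum, Finset.sum_mul, Finset.sum_mul]
  refine Finset.sum_congr rfl fun x hx => ?_
  rw [Finset.sum_mul, Finset.sum_mul]
  refine Finset.sum_congr rfl fun y hy => ?_
  have h : hlen (x - y) ≤ i := (hlen_sub_le (mem_hball.1 (hk hx)) (mem_hball.1 (hk hy))).trans hi
  rw [specKer, unifKer, unifKer, if_pos h, if_pos (h.trans (Nat.le_succ _)), pow_succ]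
  field_simp

variable {c : ℝ} {Ω : Type*} [MeasurableSpace Ω] {μ : Measure Ω} [IsProbabilityMeasure μ]
  {Z : ℝ≥0 → Ω → HierGroup M}

omit [NeZero M] in
lemma corr_eq_sum_indicator (hS : ∀ x, φ x ≠ 0 → x ∈ S) (z : HierGroup M) :
    corr S φ z = ∑ x ∈ S, ∑ y ∈ S, φ x * φ y * Set.indicator {y - x} (fun _ => (1 : ℝ)) z := by
  classical
  refine Finset.sum_congr rfl fun x _ => ?_
  by_cases h : x + z ∈ S
  · rw [Finset.sum_eq_single (x + z)]
    · simp
    · intro y _ hy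
      rw [Set.indicator_of_notMem, mul_zero]
      rintro rfl
      exact hy (by simp)
    · exact fun h' => absurd h h'
  · rw [not_not.1 fun h' => h (hS _ h'), mul_zero]
    refine (Finset.sum_eq_zero fun y hy => ?_).symm
    rw [Set.indicator_of_notMem, mul_zero]
    rintro rfl
    exact h (by simpa using hy)

/-- The semigroup of the walk in spectral form, tested with the correlation function of `φ`. -/
def corrSemigroup (M : ℕ) (c : ℝ) (S : Finset (HierGroup M)) (φ : HierGroup M → ℝ) (u : ℝ) : ℝ :=
  ∑' i, corrWeight S φ i * Real.exp (-(parB M c * parA M c ^ i * u))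

omit [NeZero M] in
lemma hasSum_corrSemigroup (hM : 1 < M) (hc0 : 0 < c) (hc1 : c < 1) {u : ℝ} (hu : 0 ≤ u) :
    HasSum (fun i => corrWeight S φ i * Real.exp (-(parB M c * parA M c ^ i * u)))
      (corrSemigroup M c S φ u) := by
  refine Summable.hasSum (Summable.of_norm_bounded
    (g := fun i => (∑ x ∈ S, |φ x|) ^ 2 * (M : ℝ)⁻¹ ^ i)
    ((summable_inv_pow hM).mul_left _) fun i => ?_)
  rw [Real.norm_eq_abs, abs_mul, abs_of_pos (Real.exp_pos _)]
  exact (mul_le_of_le_one_right (abs_nonneg _) (exp_rate_le_one hM hc0 hc1 hu i)).trans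
    (abs_corrWeight_le hM S φ i)

omit [NeZero M] in
lemma sum_mul_transProb (hM : 1 < M) (hc0 : 0 < c) (hc1 : c < 1) {u : ℝ} (hu : 0 ≤ u) :
    ∑ x ∈ S, ∑ y ∈ S, φ x * φ y * transProb M c u 0 (y - x) = corrSemigroup M c S φ u := by
  have hs : ∀ z, Summable fun i => Real.exp (-(parB M c * parA M c ^ i * u)) * specKer M i z := by
    intro z
    refine Summable.of_norm_bounded (summable_inv_pow hM) fun i => ?_
    rw [norm_mul, Real.norm_eq_abs, Real.norm_eq_abs, abs_of_pos (Real.exp_pos _)]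
    exact (mul_le_of_le_one_left (abs_nonneg _) (exp_rate_le_one hM hc0 hc1 hu i)).trans
      (abs_specKer_le hM i _)
  refine HasSum.unique (f := fun i => corrWeight S φ i *
    Real.exp (-(parB M c * parA M c ^ i * u))) ?_ (hasSum_corrSemigroup hM hc0 hc1 hu)
  simp only [corrWeight, Finset.sum_mul]
  refine hasSum_sum fun x _ => hasSum_sum fun y _ => ?_
  rw [transProb_eq hM hc0 hc1, zero_sub, neg_sub]
  refine (congrArg (fun f => HasSum f _) (funext fun i => ?_)).mp
    ((hs (x - y)).hasSum.mul_left (φ x * φ y))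
  ring

omit [NeZero M] in
lemma transProb_neg (hM : 1 < M) (hc0 : 0 < c) (hc1 : c < 1) (t : ℝ) (y : HierGroup M) :
    transProb M c t 0 (-y) = transProb M c t 0 y := by
  rw [transProb_eq hM hc0 hc1, transProb_eq hM hc0 hc1]
  refine tsum_congr fun i => ?_
  rw [zero_sub, zero_sub, neg_neg, specKer, specKer, unifKer, unifKer, unifKer, unifKer, hlen_neg]


omit [NeZero M] in
lemma transProb_nonneg (hM : 1 < M) (hc0 : 0 < c) (hc1 : c < 1) {t : ℝ} (ht : 0 ≤ t)
    (x y : HierGroup M) : 0 ≤ transProb M c t x y := by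
  have : NeZero M := ⟨by omega⟩
  have h : ∀ n x y, 0 ≤ nStepProb M c n x y := by
    intro n
    induction n with
    | zero => intro x y; rw [nStepProb]; split_ifs <;> norm_num
    | succ n ih =>
      intro x y
      rw [nStepProb]
      refine tsum_nonneg fun w => mul_nonneg ?_ (ih w y)
      rw [stepProb_eq_stepKer]
      exact stepKer_nonneg hM hc0 hc1 _
  exact mul_nonneg (Real.exp_pos _).le (tsum_nonneg fun n => mul_nonneg (by positivity) (h n x y))

omit [NeZero M] in
lemma integral_corr_of_law (hM : 1 < M) (hc0 : 0 < c) (hc1 : c < 1) (hS : ∀ x, φ x ≠ 0 → x ∈ S)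
    {α : Type*} [MeasurableSpace α] {P : Measure α} [IsProbabilityMeasure P] {W : α → HierGroup M}
    (hW : Measurable W) {u : ℝ} (hu : 0 ≤ u)
    (h : ∀ y, P {ω | W ω = y} = ENNReal.ofReal (transProb M c u 0 y)) :
    ∫ ω, corr S φ (W ω) ∂P = corrSemigroup M c S φ u := by
  have : NeZero M := ⟨by omega⟩
  have hi : ∀ z : HierGroup M, Integrable
      (fun ω => Set.indicator {z} (fun _ => (1 : ℝ)) (W ω)) P := by
    intro z
    refine Integrable.of_bound ((measurable_const.indicator
      (measurableSet_singleton z)).comp hW).aestronglyMeasurable 1 (Eventually.of_forall fun ω => ?_)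
    by_cases hz : W ω ∈ ({z} : Set (HierGroup M)) <;> simp [hz]
  have hv : ∀ z : HierGroup M,
      ∫ ω, Set.indicator {z} (fun _ => (1 : ℝ)) (W ω) ∂P = transProb M c u 0 z := by
    intro z
    have h1 : (fun ω => Set.indicator {z} (fun _ => (1 : ℝ)) (W ω)) =
        Set.indicator {ω | W ω = z} 1 := by
      ext ω; by_cases hz : W ω = z <;> simp [hz]
    refine (congrArg (integral P) h1).trans ?_
    rw [integral_indicator_one (s := {ω | W ω = z}) (hW (measurableSet_singleton z)),
      measureReal_def, h, ENNReal.toReal_ofReal (transProb_nonneg hM hc0 hc1 hu _ _)]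
  simp only [corr_eq_sum_indicator hS]
  rw [integral_finsetSum _ fun x _ => integrable_finsetSum _ fun y _ => (hi _).const_mul _,
    ← sum_mul_transProb hM hc0 hc1 hu]
  refine Finset.sum_congr rfl fun x _ => ?_
  rw [integral_finsetSum _ fun y _ => (hi _).const_mul _]
  exact Finset.sum_congr rfl fun y _ => by rw [integral_const_mul, hv]

lemma IsCRandomWalk.integral_corr_increment (hM : 1 < M) (hc0 : 0 < c) (hc1 : c < 1)
    (hS : ∀ x, φ x ≠ 0 → x ∈ S) (hZ : IsCRandomWalk M c μ Z) (s t : ℝ≥0) :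
    ∫ ω, corr S φ (Z t ω - Z s ω) ∂μ = corrSemigroup M c S φ |(s : ℝ) - t| := by
  refine integral_corr_of_law hM hc0 hc1 hS (measurable_sub_hier (hZ.measurable s) (hZ.measurable t))
    (abs_nonneg _) fun y => ?_
  rcases le_total s t with hst | hst
  · rw [abs_sub_comm, abs_of_nonneg (sub_nonneg.2 (NNReal.coe_le_coe.2 hst))]
    exact hZ.increment_law s t hst y
  · rw [abs_of_nonneg (sub_nonneg.2 (NNReal.coe_le_coe.2 hst)), ← transProb_neg hM hc0 hc1,
      ← hZ.increment_law t s hst]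
    congr 1
    ext ω
    simp only [Set.mem_ofPred_eq]
    rw [← neg_sub (Z t ω), neg_inj]

/-- The walk is symmetric, so `-Z s` has the law of `Z s`, and an independent copy of `Z t` has the
law of the increment over `[s, s + t]`, which is independent of `Z s`. -/
lemma IsCRandomWalk.map_neg_prod (hM : 1 < M) (hc0 : 0 < c) (hc1 : c < 1)
    (hZ : IsCRandomWalk M c μ Z) (s t : ℝ≥0) :
    (μ.prod μ).map (fun p => (-Z s p.1, Z t p.2)) =
      μ.map (fun ω => (Z s ω, Z (s + t) ω - Z s ω)) := by
  have hms : Measurable fun ω => -Z s ω :=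
    (Measurable.of_discrete (f := fun z : HierGroup M => -z)).comp (hZ.measurable s)
  have hmd : Measurable fun ω => Z (s + t) ω - Z s ω :=
    measurable_sub_hier (hZ.measurable s) (hZ.measurable _)
  have hlaw0 : ∀ r y, μ {ω | Z r ω = y} = ENNReal.ofReal (transProb M c r 0 y) := by
    intro r y
    have := hZ.increment_law 0 r zero_le y
    rw [NNReal.coe_zero, sub_zero] at this
    rw [← this]
    refine measure_congr ?_
    filter_upwards [hZ.start] with ω hω
    exact propext (by
      show Z r ω = y ↔ Z r ω - Z 0 ω = y
      rw [hω, sub_zero])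
  have h1 : μ.map (fun ω => -Z s ω) = μ.map (Z s) := by
    refine Measure.ext_of_singleton fun y => ?_
    rw [Measure.map_apply hms (measurableSet_singleton y),
      Measure.map_apply (hZ.measurable s) (measurableSet_singleton y)]
    have e : (fun ω => -Z s ω) ⁻¹' {y} = {ω | Z s ω = -y} := by
      ext ω; simp [neg_eq_iff_eq_neg]
    rw [e]
    exact (hlaw0 s (-y)).trans ((congrArg _ (transProb_neg hM hc0 hc1 _ _)).trans (hlaw0 s y).symm)
  have h2 : μ.map (Z t) = μ.map (fun ω => Z (s + t) ω - Z s ω) := by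
    refine Measure.ext_of_singleton fun y => ?_
    rw [Measure.map_apply hmd (measurableSet_singleton y),
      Measure.map_apply (hZ.measurable t) (measurableSet_singleton y)]
    refine (hlaw0 t y).trans ?_
    have := hZ.increment_law s (s + t) le_self_add y
    rw [NNReal.coe_add, add_sub_cancel_left] at this
    exact this.symm
  have hind : IndepFun (Z s) (fun ω => Z (s + t) ω - Z s ω) μ := by
    have hi := hZ.indep_increments.indepFun_sub_sub (r := 0) (s := s) (t := s + t)
      zero_le le_self_add
    refine hi.congr ?_ (ae_eq_refl _)
    filter_upwards [hZ.start] with ω hω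
    simp [hω]
  rw [(indepFun_iff_map_prod_eq_prod_map_map (hZ.measurable s).aemeasurable hmd.aemeasurable).1 hind,
    ← h1, ← h2, Measure.map_prod_map _ _ hms (hZ.measurable t)]
  rfl

/-- The difference of two independent copies at times `s` and `t` is distributed like one walk at
time `s + t`; this is the source of the terms in `s + t` in the limit. -/
lemma IsCRandomWalk.integral_corr_pair (hM : 1 < M) (hc0 : 0 < c) (hc1 : c < 1)
    (hS : ∀ x, φ x ≠ 0 → x ∈ S) (hZ : IsCRandomWalk M c μ Z) (s t : ℝ≥0) :
    ∫ p, corr S φ (Z t p.2 - Z s p.1) ∂(μ.prod μ) = corrSemigroup M c S φ (s + t) := by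
  have hm1 : Measurable fun p : Ω × Ω => (-Z s p.1, Z t p.2) :=
    ((Measurable.of_discrete (f := fun z : HierGroup M => -z)).comp
      ((hZ.measurable s).comp measurable_fst)).prodMk ((hZ.measurable t).comp measurable_snd)
  have hm2 : Measurable fun ω => (Z s ω, Z (s + t) ω - Z s ω) :=
    (hZ.measurable s).prodMk (measurable_sub_hier (hZ.measurable s) (hZ.measurable _))
  have hg : Measurable fun p : HierGroup M × HierGroup M => corr S φ (p.1 + p.2) :=
    Measurable.of_discrete
  have e1 : ∀ p : Ω × Ω, Z t p.2 - Z s p.1 = -Z s p.1 + Z t p.2 := fun p => by abel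
  simp only [e1]
  have h1 := integral_map (μ := μ.prod μ) hm1.aemeasurable hg.aestronglyMeasurable
  rw [← h1, hZ.map_neg_prod hM hc0 hc1, integral_map hm2.aemeasurable hg.aestronglyMeasurable]
  simp only [add_sub_cancel]
  refine integral_corr_of_law hM hc0 hc1 hS (hZ.measurable _) (by positivity) fun y => ?_
  have := hZ.increment_law 0 (s + t) zero_le y
  rw [NNReal.coe_zero, sub_zero, NNReal.coe_add] at this
  rw [← this]
  refine measure_congr ?_
  filter_upwards [hZ.start] with ω hω
  exact propext (by
    show Z (s + t) ω = y ↔ Z (s + t) ω - Z 0 ω = y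
    rw [hω, sub_zero])

end OccupationMoments

/-! ### Double integrals of exponential kernels. -/

section KernelIntegrals

lemma hasDerivAt_expG {β : ℝ} (hβ : β ≠ 0) (r : ℝ) :
    HasDerivAt (expG β) ((1 - Real.exp (-(β * r))) / β) r := by
  have h2 : HasDerivAt (fun x : ℝ => β * x) β r := by simpa using (hasDerivAt_id r).const_mul β
  refine (((h2.neg.exp.sub_const 1).add h2).div_const (β ^ 2)).congr_deriv ?_
  simp only [Pi.neg_apply]
  field_simp
  ring

lemma expG_zero (β : ℝ) : expG β 0 = 0 := by simp [expG, expRem]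

lemma expG_nonneg (β t : ℝ) : 0 ≤ expG β t := div_nonneg (expRem_nonneg _) (sq_nonneg _)

lemma expG_le_sq {β t : ℝ} (hβ : 0 < β) (ht : 0 ≤ t) : expG β t ≤ t ^ 2 := by
  rw [expG, div_le_iff₀ (by positivity), ← mul_pow, mul_comm t]
  exact expRem_le_sq (by positivity)

lemma integral_exp_neg_mul {β : ℝ} (hβ : β ≠ 0) (u v : ℝ) :
    ∫ r in u..v, Real.exp (-(β * r)) = (Real.exp (-(β * u)) - Real.exp (-(β * v))) / β := by
  rw [intervalIntegral.integral_eq_sub_of_hasDerivAt (f := fun r => -Real.exp (-(β * r)) / β)]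
  · ring
  · intro r _
    have h2 : HasDerivAt (fun x : ℝ => β * x) β r := by simpa using (hasDerivAt_id r).const_mul β
    refine (h2.neg.exp.neg.div_const β).congr_deriv ?_
    simp only [Pi.neg_apply]
    field_simp
  · exact (by fun_prop : Continuous fun r : ℝ => Real.exp (-(β * r))).intervalIntegrable _ _

lemma integral_exp_neg_abs_sub {β r t : ℝ} (hβ : β ≠ 0) (hr : 0 ≤ r) (hrt : r ≤ t) :
    ∫ v in (0 : ℝ)..t, Real.exp (-(β * |r - v|)) =
      (1 - Real.exp (-(β * r))) / β + (1 - Real.exp (-(β * (t - r)))) / β := by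
  have hc : Continuous fun v : ℝ => Real.exp (-(β * |r - v|)) := by fun_prop
  rw [← intervalIntegral.integral_add_adjacent_intervals (hc.intervalIntegrable 0 r)
    (hc.intervalIntegrable r t)]
  congr 1
  · have : ∫ v in (0 : ℝ)..r, Real.exp (-(β * |r - v|)) =
        ∫ v in (0 : ℝ)..r, Real.exp (-(β * (r - v))) := by
      refine intervalIntegral.integral_congr fun v hv => ?_
      show Real.exp _ = Real.exp _
      rw [Set.uIcc_of_le hr] at hv
      rw [abs_of_nonneg (sub_nonneg.2 hv.2)]
    rw [this, intervalIntegral.integral_comp_sub_left (fun x => Real.exp (-(β * x))) r,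
      integral_exp_neg_mul hβ]
    simp
  · have : ∫ v in r..t, Real.exp (-(β * |r - v|)) =
        ∫ v in r..t, Real.exp (-(β * (v - r))) := by
      refine intervalIntegral.integral_congr fun v hv => ?_
      show Real.exp _ = Real.exp _
      rw [Set.uIcc_of_le hrt] at hv
      rw [abs_sub_comm, abs_of_nonneg (sub_nonneg.2 hv.1)]
    rw [this, intervalIntegral.integral_comp_sub_right (fun x => Real.exp (-(β * x))) r,
      integral_exp_neg_mul hβ]
    simp

lemma integral_integral_exp_neg_abs_sub {β s t : ℝ} (hβ : β ≠ 0) (hs : 0 ≤ s) (hst : s ≤ t) :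
    ∫ r in (0 : ℝ)..s, ∫ v in (0 : ℝ)..t, Real.exp (-(β * |r - v|)) =
      expG β s + expG β t - expG β (t - s) := by
  have h1 : ∫ r in (0 : ℝ)..s, ∫ v in (0 : ℝ)..t, Real.exp (-(β * |r - v|)) =
      ∫ r in (0 : ℝ)..s,
        ((1 - Real.exp (-(β * r))) / β + (1 - Real.exp (-(β * (t - r)))) / β) := by
    refine intervalIntegral.integral_congr fun r hr => ?_
    rw [Set.uIcc_of_le hs] at hr
    exact integral_exp_neg_abs_sub hβ hr.1 (hr.2.trans hst)
  rw [h1, intervalIntegral.integral_eq_sub_of_hasDerivAt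
    (f := fun r => expG β r - expG β (t - r))]
  · simp only [expG_zero, sub_zero]; ring
  · intro r _
    have h2 : HasDerivAt (fun x : ℝ => t - x) (-1) r := (hasDerivAt_id r).const_sub t
    have h := (hasDerivAt_expG hβ r).sub ((hasDerivAt_expG hβ (t - r)).comp r h2)
    refine h.congr_deriv ?_
    ring
  · exact (by fun_prop : Continuous fun r : ℝ => (1 - Real.exp (-(β * r))) / β +
      (1 - Real.exp (-(β * (t - r)))) / β).intervalIntegrable _ _

lemma integral_integral_exp_neg_add {β s t : ℝ} (hβ : β ≠ 0) :
    ∫ r in (0 : ℝ)..s, ∫ v in (0 : ℝ)..t, Real.exp (-(β * (r + v))) =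
      expG β (s + t) - expG β s - expG β t := by
  have h1 : ∀ r : ℝ, ∫ v in (0 : ℝ)..t, Real.exp (-(β * (r + v))) =
      (Real.exp (-(β * r)) - Real.exp (-(β * (r + t)))) / β := by
    intro r
    rw [intervalIntegral.integral_comp_add_left (fun x => Real.exp (-(β * x))) r,
      integral_exp_neg_mul hβ, add_zero]
  simp only [h1]
  rw [intervalIntegral.integral_eq_sub_of_hasDerivAt (f := fun r => expG β (r + t) - expG β r)]
  · simp only [expG_zero, zero_add, sub_zero]
  · intro r _
    have h2 : HasDerivAt (fun x : ℝ => x + t) 1 r := (hasDerivAt_id r).add_const t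
    have h := ((hasDerivAt_expG hβ (r + t)).comp r h2).sub (hasDerivAt_expG hβ r)
    refine h.congr_deriv ?_
    ring
  · exact (by fun_prop : Continuous fun r : ℝ =>
      (Real.exp (-(β * r)) - Real.exp (-(β * (r + t)))) / β).intervalIntegrable _ _

lemma integral_prod_restrict_Ioc {f : ℝ → ℝ → ℝ} (hf : Continuous fun p : ℝ × ℝ => f p.1 p.2)
    {s t : ℝ} (hs : 0 ≤ s) (ht : 0 ≤ t) :
    ∫ p, f (p.1.toNNReal : ℝ) (p.2.toNNReal : ℝ)
        ∂((volume.restrict (Set.Ioc 0 s)).prod (volume.restrict (Set.Ioc 0 t))) =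
      ∫ r in (0 : ℝ)..s, ∫ v in (0 : ℝ)..t, f r v := by
  have e : ∫ p, f (p.1.toNNReal : ℝ) (p.2.toNNReal : ℝ)
      ∂((volume.restrict (Set.Ioc 0 s)).prod (volume.restrict (Set.Ioc 0 t))) =
      ∫ p, f p.1 p.2 ∂((volume.restrict (Set.Ioc 0 s)).prod (volume.restrict (Set.Ioc 0 t))) := by
    rw [Measure.prod_restrict]
    refine setIntegral_congr_fun (measurableSet_Ioc.prod measurableSet_Ioc) fun p hp => ?_
    simp only [Real.coe_toNNReal _ hp.1.1.le, Real.coe_toNNReal _ hp.2.1.le]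
  rw [e, integral_prod, intervalIntegral.integral_of_le hs]
  · simp only [intervalIntegral.integral_of_le ht]
  · rw [Measure.prod_restrict]
    refine IntegrableOn.mono_set (hf.continuousOn.integrableOn_compact
      (isCompact_Icc.prod isCompact_Icc)) (Set.prod_mono Set.Ioc_subset_Icc_self
      Set.Ioc_subset_Icc_self)

end KernelIntegrals

/-! ### Second moments of occupation times summed over starting points. -/

section SecondMoments

variable {M : ℕ} [NeZero M] {S : Finset (HierGroup M)} {φ : HierGroup M → ℝ} {c : ℝ}

omit [NeZero M] in
lemma hasSum_integral_corrSemigroup (hM : 1 < M) (hc0 : 0 < c) (hc1 : c < 1)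
    {α : Type*} [MeasurableSpace α] (ρ : Measure α) [IsFiniteMeasure ρ] {u : α → ℝ}
    (hu : Measurable u) (hu0 : ∀ p, 0 ≤ u p) :
    HasSum (fun i => corrWeight S φ i * ∫ p, Real.exp (-(parB M c * parA M c ^ i * u p)) ∂ρ)
      (∫ p, corrSemigroup M c S φ (u p) ∂ρ) := by
  simp only [← integral_const_mul]
  refine hasSum_integral_of_dominated_convergence
    (fun i _ => (∑ x ∈ S, |φ x|) ^ 2 * (M : ℝ)⁻¹ ^ i) (fun i => ?_) (fun i => ?_) ?_ ?_ ?_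
  · exact ((Real.measurable_exp.comp ((hu.const_mul _).neg)).const_mul _).aestronglyMeasurable
  · refine Eventually.of_forall fun p => ?_
    rw [Real.norm_eq_abs, abs_mul, abs_of_pos (Real.exp_pos _)]
    exact (mul_le_of_le_one_right (abs_nonneg _) (exp_rate_le_one hM hc0 hc1 (hu0 p) i)).trans
      (abs_corrWeight_le hM S φ i)
  · exact Eventually.of_forall fun p => (summable_inv_pow hM).mul_left _
  · exact integrable_const _
  · exact Eventually.of_forall fun p => hasSum_corrSemigroup hM hc0 hc1 (hu0 p)

/-- The variance function of the occupation time of a single walk, summed over its starting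
points. -/
def walkVar (M : ℕ) (c : ℝ) (S : Finset (HierGroup M)) (φ : HierGroup M → ℝ) (t : ℝ) : ℝ :=
  occVar (parA M c) (parB M c) (corrWeight S φ) t

omit [NeZero M] in
lemma hasSum_walkVar (hM : 1 < M) (hc0 : 0 < c) (hc1 : c < 1) {t : ℝ} (ht : 0 ≤ t) :
    HasSum (fun i => corrWeight S φ i * expG (parB M c * parA M c ^ i) t) (walkVar M c S φ t) := by
  refine Summable.hasSum (Summable.of_norm_bounded
    (g := fun i => (∑ x ∈ S, |φ x|) ^ 2 * (M : ℝ)⁻¹ ^ i * t ^ 2)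
    (((summable_inv_pow hM).mul_left _).mul_right _) fun i => ?_)
  have hb := parB_pos hM hc1
  have ha := parA_pos hM hc0
  rw [Real.norm_eq_abs, abs_mul, abs_of_nonneg (expG_nonneg _ _)]
  exact mul_le_mul (abs_corrWeight_le hM S φ i) (expG_le_sq (by positivity) ht) (expG_nonneg _ _)
    (by positivity)

variable {Ω : Type*} [MeasurableSpace Ω] {μ : Measure Ω} [IsProbabilityMeasure μ]
  {Z : ℝ≥0 → Ω → HierGroup M}

/-- Each spectral level contributes a double integral of `e^{-β|r - v|}`; the result has the form of
a fractional Brownian covariance with `walkVar` in place of the power function. -/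
theorem IsCRandomWalk.hasSum_integral_occ_mul (hM : 1 < M) (hc0 : 0 < c) (hc1 : c < 1)
    (hS : ∀ x, φ x ≠ 0 → x ∈ S) (hZ : IsCRandomWalk M c μ Z) {s t : ℝ} (hs : 0 ≤ s) (ht : 0 ≤ t) :
    HasSum (fun x => ∫ ω, occ φ x s (fun r => Z r ω) * occ φ x t (fun r => Z r ω) ∂μ)
      (walkVar M c S φ s + walkVar M c S φ t - walkVar M c S φ |s - t|) := by
  wlog hst : s ≤ t generalizing s t
  · have := this ht hs (le_of_not_ge hst)
    rw [abs_sub_comm, add_comm (walkVar M c S φ s)]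
    simpa only [mul_comm (occ φ _ s _)] using this
  have h := _root_.hasSum_integral_occ_mul μ hS hZ.measurable hZ.rightCont hZ.measurable
    hZ.rightCont hs ht
  simp only [hZ.integral_corr_increment hM hc0 hc1 hS] at h
  have h2 := hasSum_integral_corrSemigroup (S := S) (φ := φ) hM hc0 hc1
    ((volume.restrict (Set.Ioc 0 s)).prod (volume.restrict (Set.Ioc (0 : ℝ) t)))
    (u := fun z => |((z.1.toNNReal : ℝ≥0) : ℝ) - z.2.toNNReal|) (by fun_prop) fun _ => abs_nonneg _
  have hb := parB_pos hM hc1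
  have ha := parA_pos hM hc0
  have h3 : ∀ i, ∫ z, Real.exp (-(parB M c * parA M c ^ i *
      |((Real.toNNReal (Prod.fst z) : ℝ≥0) : ℝ) - (Real.toNNReal (Prod.snd z) : ℝ≥0)|))
      ∂((volume.restrict (Set.Ioc 0 s)).prod (volume.restrict (Set.Ioc (0 : ℝ) t))) =
      expG (parB M c * parA M c ^ i) s + expG (parB M c * parA M c ^ i) t -
        expG (parB M c * parA M c ^ i) (t - s) := by
    intro i
    rw [integral_prod_restrict_Ioc (f := fun r v => Real.exp (-(parB M c * parA M c ^ i * |r - v|)))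
      (by fun_prop) hs ht, integral_integral_exp_neg_abs_sub (by positivity) hs hst]
  simp only [h3] at h2
  rw [abs_sub_comm, abs_of_nonneg (sub_nonneg.2 hst)]
  have h4 := (((hasSum_walkVar (S := S) (φ := φ) hM hc0 hc1 hs).add
    (hasSum_walkVar (S := S) (φ := φ) hM hc0 hc1 ht)).sub
    (hasSum_walkVar (S := S) (φ := φ) hM hc0 hc1 (sub_nonneg.2 hst)))
  simp only [← mul_add, ← mul_sub] at h4
  rwa [h2.unique h4] at h

/-- On `μ.prod μ` a product of means is a single expectation over two independent copies, which
reduces the sum to the semigroup at `r + v`. -/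
theorem IsCRandomWalk.hasSum_integral_occ_mul_integral_occ (hM : 1 < M) (hc0 : 0 < c) (hc1 : c < 1)
    (hS : ∀ x, φ x ≠ 0 → x ∈ S) (hZ : IsCRandomWalk M c μ Z) {s t : ℝ} (hs : 0 ≤ s) (ht : 0 ≤ t) :
    HasSum (fun x => (∫ ω, occ φ x s (fun r => Z r ω) ∂μ) * ∫ ω, occ φ x t (fun r => Z r ω) ∂μ)
      (walkVar M c S φ (s + t) - walkVar M c S φ s - walkVar M c S φ t) := by
  have h := _root_.hasSum_integral_occ_mul (μ.prod μ) hS (A := fun r p => Z r p.1)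
    (B := fun r p => Z r p.2) (fun r => (hZ.measurable r).comp measurable_fst)
    (fun p => hZ.rightCont p.1) (fun r => (hZ.measurable r).comp measurable_snd)
    (fun p => hZ.rightCont p.2) hs ht
  have e : ∀ x, ∫ p, occ φ x s (fun r => Z r (Prod.fst p)) * occ φ x t (fun r => Z r (Prod.snd p))
      ∂(μ.prod μ) = (∫ ω, occ φ x s (fun r => Z r ω) ∂μ) * ∫ ω, occ φ x t (fun r => Z r ω) ∂μ :=
    fun x => integral_prod_mul (fun ω => occ φ x s (fun r => Z r ω))
      fun ω => occ φ x t (fun r => Z r ω)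
  simp only [e, hZ.integral_corr_pair hM hc0 hc1 hS] at h
  have h2 := hasSum_integral_corrSemigroup (S := S) (φ := φ) hM hc0 hc1
    ((volume.restrict (Set.Ioc 0 s)).prod (volume.restrict (Set.Ioc (0 : ℝ) t)))
    (u := fun z => ((z.1.toNNReal : ℝ≥0) : ℝ) + z.2.toNNReal) (by fun_prop) fun _ => by positivity
  have hb := parB_pos hM hc1
  have ha := parA_pos hM hc0
  have h3 : ∀ i, ∫ z, Real.exp (-(parB M c * parA M c ^ i *
      (((Real.toNNReal (Prod.fst z) : ℝ≥0) : ℝ) + (Real.toNNReal (Prod.snd z) : ℝ≥0))))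
      ∂((volume.restrict (Set.Ioc 0 s)).prod (volume.restrict (Set.Ioc (0 : ℝ) t))) =
      expG (parB M c * parA M c ^ i) (s + t) - expG (parB M c * parA M c ^ i) s -
        expG (parB M c * parA M c ^ i) t := by
    intro i
    rw [integral_prod_restrict_Ioc (f := fun r v => Real.exp (-(parB M c * parA M c ^ i * (r + v))))
      (by fun_prop) hs ht, integral_integral_exp_neg_add (by positivity)]
  simp only [h3] at h2
  have h4 := (((hasSum_walkVar (S := S) (φ := φ) hM hc0 hc1 (add_nonneg hs ht)).sub
    (hasSum_walkVar (S := S) (φ := φ) hM hc0 hc1 hs)).sub (hasSum_walkVar (S := S) (φ := φ) hM hc0 hc1 ht))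
  simp only [← mul_sub] at h4
  rwa [h2.unique h4] at h

end SecondMoments

/-! ### Triple integrals of products of two kernels. -/

section TripleKernel

variable {α : Type*} [MeasurableSpace α] {ρ : Measure α} [SFinite ρ]

/-- Integrals of the three products of two symmetric kernels along a path through three points. -/
lemma lintegral_triple_le {k : α → α → ℝ≥0∞} (hk : Measurable fun p : α × α => k p.1 p.2)
    (hsymm : ∀ r v, k r v = k v r) {J : ℝ≥0∞} (hJ : ∀ᵐ r ∂ρ, ∫⁻ v, k r v ∂ρ ≤ J) :
    ∫⁻ p, (k p.1 p.2.1 * k p.2.1 p.2.2 + k p.1 p.2.1 * k p.1 p.2.2 + k p.1 p.2.2 * k p.2.1 p.2.2)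
      ∂(ρ.prod (ρ.prod ρ)) ≤ 3 * (J * J * ρ Set.univ) := by
  have m1 : ∀ r, Measurable (k r) := fun r => hk.comp (measurable_const.prodMk measurable_id)
  have m12 : Measurable fun p : α × α × α => k p.1 p.2.1 :=
    hk.comp (measurable_fst.prodMk (measurable_fst.comp measurable_snd))
  have m13 : Measurable fun p : α × α × α => k p.1 p.2.2 :=
    hk.comp (measurable_fst.prodMk (measurable_snd.comp measurable_snd))
  have m23 : Measurable fun p : α × α × α => k p.2.1 p.2.2 :=
    hk.comp ((measurable_fst.comp measurable_snd).prodMk (measurable_snd.comp measurable_snd))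
  have hout : ∀ f : α → ℝ≥0∞, (∀ᵐ r ∂ρ, f r ≤ J * J) → ∫⁻ r, f r ∂ρ ≤ J * J * ρ Set.univ := by
    intro f hf
    refine (lintegral_mono_ae hf).trans ?_
    rw [lintegral_const]
  have ma : Measurable fun p : α × α × α => k p.1 p.2.1 * k p.2.1 p.2.2 := m12.mul m23
  have mc : Measurable fun p : α × α × α => k p.1 p.2.1 * k p.1 p.2.2 := m12.mul m13
  have md : Measurable fun p : α × α × α => k p.1 p.2.2 * k p.2.1 p.2.2 := m13.mul m23
  have mb : Measurable fun p : α × α × α =>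
      k p.1 p.2.1 * k p.2.1 p.2.2 + k p.1 p.2.1 * k p.1 p.2.2 := ma.add (m12.mul m13)
  rw [lintegral_add_left mb, lintegral_add_left ma]
  have e1 : ∫⁻ p, k p.1 p.2.1 * k p.2.1 p.2.2 ∂(ρ.prod (ρ.prod ρ)) ≤ J * J * ρ Set.univ := by
    rw [lintegral_prod _ ma.aemeasurable]
    refine hout _ ?_
    filter_upwards [hJ] with r hr
    have hm : Measurable fun q : α × α => k r q.1 * k q.1 q.2 :=
      ((m1 r).comp measurable_fst).mul hk
    rw [lintegral_prod _ hm.aemeasurable]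
    calc ∫⁻ v, ∫⁻ w, k r v * k v w ∂ρ ∂ρ ≤ ∫⁻ v, k r v * J ∂ρ := by
          refine lintegral_mono_ae ?_
          filter_upwards [hJ] with v hv
          rw [lintegral_const_mul _ (m1 v)]
          gcongr
      _ ≤ J * J := by
          rw [lintegral_mul_const _ (m1 r)]
          gcongr
  have e2 : ∫⁻ p, k p.1 p.2.1 * k p.1 p.2.2 ∂(ρ.prod (ρ.prod ρ)) ≤ J * J * ρ Set.univ := by
    rw [lintegral_prod _ mc.aemeasurable]
    refine hout _ ?_
    filter_upwards [hJ] with r hr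
    rw [lintegral_prod_mul (m1 r).aemeasurable (m1 r).aemeasurable]
    gcongr
  have e3 : ∫⁻ p, k p.1 p.2.2 * k p.2.1 p.2.2 ∂(ρ.prod (ρ.prod ρ)) ≤ J * J * ρ Set.univ := by
    rw [lintegral_prod _ md.aemeasurable]
    refine hout _ ?_
    filter_upwards [hJ] with r hr
    have hm : Measurable fun q : α × α => k r q.2 * k q.1 q.2 :=
      ((m1 r).comp measurable_snd).mul hk
    rw [lintegral_prod_symm _ hm.aemeasurable]
    calc ∫⁻ w, ∫⁻ v, k r w * k v w ∂ρ ∂ρ ≤ ∫⁻ w, k r w * J ∂ρ := by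
          refine lintegral_mono_ae ?_
          filter_upwards [hJ] with w hw
          simp only [hsymm _ w]
          rw [lintegral_const_mul _ (m1 w)]
          gcongr
      _ ≤ J * J := by
          rw [lintegral_mul_const _ (m1 r)]
          gcongr
  calc _ ≤ J * J * ρ Set.univ + J * J * ρ Set.univ + J * J * ρ Set.univ :=
        add_le_add (add_le_add e1 e2) e3
    _ = _ := by ring

lemma lintegral_cube {f : α → ℝ≥0∞} (hf : Measurable f) :
    (∫⁻ r, f r ∂ρ) ^ 3 = ∫⁻ p, f p.1 * (f p.2.1 * f p.2.2) ∂(ρ.prod (ρ.prod ρ)) := by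
  have hm : Measurable fun q : α × α => f q.1 * f q.2 :=
    (hf.comp measurable_fst).mul (hf.comp measurable_snd)
  rw [lintegral_prod_mul (g := fun q : α × α => f q.1 * f q.2) hf.aemeasurable hm.aemeasurable,
    lintegral_prod_mul hf.aemeasurable hf.aemeasurable]
  ring

end TripleKernel

/-! ### Third moments of occupation times. -/

section ThirdMoments

lemma integral_abs_sub_rpow {s r L : ℝ} (hs : s < 1) (hr : 0 ≤ r) (hrL : r ≤ L) :
    IntervalIntegrable (fun v => |r - v| ^ (-s)) volume 0 L ∧
      ∫ v in (0 : ℝ)..L, |r - v| ^ (-s) = (r ^ (1 - s) + (L - r) ^ (1 - s)) / (1 - s) := by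
  have hp : -1 < -s := by linarith
  have e1 : Set.EqOn (fun v : ℝ => (r - v) ^ (-s)) (fun v => |r - v| ^ (-s)) (Set.uIcc 0 r) := by
    intro v hv
    rw [Set.uIcc_of_le hr] at hv
    show (r - v) ^ (-s) = |r - v| ^ (-s)
    rw [abs_of_nonneg (sub_nonneg.2 hv.2)]
  have e2 : Set.EqOn (fun v : ℝ => (v - r) ^ (-s)) (fun v => |r - v| ^ (-s)) (Set.uIcc r L) := by
    intro v hv
    rw [Set.uIcc_of_le hrL] at hv
    show (v - r) ^ (-s) = |r - v| ^ (-s)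
    rw [abs_sub_comm, abs_of_nonneg (sub_nonneg.2 hv.1)]
  have i1 : IntervalIntegrable (fun v : ℝ => |r - v| ^ (-s)) volume 0 r := by
    have := (intervalIntegral.intervalIntegrable_rpow' hp (a := r) (b := 0)).comp_sub_left r
    simp only [sub_self, sub_zero] at this
    exact this.congr (e1.mono Set.uIoc_subset_uIcc)
  have i2 : IntervalIntegrable (fun v : ℝ => |r - v| ^ (-s)) volume r L := by
    have := (intervalIntegral.intervalIntegrable_rpow' hp (a := 0) (b := L - r)).comp_sub_right r
    simp only [zero_add, sub_add_cancel] at this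
    exact this.congr (e2.mono Set.uIoc_subset_uIcc)
  refine ⟨i1.trans i2, ?_⟩
  rw [← intervalIntegral.integral_add_adjacent_intervals i1 i2,
    ← intervalIntegral.integral_congr e1, ← intervalIntegral.integral_congr e2,
    intervalIntegral.integral_comp_sub_left (fun x => x ^ (-s)) r,
    intervalIntegral.integral_comp_sub_right (fun x => x ^ (-s)) r,
    integral_rpow (Or.inl hp), integral_rpow (Or.inl hp)]
  have h0 : (0 : ℝ) ^ (1 - s) = 0 := Real.zero_rpow (by linarith)
  have e : -s + 1 = 1 - s := by ring
  simp only [sub_self, sub_zero, e, h0]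
  ring

variable {M : ℕ} {c : ℝ}

/-- Since `s < 1`, the singularity of `|r - v|^(-s)` is integrable, and the bound is uniform in the
position of `r`. -/
lemma exists_lintegral_returnBound_le (hM : 1 < M) (hc0 : 0 < c) (hc1 : c < 1) {s : ℝ}
    (hs0 : 0 ≤ s) (hs : s < 1 + walkDegree M c) : ∃ C, 0 ≤ C ∧ ∀ L, 0 ≤ L → ∀ r ∈ Set.Ioc 0 L,
      ∫⁻ v, ENNReal.ofReal (returnBound M c |r - v|) ∂(volume.restrict (Set.Ioc 0 L)) ≤
        ENNReal.ofReal (C * L ^ (1 - s)) := by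
  obtain ⟨C, hC, hb⟩ := exists_returnBound_le hM hc0 hc1 hs0 hs
  have hs1 : s < 1 := by linarith [walkDegree_neg hM hc0 hc1]
  refine ⟨C * 2 / (1 - s), div_nonneg (by positivity) (by linarith), fun L hL r hr => ?_⟩
  obtain ⟨h1, h2⟩ := integral_abs_sub_rpow hs1 hr.1.le hr.2
  calc ∫⁻ v, ENNReal.ofReal (returnBound M c |r - v|) ∂(volume.restrict (Set.Ioc 0 L))
      ≤ ∫⁻ v, ENNReal.ofReal (C * |r - v| ^ (-s)) ∂(volume.restrict (Set.Ioc 0 L)) := by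
        refine lintegral_mono_ae ?_
        filter_upwards [Measure.ae_ne (volume.restrict (Set.Ioc 0 L)) r] with v hv
        exact ENNReal.ofReal_le_ofReal (hb _ (abs_pos.2 (sub_ne_zero.2 hv.symm)))
    _ = ENNReal.ofReal (∫ v, C * |r - v| ^ (-s) ∂(volume.restrict (Set.Ioc 0 L))) := by
        rw [ofReal_integral_eq_lintegral_ofReal]
        · exact (((intervalIntegrable_iff_integrableOn_Ioc_of_le hL).1 h1).const_mul C)
        · exact Eventually.of_forall fun v => by positivity
    _ ≤ ENNReal.ofReal (C * 2 / (1 - s) * L ^ (1 - s)) := by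
        refine ENNReal.ofReal_le_ofReal ?_
        rw [integral_const_mul, ← intervalIntegral.integral_of_le hL, h2]
        have h3 : r ^ (1 - s) ≤ L ^ (1 - s) := Real.rpow_le_rpow hr.1.le hr.2 (by linarith)
        have h4 : (L - r) ^ (1 - s) ≤ L ^ (1 - s) :=
          Real.rpow_le_rpow (sub_nonneg.2 hr.2) (by linarith [hr.1]) (by linarith)
        have h5 : 0 < 1 - s := by linarith
        rw [div_mul_eq_mul_div, ← mul_div_assoc, div_le_div_iff_of_pos_right h5]
        nlinarith

lemma measurable_returnBound : Measurable (returnBound M c) := by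
  unfold returnBound
  exact Measurable.tsum fun i => by fun_prop

variable [NeZero M] {ψ : HierGroup M → ℝ≥0∞}

lemma lintegral_shift_le {ρ : Measure (HierGroup M)} {k : ℝ≥0∞} (hρ : ∀ z, ρ {z} ≤ k)
    (y : HierGroup M) : ∫⁻ z, ψ (y + z) ∂ρ ≤ (∑' z, ψ z) * k := by
  rw [lintegral_countable', ← ENNReal.tsum_mul_right,
    ← (Equiv.addLeft y).tsum_eq fun z => ψ z * k]
  exact ENNReal.tsum_le_tsum fun z => by
    show _ ≤ ψ (y + z) * k
    gcongr
    exact hρ z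

variable {Ω : Type*} [MeasurableSpace Ω] {μ : Measure Ω} [IsProbabilityMeasure μ]
  {Z : ℝ≥0 → Ω → HierGroup M}

/-- The bound for the transition probabilities between two times. -/
def timeKernel (M : ℕ) (c : ℝ) (s t : ℝ≥0) : ℝ≥0∞ :=
  ENNReal.ofReal (returnBound M c |(s : ℝ) - t|)

omit [NeZero M] in
lemma timeKernel_comm (s t : ℝ≥0) : timeKernel M c s t = timeKernel M c t s := by
  rw [timeKernel, timeKernel, abs_sub_comm]

omit [NeZero M] [IsProbabilityMeasure μ] in
lemma IsCRandomWalk.measure_increment_le (hM : 1 < M) (hc0 : 0 < c) (hc1 : c < 1)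
    (hZ : IsCRandomWalk M c μ Z) {s t : ℝ≥0} (hst : s ≤ t) (y : HierGroup M) :
    μ {ω | Z t ω - Z s ω = y} ≤ timeKernel M c s t := by
  have h0 : (0 : ℝ) ≤ (t : ℝ) - s := sub_nonneg.2 (NNReal.coe_le_coe.2 hst)
  rw [hZ.increment_law s t hst, timeKernel, abs_sub_comm, abs_of_nonneg h0]
  exact ENNReal.ofReal_le_ofReal ((le_abs_self _).trans (abs_transProb_le hM hc0 hc1 h0 _ _))

omit [NeZero M] in
lemma measurable_comp_hier {α : Type*} [MeasurableSpace α] (f : HierGroup M → ℝ≥0∞)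
    {a : α → HierGroup M} (ha : Measurable a) : Measurable fun p => f (a p) :=
  (Measurable.of_discrete (f := f)).comp ha

omit [NeZero M] in
lemma measurable_comp_add {α : Type*} [MeasurableSpace α] (f : HierGroup M → ℝ≥0∞)
    (x : HierGroup M) {a : α → HierGroup M} (ha : Measurable a) :
    Measurable fun p => f (x + a p) :=
  measurable_comp_hier (fun y => f (x + y)) ha

/-- The substitution `y = x + Z r` frees the sum from the first position. The two remaining
displacements are independent, and the time kernel bounds every point probability of each. -/
lemma IsCRandomWalk.tsum_triple_le (hM : 1 < M) (hc0 : 0 < c) (hc1 : c < 1)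
    (hZ : IsCRandomWalk M c μ Z) {r s t : ℝ≥0} (hrs : r ≤ s) (hst : s ≤ t) :
    ∑' x, ∫⁻ ω, ψ (x + Z r ω) * (ψ (x + Z s ω) * ψ (x + Z t ω)) ∂μ ≤
      (∑' z, ψ z) ^ 3 * (timeKernel M c r s * timeKernel M c s t) := by
  have m1 := measurable_sub_hier (hZ.measurable r) (hZ.measurable s)
  have m2 := measurable_sub_hier (hZ.measurable s) (hZ.measurable t)
  have hind : IndepFun (fun ω => Z s ω - Z r ω) (fun ω => Z t ω - Z s ω) μ :=
    hZ.indep_increments.indepFun_sub_sub hrs hst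
  have hmψ : ∀ y : HierGroup M, Measurable fun p : HierGroup M × HierGroup M =>
      ψ (y + p.1) * ψ (y + p.1 + p.2) := fun y => Measurable.of_discrete
  have hm3 : ∀ x, Measurable fun ω => ψ (x + Z r ω) * (ψ (x + Z s ω) * ψ (x + Z t ω)) := fun x =>
    (measurable_comp_add ψ x (hZ.measurable r)).mul
      ((measurable_comp_add ψ x (hZ.measurable s)).mul
        (measurable_comp_add ψ x (hZ.measurable t)))
  rw [← lintegral_tsum fun x => (hm3 x).aemeasurable]
  have e1 : ∀ ω, ∑' x, ψ (x + Z r ω) * (ψ (x + Z s ω) * ψ (x + Z t ω)) =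
      ∑' y, ψ y * (ψ (y + (Z s ω - Z r ω)) * ψ (y + (Z s ω - Z r ω) + (Z t ω - Z s ω))) := by
    intro ω
    rw [← (Equiv.addRight (Z r ω)).tsum_eq fun y =>
      ψ y * (ψ (y + (Z s ω - Z r ω)) * ψ (y + (Z s ω - Z r ω) + (Z t ω - Z s ω)))]
    refine tsum_congr fun x => ?_
    have h1 : x + Z r ω + (Z s ω - Z r ω) = x + Z s ω := by abel
    have h2 : x + Z s ω + (Z t ω - Z s ω) = x + Z t ω := by abel
    rw [Equiv.coe_addRight, h1, h2]
  simp only [e1]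
  have hmD : ∀ y : HierGroup M, Measurable fun ω =>
      ψ (y + (Z s ω - Z r ω)) * ψ (y + (Z s ω - Z r ω) + (Z t ω - Z s ω)) := by
    intro y
    have h := (hmψ y).comp (m1.prodMk m2)
    simp only [Function.comp_def] at h
    exact h
  rw [lintegral_tsum fun y => ((hmD y).const_mul _).aemeasurable]
  have e2 : ∀ y, ∫⁻ ω, ψ y * (ψ (y + (Z s ω - Z r ω)) *
      ψ (y + (Z s ω - Z r ω) + (Z t ω - Z s ω))) ∂μ ≤
      ψ y * ((∑' z, ψ z) ^ 2 * (timeKernel M c r s * timeKernel M c s t)) := by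
    intro y
    rw [lintegral_const_mul _ (hmD y)]
    gcongr
    have h1 := lintegral_map (μ := μ) (hmψ y) (m1.prodMk m2)
    rw [← h1, (indepFun_iff_map_prod_eq_prod_map_map m1.aemeasurable m2.aemeasurable).1 hind,
      lintegral_prod _ (hmψ y).aemeasurable]
    have k1 : ∀ z, μ.map (fun ω => Z s ω - Z r ω) {z} ≤ timeKernel M c r s := fun z => by
      rw [Measure.map_apply m1 (measurableSet_singleton z)]
      exact hZ.measure_increment_le hM hc0 hc1 hrs z
    have k2 : ∀ z, μ.map (fun ω => Z t ω - Z s ω) {z} ≤ timeKernel M c s t := fun z => by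
      rw [Measure.map_apply m2 (measurableSet_singleton z)]
      exact hZ.measure_increment_le hM hc0 hc1 hst z
    calc _ ≤ ∫⁻ z, ψ (y + z) * ((∑' z, ψ z) * timeKernel M c s t)
          ∂(μ.map fun ω => Z s ω - Z r ω) := by
          refine lintegral_mono fun z => ?_
          dsimp only
          rw [lintegral_const_mul _ Measurable.of_discrete]
          gcongr
          exact lintegral_shift_le k2 (y + z)
      _ ≤ (∑' z, ψ z) * timeKernel M c r s * ((∑' z, ψ z) * timeKernel M c s t) := by
          rw [lintegral_mul_const _ Measurable.of_discrete]
          gcongr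
          exact lintegral_shift_le k1 y
      _ = _ := by ring
  refine (ENNReal.tsum_le_tsum e2).trans ?_
  rw [ENNReal.tsum_mul_right]
  exact le_of_eq (by ring)

/-- The three times come in an unknown order; each order produces one of the three products of
consecutive kernels, and their sum covers all cases. -/
lemma IsCRandomWalk.tsum_triple_le_sum (hM : 1 < M) (hc0 : 0 < c) (hc1 : c < 1)
    (hZ : IsCRandomWalk M c μ Z) (r s t : ℝ≥0) :
    ∑' x, ∫⁻ ω, ψ (x + Z r ω) * (ψ (x + Z s ω) * ψ (x + Z t ω)) ∂μ ≤
      (∑' z, ψ z) ^ 3 * (timeKernel M c r s * timeKernel M c s t +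
        timeKernel M c r s * timeKernel M c r t + timeKernel M c r t * timeKernel M c s t) := by
  have key : ∀ {u v w : ℝ≥0}, u ≤ v → v ≤ w →
      (∀ x ω, ψ (x + Z r ω) * (ψ (x + Z s ω) * ψ (x + Z t ω)) =
        ψ (x + Z u ω) * (ψ (x + Z v ω) * ψ (x + Z w ω))) →
      timeKernel M c u v * timeKernel M c v w ≤ (timeKernel M c r s * timeKernel M c s t +
        timeKernel M c r s * timeKernel M c r t + timeKernel M c r t * timeKernel M c s t) →
      ∑' x, ∫⁻ ω, ψ (x + Z r ω) * (ψ (x + Z s ω) * ψ (x + Z t ω)) ∂μ ≤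
      (∑' z, ψ z) ^ 3 * (timeKernel M c r s * timeKernel M c s t +
        timeKernel M c r s * timeKernel M c r t + timeKernel M c r t * timeKernel M c s t) := by
    intro u v w huv hvw he hk
    simp only [he]
    exact (hZ.tsum_triple_le hM hc0 hc1 huv hvw).trans (by gcongr)
  have c1 := timeKernel_comm (M := M) (c := c) r s
  have c2 := timeKernel_comm (M := M) (c := c) r t
  have c3 := timeKernel_comm (M := M) (c := c) s t
  have l1 : timeKernel M c r s * timeKernel M c s t ≤ timeKernel M c r s * timeKernel M c s t +
      timeKernel M c r s * timeKernel M c r t + timeKernel M c r t * timeKernel M c s t := by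
    rw [add_assoc]; exact le_self_add
  have l2 : timeKernel M c r s * timeKernel M c r t ≤ timeKernel M c r s * timeKernel M c s t +
      timeKernel M c r s * timeKernel M c r t + timeKernel M c r t * timeKernel M c s t :=
    le_add_self.trans le_self_add
  have l3 : timeKernel M c r t * timeKernel M c s t ≤ timeKernel M c r s * timeKernel M c s t +
      timeKernel M c r s * timeKernel M c r t + timeKernel M c r t * timeKernel M c s t :=
    le_add_self
  -- Of the eight sign patterns two are cyclic and force equal times; they are covered by the same
  -- argument as their neighbours.
  rcases le_total r s with h1 | h1 <;> rcases le_total s t with h2 | h2 <;>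
    rcases le_total r t with h3 | h3
  · exact key h1 h2 (fun x ω => rfl) l1
  · exact key h1 h2 (fun x ω => rfl) l1
  · exact key h3 h2 (fun x ω => by ring) (by rw [← c3]; exact l3)
  · exact key h3 h1 (fun x ω => by ring) (by rw [← c2, mul_comm]; exact l2)
  · exact key h1 h3 (fun x ω => by ring) (by rw [← c1]; exact l2)
  · exact key h2 h3 (fun x ω => by ring) (by rw [← c2, mul_comm]; exact l3)
  · exact key h2 h1 (fun x ω => by ring) (by rw [← c1, ← c3, mul_comm]; exact l1)
  · exact key h2 h1 (fun x ω => by ring) (by rw [← c1, ← c3, mul_comm]; exact l1)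

omit [NeZero M] [IsProbabilityMeasure μ] in
lemma IsCRandomWalk.measurable_along (hZ : IsCRandomWalk M c μ Z) {α : Type*} [MeasurableSpace α]
    {u : α → ℝ} {v : α → Ω} (hu : Measurable u) (hv : Measurable v) :
    Measurable fun q => Z (u q).toNNReal (v q) := by
  have h := (measurable_toNNReal_path hZ.measurable hZ.rightCont).comp (hu.prodMk hv)
  simp only [Function.comp_def] at h
  exact h

/-- Of the three time integrations, two act on kernels and give `L^(1-s)` each, while the third
gives `L`; together `L^(3-2s)`. -/
theorem IsCRandomWalk.exists_tsum_occ_cube_le (hM : 1 < M) (hc0 : 0 < c) (hc1 : c < 1) {s : ℝ}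
    (hs0 : 0 ≤ s) (hs : s < 1 + walkDegree M c) (hZ : IsCRandomWalk M c μ Z)
    {S : Finset (HierGroup M)} {φ : HierGroup M → ℝ} (hS : ∀ x, φ x ≠ 0 → x ∈ S) :
    ∃ C, 0 ≤ C ∧ ∀ L, 0 ≤ L →
      ∑' x, ∫⁻ ω, ENNReal.ofReal (occ (fun y => |φ y|) x L (fun r => Z r ω) ^ 3) ∂μ ≤
        ENNReal.ofReal (C * L ^ (3 - 2 * s)) := by
  obtain ⟨C, hC, hJ⟩ := exists_lintegral_returnBound_le hM hc0 hc1 hs0 hs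
  have hs1 : s < 1 := by linarith [walkDegree_neg hM hc0 hc1]
  have hA0 : 0 ≤ ∑ y ∈ S, |φ y| := Finset.sum_nonneg fun _ _ => abs_nonneg _
  refine ⟨(∑ y ∈ S, |φ y|) ^ 3 * (3 * C ^ 2), by positivity, fun L hL => ?_⟩
  set ψ : HierGroup M → ℝ≥0∞ := fun y => ENNReal.ofReal |φ y| with hψ
  set vs := volume.restrict (Set.Ioc 0 L) with hvs
  have hA : ∑' z, ψ z = ENNReal.ofReal (∑ y ∈ S, |φ y|) := by
    rw [ENNReal.ofReal_sum_of_nonneg fun _ _ => abs_nonneg _, tsum_eq_sum fun x hx => ?_]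
    simp [hψ, not_not.1 fun h => hx (hS x h)]
  have hm1 : ∀ x ω, Measurable fun r : ℝ => ψ (x + Z r.toNNReal ω) := fun x ω =>
    measurable_comp_add ψ x (hZ.measurable_along measurable_id measurable_const)
  have e1 : ∀ x ω, ENNReal.ofReal (occ (fun y => |φ y|) x L (fun r => Z r ω) ^ 3) =
      ∫⁻ p, ψ (x + Z p.1.toNNReal ω) * (ψ (x + Z p.2.1.toNNReal ω) * ψ (x + Z p.2.2.toNNReal ω))
        ∂(vs.prod (vs.prod vs)) := by
    intro x ω
    rw [← lintegral_cube (hm1 x ω), occ_eq_integral _ _ hL,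
      ENNReal.ofReal_pow (integral_nonneg fun _ => abs_nonneg _),
      ofReal_integral_eq_lintegral_ofReal _ (Eventually.of_forall fun _ => abs_nonneg _)]
    refine Integrable.of_bound (C := ∑ y ∈ S, |φ y|) ?_ (Eventually.of_forall fun r => ?_)
    · exact ((measurable_comp_shift (fun y => |φ y|) x
        (hZ.measurable_along measurable_id measurable_const)).aestronglyMeasurable)
    · rw [Real.norm_eq_abs, abs_abs]
      exact abs_le_sum_abs hS _
  have hm3 : ∀ x, Measurable fun q : Ω × (ℝ × ℝ × ℝ) => ψ (x + Z q.2.1.toNNReal q.1) *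
      (ψ (x + Z q.2.2.1.toNNReal q.1) * ψ (x + Z q.2.2.2.toNNReal q.1)) := fun x =>
    (measurable_comp_add ψ x (hZ.measurable_along (measurable_fst.comp measurable_snd)
      measurable_fst)).mul
      ((measurable_comp_add ψ x (hZ.measurable_along
        (measurable_fst.comp (measurable_snd.comp measurable_snd)) measurable_fst)).mul
      (measurable_comp_add ψ x (hZ.measurable_along
        (measurable_snd.comp (measurable_snd.comp measurable_snd)) measurable_fst)))
  have hkm : Measurable fun p : ℝ × ℝ => ENNReal.ofReal (returnBound M c |p.1 - p.2|) :=
    ENNReal.measurable_ofReal.comp (measurable_returnBound.comp (by fun_prop))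
  calc ∑' x, ∫⁻ ω, ENNReal.ofReal (occ (fun y => |φ y|) x L (fun r => Z r ω) ^ 3) ∂μ
      = ∑' x, ∫⁻ p, ∫⁻ ω, ψ (x + Z p.1.toNNReal ω) *
          (ψ (x + Z p.2.1.toNNReal ω) * ψ (x + Z p.2.2.toNNReal ω)) ∂μ
          ∂(vs.prod (vs.prod vs)) := by
        refine tsum_congr fun x => ?_
        simp only [e1]
        exact lintegral_lintegral_swap (hm3 x).aemeasurable
    _ = ∫⁻ p, ∑' x, ∫⁻ ω, ψ (x + Z p.1.toNNReal ω) *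
          (ψ (x + Z p.2.1.toNNReal ω) * ψ (x + Z p.2.2.toNNReal ω)) ∂μ
          ∂(vs.prod (vs.prod vs)) :=
        (lintegral_tsum fun x => ((hm3 x).lintegral_prod_left').aemeasurable).symm
    _ ≤ ∫⁻ p, (∑' z, ψ z) ^ 3 * (ENNReal.ofReal (returnBound M c |p.1 - p.2.1|) *
          ENNReal.ofReal (returnBound M c |p.2.1 - p.2.2|) +
          ENNReal.ofReal (returnBound M c |p.1 - p.2.1|) *
          ENNReal.ofReal (returnBound M c |p.1 - p.2.2|) +
          ENNReal.ofReal (returnBound M c |p.1 - p.2.2|) *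
          ENNReal.ofReal (returnBound M c |p.2.1 - p.2.2|)) ∂(vs.prod (vs.prod vs)) := by
        refine lintegral_mono_ae ?_
        have hae : ∀ᵐ p ∂(vs.prod (vs.prod vs)), p ∈ Set.Ioc 0 L ×ˢ Set.Ioc 0 L ×ˢ Set.Ioc 0 L := by
          rw [hvs, Measure.prod_restrict, Measure.prod_restrict]
          exact ae_restrict_mem (measurableSet_Ioc.prod (measurableSet_Ioc.prod measurableSet_Ioc))
        filter_upwards [hae] with p hp
        refine (hZ.tsum_triple_le_sum hM hc0 hc1 _ _ _).trans (le_of_eq ?_)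
        simp only [timeKernel, Real.coe_toNNReal _ hp.1.1.le, Real.coe_toNNReal _ hp.2.1.1.le,
          Real.coe_toNNReal _ hp.2.2.1.le]
    _ ≤ (∑' z, ψ z) ^ 3 * (3 * (ENNReal.ofReal (C * L ^ (1 - s)) * ENNReal.ofReal (C * L ^ (1 - s)) *
          vs Set.univ)) := by
        rw [lintegral_const_mul' _ _ (by rw [hA]; exact ENNReal.pow_ne_top ENNReal.ofReal_ne_top)]
        gcongr
        refine lintegral_triple_le (k := fun r v => ENNReal.ofReal (returnBound M c |r - v|)) hkm
          (fun r v => by rw [abs_sub_comm]) ?_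
        filter_upwards [ae_restrict_mem measurableSet_Ioc] with r hr
        exact hJ L hL r hr
    _ = _ := by
        have e2 : vs Set.univ = ENNReal.ofReal L := by simp [hvs]
        have e3 : L ^ (3 - 2 * s) = L ^ (1 - s) * L ^ (1 - s) * L := by
          rcases hL.eq_or_lt with rfl | hL'
          · rw [mul_zero, Real.zero_rpow (by linarith)]
          · rw [← Real.rpow_add hL', ← Real.rpow_add_one hL'.ne']
            congr 1; ring
        rw [hA, e2, e3, ← ENNReal.ofReal_pow hA0, show (3 : ℝ≥0∞) = ENNReal.ofReal 3 by simp,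
          ← ENNReal.ofReal_mul (by positivity), ← ENNReal.ofReal_mul (by positivity),
          ← ENNReal.ofReal_mul (by positivity), ← ENNReal.ofReal_mul (by positivity)]
        congr 1
        ring

end ThirdMoments

/-! ### Finiteness and intensity of the particle system. -/

section ParticleCounts

variable {M : ℕ} [NeZero M] {c : ℝ} {ν : Measure ℕ} {Ω : Type*} [MeasurableSpace Ω]
  {μ : Measure Ω} {θ : HierGroup M → Ω → ℕ} {Z : HierGroup M → ℕ → ℝ≥0 → Ω → HierGroup M}

/-- The set of particles that are at `y` at time `t`. -/
def particlesAt (θ : HierGroup M → Ω → ℕ) (Z : HierGroup M → ℕ → ℝ≥0 → Ω → HierGroup M) (t : ℝ≥0)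
    (y : HierGroup M) (ω : Ω) : Set (HierGroup M × ℕ) :=
  {q | q.2 < θ q.1 ω ∧ q.1 + Z q.1 q.2 t ω = y}

/-- The number of particles at `y` at time `t`, as an extended nonnegative real number. -/
def countAt (θ : HierGroup M → Ω → ℕ) (Z : HierGroup M → ℕ → ℝ≥0 → Ω → HierGroup M) (t : ℝ≥0)
    (y : HierGroup M) (ω : Ω) : ℝ≥0∞ :=
  ∑' q, (particlesAt θ Z t y ω).indicator 1 q

omit [NeZero M] [MeasurableSpace Ω] in
lemma countAt_eq_empirical (t : ℝ≥0) (y : HierGroup M) (ω : Ω) :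
    countAt θ Z t y ω = (empirical θ Z t {y} ω : ℝ≥0∞) := by
  rw [countAt, ← tsum_subtype]
  exact ENNReal.tsum_set_one _

omit [NeZero M] [MeasurableSpace Ω] in
-- The two default values agree: both conversions send infinity to zero.
lemma empirical_toNat_eq (t : ℝ≥0) (y : HierGroup M) (ω : Ω) :
    ((empirical θ Z t {y} ω).toNat : ℝ) = (countAt θ Z t y ω).toReal := by
  rw [countAt_eq_empirical]
  cases h : empirical θ Z t {y} ω <;> simp

omit [NeZero M] [MeasurableSpace Ω] in
lemma hasSum_indicator_particlesAt {t : ℝ≥0} {y : HierGroup M} {ω : Ω}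
    (h : countAt θ Z t y ω ≠ ⊤) :
    HasSum (fun q => (particlesAt θ Z t y ω).indicator (fun _ => (1 : ℝ)) q)
      (countAt θ Z t y ω).toReal := by
  have h1 := ENNReal.hasSum_toReal h
  rw [← ENNReal.tsum_toReal_eq fun q => ENNReal.ne_top_of_tsum_ne_top h q] at h1
  refine (congrArg (fun f => HasSum f _) (funext fun q => ?_)).mp h1
  by_cases hq : q ∈ particlesAt θ Z t y ω <;> simp [hq]

lemma measurable_countAt {α : Type*} [MeasurableSpace α] {τ : α → ℝ≥0} {v : α → Ω}
    (hτ : Measurable τ) (hv : Measurable v) (hθ : ∀ x, Measurable (θ x))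
    (hZ : ∀ x j, IsCRandomWalk M c μ (Z x j)) (y : HierGroup M) :
    Measurable fun p => countAt θ Z (τ p) y (v p) := by
  refine Measurable.tsum fun q => ?_
  have h1 : Measurable fun p => θ q.1 (v p) := (hθ q.1).comp hv
  have h2 : Measurable fun p => Z q.1 q.2 (τ p) (v p) := by
    have h := (measurable_uncurry_of_rightCont (hZ q.1 q.2).measurable (hZ q.1 q.2).rightCont).comp
      (hτ.prodMk hv)
    simp only [Function.comp_def] at h
    exact h
  have h3 : MeasurableSet {p | q ∈ particlesAt θ Z (τ p) y (v p)} := by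
    refine (h1 (measurableSet_Ioi (a := q.2))).inter ?_
    exact h2 (MeasurableSet.of_discrete (s := {z | q.1 + z = y}))
  have h4 : (fun p => (particlesAt θ Z (τ p) y (v p)).indicator (1 : HierGroup M × ℕ → ℝ≥0∞) q) =
      {p | q ∈ particlesAt θ Z (τ p) y (v p)}.indicator 1 := by
    ext p
    by_cases hq : q ∈ particlesAt θ Z (τ p) y (v p) <;> simp [hq]
  rw [h4]
  exact measurable_one.indicator h3

lemma tsum_measure_lt [IsProbabilityMeasure ν] {θ₀ : Ω → ℕ} (hθ : Measurable θ₀)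
    (hl : μ.map θ₀ = ν) : ∑' j, μ {ω | j < θ₀ ω} = ∫⁻ k, (k : ℝ≥0∞) ∂ν := by
  have h1 : ∀ j, μ {ω | j < θ₀ ω} = ∫⁻ ω, {ω | j < θ₀ ω}.indicator 1 ω ∂μ := fun j =>
    (lintegral_indicator_one (hθ (measurableSet_Ioi (a := j)))).symm
  simp only [h1]
  have h2 : ∀ j, Measurable ({ω | j < θ₀ ω}.indicator (1 : Ω → ℝ≥0∞)) := fun j =>
    measurable_one.indicator (hθ (measurableSet_Ioi (a := j)))
  rw [← lintegral_tsum fun j => (h2 j).aemeasurable, ← hl, lintegral_map Measurable.of_discrete hθ]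
  refine lintegral_congr fun ω => ?_
  rw [tsum_eq_sum (s := Finset.range (θ₀ ω)) fun j hj => ?_]
  · rw [Finset.sum_congr rfl fun j hj => ?_, Finset.sum_const, Finset.card_range, nsmul_one]
    rw [Set.indicator_of_mem (by simpa using hj)]
    rfl
  · exact Set.indicator_of_notMem (by simpa using hj) _

/-- Counting measure is invariant for the walk: the probabilities of reaching `y` add up to one over
all starting points, so the intensity stays constant in time. -/
theorem IsParticleSystem.lintegral_countAt [IsProbabilityMeasure ν] [IsProbabilityMeasure μ]
    (hsys : IsParticleSystem M c ν μ θ Z) (t : ℝ≥0) (y : HierGroup M) :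
    ∫⁻ ω, countAt θ Z t y ω ∂μ = ∫⁻ k, (k : ℝ≥0∞) ∂ν := by
  have hm : ∀ q : HierGroup M × ℕ, MeasurableSet {ω | q ∈ particlesAt θ Z t y ω} := fun q =>
    (hsys.measurable_init q.1 (measurableSet_Ioi (a := q.2))).inter
      ((hsys.walk q.1 q.2).measurable t (MeasurableSet.of_discrete (s := {z | q.1 + z = y})))
  have h1 : ∀ q : HierGroup M × ℕ, ∫⁻ ω, (particlesAt θ Z t y ω).indicator 1 q ∂μ =
      μ {ω | q.2 < θ q.1 ω} * μ.map (Z 0 0 t) {y - q.1} := by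
    intro q
    have e1 : ∀ ω, (particlesAt θ Z t y ω).indicator (1 : HierGroup M × ℕ → ℝ≥0∞) q =
        {ω | q ∈ particlesAt θ Z t y ω}.indicator 1 ω := fun ω => by
      by_cases hq : q ∈ particlesAt θ Z t y ω <;> simp [hq]
    simp only [e1]
    rw [lintegral_indicator_one (hm q)]
    have hind := hsys.indep_init_walks.comp (measurable_pi_apply q.1)
      ((measurable_pi_apply t).comp (measurable_pi_apply q))
    have h2 := hind.measure_inter_preimage_eq_mul (Set.Ioi q.2) {y - q.1} measurableSet_Ioi
      (measurableSet_singleton _)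
    have e2 : μ.map (Z 0 0 t) = μ.map (Z q.1 q.2 t) := by
      have h3 := congrArg (fun ρ => Measure.map (fun z : ℝ≥0 → HierGroup M => z t) ρ)
        ((hsys.walk 0 0).map_path_eq (hsys.walk q.1 q.2))
      rw [Measure.map_map (measurable_pi_apply t) (hsys.walk 0 0).measurable_path,
        Measure.map_map (measurable_pi_apply t) (hsys.walk q.1 q.2).measurable_path] at h3
      exact h3
    rw [e2, Measure.map_apply ((hsys.walk q.1 q.2).measurable t) (measurableSet_singleton _)]
    refine Eq.trans ?_ h2
    congr 1
    ext ω
    simp [particlesAt, eq_sub_iff_add_eq, add_comm]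
  have hm' : ∀ q : HierGroup M × ℕ,
      Measurable fun ω => (particlesAt θ Z t y ω).indicator (1 : HierGroup M × ℕ → ℝ≥0∞) q := by
    intro q
    have e1 : (fun ω => (particlesAt θ Z t y ω).indicator (1 : HierGroup M × ℕ → ℝ≥0∞) q) =
        {ω | q ∈ particlesAt θ Z t y ω}.indicator 1 := by
      ext ω
      by_cases hq : q ∈ particlesAt θ Z t y ω <;> simp [hq]
    rw [e1]
    exact measurable_one.indicator (hm q)
  simp only [countAt]
  rw [lintegral_tsum fun q => (hm' q).aemeasurable]
  simp only [h1]
  rw [ENNReal.tsum_prod' (f := fun q : HierGroup M × ℕ =>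
    μ {ω | q.2 < θ q.1 ω} * μ.map (Z 0 0 t) {y - q.1})]
  simp only [ENNReal.tsum_mul_right, tsum_measure_lt (hsys.measurable_init _) (hsys.law_init _),
    ENNReal.tsum_mul_left]
  have h6 : ∑' x, μ.map (Z 0 0 t) {y - x} = ∑' z, μ.map (Z 0 0 t) {z} :=
    (Equiv.subLeft y).tsum_eq (fun z => μ.map (Z 0 0 t) {z})
  rw [h6]
  have := Measure.isProbabilityMeasure_map (μ := μ) ((hsys.walk 0 0).measurable t).aemeasurable
  have h5 := lintegral_countable' (μ := μ.map (Z 0 0 t)) (fun _ => (1 : ℝ≥0∞))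
  simp only [lintegral_const, measure_univ, one_mul] at h5
  rw [← h5, mul_one]

lemma lintegral_natCast_eq [IsProbabilityMeasure ν]
    (hν : Integrable (fun k : ℕ => (k : ℝ)) ν) :
    ∫⁻ k, (k : ℝ≥0∞) ∂ν = ENNReal.ofReal (∫ k, (k : ℝ) ∂ν) := by
  rw [ofReal_integral_eq_lintegral_ofReal hν (Eventually.of_forall fun k => Nat.cast_nonneg k)]
  simp

variable [IsProbabilityMeasure ν] [IsProbabilityMeasure μ]

theorem IsParticleSystem.countAt_ae_lt_top (hsys : IsParticleSystem M c ν μ θ Z)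
    (hν : Integrable (fun k : ℕ => (k : ℝ)) ν) (t : ℝ≥0) (y : HierGroup M) :
    ∀ᵐ ω ∂μ, countAt θ Z t y ω < ⊤ := by
  refine ae_lt_top (measurable_countAt measurable_const measurable_id hsys.measurable_init
    hsys.walk y) ?_
  show ∫⁻ ω, countAt θ Z t y ω ∂μ ≠ ⊤
  rw [hsys.lintegral_countAt, lintegral_natCast_eq hν]
  exact ENNReal.ofReal_ne_top

theorem IsParticleSystem.integrable_countAt (hsys : IsParticleSystem M c ν μ θ Z)
    (hν : Integrable (fun k : ℕ => (k : ℝ)) ν) (t : ℝ≥0) (y : HierGroup M) :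
    Integrable (fun ω => (countAt θ Z t y ω).toReal) μ := by
  refine integrable_toReal_of_lintegral_ne_top (measurable_countAt measurable_const measurable_id
    hsys.measurable_init hsys.walk y).aemeasurable ?_
  show ∫⁻ ω, countAt θ Z t y ω ∂μ ≠ ⊤
  rw [hsys.lintegral_countAt, lintegral_natCast_eq hν]
  exact ENNReal.ofReal_ne_top

theorem IsParticleSystem.integral_countAt (hsys : IsParticleSystem M c ν μ θ Z)
    (hν : Integrable (fun k : ℕ => (k : ℝ)) ν) (t : ℝ≥0) (y : HierGroup M) :
    ∫ ω, (countAt θ Z t y ω).toReal ∂μ = ∫ k, (k : ℝ) ∂ν := by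
  have hm : Measurable fun ω => countAt θ Z t y ω :=
    measurable_countAt measurable_const measurable_id hsys.measurable_init hsys.walk y
  rw [integral_toReal hm.aemeasurable (hsys.countAt_ae_lt_top hν t y), hsys.lintegral_countAt,
    lintegral_natCast_eq hν, ENNReal.toReal_ofReal (integral_nonneg fun k => Nat.cast_nonneg k)]

variable {S : Finset (HierGroup M)} {φ : HierGroup M → ℝ}

omit [NeZero M] [MeasurableSpace Ω] in
lemma empiricalPairing_eq (hS : ∀ x, φ x ≠ 0 → x ∈ S) (t : ℝ≥0) (ω : Ω) :
    empiricalPairing θ Z φ t ω = ∑ y ∈ S, φ y * (countAt θ Z t y ω).toReal := by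
  rw [empiricalPairing, tsum_eq_sum (s := S) fun x hx => ?_]
  · simp only [empirical_toNat_eq]
  · rw [not_not.1 fun h => hx (hS x h), zero_mul]

theorem IsParticleSystem.centeredPairing_eq (hsys : IsParticleSystem M c ν μ θ Z)
    (hν : Integrable (fun k : ℕ => (k : ℝ)) ν) (hS : ∀ x, φ x ≠ 0 → x ∈ S) (r : ℝ) (ω : Ω) :
    centeredPairing μ θ Z φ r ω =
      ∑ y ∈ S, φ y * (countAt θ Z r.toNNReal y ω).toReal - (∫ k, (k : ℝ) ∂ν) * ∑ y ∈ S, φ y := by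
  rw [centeredPairing]
  simp only [empiricalPairing_eq hS]
  rw [integral_finsetSum _ fun y _ => (hsys.integrable_countAt hν _ y).const_mul _]
  simp only [integral_const_mul, hsys.integral_countAt hν]
  rw [← Finset.sum_mul, mul_comm (∑ y ∈ S, φ y)]

end ParticleCounts

/-! ### Occupation times as sums over particles. -/

section OccupationSums

variable {M : ℕ} {c : ℝ} {Ω : Type*} {S : Finset (HierGroup M)} {φ : HierGroup M → ℝ}
  {θ : HierGroup M → Ω → ℕ} {Z : HierGroup M → ℕ → ℝ≥0 → Ω → HierGroup M}

/-- The contribution of the particle `q` to `⟨N_t, φ⟩`. -/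
def particleTerm (θ : HierGroup M → Ω → ℕ) (Z : HierGroup M → ℕ → ℝ≥0 → Ω → HierGroup M)
    (φ : HierGroup M → ℝ) (ω : Ω) (q : HierGroup M × ℕ) (t : ℝ≥0) : ℝ :=
  if q.2 < θ q.1 ω then φ (q.1 + Z q.1 q.2 t ω) else 0

lemma particleTerm_eq_sum (hS : ∀ x, φ x ≠ 0 → x ∈ S) (ω : Ω) (q : HierGroup M × ℕ) (t : ℝ≥0) :
    particleTerm θ Z φ ω q t =
      ∑ y ∈ S, φ y * (particlesAt θ Z t y ω).indicator (fun _ => (1 : ℝ)) q := by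
  rw [particleTerm]
  split_ifs with h
  · by_cases hx : q.1 + Z q.1 q.2 t ω ∈ S
    · rw [Finset.sum_eq_single_of_mem _ hx]
      · have hq : q ∈ particlesAt θ Z t (q.1 + Z q.1 q.2 t ω) ω := ⟨h, rfl⟩
        rw [Set.indicator_of_mem hq, mul_one]
      · intro y _ hy
        rw [Set.indicator_of_notMem fun hq => hy hq.2.symm, mul_zero]
    · rw [not_not.1 fun h' => hx (hS _ h')]
      refine (Finset.sum_eq_zero fun y hy => ?_).symm
      rw [Set.indicator_of_notMem fun hq => hx (by rw [hq.2]; exact hy), mul_zero]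
  · refine (Finset.sum_eq_zero fun y _ => ?_).symm
    rw [Set.indicator_of_notMem fun hq => h hq.1, mul_zero]

lemma enorm_particleTerm_le (hS : ∀ x, φ x ≠ 0 → x ∈ S) (ω : Ω) (q : HierGroup M × ℕ) (t : ℝ≥0) :
    ‖particleTerm θ Z φ ω q t‖ₑ ≤ ENNReal.ofReal (∑ y ∈ S, |φ y|) *
      ∑ y ∈ S, (particlesAt θ Z t y ω).indicator (1 : HierGroup M × ℕ → ℝ≥0∞) q := by
  rw [particleTerm_eq_sum hS, Finset.mul_sum]
  refine (enorm_sum_le _ _).trans (Finset.sum_le_sum fun y hy => ?_)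
  rw [enorm_mul, Real.enorm_eq_ofReal_abs]
  gcongr
  · exact Finset.single_le_sum (f := fun y => |φ y|) (fun _ _ => abs_nonneg _) hy
  · by_cases hq : q ∈ particlesAt θ Z t y ω <;> simp [hq]

lemma hasSum_particleTerm (hS : ∀ x, φ x ≠ 0 → x ∈ S) {t : ℝ≥0} {ω : Ω}
    (h : ∀ y ∈ S, countAt θ Z t y ω ≠ ⊤) :
    HasSum (fun q => particleTerm θ Z φ ω q t) (∑ y ∈ S, φ y * (countAt θ Z t y ω).toReal) := by
  simp only [particleTerm_eq_sum hS]
  exact hasSum_sum fun y hy => (hasSum_indicator_particlesAt (h y hy)).mul_left _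

lemma measurable_particleTerm [NeZero M] (hZ : ∀ x j ω, RightCont fun t => Z x j t ω) (ω : Ω)
    (q : HierGroup M × ℕ) : Measurable fun r : ℝ => particleTerm θ Z φ ω q r.toNNReal := by
  have h1 : Measurable fun r : ℝ => Z q.1 q.2 r.toNNReal ω :=
    (hZ q.1 q.2 ω).measurable.comp measurable_real_toNNReal
  exact Measurable.ite (MeasurableSet.const _) (measurable_comp_shift φ q.1 h1) measurable_const

/-- The total occupation time is the sum of the occupation times of the particles. -/
theorem hasSum_randomSum_occ [NeZero M] (hZ : ∀ x j ω, RightCont fun t => Z x j t ω)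
    (hS : ∀ x, φ x ≠ 0 → x ∈ S) {ω : Ω}
    (hm : ∀ y, Measurable fun r : ℝ => countAt θ Z r.toNNReal y ω) {L : ℝ} (hL : 0 ≤ L)
    (h : ∫⁻ r, ∑ y ∈ S, countAt θ Z r.toNNReal y ω ∂(volume.restrict (Set.Ioc 0 L)) ≠ ⊤) :
    IntervalIntegrable (fun r => ∑ y ∈ S, φ y * (countAt θ Z r.toNNReal y ω).toReal) volume 0 L ∧
    HasSum (fun x => randomSum (θ x ω) fun j => occ φ x L fun t => Z x j t ω)
      (∫ r in (0 : ℝ)..L, ∑ y ∈ S, φ y * (countAt θ Z r.toNNReal y ω).toReal) := by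
  set vs := volume.restrict (Set.Ioc 0 L) with hvs
  have hms : Measurable fun r : ℝ => ∑ y ∈ S, countAt θ Z r.toNNReal y ω :=
    Finset.measurable_fun_sum _ fun y _ => hm y
  have hm1 : ∀ q, Measurable fun r : ℝ => particleTerm θ Z φ ω q r.toNNReal :=
    measurable_particleTerm hZ ω
  have hfin : ∀ᵐ r ∂vs, ∀ y ∈ S, countAt θ Z r.toNNReal y ω ≠ ⊤ := by
    filter_upwards [ae_lt_top hms h] with r hr y hy
    exact ((ENNReal.sum_lt_top.1 hr) y hy).ne
  -- Absolute summability, from bounded `φ` and finite total occupation of `S`, justifies the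
  -- exchange of the sum over particles with the time integral.
  have hsum : ∑' q, ∫⁻ r, ‖particleTerm θ Z φ ω q r.toNNReal‖ₑ ∂vs ≠ ⊤ := by
    rw [← lintegral_tsum fun q => (hm1 q).enorm.aemeasurable]
    refine ne_top_of_le_ne_top (ENNReal.mul_ne_top (ENNReal.ofReal_ne_top
      (r := ∑ y ∈ S, |φ y|)) h) ?_
    rw [← lintegral_const_mul _ hms]
    refine lintegral_mono fun r => ?_
    refine (ENNReal.tsum_le_tsum fun q => enorm_particleTerm_le hS ω q _).trans ?_
    rw [ENNReal.tsum_mul_left, Summable.tsum_finsetSum fun _ _ => ENNReal.summable]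
    rfl
  have hint : ∀ q, Integrable (fun r : ℝ => particleTerm θ Z φ ω q r.toNNReal) vs := fun q =>
    ⟨(hm1 q).aestronglyMeasurable, (ENNReal.ne_top_of_tsum_ne_top hsum q).lt_top⟩
  have hsn : Summable fun q => ∫ r, ‖particleTerm θ Z φ ω q r.toNNReal‖ ∂vs := by
    refine (ENNReal.summable_toReal hsum).congr fun q => ?_
    rw [integral_norm_eq_lintegral_enorm (hm1 q).aestronglyMeasurable]
  have key := hasSum_integral_of_summable_integral_norm hint hsn
  have e1 : ∫ r, ∑' q, particleTerm θ Z φ ω q r.toNNReal ∂vs =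
      ∫ r in (0 : ℝ)..L, ∑ y ∈ S, φ y * (countAt θ Z r.toNNReal y ω).toReal := by
    rw [intervalIntegral.integral_of_le hL]
    refine integral_congr_ae ?_
    filter_upwards [hfin] with r hr
    exact (hasSum_particleTerm hS hr).tsum_eq
  rw [e1] at key
  refine ⟨?_, ?_⟩
  · rw [intervalIntegrable_iff_integrableOn_Ioc_of_le hL]
    refine integrable_finsetSum _ fun y hy => Integrable.const_mul ?_ _
    refine integrable_toReal_of_lintegral_ne_top (hm y).aemeasurable (ne_top_of_le_ne_top h ?_)
    refine lintegral_mono fun r => ?_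
    exact Finset.single_le_sum (f := fun y => countAt θ Z r.toNNReal y ω) (fun _ _ => zero_le) hy
  · refine key.prod_fiberwise fun x => ?_
    have e2 : ∀ j, ∫ r, particleTerm θ Z φ ω (x, j) r.toNNReal ∂vs =
        if j < θ x ω then occ φ x L (fun t => Z x j t ω) else 0 := by
      intro j
      simp only [particleTerm]
      split_ifs with hj
      · rw [occ_eq_integral φ x hL]
      · simp
    simp only [e2, randomSum]
    have : HasSum (fun j => if j < θ x ω then occ φ x L (fun t => Z x j t ω) else 0)
        (∑ j ∈ Finset.range (θ x ω),
          if j < θ x ω then occ φ x L (fun t => Z x j t ω) else 0) :=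
      hasSum_sum_of_ne_finset_zero fun j hj => if_neg (by simpa using hj)
    rwa [Finset.sum_congr rfl fun j hj => if_pos (by simpa using hj)] at this

end OccupationSums

/-! ### The occupation time fluctuation as a series over starting points. -/

section OccupationField

variable {M : ℕ} [NeZero M] {c : ℝ} {ν : Measure ℕ} {Ω : Type*} [MeasurableSpace Ω]
  {μ : Measure Ω} [IsProbabilityMeasure ν] [IsProbabilityMeasure μ]
  {θ : HierGroup M → Ω → ℕ} {Z : HierGroup M → ℕ → ℝ≥0 → Ω → HierGroup M}
  {S : Finset (HierGroup M)} {φ : HierGroup M → ℝ}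

/-- Monotonicity in the horizon reduces all real `L` to integers, so one null set serves every time.
-/
theorem IsParticleSystem.ae_lintegral_countAt_ne_top (hsys : IsParticleSystem M c ν μ θ Z)
    (hν : Integrable (fun k : ℕ => (k : ℝ)) ν) (S : Finset (HierGroup M)) :
    ∀ᵐ ω ∂μ, ∀ L : ℝ, ∫⁻ r, ∑ y ∈ S, countAt θ Z r.toNNReal y ω
      ∂(volume.restrict (Set.Ioc 0 L)) ≠ ⊤ := by
  have hm : ∀ y, Measurable fun p : Ω × ℝ => countAt θ Z p.2.toNNReal y p.1 :=
    measurable_countAt (measurable_real_toNNReal.comp measurable_snd) measurable_fst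
      hsys.measurable_init hsys.walk
  have hms : Measurable fun p : Ω × ℝ => ∑ y ∈ S, countAt θ Z p.2.toNNReal y p.1 :=
    Finset.measurable_fun_sum _ fun y _ => hm y
  have h1 : ∀ n : ℕ, ∀ᵐ ω ∂μ, ∫⁻ r, ∑ y ∈ S, countAt θ Z r.toNNReal y ω
      ∂(volume.restrict (Set.Ioc 0 (n : ℝ))) < ⊤ := by
    intro n
    refine ae_lt_top hms.lintegral_prod_right' ?_
    have e : ∫⁻ ω, ∫⁻ r, ∑ y ∈ S, countAt θ Z r.toNNReal y ω
        ∂(volume.restrict (Set.Ioc 0 (n : ℝ))) ∂μ =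
        ∫⁻ r, ∫⁻ ω, ∑ y ∈ S, countAt θ Z r.toNNReal y ω ∂μ
        ∂(volume.restrict (Set.Ioc 0 (n : ℝ))) := lintegral_lintegral_swap hms.aemeasurable
    have e2 : ∀ r : ℝ, ∫⁻ ω, ∑ y ∈ S, countAt θ Z r.toNNReal y ω ∂μ =
        S.card * ENNReal.ofReal (∫ k, (k : ℝ) ∂ν) := by
      intro r
      have hmr : ∀ y, Measurable fun ω => countAt θ Z r.toNNReal y ω :=
        measurable_countAt measurable_const measurable_id hsys.measurable_init hsys.walk
      rw [lintegral_finsetSum' _ fun y _ => (hmr y).aemeasurable]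
      simp only [hsys.lintegral_countAt, lintegral_natCast_eq hν, Finset.sum_const, nsmul_eq_mul]
    rw [e]
    simp only [e2, lintegral_const]
    refine ENNReal.mul_ne_top (ENNReal.mul_ne_top (ENNReal.natCast_ne_top _)
      ENNReal.ofReal_ne_top) ?_
    simp
  filter_upwards [ae_all_iff.2 h1] with ω hω L
  obtain ⟨n, hn⟩ := exists_nat_ge L
  refine ne_top_of_le_ne_top (hω n).ne (lintegral_mono' (Measure.restrict_mono
    (Set.Ioc_subset_Ioc_right hn) le_rfl) le_rfl)

/-- The occupation time fluctuation without norming. -/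
def occField (μ : Measure Ω) (θ : HierGroup M → Ω → ℕ)
    (Z : HierGroup M → ℕ → ℝ≥0 → Ω → HierGroup M) (φ : HierGroup M → ℝ) (L : ℝ) (ω : Ω) : ℝ :=
  ∫ r in (0 : ℝ)..L, centeredPairing μ θ Z φ r ω

/-- The means of the single-site contributions add up to the mean of the whole pairing, which allows
centering site by site. -/
lemma IsCRandomWalk.hasSum_integral_occ {Z₀ : ℝ≥0 → Ω → HierGroup M} (hZ : IsCRandomWalk M c μ Z₀)
    (hS : ∀ x, φ x ≠ 0 → x ∈ S) {L : ℝ} (hL : 0 ≤ L) :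
    HasSum (fun x => ∫ ω, occ φ x L (fun t => Z₀ t ω) ∂μ) (L * ∑ y ∈ S, φ y) := by
  have hm : Measurable fun p : ℝ × Ω => Z₀ p.1.toNNReal p.2 :=
    measurable_toNNReal_path hZ.measurable hZ.rightCont
  have h := hasSum_integral_of_dominated_convergence
    (μ := (volume.restrict (Set.Ioc 0 L)).prod μ)
    (F := fun x p => φ (x + Z₀ p.1.toNNReal p.2)) (f := fun _ => ∑ y ∈ S, φ y)
    (fun x p => |φ (x + Z₀ p.1.toNNReal p.2)|)
    (fun x => (measurable_comp_shift φ x hm).aestronglyMeasurable)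
    (fun x => Eventually.of_forall fun p => le_rfl)
    (Eventually.of_forall fun p => (hasSum_abs_shift hS _).summable)
    (by simp only [fun p : ℝ × Ω => (hasSum_abs_shift hS (Z₀ p.1.toNNReal p.2)).tsum_eq]
        exact integrable_const _)
    (Eventually.of_forall fun p => by
      simpa using hasSum_shift hS (fun _ => 1) (Z₀ p.1.toNNReal p.2))
  have e : ∫ _ : ℝ × Ω, ∑ y ∈ S, φ y ∂((volume.restrict (Set.Ioc 0 L)).prod μ) =
      L * ∑ y ∈ S, φ y := by
    rw [integral_const, measureReal_def, ← Set.univ_prod_univ, Measure.prod_prod]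
    simp [hL]
  rw [e] at h
  refine (congrArg (fun f => HasSum f _) (funext fun x => ?_)).mp h
  have hint : Integrable (fun p : ℝ × Ω => φ (x + Z₀ p.1.toNNReal p.2))
      ((volume.restrict (Set.Ioc 0 L)).prod μ) :=
    Integrable.of_bound (measurable_comp_shift φ x hm).aestronglyMeasurable _
      (Eventually.of_forall fun p => abs_le_sum_abs hS _)
  rw [integral_prod_symm _ hint]
  simp only [occ_eq_integral φ x hL]

lemma IsParticleSystem.measurable_centered (hsys : IsParticleSystem M c ν μ θ Z)
    (hν : Integrable (fun k : ℕ => (k : ℝ)) ν) (hS : ∀ x, φ x ≠ 0 → x ∈ S) :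
    Measurable fun p : ℝ × Ω => centeredPairing μ θ Z φ p.1 p.2 := by
  simp only [hsys.centeredPairing_eq hν hS]
  refine Measurable.sub_const (Finset.measurable_fun_sum _ fun y _ => ?_) _
  exact (measurable_countAt (measurable_real_toNNReal.comp measurable_fst) measurable_snd
    hsys.measurable_init hsys.walk y).ennreal_toReal.const_mul _

lemma IsParticleSystem.measurable_occField (hsys : IsParticleSystem M c ν μ θ Z)
    (hν : Integrable (fun k : ℕ => (k : ℝ)) ν) (hS : ∀ x, φ x ≠ 0 → x ∈ S) (L : ℝ) :
    Measurable (occField μ θ Z φ L) := by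
  unfold occField
  simp only [intervalIntegral]
  have h := (hsys.measurable_centered hν hS).stronglyMeasurable
  exact h.integral_prod_left'.measurable.sub h.integral_prod_left'.measurable

/-- Almost surely, the centered pairings are locally integrable and the occupation time fluctuation
is the sum of the contributions of the starting points. -/
theorem IsParticleSystem.ae_hasSum_occField (hsys : IsParticleSystem M c ν μ θ Z)
    (hν : Integrable (fun k : ℕ => (k : ℝ)) ν) (hS : ∀ x, φ x ≠ 0 → x ∈ S) :
    ∀ᵐ ω ∂μ, ∀ L : ℝ, 0 ≤ L →
      IntervalIntegrable (fun r => centeredPairing μ θ Z φ r ω) volume 0 L ∧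
      HasSum (fun x => randomSum (θ x ω) (fun j => occ φ x L fun t => Z x j t ω) -
        (∫ k, (k : ℝ) ∂ν) * ∫ ω', occ φ x L (fun t => Z 0 0 t ω') ∂μ) (occField μ θ Z φ L ω) := by
  filter_upwards [hsys.ae_lintegral_countAt_ne_top hν S] with ω hω L hL
  have hm : ∀ y, Measurable fun r : ℝ => countAt θ Z r.toNNReal y ω :=
    measurable_countAt measurable_real_toNNReal measurable_const hsys.measurable_init hsys.walk
  obtain ⟨h1, h2⟩ := hasSum_randomSum_occ (fun x j ω => (hsys.walk x j).rightCont ω) hS hm hL (hω L)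
  simp only [occField, hsys.centeredPairing_eq hν hS]
  refine ⟨h1.sub intervalIntegrable_const, ?_⟩
  rw [intervalIntegral.integral_sub h1 intervalIntegrable_const]
  refine h2.sub ?_
  have := ((hsys.walk 0 0).hasSum_integral_occ hS hL).mul_left (∫ k, (k : ℝ) ∂ν)
  simpa [mul_left_comm] using this

lemma IsParticleSystem.ae_continuous_occField (hsys : IsParticleSystem M c ν μ θ Z)
    (hν : Integrable (fun k : ℕ => (k : ℝ)) ν) (hS : ∀ x, φ x ≠ 0 → x ∈ S) :
    ∀ᵐ ω ∂μ, Continuous fun L => occField μ θ Z φ L ω := by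
  filter_upwards [hsys.ae_hasSum_occField hν hS] with ω hω
  refine intervalIntegral.continuous_primitive (fun a b => ?_) 0
  have h : ∀ L, IntervalIntegrable (fun r => centeredPairing μ θ Z φ r ω) volume 0 L := by
    intro L
    rcases le_total 0 L with hL | hL
    · exact (hω L hL).1
    -- Negative times are clipped to zero, so the integrand is constant there and the primitive is
    -- continuous on the whole line.
    · refine (intervalIntegrable_const (c := centeredPairing μ θ Z φ 0 ω)).congr fun r hr => ?_
      rw [Set.uIoc_of_ge hL] at hr
      simp only [centeredPairing, Real.toNNReal_of_nonpos hr.2, Real.toNNReal_zero]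
  exact (h a).symm.trans (h b)

end OccupationField

/-! ### Independence and moments of functionals of the particle paths. -/

section PathFunctionals

variable {M : ℕ} [NeZero M] {c : ℝ} {ν : Measure ℕ} {Ω : Type*} [MeasurableSpace Ω]
  {μ : Measure Ω} [IsProbabilityMeasure ν] [IsProbabilityMeasure μ]
  {θ : HierGroup M → Ω → ℕ} {Z : HierGroup M → ℕ → ℝ≥0 → Ω → HierGroup M}

/-- `f` has a measurable version on the space of all paths. -/
def IsPathFunctional (f : (ℝ≥0 → HierGroup M) → ℝ) : Prop :=
  ∃ Φ : (ℝ≥0 → HierGroup M) → ℝ, Measurable Φ ∧ ∀ z, RightCont z → Φ z = f z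

variable {f : HierGroup M → (ℝ≥0 → HierGroup M) → ℝ} {C : ℝ}

omit [IsProbabilityMeasure ν] in
lemma IsParticleSystem.integral_path_eq (hsys : IsParticleSystem M c ν μ θ Z)
    {f : (ℝ≥0 → HierGroup M) → ℝ} (hf : IsPathFunctional f) {g : ℝ → ℝ} (hg : Measurable g)
    (x : HierGroup M) (j : ℕ) :
    ∫ ω, g (f fun t => Z x j t ω) ∂μ = ∫ ω, g (f fun t => Z 0 0 t ω) ∂μ := by
  obtain ⟨Φ, hΦ, hΦf⟩ := hf
  have key : ∀ x j, ∫ ω, g (f fun t => Z x j t ω) ∂μ = ∫ z, g (Φ z) ∂(μ.map fun ω t => Z x j t ω) := by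
    intro x j
    have hgΦ : Measurable fun z => g (Φ z) := hg.comp hΦ
    rw [integral_map (hsys.walk x j).measurable_path.aemeasurable hgΦ.aestronglyMeasurable]
    simp only [hΦf _ ((hsys.walk x j).rightCont _)]
  rw [key, key, (hsys.walk x j).map_path_eq (hsys.walk 0 0)]

omit [IsProbabilityMeasure ν] [IsProbabilityMeasure μ] [NeZero M] in
lemma IsParticleSystem.measurable_path_functional (hsys : IsParticleSystem M c ν μ θ Z)
    {f : (ℝ≥0 → HierGroup M) → ℝ} (hf : IsPathFunctional f) (x : HierGroup M) (j : ℕ) :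
    Measurable fun ω => f fun t => Z x j t ω := by
  obtain ⟨Φ, hΦ, hΦf⟩ := hf
  simp only [← hΦf _ ((hsys.walk x j).rightCont _)]
  exact hΦ.comp (hsys.walk x j).measurable_path

omit [IsProbabilityMeasure ν] in
-- Independence of whole paths passes to `f` only through its measurable version on path space;
-- uniqueness of the path law makes the moments the same for all particles.
lemma IsParticleSystem.isCompound (hsys : IsParticleSystem M c ν μ θ Z)
    (hν : Integrable (fun k : ℕ => (k : ℝ) ^ 3) ν) (hf : ∀ x, IsPathFunctional (f x))
    (hC : ∀ x z, |f x z| ≤ C) (x : HierGroup M) :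
    IsCompound ν μ (θ x) (fun j ω => f x fun t => Z x j t ω) (∫ ω, f x (fun t => Z 0 0 t ω) ∂μ)
      (∫ ω, f x (fun t => Z 0 0 t ω) ^ 2 ∂μ) (∫ ω, |f x (fun t => Z 0 0 t ω)| ^ 3 ∂μ) where
  measurable_count := hsys.measurable_init x
  law_count := hsys.law_init x
  integrable_count := hν
  measurable_term := hsys.measurable_path_functional (hf x) x
  indep_terms := by
    obtain ⟨Φ, hΦ, hΦf⟩ := hf x
    have h := (hsys.indep_walks.precomp (g := fun j : ℕ => (x, j)) fun a b hab => by
      simpa using hab).comp (fun _ => Φ) fun _ => hΦ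
    simp only [Function.comp_def, hΦf _ ((hsys.walk _ _).rightCont _)] at h
    exact h
  indep_count := by
    obtain ⟨Φ, hΦ, hΦf⟩ := hf x
    have h := hsys.indep_init_walks.comp (measurable_pi_apply x)
      (measurable_pi_lambda (fun (w : HierGroup M × ℕ → ℝ≥0 → HierGroup M) (j : ℕ) => Φ (w (x, j)))
        fun j => hΦ.comp (measurable_pi_apply _))
    simp only [Function.comp_def, hΦf _ ((hsys.walk _ _).rightCont _)] at h
    exact h
  integrable_cube j := by
    refine Integrable.of_bound ((hsys.measurable_path_functional (hf x) x j).abs.pow_const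
      3).aestronglyMeasurable (C ^ 3) (Eventually.of_forall fun ω => ?_)
    rw [Real.norm_eq_abs, abs_pow, abs_abs]
    exact pow_le_pow_left₀ (abs_nonneg _) (hC _ _) 3
  mean j := hsys.integral_path_eq (hf x) (g := fun y => y) measurable_id x j
  second j := hsys.integral_path_eq (hf x) (g := fun y => y ^ 2) (by fun_prop) x j
  third j := hsys.integral_path_eq (hf x) (g := fun y => |y| ^ 3) (by fun_prop) x j

omit [IsProbabilityMeasure ν] [NeZero M] [IsProbabilityMeasure μ] in
-- The walks are grouped by starting site, and each group is then paired with the particle number of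
-- its site.
lemma IsParticleSystem.iIndepFun_randomSum (hsys : IsParticleSystem M c ν μ θ Z)
    (hf : ∀ x, IsPathFunctional (f x)) :
    iIndepFun (fun x ω => randomSum (θ x ω) fun j => f x fun t => Z x j t ω) μ := by
  choose Φ hΦ hΦf using hf
  have hV := (iIndepFun_curry (fun q => (hsys.walk q.1 q.2).measurable_path) hsys.indep_walks).comp
    (fun x (w : ℕ → ℝ≥0 → HierGroup M) j => Φ x (w j)) fun x =>
      measurable_pi_lambda _ fun j => (hΦ x).comp (measurable_pi_apply j)
  have hUV := hsys.indep_init_walks.comp measurable_id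
    (measurable_pi_lambda (fun (w : HierGroup M × ℕ → ℝ≥0 → HierGroup M) (x : HierGroup M) (j : ℕ) =>
      Φ x (w (x, j))) fun x => measurable_pi_lambda _ fun j => (hΦ x).comp (measurable_pi_apply _))
  simp only [Function.comp_def, hΦf _ _ ((hsys.walk _ _).rightCont _)] at hV hUV
  exact (iIndepFun_prodMk_of_indepFun hsys.measurable_init
    (fun x => measurable_pi_lambda _ fun j => by
      have h := (hΦ x).comp (hsys.walk x j).measurable_path
      simp only [Function.comp_def, hΦf _ _ ((hsys.walk _ _).rightCont _)] at h
      exact h) hsys.indep_init hV hUV).comp (fun _ p => randomSum p.1 p.2)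
    fun _ => measurable_randomSum

variable {m e B : ℝ} {W : Ω → ℝ}

omit [IsProbabilityMeasure ν] in
-- The common source of the tightness estimate and of the limit theorem. The constant `40` is `5 ·
-- 8`, from the Lyapunov bound and from centering.
lemma IsParticleSystem.centered_sum_facts (hsys : IsParticleSystem M c ν μ θ Z)
    (hν : Integrable (fun k : ℕ => (k : ℝ) ^ 3) ν) (hf : ∀ x, IsPathFunctional (f x))
    (hC : ∀ x z, |f x z| ≤ C)
    (hm : HasSum (fun x => (∫ ω, f x (fun t => Z 0 0 t ω) ∂μ) ^ 2) m)
    (he : HasSum (fun x => ∫ ω, f x (fun t => Z 0 0 t ω) ^ 2 ∂μ) e)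
    (hW : ∀ᵐ ω ∂μ, HasSum (fun x => randomSum (θ x ω) (fun j => f x fun t => Z x j t ω) -
      (∫ k, (k : ℝ) ∂ν) * ∫ ω', f x (fun t => Z 0 0 t ω') ∂μ) (W ω)) :
    (∫⁻ ω, ENNReal.ofReal (W ω ^ 2) ∂μ ≤ ENNReal.ofReal ((∫ k, (k : ℝ) ∂ν) * e +
      (variance (fun k : ℕ => (k : ℝ)) ν - ∫ k, (k : ℝ) ∂ν) * m)) ∧
    (∀ B, Summable (fun x => ∫ ω, |f x (fun t => Z 0 0 t ω)| ^ 3 ∂μ) →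
      ∑' x, ∫ ω, |f x (fun t => Z 0 0 t ω)| ^ 3 ∂μ ≤ B →
      ‖∫ ω, Complex.exp (W ω * Complex.I) ∂μ -
        Complex.exp (-(((∫ k, (k : ℝ) ∂ν) * e +
          (variance (fun k : ℕ => (k : ℝ)) ν - ∫ k, (k : ℝ) ∂ν) * m : ℝ) : ℂ) / 2)‖ ≤
        40 * (∫ k, (k : ℝ) ^ 3 ∂ν) * B) := by
  have hcomp := hsys.isCompound hν hf hC
  set X : HierGroup M → Ω → ℝ := fun x ω => randomSum (θ x ω) (fun j => f x fun t => Z x j t ω) -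
      (∫ k, (k : ℝ) ∂ν) * ∫ ω', f x (fun t => Z 0 0 t ω') ∂μ with hX
  have hXm : ∀ x, Measurable (X x) := fun x => (hcomp x).measurable_sum.sub_const _
  have hX3 : ∀ x, Integrable (fun ω => |X x ω| ^ 3) μ := fun x => (hcomp x).centered_third.1
  have hX2 : ∀ x, MemLp (X x) 2 μ := fun x =>
    (memLp_two_iff_integrable_sq (hXm x).aestronglyMeasurable).2
      (integrable_pow_of_integrable_abs_cube (hXm x).aestronglyMeasurable (hX3 x)).2
  have hXi : iIndepFun X μ := (hsys.iIndepFun_randomSum hf).comp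
    (fun x y => y - (∫ k, (k : ℝ) ∂ν) * ∫ ω', f x (fun t => Z 0 0 t ω') ∂μ)
    fun x => measurable_id.sub_const _
  have hX0 : ∀ x, ∫ ω, X x ω ∂μ = 0 := fun x => by
    rw [hX]
    dsimp only
    rw [integral_sub (hcomp x).integrable_sum.1 (integrable_const _), (hcomp x).integral_sum]
    simp
  have hv : HasSum (fun x => ∫ ω, X x ω ^ 2 ∂μ) ((∫ k, (k : ℝ) ∂ν) * e +
      (variance (fun k : ℕ => (k : ℝ)) ν - ∫ k, (k : ℝ) ∂ν) * m) := by
    refine (congrArg (fun f => HasSum f _) (funext fun x => ?_)).mp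
      ((he.mul_left (∫ k, (k : ℝ) ∂ν)).add
        (hm.mul_left (variance (fun k : ℕ => (k : ℝ)) ν - ∫ k, (k : ℝ) ∂ν)))
    exact (hcomp x).centered_second.symm
  refine ⟨lintegral_sq_tsum_le hX2 hXi hX0 hv hW, fun B hBs hB => ?_⟩
  have hk : 0 ≤ ∫ k : ℕ, (k : ℝ) ^ 3 ∂ν := integral_nonneg fun k => by positivity
  have hle : ∀ x, ∫ ω, |X x ω| ^ 3 ∂μ ≤
      8 * (∫ k : ℕ, (k : ℝ) ^ 3 ∂ν) * ∫ ω, |f x (fun t => Z 0 0 t ω)| ^ 3 ∂μ := fun x =>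
    (hcomp x).centered_third.2.trans (by rw [mul_assoc])
  have hs : Summable fun x => ∫ ω, |X x ω| ^ 3 ∂μ :=
    Summable.of_nonneg_of_le (fun x => integral_nonneg fun ω => by positivity) hle
      (hBs.mul_left _)
  refine (norm_integral_cexp_tsum_sub_gaussian_le hXm hXi hX3 hX0 hv hs.hasSum hW).trans ?_
  have h1 : ∑' x, ∫ ω, |X x ω| ^ 3 ∂μ ≤ 8 * (∫ k : ℕ, (k : ℝ) ^ 3 ∂ν) * B := by
    refine (hs.tsum_le_tsum hle (hBs.mul_left _)).trans ?_
    rw [tsum_mul_left]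
    gcongr
  linarith

end PathFunctionals

/-! ### Linear combinations of occupation times at several times. -/

section FiniteDimensional

variable {M : ℕ} [NeZero M] {c : ℝ} {ν : Measure ℕ} {Ω : Type*} [MeasurableSpace Ω]
  {μ : Measure Ω} [IsProbabilityMeasure ν] [IsProbabilityMeasure μ]
  {S : Finset (HierGroup M)} {φ : HierGroup M → ℝ}

omit [NeZero M] in
lemma abs_occ_le_mul (hS : ∀ x, φ x ≠ 0 → x ∈ S) (x : HierGroup M) (t : ℝ)
    (z : ℝ≥0 → HierGroup M) : |occ φ x t z| ≤ (∑ y ∈ S, |φ y|) * |t| := by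
  have := intervalIntegral.norm_integral_le_of_norm_le_const (a := 0) (b := t)
    (f := fun r : ℝ => φ (x + z r.toNNReal)) (C := ∑ y ∈ S, |φ y|) fun r _ => abs_le_sum_abs hS _
  simpa [occ] using this

omit [NeZero M] in
lemma abs_occ_le_occ_abs (hS : ∀ x, φ x ≠ 0 → x ∈ S) (x : HierGroup M) {t L : ℝ} (ht : 0 ≤ t)
    (htL : t ≤ L) {z : ℝ≥0 → HierGroup M} (hz : RightCont z) :
    |occ φ x t z| ≤ occ (fun y => |φ y|) x L z := by
  have hm : Measurable fun r : ℝ => |φ (x + z r.toNNReal)| :=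
    (measurable_comp_shift φ x (hz.measurable.comp measurable_real_toNNReal)).abs
  have hi : ∀ b, IntegrableOn (fun r : ℝ => |φ (x + z r.toNNReal)|) (Set.Ioc 0 b) := fun b =>
    Integrable.of_bound hm.aestronglyMeasurable (∑ y ∈ S, |φ y|) (Eventually.of_forall fun r => by
      rw [Real.norm_eq_abs, abs_abs]; exact abs_le_sum_abs hS _)
  rw [occ_eq_integral _ _ ht, occ_eq_integral _ _ (ht.trans htL)]
  refine abs_integral_le_integral_abs.trans ?_
  exact setIntegral_mono_set (hi L) (Eventually.of_forall fun r => abs_nonneg _)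
    (Set.Ioc_subset_Ioc_right htL).eventuallyLE

/-- Covariance of the unnormed occupation time fluctuations. -/
def fluctCov (M : ℕ) (c : ℝ) (ν : Measure ℕ) (S : Finset (HierGroup M)) (φ : HierGroup M → ℝ)
    (s t : ℝ) : ℝ :=
  (∫ k, (k : ℝ) ∂ν) * (walkVar M c S φ s + walkVar M c S φ t - walkVar M c S φ |s - t|) +
    (variance (fun k : ℕ => (k : ℝ)) ν - ∫ k, (k : ℝ) ∂ν) *
      (walkVar M c S φ (s + t) - walkVar M c S φ s - walkVar M c S φ t)

/-- Linear combinations of occupation times. -/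
def occComb {ι : Type*} [Fintype ι] (φ : HierGroup M → ℝ) (τ l : ι → ℝ) (x : HierGroup M)
    (z : ℝ≥0 → HierGroup M) : ℝ := ∑ j, l j * occ φ x (τ j) z

variable {ι : Type*} [Fintype ι] {τ l : ι → ℝ}

omit [NeZero M] in
lemma isPathFunctional_occComb (hS : ∀ x, φ x ≠ 0 → x ∈ S) (x : HierGroup M) :
    IsPathFunctional (occComb φ τ l x) := by
  choose Φ hΦ hΦf using fun j => exists_measurable_occ (abs_le_sum_abs hS) x (τ j)
  exact ⟨fun z => ∑ j, l j * Φ j z, Finset.measurable_fun_sum _ fun j _ => (hΦ j).const_mul _,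
    fun z hz => by simp only [hΦf _ z hz, occComb]⟩

omit [NeZero M] in
lemma abs_occComb_le (hS : ∀ x, φ x ≠ 0 → x ∈ S) (x : HierGroup M) (z : ℝ≥0 → HierGroup M) :
    |occComb φ τ l x z| ≤ ∑ j, |l j| * ((∑ y ∈ S, |φ y|) * |τ j|) :=
  (Finset.abs_sum_le_sum_abs _ _).trans (Finset.sum_le_sum fun j _ => by
    rw [abs_mul]; exact mul_le_mul_of_nonneg_left (abs_occ_le_mul hS x _ z) (abs_nonneg _))

variable {Z₀ : ℝ≥0 → Ω → HierGroup M}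

omit [IsProbabilityMeasure μ] [NeZero M] in
lemma IsCRandomWalk.measurable_occ (hZ : IsCRandomWalk M c μ Z₀) (hS : ∀ x, φ x ≠ 0 → x ∈ S)
    (x : HierGroup M) (t : ℝ) : Measurable fun ω => occ φ x t fun r => Z₀ r ω := by
  obtain ⟨Φ, hΦ, hΦf⟩ := exists_measurable_occ (abs_le_sum_abs hS) x t
  simp only [← hΦf _ (hZ.rightCont _)]
  exact hΦ.comp hZ.measurable_path

omit [NeZero M] in
lemma IsCRandomWalk.memLp_occ (hZ : IsCRandomWalk M c μ Z₀) (hS : ∀ x, φ x ≠ 0 → x ∈ S)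
    (x : HierGroup M) (t : ℝ) : MemLp (fun ω => occ φ x t fun r => Z₀ r ω) 2 μ :=
  MemLp.of_bound (hZ.measurable_occ hS x t).aestronglyMeasurable _
    (Eventually.of_forall fun _ => abs_occ_le_mul hS x t _)

lemma IsCRandomWalk.hasSum_integral_occComb_sq (hM : 1 < M) (hc0 : 0 < c) (hc1 : c < 1)
    (hZ : IsCRandomWalk M c μ Z₀) (hS : ∀ x, φ x ≠ 0 → x ∈ S) (hτ : ∀ j, 0 ≤ τ j) :
    HasSum (fun x => ∫ ω, occComb φ τ l x (fun t => Z₀ t ω) ^ 2 ∂μ)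
      (∑ i, ∑ j, l i * l j * (walkVar M c S φ (τ i) + walkVar M c S φ (τ j) -
        walkVar M c S φ |τ i - τ j|)) := by
  have h := hasSum_sum fun i (_ : i ∈ Finset.univ) => hasSum_sum fun j (_ : j ∈ Finset.univ) =>
    (hZ.hasSum_integral_occ_mul hM hc0 hc1 hS (hτ i) (hτ j)).mul_left (l i * l j)
  refine (congrArg (fun f => HasSum f _) (funext fun x => ?_)).mp h
  have hint : ∀ i j, Integrable (fun ω => l i * l j * (occ φ x (τ i) (fun r => Z₀ r ω) *
      occ φ x (τ j) fun r => Z₀ r ω)) μ := fun i j =>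
    ((hZ.memLp_occ hS x (τ i)).integrable_mul (hZ.memLp_occ hS x (τ j))).const_mul _
  simp only [occComb, sq, Finset.sum_mul_sum]
  have e : ∀ i j ω, l i * occ φ x (τ i) (fun r => Z₀ r ω) * (l j * occ φ x (τ j) fun r => Z₀ r ω) =
      l i * l j * (occ φ x (τ i) (fun r => Z₀ r ω) * occ φ x (τ j) fun r => Z₀ r ω) :=
    fun i j ω => by ring
  simp only [e]
  rw [integral_finsetSum _ fun i _ => integrable_finsetSum _ fun j _ => hint i j]
  refine Finset.sum_congr rfl fun i _ => ?_
  rw [integral_finsetSum _ fun j _ => hint i j]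
  exact Finset.sum_congr rfl fun j _ => (integral_const_mul _ _).symm

omit [NeZero M] in
lemma IsCRandomWalk.integral_occComb (hZ : IsCRandomWalk M c μ Z₀) (hS : ∀ x, φ x ≠ 0 → x ∈ S)
    (x : HierGroup M) : ∫ ω, occComb φ τ l x (fun t => Z₀ t ω) ∂μ =
      ∑ j, l j * ∫ ω, occ φ x (τ j) (fun t => Z₀ t ω) ∂μ := by
  simp only [occComb]
  rw [integral_finsetSum _ fun j _ => ((hZ.memLp_occ hS x (τ j)).integrable one_le_two).const_mul _]
  simp only [integral_const_mul]

lemma IsCRandomWalk.hasSum_sq_integral_occComb (hM : 1 < M) (hc0 : 0 < c) (hc1 : c < 1)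
    (hZ : IsCRandomWalk M c μ Z₀) (hS : ∀ x, φ x ≠ 0 → x ∈ S) (hτ : ∀ j, 0 ≤ τ j) :
    HasSum (fun x => (∫ ω, occComb φ τ l x (fun t => Z₀ t ω) ∂μ) ^ 2)
      (∑ i, ∑ j, l i * l j * (walkVar M c S φ (τ i + τ j) - walkVar M c S φ (τ i) -
        walkVar M c S φ (τ j))) := by
  have h := hasSum_sum fun i (_ : i ∈ Finset.univ) => hasSum_sum fun j (_ : j ∈ Finset.univ) =>
    (hZ.hasSum_integral_occ_mul_integral_occ hM hc0 hc1 hS (hτ i) (hτ j)).mul_left (l i * l j)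
  refine (congrArg (fun f => HasSum f _) (funext fun x => ?_)).mp h
  rw [hZ.integral_occComb hS, sq, Finset.sum_mul_sum]
  exact Finset.sum_congr rfl fun i _ => Finset.sum_congr rfl fun j _ => by ring

/-- A combination at times up to `L` is dominated by `∑ |l j|` times the occupation time of `|φ|` up
to `L`, so its third moments reduce to those of one functional. -/
theorem IsCRandomWalk.exists_occComb_cube_le (hM : 1 < M) (hc0 : 0 < c) (hc1 : c < 1) {s : ℝ}
    (hs0 : 0 ≤ s) (hs : s < 1 + walkDegree M c) (hZ : IsCRandomWalk M c μ Z₀)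
    (hS : ∀ x, φ x ≠ 0 → x ∈ S) : ∃ C, 0 ≤ C ∧ ∀ (k : ℕ) (τ l : Fin k → ℝ) (L : ℝ), 0 ≤ L →
      (∀ j, 0 ≤ τ j) → (∀ j, τ j ≤ L) →
      Summable (fun x => ∫ ω, |occComb φ τ l x (fun t => Z₀ t ω)| ^ 3 ∂μ) ∧
      ∑' x, ∫ ω, |occComb φ τ l x (fun t => Z₀ t ω)| ^ 3 ∂μ ≤
        (∑ j, |l j|) ^ 3 * (C * L ^ (3 - 2 * s)) := by
  obtain ⟨C, hC, h⟩ := hZ.exists_tsum_occ_cube_le hM hc0 hc1 hs0 hs hS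
  refine ⟨C, hC, fun k τ l L hL hτ0 hτL => ?_⟩
  have hA0 : 0 ≤ ∑ j, |l j| := Finset.sum_nonneg fun _ _ => abs_nonneg _
  set b : HierGroup M → ℝ := fun x => ∫ ω, |occComb φ τ l x (fun t => Z₀ t ω)| ^ 3 ∂μ with hb
  have hb0 : ∀ x, 0 ≤ b x := fun x => integral_nonneg fun ω => by positivity
  have hpt : ∀ x ω, |occComb φ τ l x (fun t => Z₀ t ω)| ≤
      (∑ j, |l j|) * occ (fun y => |φ y|) x L fun t => Z₀ t ω := by
    intro x ω
    rw [Finset.sum_mul]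
    refine (Finset.abs_sum_le_sum_abs _ _).trans (Finset.sum_le_sum fun j _ => ?_)
    rw [abs_mul]
    exact mul_le_mul_of_nonneg_left (abs_occ_le_occ_abs hS x (hτ0 j) (hτL j) (hZ.rightCont ω))
      (abs_nonneg _)
  have hmeas : ∀ x, Measurable fun ω => occComb φ τ l x fun t => Z₀ t ω := fun x =>
    Finset.measurable_fun_sum _ fun j _ => (hZ.measurable_occ hS x (τ j)).const_mul _
  have hle : ∀ x, ENNReal.ofReal (b x) ≤ ENNReal.ofReal ((∑ j, |l j|) ^ 3) *
      ∫⁻ ω, ENNReal.ofReal (occ (fun y => |φ y|) x L (fun t => Z₀ t ω) ^ 3) ∂μ := by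
    intro x
    have hi : Integrable (fun ω => |occComb φ τ l x (fun t => Z₀ t ω)| ^ 3) μ := by
      refine Integrable.of_bound ((hmeas x).abs.pow_const 3).aestronglyMeasurable
        ((∑ j, |l j| * ((∑ y ∈ S, |φ y|) * |τ j|)) ^ 3) (Eventually.of_forall fun ω => ?_)
      rw [Real.norm_eq_abs, abs_pow, abs_abs]
      exact pow_le_pow_left₀ (abs_nonneg _) (abs_occComb_le hS x _) 3
    rw [hb]
    dsimp only
    rw [ofReal_integral_eq_lintegral_ofReal hi (Eventually.of_forall fun ω => by positivity),
      ← lintegral_const_mul' _ _ ENNReal.ofReal_ne_top]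
    refine lintegral_mono fun ω => ?_
    rw [← ENNReal.ofReal_mul (by positivity), ← mul_pow]
    exact ENNReal.ofReal_le_ofReal (pow_le_pow_left₀ (abs_nonneg _) (hpt x ω) 3)
  have hD0 : 0 ≤ (∑ j, |l j|) ^ 3 * (C * L ^ (3 - 2 * s)) := by positivity
  have hsum : ∀ u : Finset (HierGroup M), ∑ x ∈ u, b x ≤
      (∑ j, |l j|) ^ 3 * (C * L ^ (3 - 2 * s)) := by
    intro u
    rw [← ENNReal.ofReal_le_ofReal_iff hD0, ENNReal.ofReal_sum_of_nonneg fun x _ => hb0 x,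
      ENNReal.ofReal_mul (by positivity)]
    calc _ ≤ ∑ x ∈ u, ENNReal.ofReal ((∑ j, |l j|) ^ 3) *
          ∫⁻ ω, ENNReal.ofReal (occ (fun y => |φ y|) x L (fun t => Z₀ t ω) ^ 3) ∂μ :=
          Finset.sum_le_sum fun x _ => hle x
      _ ≤ _ := by
          rw [← Finset.mul_sum]
          gcongr
          exact (ENNReal.sum_le_tsum u).trans (h L hL)
  exact ⟨summable_of_sum_le hb0 hsum, Real.tsum_le_of_sum_le hb0 hsum⟩

end FiniteDimensional

/-! ### Second moments and characteristic functions of the fluctuation. -/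

section OccupationFieldMoments

variable {M : ℕ} [NeZero M] {c : ℝ} {ν : Measure ℕ} {Ω : Type*} [MeasurableSpace Ω]
  {μ : Measure Ω} [IsProbabilityMeasure ν] [IsProbabilityMeasure μ]
  {θ : HierGroup M → Ω → ℕ} {Z : HierGroup M → ℕ → ℝ≥0 → Ω → HierGroup M}
  {S : Finset (HierGroup M)} {φ : HierGroup M → ℝ}

omit [NeZero M] in
lemma integrable_of_integrable_cube (hν : Integrable (fun k : ℕ => (k : ℝ) ^ 3) ν) :
    Integrable (fun k : ℕ => (k : ℝ)) ν :=
  (integrable_pow_of_integrable_abs_cube (X := fun k : ℕ => (k : ℝ))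
    Measurable.of_discrete.aestronglyMeasurable (by simpa using hν)).1

lemma IsParticleSystem.ae_hasSum_comb (hsys : IsParticleSystem M c ν μ θ Z)
    (hν : Integrable (fun k : ℕ => (k : ℝ)) ν) (hS : ∀ x, φ x ≠ 0 → x ∈ S) {ι : Type*} [Fintype ι]
    {τ l : ι → ℝ} (hτ : ∀ j, 0 ≤ τ j) :
    ∀ᵐ ω ∂μ, HasSum (fun x =>
      randomSum (θ x ω) (fun j => occComb φ τ l x fun t => Z x j t ω) -
        (∫ k, (k : ℝ) ∂ν) * ∫ ω', occComb φ τ l x (fun t => Z 0 0 t ω') ∂μ)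
      (∑ j, l j * occField μ θ Z φ (τ j) ω) := by
  filter_upwards [hsys.ae_hasSum_occField hν hS] with ω hω
  have h := hasSum_sum fun j (_ : j ∈ Finset.univ) => ((hω (τ j) (hτ j)).2).mul_left (l j)
  refine (congrArg (fun f => HasSum f _) (funext fun x => ?_)).mp h
  rw [(hsys.walk 0 0).integral_occComb hS]
  simp only [randomSum, occComb, mul_sub, Finset.sum_sub_distrib]
  congr 1
  · simp only [Finset.mul_sum]
    exact Finset.sum_comm
  · rw [Finset.mul_sum]
    exact Finset.sum_congr rfl fun j _ => by ring

omit [NeZero M] [IsProbabilityMeasure ν] in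
lemma sum_fluctCov {ι : Type*} [Fintype ι] (τ l : ι → ℝ) :
    ∑ i, ∑ j, l i * l j * fluctCov M c ν S φ (τ i) (τ j) =
      (∫ k, (k : ℝ) ∂ν) * (∑ i, ∑ j, l i * l j * (walkVar M c S φ (τ i) + walkVar M c S φ (τ j) -
        walkVar M c S φ |τ i - τ j|)) +
      (variance (fun k : ℕ => (k : ℝ)) ν - ∫ k, (k : ℝ) ∂ν) *
      (∑ i, ∑ j, l i * l j * (walkVar M c S φ (τ i + τ j) - walkVar M c S φ (τ i) -
        walkVar M c S φ (τ j))) := by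
  simp only [Finset.mul_sum, ← Finset.sum_add_distrib, fluctCov]
  exact Finset.sum_congr rfl fun i _ => Finset.sum_congr rfl fun j _ => by ring

/-- An upper bound is enough here: applied to two times with opposite weights, it controls the
increments for tightness. -/
theorem IsParticleSystem.lintegral_occField_comb_sq_le (hsys : IsParticleSystem M c ν μ θ Z)
    (hM : 1 < M) (hc0 : 0 < c) (hc1 : c < 1)
    (hν : Integrable (fun k : ℕ => (k : ℝ) ^ 3) ν) (hS : ∀ x, φ x ≠ 0 → x ∈ S) {ι : Type*}
    [Fintype ι] {τ l : ι → ℝ} (hτ : ∀ j, 0 ≤ τ j) :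
    ∫⁻ ω, ENNReal.ofReal ((∑ j, l j * occField μ θ Z φ (τ j) ω) ^ 2) ∂μ ≤
      ENNReal.ofReal (∑ i, ∑ j, l i * l j * fluctCov M c ν S φ (τ i) (τ j)) := by
  rw [sum_fluctCov]
  exact (hsys.centered_sum_facts hν (isPathFunctional_occComb hS) (abs_occComb_le hS)
    ((hsys.walk 0 0).hasSum_sq_integral_occComb hM hc0 hc1 hS hτ)
    ((hsys.walk 0 0).hasSum_integral_occComb_sq hM hc0 hc1 hS hτ)
    (hsys.ae_hasSum_comb (integrable_of_integrable_cube hν) hS hτ)).1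

theorem IsParticleSystem.exists_norm_charFun_occField_sub_le
    (hsys : IsParticleSystem M c ν μ θ Z) (hM : 1 < M) (hc0 : 0 < c) (hc1 : c < 1) {s : ℝ}
    (hs0 : 0 ≤ s) (hs : s < 1 + walkDegree M c)
    (hν : Integrable (fun k : ℕ => (k : ℝ) ^ 3) ν) (hS : ∀ x, φ x ≠ 0 → x ∈ S) :
    ∃ C, 0 ≤ C ∧ ∀ (k : ℕ) (τ l : Fin k → ℝ) (L : ℝ), 0 ≤ L → (∀ j, 0 ≤ τ j) → (∀ j, τ j ≤ L) →
      ‖∫ ω, Complex.exp ((∑ j, l j * occField μ θ Z φ (τ j) ω : ℝ) * Complex.I) ∂μ -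
        Complex.exp (-((∑ i, ∑ j, l i * l j * fluctCov M c ν S φ (τ i) (τ j) : ℝ) : ℂ) / 2)‖ ≤
        C * ((∑ j, |l j|) ^ 3 * L ^ (3 - 2 * s)) := by
  obtain ⟨C, hC, h⟩ := (hsys.walk 0 0).exists_occComb_cube_le hM hc0 hc1 hs0 hs hS
  have hk : 0 ≤ ∫ k : ℕ, (k : ℝ) ^ 3 ∂ν := integral_nonneg fun k => by positivity
  refine ⟨40 * (∫ k : ℕ, (k : ℝ) ^ 3 ∂ν) * C, by positivity, fun k τ l L hL hτ hτL => ?_⟩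
  obtain ⟨h1, h2⟩ := h k τ l L hL hτ hτL
  rw [sum_fluctCov]
  refine ((hsys.centered_sum_facts hν (isPathFunctional_occComb hS) (abs_occComb_le hS)
    ((hsys.walk 0 0).hasSum_sq_integral_occComb hM hc0 hc1 hS hτ)
    ((hsys.walk 0 0).hasSum_integral_occComb_sq hM hc0 hc1 hS hτ)
    (hsys.ae_hasSum_comb (integrable_of_integrable_cube hν) hS hτ)).2 _ h1 h2).trans (le_of_eq ?_)
  ring

end OccupationFieldMoments

/-! ### Positivity of the covariance forms at finite scale. -/

section PositiveDefinite

variable {M : ℕ} [NeZero M] {c : ℝ} {Ω : Type*} [MeasurableSpace Ω] {μ : Measure Ω}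
  [IsProbabilityMeasure μ] {Z₀ : ℝ≥0 → Ω → HierGroup M}
  {S : Finset (HierGroup M)} {φ : HierGroup M → ℝ} {ι : Type*} [Fintype ι] {τ : ι → ℝ}

/-- The form is a sum over starting points of squared means. -/
lemma IsCRandomWalk.walkVar_mean_nonneg (hM : 1 < M) (hc0 : 0 < c) (hc1 : c < 1)
    (hZ : IsCRandomWalk M c μ Z₀) (hS : ∀ x, φ x ≠ 0 → x ∈ S) (hτ : ∀ j, 0 ≤ τ j) (l : ι → ℝ) :
    0 ≤ ∑ i, ∑ j, l i * l j * (walkVar M c S φ (τ i + τ j) - walkVar M c S φ (τ i) -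
      walkVar M c S φ (τ j)) :=
  (hZ.hasSum_sq_integral_occComb hM hc0 hc1 hS hτ).nonneg fun _ => sq_nonneg _

/-- Jensen's inequality, summed over the starting points. -/
lemma IsCRandomWalk.walkVar_mean_le (hM : 1 < M) (hc0 : 0 < c) (hc1 : c < 1)
    (hZ : IsCRandomWalk M c μ Z₀) (hS : ∀ x, φ x ≠ 0 → x ∈ S) (hτ : ∀ j, 0 ≤ τ j) (l : ι → ℝ) :
    ∑ i, ∑ j, l i * l j * (walkVar M c S φ (τ i + τ j) - walkVar M c S φ (τ i) -
      walkVar M c S φ (τ j)) ≤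
    ∑ i, ∑ j, l i * l j * (walkVar M c S φ (τ i) + walkVar M c S φ (τ j) -
      walkVar M c S φ |τ i - τ j|) := by
  refine hasSum_le (fun x => ?_) (hZ.hasSum_sq_integral_occComb hM hc0 hc1 hS hτ)
    (hZ.hasSum_integral_occComb_sq hM hc0 hc1 hS hτ)
  have hm : MemLp (fun ω => occComb φ τ l x fun t => Z₀ t ω) 2 μ :=
    memLp_finsetSum _ fun j _ => (hZ.memLp_occ hS x (τ j)).const_mul (l j)
  have h := variance_nonneg (fun ω => occComb φ τ l x fun t => Z₀ t ω) μ
  rw [variance_eq_sub hm] at h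
  exact sub_nonneg.1 h

end PositiveDefinite

/-! ### Scaling limit of the variance function. -/

section Scaling

variable {M : ℕ} {c : ℝ}

/-- The Hurst parameter of the limit processes. -/
def hurst (M : ℕ) (c : ℝ) : ℝ := (1 - walkDegree M c) / 2

lemma half_lt_hurst (hM : 1 < M) (hc0 : 0 < c) (hc1 : c < 1) : 1 / 2 < hurst M c := by
  have := walkDegree_neg hM hc0 hc1
  rw [hurst]; linarith

lemma hurst_lt_one (hM : 1 < M) (hc0 : 0 < c) (hc1 : c < 1) : hurst M c < 1 := by
  have := neg_one_lt_walkDegree hM hc0 hc1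
  rw [hurst]; linarith

lemma two_sub_two_mul_hurst : 2 - 2 * hurst M c = 1 + walkDegree M c := by rw [hurst]; ring

/-- The time scales along which convergence takes place. -/
def timeScale (M : ℕ) (c : ℝ) (n : ℕ) : ℝ := parA M c ^ (-(n : ℤ))

lemma timeScale_pos (hM : 1 < M) (hc0 : 0 < c) (n : ℕ) : 0 < timeScale M c n :=
  zpow_pos (parA_pos hM hc0) _

lemma tendsto_timeScale (hM : 1 < M) (hc0 : 0 < c) (hc1 : c < 1) :
    Tendsto (timeScale M c) atTop atTop := by
  have h := tendsto_pow_atTop_atTop_of_one_lt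
    ((one_lt_inv₀ (parA_pos hM hc0)).2 (parA_lt_one hM hc1))
  refine h.congr fun n => ?_
  rw [timeScale, zpow_neg, zpow_natCast, inv_pow]

variable {S : Finset (HierGroup M)} {φ : HierGroup M → ℝ}

/-- The limit weight `(M - 1)/M` and the factor `b^{-(1+γ)}` produced by the scaling combine to
`K²`. -/
lemma tendsto_walkVar_scaled [NeZero M] (hM : 1 < M) (hc0 : 0 < c) (hc1 : c < 1) {t : ℝ} (ht : 0 ≤ t) :
    Tendsto (fun n => walkVar M c S φ (timeScale M c n * t) / timeScale M c n ^ (2 * hurst M c))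
      atTop (𝓝 (limitConst M c ^ 2 * (∑ x ∈ S, φ x) ^ 2 *
        oscPow (parA M c) (parB M c) (hurst M c) t)) := by
  have h := tendsto_occVar_scaled (parA_pos hM hc0) (parA_lt_one hM hc1) (parB_pos hM hc1)
    (zero_lt_one.trans hM) (half_lt_hurst hM hc0 hc1) (hurst_lt_one hM hc0 hc1)
    (by rw [two_sub_two_mul_hurst]; exact parA_rpow_one_add_walkDegree hM hc0 hc1)
    (sq_nonneg _) (abs_corrWeight_le hM S φ) (tendsto_corrWeight hM S φ) ht
  rw [two_sub_two_mul_hurst] at h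
  have e : limitConst M c ^ 2 * (∑ x ∈ S, φ x) ^ 2 = (∑ x ∈ S, φ x) ^ 2 * (((M : ℝ) - 1) / M) *
      parB M c ^ (-(1 + walkDegree M c)) := by rw [limitConst_sq hM hc1]; ring
  rw [e]
  exact h

lemma walkVar_scaled_le (hM : 1 < M) (hc0 : 0 < c) (hc1 : c < 1) {t : ℝ} (ht : 0 ≤ t) (n : ℕ) :
    walkVar M c S φ (timeScale M c n * t) / timeScale M c n ^ (2 * hurst M c) ≤
      (∑ x ∈ S, |φ x|) ^ 2 * parB M c ^ (-(2 - 2 * hurst M c)) *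
        oscPow (parA M c) (parB M c) (hurst M c) t :=
  occVar_scaled_le (parA_pos hM hc0) (parA_lt_one hM hc1) (parB_pos hM hc1)
    (zero_lt_one.trans hM) (half_lt_hurst hM hc0 hc1) (hurst_lt_one hM hc0 hc1)
    (by rw [two_sub_two_mul_hurst]; exact parA_rpow_one_add_walkDegree hM hc0 hc1)
    (sq_nonneg _) (abs_corrWeight_le hM S φ) ht n

lemma walkVar_zero : walkVar M c S φ 0 = 0 := by simp [walkVar, occVar, expG_zero]

end Scaling

/-! ### Limit kernels and their positivity. -/

section LimitCovariances

variable {M : ℕ} [NeZero M] {c : ℝ} {Ω : Type*} [MeasurableSpace Ω] {μ : Measure Ω}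
  [IsProbabilityMeasure μ] {Z₀ : ℝ≥0 → Ω → HierGroup M}

/-- `C` is positive semidefinite on nonnegative times. -/
def IsPosSemidefKernel (C : ℝ → ℝ → ℝ) : Prop :=
  ∀ (ι : Type) [Fintype ι] (τ l : ι → ℝ), (∀ j, 0 ≤ τ j) → 0 ≤ ∑ i, ∑ j, l i * l j * C (τ i) (τ j)

omit [NeZero M] in
lemma IsPosSemidefKernel.finsupp_sum_nonneg {C : ℝ → ℝ → ℝ} (h : IsPosSemidefKernel C)
    (f : ℝ≥0 →₀ ℝ) : 0 ≤ f.sum fun s a => f.sum fun t b => a * b * C s t := by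
  have h1 := h f.support (fun s => (s : ℝ≥0)) (fun s => f s) fun s => NNReal.coe_nonneg _
  have e : ∀ g : ℝ≥0 → ℝ, ∑ s : f.support, g s = ∑ s ∈ f.support, g s := fun g =>
    Finset.sum_coe_sort f.support g
  simp only [Finsupp.sum]
  rw [← e fun s => ∑ t ∈ f.support, f s * f t * C s t]
  simp only [← e]
  exact h1

lemma IsPosSemidefKernel.increment_nonneg {C : ℝ → ℝ → ℝ} (h : IsPosSemidefKernel C)
    (hsymm : ∀ s t, C s t = C t s) {s t : ℝ} (hs : 0 ≤ s) (ht : 0 ≤ t) :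
    0 ≤ C t t - 2 * C s t + C s s := by
  have h1 := h (Fin 2) ![s, t] ![-1, 1] (by intro j; fin_cases j <;> simpa)
  simp only [Fin.sum_univ_two, Matrix.cons_val_zero, Matrix.cons_val_one] at h1
  rw [hsymm t s] at h1
  linarith

section

variable {a b H : ℝ} {s t : ℝ}

lemma ofBmCov_symm : ofBmCov a b H s t = ofBmCov a b H t s := by
  rw [ofBmCov, ofBmCov, abs_sub_comm]; ring

lemma etaCov_symm : etaCov a b H s t = etaCov a b H t s := by
  rw [etaCov, etaCov, add_comm s t]; ring

lemma osfBmCov_symm : osfBmCov a b H s t = osfBmCov a b H t s := by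
  rw [osfBmCov, osfBmCov, abs_sub_comm, add_comm s t]; ring

/-- In the limit, `2 ofBm` stands for full second moments and `η` for products of means, so `2
osfBm` stands for covariances. -/
lemma two_mul_osfBmCov : 2 * osfBmCov a b H s t = 2 * ofBmCov a b H s t - etaCov a b H s t := by
  rw [osfBmCov, ofBmCov, etaCov]; ring

lemma ofBmCov_increment (hst : s ≤ t) :
    ofBmCov a b H t t - 2 * ofBmCov a b H s t + ofBmCov a b H s s = oscPow a b H (t - s) := by
  simp only [ofBmCov, sub_self, abs_zero, oscPow_zero]
  rw [abs_sub_comm, abs_of_nonneg (sub_nonneg.2 hst)]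
  ring

end

lemma tendsto_scaled_ofBm (hM : 1 < M) (hc0 : 0 < c) (hc1 : c < 1) (S : Finset (HierGroup M))
    (φ : HierGroup M → ℝ) {s t : ℝ} (hs : 0 ≤ s) (ht : 0 ≤ t) :
    Tendsto (fun n => (walkVar M c S φ (timeScale M c n * s) +
      walkVar M c S φ (timeScale M c n * t) -
      walkVar M c S φ |timeScale M c n * s - timeScale M c n * t|) /
        timeScale M c n ^ (2 * hurst M c)) atTop
      (𝓝 (limitConst M c ^ 2 * (∑ x ∈ S, φ x) ^ 2 *
        (2 * ofBmCov (parA M c) (parB M c) (hurst M c) s t))) := by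
  have h := ((tendsto_walkVar_scaled (S := S) (φ := φ) hM hc0 hc1 hs).add
    (tendsto_walkVar_scaled (S := S) (φ := φ) hM hc0 hc1 ht)).sub
    (tendsto_walkVar_scaled (S := S) (φ := φ) hM hc0 hc1 (abs_nonneg (s - t)))
  have e : ∀ n, timeScale M c n * |s - t| = |timeScale M c n * s - timeScale M c n * t| := by
    intro n
    rw [← mul_sub, abs_mul, abs_of_pos (timeScale_pos hM hc0 n)]
  simp only [e, ← add_div, ← sub_div] at h
  convert h using 2
  rw [ofBmCov]; ring

lemma tendsto_scaled_eta (hM : 1 < M) (hc0 : 0 < c) (hc1 : c < 1) (S : Finset (HierGroup M))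
    (φ : HierGroup M → ℝ) {s t : ℝ} (hs : 0 ≤ s) (ht : 0 ≤ t) :
    Tendsto (fun n => (walkVar M c S φ (timeScale M c n * s + timeScale M c n * t) -
      walkVar M c S φ (timeScale M c n * s) - walkVar M c S φ (timeScale M c n * t)) /
        timeScale M c n ^ (2 * hurst M c)) atTop
      (𝓝 (limitConst M c ^ 2 * (∑ x ∈ S, φ x) ^ 2 *
        etaCov (parA M c) (parB M c) (hurst M c) s t)) := by
  have h := ((tendsto_walkVar_scaled (S := S) (φ := φ) hM hc0 hc1 (add_nonneg hs ht)).sub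
    (tendsto_walkVar_scaled (S := S) (φ := φ) hM hc0 hc1 hs)).sub
    (tendsto_walkVar_scaled (S := S) (φ := φ) hM hc0 hc1 ht)
  simp only [mul_add, ← sub_div] at h
  convert h using 2
  rw [etaCov]; ring

/-- Passage to the limit in a quadratic form. -/
lemma tendsto_sum_div {ι : Type*} [Fintype ι] {D : ℕ → ι → ι → ℝ} {E : ι → ι → ℝ} {F : ℕ → ℝ}
    (h : ∀ i j, Tendsto (fun n => D n i j / F n) atTop (𝓝 (E i j))) (l : ι → ℝ) :
    Tendsto (fun n => (∑ i, ∑ j, l i * l j * D n i j) / F n) atTop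
      (𝓝 (∑ i, ∑ j, l i * l j * E i j)) := by
  simp only [Finset.sum_div, mul_div_assoc]
  exact tendsto_finsetSum _ fun i _ => tendsto_finsetSum _ fun j _ => (h i j).const_mul _

/-- Limits of positive semidefinite forms: squared means give the kernel of `η`, and the difference
of second moments and squared means gives that of osfBm. The walk enters only as a witness of
positivity at finite scales. -/
lemma IsCRandomWalk.limit_kernels (hM : 1 < M) (hc0 : 0 < c) (hc1 : c < 1)
    (hZ : IsCRandomWalk M c μ Z₀) :
    IsPosSemidefKernel (etaCov (parA M c) (parB M c) (hurst M c)) ∧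
    IsPosSemidefKernel (osfBmCov (parA M c) (parB M c) (hurst M c)) := by
  classical
  -- Any test function with nonzero sum would do; the point mass makes the sum equal to one.
  set φ : HierGroup M → ℝ := fun x => if x = 0 then 1 else 0 with hφ
  have hS : ∀ x, φ x ≠ 0 → x ∈ ({0} : Finset (HierGroup M)) := by
    intro x hx
    by_contra h
    exact hx (if_neg (by simpa using h))
  have hsum : (∑ x ∈ ({0} : Finset (HierGroup M)), φ x) ^ 2 = 1 := by simp [hφ]
  have hK := pow_pos (limitConst_pos (c := c) hM hc1) 2
  have hτn : ∀ {ι : Type} {τ : ι → ℝ}, (∀ j, 0 ≤ τ j) → ∀ (n : ℕ) j, 0 ≤ timeScale M c n * τ j :=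
    fun hτ n j => mul_nonneg (timeScale_pos hM hc0 n).le (hτ j)
  have hη : IsPosSemidefKernel (etaCov (parA M c) (parB M c) (hurst M c)) := by
    intro ι _ τ l hτ
    have h := tendsto_sum_div (fun i j => tendsto_scaled_eta hM hc0 hc1 {0} φ (hτ i) (hτ j)) l
    have h0 := ge_of_tendsto' h fun n => div_nonneg
      (hZ.walkVar_mean_nonneg hM hc0 hc1 hS (hτn hτ n) l)
      (Real.rpow_nonneg (timeScale_pos hM hc0 n).le _)
    rw [hsum] at h0
    have e : ∑ i, ∑ j, l i * l j * (limitConst M c ^ 2 * 1 *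
        etaCov (parA M c) (parB M c) (hurst M c) (τ i) (τ j)) = limitConst M c ^ 2 *
        ∑ i, ∑ j, l i * l j * etaCov (parA M c) (parB M c) (hurst M c) (τ i) (τ j) := by
      simp only [Finset.mul_sum]
      exact Finset.sum_congr rfl fun i _ => Finset.sum_congr rfl fun j _ => by ring
    rw [e] at h0
    exact nonneg_of_mul_nonneg_right h0 hK
  refine ⟨hη, ?_⟩
  intro ι _ τ l hτ
  have h1 := tendsto_sum_div (fun i j => tendsto_scaled_eta hM hc0 hc1 {0} φ (hτ i) (hτ j)) l
  have h2 := tendsto_sum_div (fun i j => tendsto_scaled_ofBm hM hc0 hc1 {0} φ (hτ i) (hτ j)) l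
  have h0 := le_of_tendsto_of_tendsto' h1 h2 fun n => div_le_div_of_nonneg_right
    (hZ.walkVar_mean_le hM hc0 hc1 hS (hτn hτ n) l) (Real.rpow_nonneg (timeScale_pos hM hc0 n).le _)
  rw [hsum, ← sub_nonneg] at h0
  have e : ∑ i, ∑ j, l i * l j * (limitConst M c ^ 2 * 1 *
      (2 * ofBmCov (parA M c) (parB M c) (hurst M c) (τ i) (τ j))) -
      ∑ i, ∑ j, l i * l j * (limitConst M c ^ 2 * 1 *
      etaCov (parA M c) (parB M c) (hurst M c) (τ i) (τ j)) = 2 * limitConst M c ^ 2 *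
      ∑ i, ∑ j, l i * l j * osfBmCov (parA M c) (parB M c) (hurst M c) (τ i) (τ j) := by
    simp only [Finset.mul_sum, ← Finset.sum_sub_distrib]
    refine Finset.sum_congr rfl fun i _ => Finset.sum_congr rfl fun j _ => ?_
    have := two_mul_osfBmCov (a := parA M c) (b := parB M c) (H := hurst M c) (s := τ i) (t := τ j)
    linear_combination (-(l i * l j * limitConst M c ^ 2)) * this
  rw [e] at h0
  exact nonneg_of_mul_nonneg_right h0 (by positivity)

end LimitCovariances

/-! ### Calculus of Kolmogorov's moment condition. -/

section IncrementBounds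

variable {Ω : Type*} [MeasurableSpace Ω] {P : Measure Ω} {X Y : ℝ≥0 → Ω → ℝ} {τ : ℝ≥0} {C D p : ℝ}

lemma IncrementBound.mono (h : IncrementBound P X τ C p) (hCD : C ≤ D) : IncrementBound P X τ D p :=
  fun s t hst ht => (h s t hst ht).trans <| ENNReal.ofReal_le_ofReal <| by
    have : (0 : ℝ) ≤ ((t : ℝ) - s) ^ p :=
      Real.rpow_nonneg (sub_nonneg.2 (NNReal.coe_le_coe.2 hst)) p
    gcongr

lemma IncrementBound.linear_comb (hX : IncrementBound P X τ C p) (hY : IncrementBound P Y τ D p)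
    (hXm : ∀ t, AEMeasurable (X t) P) (hC : 0 ≤ C) (hD : 0 ≤ D) (α β : ℝ) :
    IncrementBound P (fun t ω => α * X t ω + β * Y t ω) τ (2 * α ^ 2 * C + 2 * β ^ 2 * D) p := by
  intro s t hst ht
  have h0 : (0 : ℝ) ≤ ((t : ℝ) - s) ^ p :=
    Real.rpow_nonneg (sub_nonneg.2 (NNReal.coe_le_coe.2 hst)) p
  calc ∫⁻ ω, ENNReal.ofReal ((α * X t ω + β * Y t ω - (α * X s ω + β * Y s ω)) ^ 2) ∂P
      ≤ ∫⁻ ω, (ENNReal.ofReal (2 * α ^ 2) * ENNReal.ofReal ((X t ω - X s ω) ^ 2) +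
          ENNReal.ofReal (2 * β ^ 2) * ENNReal.ofReal ((Y t ω - Y s ω) ^ 2)) ∂P := by
        refine lintegral_mono fun ω => ?_
        rw [← ENNReal.ofReal_mul (by positivity), ← ENNReal.ofReal_mul (by positivity),
          ← ENNReal.ofReal_add (by positivity) (by positivity)]
        refine ENNReal.ofReal_le_ofReal ?_
        nlinarith [sq_nonneg (α * (X t ω - X s ω) - β * (Y t ω - Y s ω))]
    _ = ENNReal.ofReal (2 * α ^ 2) * ∫⁻ ω, ENNReal.ofReal ((X t ω - X s ω) ^ 2) ∂P +
          ENNReal.ofReal (2 * β ^ 2) * ∫⁻ ω, ENNReal.ofReal ((Y t ω - Y s ω) ^ 2) ∂P := by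
        have hm : AEMeasurable (fun ω => ENNReal.ofReal (2 * α ^ 2) *
            ENNReal.ofReal ((X t ω - X s ω) ^ 2)) P := by
          have := hXm t
          have := hXm s
          fun_prop
        rw [lintegral_add_left' hm, lintegral_const_mul' _ _ ENNReal.ofReal_ne_top,
          lintegral_const_mul' _ _ ENNReal.ofReal_ne_top]
    _ ≤ ENNReal.ofReal (2 * α ^ 2) * ENNReal.ofReal (C * ((t : ℝ) - s) ^ p) +
          ENNReal.ofReal (2 * β ^ 2) * ENNReal.ofReal (D * ((t : ℝ) - s) ^ p) := by
        gcongr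
        · exact hX s t hst ht
        · exact hY s t hst ht
    _ = _ := by
        rw [← ENNReal.ofReal_mul (by positivity), ← ENNReal.ofReal_mul (by positivity),
          ← ENNReal.ofReal_add (by positivity) (by positivity)]
        congr 1
        ring

lemma IsContCenteredGaussian.incrementBound [IsProbabilityMeasure P] {K : ℝ → ℝ → ℝ}
    (h : IsContCenteredGaussian P X K)
    (hK : ∀ s t : ℝ≥0, s ≤ t → t ≤ τ → K t t - 2 * K s t + K s s ≤ C * ((t : ℝ) - s) ^ p) :
    IncrementBound P X τ C p := by
  intro s t hst ht
  rw [lintegral_sub_sq_eq (h.memLp_two s) (h.memLp_two t), h.cov, h.cov, h.cov]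
  exact ENNReal.ofReal_le_ofReal (hK s t hst ht)

end IncrementBounds

/-! ### Existence of the limit processes. -/

section LimitProcesses

variable {M : ℕ} [NeZero M] {c : ℝ} {Ω : Type*} [MeasurableSpace Ω] {μ : Measure Ω}
  [IsProbabilityMeasure μ] {Z₀ : ℝ≥0 → Ω → HierGroup M}

/-- The increments of a kernel are dominated by those of oscillatory fractional Brownian motion. -/
def IncrementDominated (M : ℕ) (c : ℝ) (K : ℝ → ℝ → ℝ) : Prop :=
  ∀ s t : ℝ≥0, s ≤ t → K t t - 2 * K s t + K s s ≤
    2 * oscPow (parA M c) (parB M c) (hurst M c) ((t : ℝ) - s)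

omit [NeZero M] in
lemma ofBm_incrementDominated (hM : 1 < M) (hc0 : 0 < c) (hc1 : c < 1) :
    IncrementDominated M c (ofBmCov (parA M c) (parB M c) (hurst M c)) := by
  intro s t hst
  rw [ofBmCov_increment (NNReal.coe_le_coe.2 hst)]
  have := oscPow_nonneg (H := hurst M c) (parA_pos hM hc0) (parB_pos hM hc1)
    (sub_nonneg.2 (NNReal.coe_le_coe.2 hst))
  linarith

/-- In `2 ofBm = 2 osfBm + η` all kernels have nonnegative increment variances, so that of `η` is at
most twice that of ofBm, which is `oscPow`. -/
lemma IsCRandomWalk.eta_incrementDominated (hM : 1 < M) (hc0 : 0 < c) (hc1 : c < 1)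
    (hZ : IsCRandomWalk M c μ Z₀) :
    IncrementDominated M c (etaCov (parA M c) (parB M c) (hurst M c)) := by
  intro s t hst
  have h1 := (hZ.limit_kernels hM hc0 hc1).2.increment_nonneg (fun _ _ => osfBmCov_symm)
    s.coe_nonneg t.coe_nonneg
  rw [← ofBmCov_increment (NNReal.coe_le_coe.2 hst)]
  have e := fun s t : ℝ => two_mul_osfBmCov (a := parA M c) (b := parB M c) (H := hurst M c)
    (s := s) (t := t)
  linarith [e s s, e s t, e t t]

lemma IsCRandomWalk.osf_incrementDominated (hM : 1 < M) (hc0 : 0 < c) (hc1 : c < 1)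
    (hZ : IsCRandomWalk M c μ Z₀) :
    IncrementDominated M c (osfBmCov (parA M c) (parB M c) (hurst M c)) := by
  intro s t hst
  have h1 := (hZ.limit_kernels hM hc0 hc1).1.increment_nonneg (fun _ _ => etaCov_symm)
    s.coe_nonneg t.coe_nonneg
  have h2 := oscPow_nonneg (H := hurst M c) (parA_pos hM hc0) (parB_pos hM hc1)
    (sub_nonneg.2 (NNReal.coe_le_coe.2 hst))
  have h3 := ofBmCov_increment (a := parA M c) (b := parB M c) (H := hurst M c)
    (NNReal.coe_le_coe.2 hst)
  have e := fun s t : ℝ => two_mul_osfBmCov (a := parA M c) (b := parB M c) (H := hurst M c)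
    (s := s) (t := t)
  linarith [e s s, e s t, e t t]

lemma IsCRandomWalk.ofBm_posSemidef (hM : 1 < M) (hc0 : 0 < c) (hc1 : c < 1)
    (hZ : IsCRandomWalk M c μ Z₀) :
    IsPosSemidefKernel (ofBmCov (parA M c) (parB M c) (hurst M c)) := by
  intro ι _ τ l hτ
  obtain ⟨h1, h2⟩ := hZ.limit_kernels hM hc0 hc1
  have e : ∑ i, ∑ j, l i * l j * ofBmCov (parA M c) (parB M c) (hurst M c) (τ i) (τ j) =
      ∑ i, ∑ j, l i * l j * osfBmCov (parA M c) (parB M c) (hurst M c) (τ i) (τ j) +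
      (∑ i, ∑ j, l i * l j * etaCov (parA M c) (parB M c) (hurst M c) (τ i) (τ j)) / 2 := by
    simp only [Finset.sum_div, ← Finset.sum_add_distrib]
    refine Finset.sum_congr rfl fun i _ => Finset.sum_congr rfl fun j _ => ?_
    have := two_mul_osfBmCov (a := parA M c) (b := parB M c) (H := hurst M c) (s := τ i) (t := τ j)
    linear_combination (-(l i * l j) / 2) * this
  rw [e]
  have h3 := h1 ι τ l hτ
  have h4 := h2 ι τ l hτ
  positivity

/-- The exponent in Kolmogorov's condition. -/
def kolExp (M : ℕ) (c : ℝ) : ℝ := (1 + 2 * hurst M c) / 2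

omit [NeZero M] in
-- The exponent is the midpoint of `1` and `2H`: above `1` for chaining, below `2H` for the bound on
-- `t^{2H} h_t` near zero.
lemma one_lt_kolExp (hM : 1 < M) (hc0 : 0 < c) (hc1 : c < 1) : 1 < kolExp M c := by
  have := half_lt_hurst hM hc0 hc1
  rw [kolExp]; linarith

omit [NeZero M] in
lemma exists_oscPow_le_kolExp (hM : 1 < M) (hc0 : 0 < c) (hc1 : c < 1) (N : ℝ≥0) :
    ∃ A, 0 ≤ A ∧ ∀ t, 0 ≤ t → t ≤ (N : ℝ) →
      oscPow (parA M c) (parB M c) (hurst M c) t ≤ A * t ^ kolExp M c :=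
  exists_oscPow_le (parA_pos hM hc0) (parA_lt_one hM hc1) (parB_pos hM hc1)
    (half_lt_hurst hM hc0 hc1) (hurst_lt_one hM hc0 hc1) (one_lt_kolExp hM hc0 hc1).le
    (by have := half_lt_hurst hM hc0 hc1; rw [kolExp]; linarith) N N.coe_nonneg

omit [NeZero M] in
lemma IncrementDominated.exists_le (hM : 1 < M) (hc0 : 0 < c) (hc1 : c < 1) {K : ℝ → ℝ → ℝ}
    (h : IncrementDominated M c K) (τ : ℝ≥0) : ∃ A, 0 ≤ A ∧ ∀ s t : ℝ≥0, s ≤ t → t ≤ τ →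
      K t t - 2 * K s t + K s s ≤ A * ((t : ℝ) - s) ^ kolExp M c := by
  obtain ⟨A, hA, hle⟩ := exists_oscPow_le_kolExp hM hc0 hc1 τ
  refine ⟨2 * A, by positivity, fun s t hst ht => (h s t hst).trans ?_⟩
  have := hle ((t : ℝ) - s) (sub_nonneg.2 (NNReal.coe_le_coe.2 hst))
    ((sub_le_self _ s.coe_nonneg).trans (NNReal.coe_le_coe.2 ht))
  linarith

omit [NeZero M] in
lemma IncrementDominated.exists_process (hM : 1 < M) (hc0 : 0 < c) (hc1 : c < 1) {K : ℝ → ℝ → ℝ}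
    (h : IncrementDominated M c K) (hsymm : ∀ s t, K s t = K t s) (hK : IsPosSemidefKernel K) :
    ∃ (Ω : Type) (_ : MeasurableSpace Ω) (P : Measure Ω) (_ : IsProbabilityMeasure P)
      (X : ℝ≥0 → Ω → ℝ), IsContCenteredGaussian P X K :=
  exists_isContCenteredGaussian K (fun s t => hsymm s t) hK.finsupp_sum_nonneg
    (one_lt_kolExp hM hc0 hc1) (h.exists_le hM hc0 hc1)

omit [NeZero M] in
lemma IsContCenteredGaussian.exists_incrementBound (hM : 1 < M) (hc0 : 0 < c) (hc1 : c < 1)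
    {K : ℝ → ℝ → ℝ} (h : IncrementDominated M c K) {Ω' : Type*} [MeasurableSpace Ω']
    {P : Measure Ω'} [IsProbabilityMeasure P] {X : ℝ≥0 → Ω' → ℝ}
    (hX : IsContCenteredGaussian P X K) (τ : ℝ≥0) :
    ∃ A, 0 ≤ A ∧ IncrementBound P X τ A (kolExp M c) := by
  obtain ⟨A, hA, hle⟩ := h.exists_le hM hc0 hc1 τ
  exact ⟨A, hA, hX.incrementBound hle⟩

end LimitProcesses

/-! ### Independent processes on a product space. -/

section IndependentPair

variable {Ω₁ Ω₂ : Type*} [MeasurableSpace Ω₁] [MeasurableSpace Ω₂] {P₁ : Measure Ω₁}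
  {P₂ : Measure Ω₂} [IsProbabilityMeasure P₁] [IsProbabilityMeasure P₂]

/-- Functions of different coordinates are independent under a product measure, also without
measurability. -/
lemma indepFun_fst_snd {E F : Type*} [MeasurableSpace E] [MeasurableSpace F] (U : Ω₁ → E)
    (V : Ω₂ → F) : IndepFun (fun p : Ω₁ × Ω₂ => U p.1) (fun p => V p.2) (P₁.prod P₂) := by
  rw [indepFun_iff_measure_inter_preimage_eq_mul]
  intro s t _ _
  have e1 : (fun p : Ω₁ × Ω₂ => U p.1) ⁻¹' s = (U ⁻¹' s) ×ˢ Set.univ := by ext; simp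
  have e2 : (fun p : Ω₁ × Ω₂ => V p.2) ⁻¹' t = Set.univ ×ˢ (V ⁻¹' t) := by ext; simp
  rw [e1, e2, Set.prod_inter_prod, Set.univ_inter, Set.inter_univ]
  simp [Measure.prod_prod]

lemma HasGaussianFdd.linear_comb_prod {S : Type*} {X : S → Ω₁ → ℝ} {Y : S → Ω₂ → ℝ}
    {C D : S → S → ℝ} (hX : HasGaussianFdd P₁ X C) (hY : HasGaussianFdd P₂ Y D) (α β : ℝ) :
    HasGaussianFdd (P₁.prod P₂) (fun t p => α * X t p.1 + β * Y t p.2)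
      (fun s t => α ^ 2 * C s t + β ^ 2 * D s t) := by
  intro k t l
  have e : ∀ p : Ω₁ × Ω₂, Complex.exp ((∑ j, l j * (α * X (t j) p.1 + β * Y (t j) p.2) : ℝ) *
      Complex.I) = Complex.exp ((∑ j, (l j * α) * X (t j) p.1 : ℝ) * Complex.I) *
      Complex.exp ((∑ j, (l j * β) * Y (t j) p.2 : ℝ) * Complex.I) := by
    intro p
    rw [← Complex.exp_add, ← add_mul, ← Complex.ofReal_add, ← Finset.sum_add_distrib]
    congr 4
    funext j
    ring
  simp only [e]
  have h := integral_prod_mul (μ := P₁) (ν := P₂)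
    (fun ω => Complex.exp ((∑ j, (l j * α) * X (t j) ω : ℝ) * Complex.I))
    (fun ω => Complex.exp ((∑ j, (l j * β) * Y (t j) ω : ℝ) * Complex.I))
  rw [h, hX, hY, ← Complex.exp_add, ← add_div, ← neg_add, ← Complex.ofReal_add]
  congr 4
  simp only [← Finset.sum_add_distrib]
  exact Finset.sum_congr rfl fun i _ => Finset.sum_congr rfl fun j _ => by ring

end IndependentPair

/-! ### Convergence of the normed fluctuations. -/

section Convergence

variable {M : ℕ} [NeZero M] {c : ℝ} {ν : Measure ℕ} [IsProbabilityMeasure ν]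
  {Ω : Type*} [MeasurableSpace Ω] {μ : Measure Ω} [IsProbabilityMeasure μ]
  {θ : HierGroup M → Ω → ℕ} {Z : HierGroup M → ℕ → ℝ≥0 → Ω → HierGroup M}
  {S : Finset (HierGroup M)} {φ : HierGroup M → ℝ}

/-- Covariance of the limit process. -/
def limitCov (M : ℕ) (c : ℝ) (ν : Measure ℕ) (σ s t : ℝ) : ℝ :=
  limitConst M c ^ 2 * σ ^ 2 *
    (2 * (∫ k, (k : ℝ) ∂ν) * osfBmCov (parA M c) (parB M c) (hurst M c) s t +
      variance (fun k : ℕ => (k : ℝ)) ν * etaCov (parA M c) (parB M c) (hurst M c) s t)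

omit [IsProbabilityMeasure ν] in
-- The limit `Eθ · 2 ofBm + (Var θ - Eθ) · η` is rearranged by `two_mul_osfBmCov` into `2 Eθ · osfBm
-- + Var θ · η`, whose coefficients are nonnegative.
lemma tendsto_scaled_fluctCov (hM : 1 < M) (hc0 : 0 < c) (hc1 : c < 1) (S : Finset (HierGroup M))
    (φ : HierGroup M → ℝ) {s t : ℝ} (hs : 0 ≤ s) (ht : 0 ≤ t) :
    Tendsto (fun n => fluctCov M c ν S φ (timeScale M c n * s) (timeScale M c n * t) /
      timeScale M c n ^ (2 * hurst M c)) atTop (𝓝 (limitCov M c ν (∑ x ∈ S, φ x) s t)) := by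
  have h := ((tendsto_scaled_ofBm hM hc0 hc1 S φ hs ht).const_mul (∫ k, (k : ℝ) ∂ν)).add
    ((tendsto_scaled_eta hM hc0 hc1 S φ hs ht).const_mul
      (variance (fun k : ℕ => (k : ℝ)) ν - ∫ k, (k : ℝ) ∂ν))
  refine (h.congr fun n => by rw [fluctCov]; ring).trans_eq ?_
  have e := two_mul_osfBmCov (a := parA M c) (b := parB M c) (H := hurst M c) (s := s) (t := t)
  rw [limitCov]
  congr 1
  linear_combination (-(limitConst M c ^ 2 * (∑ x ∈ S, φ x) ^ 2 * ∫ k, (k : ℝ) ∂ν)) * e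

omit [NeZero M] in
lemma timeScale_rpow_hurst_sq (hM : 1 < M) (hc0 : 0 < c) (n : ℕ) :
    (timeScale M c n ^ hurst M c) ^ 2 = timeScale M c n ^ (2 * hurst M c) := by
  rw [← Real.rpow_natCast, ← Real.rpow_mul (timeScale_pos hM hc0 n).le]
  congr 1; push_cast; ring

omit [NeZero M] in
-- With `s = (7/8)(1 + γ)` the total power of the time scale is `3 - 2s - 3H = -(1 + γ)/4`. Any
-- factor strictly between `3/4` and `1` would serve.
lemma tendsto_charFun_error (hM : 1 < M) (hc0 : 0 < c) (hc1 : c < 1) (A : ℝ) {N : ℝ} (hN : 0 ≤ N) :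
    Tendsto (fun n => (A * (timeScale M c n ^ hurst M c)⁻¹) ^ 3 *
      (timeScale M c n * N) ^ (3 - 2 * (7 / 8 * (1 + walkDegree M c)))) atTop (𝓝 0) := by
  have hγ := neg_one_lt_walkDegree hM hc0 hc1
  have h := ((tendsto_rpow_neg_atTop (y := (1 + walkDegree M c) / 4) (by linarith)).comp
    (tendsto_timeScale hM hc0 hc1)).const_mul
      (A ^ 3 * N ^ (3 - 2 * (7 / 8 * (1 + walkDegree M c))))
  rw [mul_zero] at h
  refine h.congr fun n => ?_
  have hT := timeScale_pos (c := c) hM hc0 n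
  rw [Function.comp_apply, Real.mul_rpow hT.le hN, mul_pow, ← Real.rpow_neg hT.le,
    ← Real.rpow_natCast (timeScale M c n ^ (-hurst M c)), ← Real.rpow_mul hT.le]
  have e : -((1 + walkDegree M c) / 4) = -hurst M c * ((3 : ℕ) : ℝ) +
      (3 - 2 * (7 / 8 * (1 + walkDegree M c))) := by rw [hurst]; push_cast; ring
  rw [e, Real.rpow_add hT]
  ring

theorem IsParticleSystem.tendsto_charFun_occFluct (hsys : IsParticleSystem M c ν μ θ Z)
    (hM : 1 < M) (hc0 : 0 < c) (hc1 : c < 1) (hν : Integrable (fun k : ℕ => (k : ℝ) ^ 3) ν)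
    (hS : ∀ x, φ x ≠ 0 → x ∈ S) (k : ℕ) (t : Fin k → ℝ≥0) (l : Fin k → ℝ) :
    Tendsto (fun n => ∫ ω, Complex.exp ((∑ j, l j * occFluct μ θ Z (timeScale M c n ^ hurst M c)
      (timeScale M c n) φ (t j) ω : ℝ) * Complex.I) ∂μ) atTop
      (𝓝 (Complex.exp
        (-(∑ i, ∑ j, l i * l j * limitCov M c ν (∑ x ∈ S, φ x) (t i) (t j) : ℝ) / 2))) := by
  have hγ := neg_one_lt_walkDegree hM hc0 hc1
  obtain ⟨C, hC, hle⟩ := hsys.exists_norm_charFun_occField_sub_le hM hc0 hc1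
    (s := 7 / 8 * (1 + walkDegree M c)) (by linarith) (by linarith) hν hS
  -- A convenient common horizon: the sum of the nonnegative times exceeds none of them from below
  -- and also covers `k = 0`.
  set N : ℝ := ∑ j, (t j : ℝ) with hN
  have hN0 : 0 ≤ N := Finset.sum_nonneg fun j _ => (t j).coe_nonneg
  have hmain : Tendsto (fun n => Complex.exp (-((∑ i, ∑ j,
      (l i * (timeScale M c n ^ hurst M c)⁻¹) * (l j * (timeScale M c n ^ hurst M c)⁻¹) *
        fluctCov M c ν S φ (timeScale M c n * t i) (timeScale M c n * t j) : ℝ) : ℂ) / 2)) atTop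
      (𝓝 (Complex.exp
        (-((∑ i, ∑ j, l i * l j * limitCov M c ν (∑ x ∈ S, φ x) (t i) (t j) : ℝ) : ℂ) / 2))) := by
    have h1 := tendsto_sum_div (fun i j => tendsto_scaled_fluctCov (ν := ν) hM hc0 hc1 S φ
      (t i).coe_nonneg (t j).coe_nonneg) l
    have h2 := ((Complex.continuous_ofReal.tendsto _).comp h1).neg.div_const 2
    refine ((Complex.continuous_exp.tendsto _).comp h2).congr fun n => ?_
    simp only [Function.comp_apply]
    congr 4
    rw [← timeScale_rpow_hurst_sq hM hc0, Finset.sum_div]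
    refine Finset.sum_congr rfl fun i _ => ?_
    rw [Finset.sum_div]
    exact Finset.sum_congr rfl fun j _ => by ring
  have herr := (tendsto_charFun_error hM hc0 hc1 (∑ j, |l j|) hN0).const_mul C
  rw [mul_zero] at herr
  have hzero := squeeze_zero_norm (fun n => ?_) herr (f := fun n =>
    (∫ ω, Complex.exp ((∑ j, l j * occFluct μ θ Z (timeScale M c n ^ hurst M c)
      (timeScale M c n) φ (t j) ω : ℝ) * Complex.I) ∂μ) - Complex.exp (-((∑ i, ∑ j,
      (l i * (timeScale M c n ^ hurst M c)⁻¹) * (l j * (timeScale M c n ^ hurst M c)⁻¹) *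
        fluctCov M c ν S φ (timeScale M c n * t i) (timeScale M c n * t j) : ℝ) : ℂ) / 2))
  · have h := hzero.add hmain
    simpa only [sub_add_cancel, zero_add] using h
  · have hT := timeScale_pos (c := c) hM hc0 n
    have h := hle k (fun j => timeScale M c n * t j) (fun j => l j * (timeScale M c n ^ hurst M c)⁻¹)
      (timeScale M c n * N) (mul_nonneg hT.le hN0) (fun j => mul_nonneg hT.le (t j).coe_nonneg)
      (fun j => mul_le_mul_of_nonneg_left (Finset.single_le_sum
        (f := fun j => (t j : ℝ)) (fun j _ => (t j).coe_nonneg) (Finset.mem_univ j)) hT.le)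
    have e : ∑ j, |l j * (timeScale M c n ^ hurst M c)⁻¹| =
        (∑ j, |l j|) * (timeScale M c n ^ hurst M c)⁻¹ := by
      rw [Finset.sum_mul]
      refine Finset.sum_congr rfl fun j _ => ?_
      rw [abs_mul, abs_of_nonneg (inv_nonneg.2 (Real.rpow_nonneg hT.le _))]
    rw [e] at h
    simp only [mul_assoc (l _) _ (occField _ _ _ _ _ _)] at h
    exact h

/-- The sequence of occupation time fluctuations satisfies Kolmogorov's tightness condition. -/
theorem IsParticleSystem.exists_incrementBound_occFluct (hsys : IsParticleSystem M c ν μ θ Z)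
    (hM : 1 < M) (hc0 : 0 < c) (hc1 : c < 1) (hν : Integrable (fun k : ℕ => (k : ℝ) ^ 3) ν)
    (hS : ∀ x, φ x ≠ 0 → x ∈ S) (τ : ℝ≥0) :
    ∃ A, 0 ≤ A ∧ ∀ n, IncrementBound μ (occFluct μ θ Z (timeScale M c n ^ hurst M c)
      (timeScale M c n) φ) τ A (kolExp M c) := by
  obtain ⟨A, hA, hle⟩ := exists_oscPow_le_kolExp hM hc0 hc1 τ
  set m : ℝ := ∫ k, (k : ℝ) ∂ν
  have hm : 0 ≤ m := integral_nonneg fun k => Nat.cast_nonneg k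
  set v : ℝ := variance (fun k : ℕ => (k : ℝ)) ν
  set B : ℝ := (∑ x ∈ S, |φ x|) ^ 2 * parB M c ^ (-(2 - 2 * hurst M c))
  have hB : 0 ≤ B := mul_nonneg (sq_nonneg _) (Real.rpow_nonneg (parB_pos hM hc1).le _)
  refine ⟨(m + |v - m|) * (2 * (B * A)), by positivity, fun n s t hst ht => ?_⟩
  have hT := timeScale_pos (c := c) hM hc0 n
  have hts : (0 : ℝ) ≤ (t : ℝ) - s := sub_nonneg.2 (NNReal.coe_le_coe.2 hst)
  set F := timeScale M c n ^ hurst M c with hF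
  -- Two times with weights `-F⁻¹` and `F⁻¹` represent an increment of the normed process.
  set τ' : Fin 2 → ℝ := ![timeScale M c n * s, timeScale M c n * t] with hτ'
  have h0 : ∀ j, 0 ≤ τ' j := by
    intro j
    fin_cases j
    · exact mul_nonneg hT.le s.coe_nonneg
    · exact mul_nonneg hT.le t.coe_nonneg
  have h := hsys.lintegral_occField_comb_sq_le hM hc0 hc1 hν hS (l := ![-F⁻¹, F⁻¹]) h0
  have h1 := (hsys.walk 0 0).walkVar_mean_nonneg hM hc0 hc1 hS h0 ![-F⁻¹, F⁻¹]
  have h2 := (hsys.walk 0 0).walkVar_mean_le hM hc0 hc1 hS h0 ![-F⁻¹, F⁻¹]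
  have e : ∑ i, ∑ j, (![-F⁻¹, F⁻¹] i : ℝ) * (![-F⁻¹, F⁻¹] j : ℝ) * (walkVar M c S φ (τ' i) +
      walkVar M c S φ (τ' j) - walkVar M c S φ |τ' i - τ' j|) =
      2 * (walkVar M c S φ (timeScale M c n * (t - s)) / timeScale M c n ^ (2 * hurst M c)) := by
    rw [← timeScale_rpow_hurst_sq hM hc0, ← hF]
    simp only [Fin.sum_univ_two, hτ', Matrix.cons_val_zero, Matrix.cons_val_one, sub_self,
      abs_zero, walkVar_zero]
    rw [← mul_sub, ← mul_sub, abs_mul, abs_mul, abs_of_pos hT, abs_sub_comm, abs_of_nonneg hts]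
    ring
  rw [sum_fluctCov] at h
  rw [e] at h h2
  have hU := (walkVar_scaled_le (S := S) (φ := φ) hM hc0 hc1 hts n).trans
    (mul_le_mul_of_nonneg_left (hle _ hts ((sub_le_self _ s.coe_nonneg).trans
      (NNReal.coe_le_coe.2 ht))) hB)
  refine le_trans (le_of_eq (lintegral_congr fun ω => ?_))
    (h.trans (ENNReal.ofReal_le_ofReal ?_))
  · congr 2
    simp only [Fin.sum_univ_two, hτ', Matrix.cons_val_zero, Matrix.cons_val_one, occFluct, occField]
    ring
  -- The sign of `Var θ - Eθ` is arbitrary; the form of the means is nonnegative and below the full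
  -- second moment, so the absolute value may be used.
  · have h3 := mul_le_mul (le_abs_self (v - m)) h2 h1 (abs_nonneg _)
    have h4 := mul_le_mul_of_nonneg_left hU (by positivity : 0 ≤ 2 * (m + |v - m|))
    linarith

theorem IsParticleSystem.convergesWeaklyC_occFluct (hsys : IsParticleSystem M c ν μ θ Z)
    (hM : 1 < M) (hc0 : 0 < c) (hc1 : c < 1) (hν : Integrable (fun k : ℕ => (k : ℝ) ^ 3) ν)
    (hS : ∀ x, φ x ≠ 0 → x ∈ S) {Ω' : Type*} [MeasurableSpace Ω'] {P : Measure Ω'}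
    [IsProbabilityMeasure P] {Y : ℝ≥0 → Ω' → ℝ} (hYm : ∀ t, AEMeasurable (Y t) P)
    (hYc : ∀ ω, Continuous fun t => Y t ω)
    (hYB : ∀ τ, ∃ A, 0 ≤ A ∧ IncrementBound P Y τ A (kolExp M c))
    (hY : HasGaussianFdd P Y fun s t : ℝ≥0 => limitCov M c ν (∑ x ∈ S, φ x) s t) :
    ConvergesWeaklyC μ P (fun n => occFluct μ θ Z (timeScale M c n ^ hurst M c)
      (timeScale M c n) φ) Y := by
  have hν1 := integrable_of_integrable_cube hν
  refine convergesWeaklyC_of_charFun (fun n t => ?_) hYm (fun n => ?_)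
    (Eventually.of_forall hYc) (one_lt_kolExp hM hc0 hc1) (fun τ => ?_) fun k t l => ?_
  · exact ((hsys.measurable_occField hν1 hS (timeScale M c n * t)).const_mul _).aemeasurable
  · filter_upwards [hsys.ae_continuous_occField hν1 hS] with ω hω
    have h : Continuous fun t : ℝ≥0 => timeScale M c n * (t : ℝ) := by fun_prop
    exact (hω.comp h).const_mul _
  · obtain ⟨A, hA, hAX⟩ := hsys.exists_incrementBound_occFluct hM hc0 hc1 hν hS τ
    obtain ⟨B, hB, hBY⟩ := hYB τ
    exact ⟨max A B, hA.trans (le_max_left A B), fun n => (hAX n).mono (le_max_left A B),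
      hBY.mono (le_max_right A B)⟩
  · rw [hY k t l]
    exact hsys.tendsto_charFun_occFluct hM hc0 hc1 hν hS k t l

end Convergence

/-! ### Equality of mean and variance for the Poisson law. -/

section PoissonMoments

/-- Size-biasing of the Poisson law. -/
lemma integral_natCast_mul_poissonMeasure {l : ℝ≥0} {f : ℕ → ℝ}
    (hf : Integrable (fun k : ℕ => (k : ℝ) * f k) (poissonMeasure l)) :
    ∫ k : ℕ, (k : ℝ) * f k ∂(poissonMeasure l) = l * ∫ k, f (k + 1) ∂(poissonMeasure l) := by
  have h := hasSum_integral_poissonMeasure hf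
  have h0 := h.summable.tsum_eq_zero_add
  simp only [Nat.cast_zero, zero_mul, mul_zero, zero_add, smul_eq_mul] at h0
  rw [integral_poissonMeasure, integral_poissonMeasure]
  simp only [smul_eq_mul]
  rw [h0, ← tsum_mul_left]
  refine tsum_congr fun n => ?_
  rw [Nat.factorial_succ]
  push_cast
  have : ((n : ℝ) + 1) ≠ 0 := by positivity
  have h2 : (n.factorial : ℝ) ≠ 0 := by positivity
  field_simp
  ring

/-- Size-biasing is applied to the constant one and to the identity, giving the first two moments
`l` and `l² + l`. -/
lemma variance_poissonMeasure_eq_integral {l : ℝ≥0}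
    (h1 : Integrable (fun k : ℕ => (k : ℝ)) (poissonMeasure l))
    (h2 : Integrable (fun k : ℕ => (k : ℝ) ^ 2) (poissonMeasure l)) :
    ∫ k : ℕ, (k : ℝ) ∂(poissonMeasure l) = variance (fun k : ℕ => (k : ℝ)) (poissonMeasure l) := by
  have e1 := integral_natCast_mul_poissonMeasure (l := l) (f := fun _ => 1) (by simpa using h1)
  have e2 := integral_natCast_mul_poissonMeasure (l := l) (f := fun k => (k : ℝ))
    (by simpa only [← pow_two] using h2)
  simp only [mul_one, integral_const, probReal_univ, smul_eq_mul] at e1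
  simp only [← pow_two, Nat.cast_add, Nat.cast_one] at e2
  rw [integral_add h1 (integrable_const _), integral_const, probReal_univ, one_smul, e1] at e2
  rw [variance_eq_sub ((memLp_two_iff_integrable_sq
    Measurable.of_discrete.aestronglyMeasurable).2 h2)]
  simp only [Pi.pow_apply]
  rw [e1, e2]
  ring

end PoissonMoments

/-! ### The two limit theorems. -/

section FinalStatements

lemma HasGaussianFdd.const_mul {S Ω : Type*} [MeasurableSpace Ω] {P : Measure Ω} {X : S → Ω → ℝ}
    {C : S → S → ℝ} (hX : HasGaussianFdd P X C) (α : ℝ) :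
    HasGaussianFdd P (fun t ω => α * X t ω) (fun s t => α ^ 2 * C s t) := by
  intro k t l
  simp only [← mul_assoc]
  rw [hX k t fun j => l j * α]
  congr 4
  exact Finset.sum_congr rfl fun i _ => Finset.sum_congr rfl fun j _ => by ring

variable {M : ℕ} [NeZero M] {c : ℝ} {ν : Measure ℕ} [IsProbabilityMeasure ν]
  {Ω : Type*} [MeasurableSpace Ω] {μ : Measure Ω} [IsProbabilityMeasure μ]
  {θ : HierGroup M → Ω → ℕ} {Z : HierGroup M → ℕ → ℝ≥0 → Ω → HierGroup M}

lemma HasBddSupport.exists_tsum_eq {φ : HierGroup M → ℝ} (h : HasBddSupport φ) :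
    ∃ S : Finset (HierGroup M), (∀ x, φ x ≠ 0 → x ∈ S) ∧ ∑' x, φ x = ∑ x ∈ S, φ x := by
  obtain ⟨S, hS⟩ := h.exists_finset
  exact ⟨S, hS, tsum_eq_sum fun x hx => not_not.1 fun h => hx (hS x h)⟩

theorem IsParticleSystem.exists_osfBm_eta_limit (hsys : IsParticleSystem M c ν μ θ Z)
    (hM : 1 < M) (hc0 : 0 < c) (hc1 : c < 1) (hν : Integrable (fun k : ℕ => (k : ℝ) ^ 3) ν) :
    ∃ (Ω' : Type) (_ : MeasurableSpace Ω') (P : Measure Ω') (_ : IsProbabilityMeasure P)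
      (ζ η : ℝ≥0 → Ω' → ℝ),
      IsContCenteredGaussian P ζ (osfBmCov (parA M c) (parB M c) (hurst M c)) ∧
      IsContCenteredGaussian P η (etaCov (parA M c) (parB M c) (hurst M c)) ∧
      IndepFun (fun ω t => ζ t ω) (fun ω t => η t ω) P ∧
      ∀ φ : HierGroup M → ℝ, HasBddSupport φ →
        ConvergesWeaklyC μ P
          (fun n => occFluct μ θ Z (timeScale M c n ^ hurst M c) (timeScale M c n) φ)
          (fun t ω => limitConst M c * (√(2 * ∫ k : ℕ, (k : ℝ) ∂ν) * ζ t ω +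
            √(variance (fun k : ℕ => (k : ℝ)) ν) * η t ω) * ∑' x, φ x) := by
  have hZ := hsys.walk 0 0
  obtain ⟨hη, hζ⟩ := hZ.limit_kernels hM hc0 hc1
  have hdζ := hZ.osf_incrementDominated hM hc0 hc1
  have hdη := hZ.eta_incrementDominated hM hc0 hc1
  obtain ⟨Ω₁, _, P₁, _, ζ, hζG⟩ := hdζ.exists_process hM hc0 hc1 (fun _ _ => osfBmCov_symm) hζ
  obtain ⟨Ω₂, _, P₂, _, η, hηG⟩ := hdη.exists_process hM hc0 hc1 (fun _ _ => etaCov_symm) hη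
  have hζ' := hζG.comp_measurePreserving (measurePreserving_fst (μ := P₁) (ν := P₂))
  have hη' := hηG.comp_measurePreserving (measurePreserving_snd (μ := P₁) (ν := P₂))
  refine ⟨Ω₁ × Ω₂, inferInstance, P₁.prod P₂, inferInstance, fun t p => ζ t p.1, fun t p => η t p.2,
    hζ', hη', indepFun_fst_snd (fun ω t => ζ t ω) fun ω t => η t ω, fun φ hφ => ?_⟩
  obtain ⟨S, hS, hsum⟩ := hφ.exists_tsum_eq
  set α : ℝ := limitConst M c * √(2 * ∫ k : ℕ, (k : ℝ) ∂ν) * ∑ x ∈ S, φ x with hα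
  set β : ℝ := limitConst M c * √(variance (fun k : ℕ => (k : ℝ)) ν) * ∑ x ∈ S, φ x with hβ
  have e : (fun (t : ℝ≥0) (p : Ω₁ × Ω₂) => limitConst M c * (√(2 * ∫ k : ℕ, (k : ℝ) ∂ν) * ζ t p.1 +
      √(variance (fun k : ℕ => (k : ℝ)) ν) * η t p.2) * ∑' x, φ x) =
      fun t p => α * ζ t p.1 + β * η t p.2 := by
    funext t p
    rw [hsum, hα, hβ]
    ring
  rw [e]
  have hζm : ∀ t, AEMeasurable (fun p : Ω₁ × Ω₂ => ζ t p.1) (P₁.prod P₂) := fun t =>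
    (hζ'.memLp_two t).1.aemeasurable
  have hηm : ∀ t, AEMeasurable (fun p : Ω₁ × Ω₂ => η t p.2) (P₁.prod P₂) := fun t =>
    (hη'.memLp_two t).1.aemeasurable
  refine hsys.convergesWeaklyC_occFluct hM hc0 hc1 hν hS
    (fun t => ((hζm t).const_mul α).add ((hηm t).const_mul β))
    (fun p => ((hζ'.continuous_paths p).const_mul α).add ((hη'.continuous_paths p).const_mul β))
    (fun τ => ?_) ?_
  · obtain ⟨A, hA, hAζ⟩ := hζ'.exists_incrementBound hM hc0 hc1 hdζ τ
    obtain ⟨B, hB, hBη⟩ := hη'.exists_incrementBound hM hc0 hc1 hdη τ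
    exact ⟨_, by positivity, hAζ.linear_comb hBη hζm hA hB α β⟩
  · have h := hζG.hasGaussianFdd.linear_comb_prod hηG.hasGaussianFdd α β
    refine (congrArg (HasGaussianFdd _ _) ?_).mp h
    funext s t
    have h1 : 0 ≤ 2 * ∫ k : ℕ, (k : ℝ) ∂ν :=
      mul_nonneg two_pos.le (integral_nonneg fun k => Nat.cast_nonneg k)
    rw [hα, hβ, limitCov, mul_pow, mul_pow, mul_pow, mul_pow, Real.sq_sqrt h1,
      Real.sq_sqrt (variance_nonneg _ _)]
    ring

theorem IsParticleSystem.exists_ofBm_limit (hsys : IsParticleSystem M c ν μ θ Z)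
    (hM : 1 < M) (hc0 : 0 < c) (hc1 : c < 1) (hν : Integrable (fun k : ℕ => (k : ℝ) ^ 3) ν)
    (hmv : ∫ k : ℕ, (k : ℝ) ∂ν = variance (fun k : ℕ => (k : ℝ)) ν) :
    ∃ (Ω' : Type) (_ : MeasurableSpace Ω') (P : Measure Ω') (_ : IsProbabilityMeasure P)
      (ξ : ℝ≥0 → Ω' → ℝ),
      IsContCenteredGaussian P ξ (ofBmCov (parA M c) (parB M c) (hurst M c)) ∧
      ∀ φ : HierGroup M → ℝ, HasBddSupport φ →
        ConvergesWeaklyC μ P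
          (fun n => occFluct μ θ Z (timeScale M c n ^ hurst M c) (timeScale M c n) φ)
          (fun t ω => limitConst M c * √(2 * ∫ k : ℕ, (k : ℝ) ∂ν) * ξ t ω * ∑' x, φ x) := by
  have hZ := hsys.walk 0 0
  have hd := ofBm_incrementDominated (c := c) hM hc0 hc1
  obtain ⟨Ω₁, _, P, _, ξ, hξ⟩ := hd.exists_process hM hc0 hc1 (fun _ _ => ofBmCov_symm)
    (hZ.ofBm_posSemidef hM hc0 hc1)
  refine ⟨Ω₁, inferInstance, P, inferInstance, ξ, hξ, fun φ hφ => ?_⟩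
  obtain ⟨S, hS, hsum⟩ := hφ.exists_tsum_eq
  set α : ℝ := limitConst M c * √(2 * ∫ k : ℕ, (k : ℝ) ∂ν) * ∑ x ∈ S, φ x with hα
  have e : (fun (t : ℝ≥0) (ω : Ω₁) => limitConst M c * √(2 * ∫ k : ℕ, (k : ℝ) ∂ν) * ξ t ω *
      ∑' x, φ x) = fun t ω => α * ξ t ω := by
    funext t ω
    rw [hsum, hα]
    ring
  rw [e]
  have hξm : ∀ t, AEMeasurable (ξ t) P := fun t => (hξ.memLp_two t).1.aemeasurable
  refine hsys.convergesWeaklyC_occFluct hM hc0 hc1 hν hS (fun t => (hξm t).const_mul α)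
    (fun ω => (hξ.continuous_paths ω).const_mul α) (fun τ => ?_) ?_
  · obtain ⟨A, hA, hAξ⟩ := hξ.exists_incrementBound hM hc0 hc1 hd τ
    -- The two-process bound is reused with second coefficient zero to treat a single multiple of
    -- `ξ`.
    have h := hAξ.linear_comb hAξ hξm hA hA α 0
    simp only [zero_mul, add_zero] at h
    exact ⟨_, by positivity, h⟩
  · refine (congrArg (HasGaussianFdd _ _) ?_).mp (hξ.hasGaussianFdd.const_mul α)
    funext s t
    have h1 : 0 ≤ 2 * ∫ k : ℕ, (k : ℝ) ∂ν :=
      mul_nonneg two_pos.le (integral_nonneg fun k => Nat.cast_nonneg k)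
    have e2 := two_mul_osfBmCov (a := parA M c) (b := parB M c) (H := hurst M c) (s := s) (t := t)
    rw [hα, limitCov, ← hmv, mul_pow, mul_pow, Real.sq_sqrt h1]
    linear_combination (-(limitConst M c ^ 2 * (∑ x ∈ S, φ x) ^ 2 * ∫ k, (k : ℝ) ∂ν)) * e2

end FinalStatements

theorem theorem2p2 (M : ℕ) (hM : 1 < M) (c : ℝ) (hc0 : 0 < c) (hc1 : c < 1)
    (ν : Measure ℕ) [IsProbabilityMeasure ν] (hν : Integrable (fun k : ℕ => (k : ℝ) ^ 3) ν)
    {Ω : Type*} [MeasurableSpace Ω] (μ : Measure Ω) [IsProbabilityMeasure μ]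
    (θ : HierGroup M → Ω → ℕ) (Z : HierGroup M → ℕ → ℝ≥0 → Ω → HierGroup M)
    (hsys : IsParticleSystem M c ν μ θ Z)
    (γ H a b K Eθ Vθ : ℝ) (hγ : γ = walkDegree M c) (hH : H = (1 - γ) / 2)
    (ha : a = parA M c) (hb : b = parB M c) (hK : K = limitConst M c)
    (hE : Eθ = ∫ k : ℕ, (k : ℝ) ∂ν) (hV : Vθ = variance (fun k : ℕ => (k : ℝ)) ν)
    (T : ℕ → ℝ) (hT : ∀ n, T n = a ^ (-(n : ℤ))) :
    -- the parameter range of the limit processes, and convergence of the series for `h`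
    (1 / 2 < H ∧ H < 1) ∧ (∀ t : ℝ, 0 < t → Summable (oscTerm a b H t)) ∧ 0 < K ∧
    -- the objects which define the fluctuation process make sense
    (∀ (t : ℝ≥0) (x : HierGroup M), (∀ᵐ ω ∂μ, empirical θ Z t {x} ω < ⊤) ∧
      Integrable (fun ω => ((empirical θ Z t {x} ω).toNat : ℝ)) μ) ∧
    (∀ φ : HierGroup M → ℝ, HasBddSupport φ → ∀ᵐ ω ∂μ, ∀ t : ℝ, 0 ≤ t →
      IntervalIntegrable (fun r => centeredPairing μ θ Z φ r ω) volume 0 t) ∧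
    -- convergence to the combination of independent `ζ` (osfBm) and `η`
    (∃ (Ω' : Type) (_ : MeasurableSpace Ω') (P : Measure Ω') (_ : IsProbabilityMeasure P)
      (ζ η : ℝ≥0 → Ω' → ℝ),
      IsContCenteredGaussian P ζ (osfBmCov a b H) ∧
      IsContCenteredGaussian P η (etaCov a b H) ∧
      IndepFun (fun ω t => ζ t ω) (fun ω t => η t ω) P ∧
      ∀ φ : HierGroup M → ℝ, HasBddSupport φ →
        ConvergesWeaklyC μ P
          (fun n => occFluct μ θ Z (T n ^ ((1 - γ) / 2)) (T n) φ)
          (fun t ω => K * (√(2 * Eθ) * ζ t ω + √Vθ * η t ω) * ∑' x, φ x)) ∧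
    -- the Poisson case and, more generally, the case of equal mean and variance: `ξ` is ofBm
    (((∃ l : ℝ≥0, ν = poissonMeasure l) ∨ Eθ = Vθ) →
      ∃ (Ω' : Type) (_ : MeasurableSpace Ω') (P : Measure Ω') (_ : IsProbabilityMeasure P)
        (ξ : ℝ≥0 → Ω' → ℝ),
        IsContCenteredGaussian P ξ (ofBmCov a b H) ∧
        ∀ φ : HierGroup M → ℝ, HasBddSupport φ →
          ConvergesWeaklyC μ P
            (fun n => occFluct μ θ Z (T n ^ ((1 - γ) / 2)) (T n) φ)
            (fun t ω => K * √(2 * Eθ) * ξ t ω * ∑' x, φ x)) := by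
  have : NeZero M := ⟨by omega⟩
  have hν1 := integrable_of_integrable_cube hν
  have hTs : T = timeScale M c := funext fun n => by rw [hT, ha, timeScale]
  have hHs : H = hurst M c := by rw [hH, hγ, hurst]
  subst hHs
  subst hγ ha hb hK hE hV hTs
  refine ⟨⟨half_lt_hurst hM hc0 hc1, hurst_lt_one hM hc0 hc1⟩, fun t ht =>
    summable_oscTerm (parA_pos hM hc0) (parA_lt_one hM hc1) (parB_pos hM hc1)
      (half_lt_hurst hM hc0 hc1) (hurst_lt_one hM hc0 hc1) ht, limitConst_pos hM hc1,
    fun t x => ⟨?_, ?_⟩, fun φ hφ => ?_, hsys.exists_osfBm_eta_limit hM hc0 hc1 hν, fun h => ?_⟩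
  · filter_upwards [hsys.countAt_ae_lt_top hν1 t x] with ω hω
    rw [countAt_eq_empirical] at hω
    exact ENat.toENNReal_lt_top.1 hω
  · simp only [empirical_toNat_eq]
    exact hsys.integrable_countAt hν1 t x
  · obtain ⟨S, hS⟩ := hφ.exists_finset
    filter_upwards [hsys.ae_hasSum_occField hν1 hS] with ω hω t ht using (hω t ht).1
  · refine hsys.exists_ofBm_limit hM hc0 hc1 hν (h.elim ?_ id)
    rintro ⟨l, rfl⟩
    exact variance_poissonMeasure_eq_integral hν1 (integrable_pow_of_integrable_abs_cube
      (X := fun k : ℕ => (k : ℝ)) Measurable.of_discrete.aestronglyMeasurable (by simpa using hν)).2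

end
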